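/- Let $\mathfrak h\ne 0$ be a finite-dimensional complex symplectic vector space of dimension $d$ with symplectic form $(-,-)$, regarded as a purely odd super-vector space and as an abelian Lie super-algebra, and let $\beta\in\mathbb C$ with $\beta^4=(-1)^{d/2}$. Let $S=S(\mathfrak h)$ be its symmetric algebra in super-vector spaces (the exterior algebra of the vector space $\mathfrak h$), a commutative and cocommutative Hopf super-algebra with coproduct $\Delta(g)=\sum g'\otimes g''$, $\Delta(a)=a\otimes 1+1\otimes a$ for $a\in\mathfrak h$, and antipode $s$, $s(a)=-a$; write $S^k$ for its degree-$k$ part. For bases with $(a_i,b_j)=\delta_{ij}$ put $C=\sum_i b_i\otimes a_i$, $\hat C=\sum_i b_ia_i$, $\gamma=\exp(C)$, $\sigma=\exp(\tfrac12\hat C)$. Let $\lambda:S\to\mathbb C$ be the linear form vanishing in all degrees $\neq d$ with $\lambda(\hat C^{d/2})=2^{d/2}(d/2)!$, and let $\phi:S\to S$, $\phi(g)=\beta^2(\mathrm{id}\otimes\lambda)(\gamma^{-1}\cdot(1\otimes g))$. The braided monoidal category $\mathcal{SF}(\mathfrak h)=\mathcal{SF}_0\oplus\mathcal{SF}_1$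 has $\mathcal{SF}_0=\mathrm{Rep}^{fd}(\mathfrak h)$ (finite-dimensional representations in super-vector spaces) and $\mathcal{SF}_1=\mathrm{sVect}^{fd}$. The tensor product is $X*Y=X\otimes Y$ (in $\mathcal{SF}_0$, $\mathcal{SF}_1$, $\mathcal{SF}_1$, respectively) if $(X,Y)$ is in sector $00$, $01$, $10$, and $X*Y=S\otimes X\otimes Y\in\mathcal{SF}_0$, with $S$ acting by left multiplication, in sector $11$. The unit is $\mathbb 1=\mathbb C^{1|0}$ in sector $0$ with trivial action. Up to the Koszul signs for moving elements past each other, the associator $X*(Y*Z)\to(X*Y)*Z$ is the identity in sectors $000,001,100$; the action of $\gamma$ on $X$ and $Z$ in sector $010$; $x\otimes g\otimes y\otimes z\mapsto\sum g'\otimes s(g'')x\otimes y\otimes z$ in sector $011$; the action of $\gamma$ on $S$ and $Y$ in sector $101$; $g\otimes x\otimes y\otimes z\mapsto\sum g'\otimes x\otimes y\otimes g''z$ in sector $110$; and $x\otimes g\otimes y\otimes z\mapsto\phi(g)\otimes x\otimes y\otimes z$ in sector $111$. With $\tau$ the symmetric braiding and $\omega$ the parity involution of super-vector spaces, the braiding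 is $\tau\circ\gamma^{-1}$, $\tau\circ(\sigma\otimes\mathrm{id})$, $\tau\circ(\mathrm{id}\otimes\sigma\omega)$ and $g\otimes x\otimes y\mapsto\beta\,\sigma^{-1}g\otimes\tau(x\otimes\omega y)$ in sectors $00,01,10,11$. Let $\beta=1$ (so $4\mid d$), let $\mathfrak f\subset\mathfrak h$ be a Lagrangian subspace, and choose non-zero elements $m\in S^{d/2}(\mathfrak f)$ and $1_H\in S^d(\mathfrak h)$. Let $L=Sm\subset S$, which contains $1_H$, let $\chi$ be the linear form on $S$ which vanishes in degrees $\ne d$ and has $\chi(1_H)=1$, and let $T=\mathbb C^{1|0}\in\mathcal{SF}_1$. Let $H=H(\mathfrak f)=L\oplus T$ with unit $1_H$ and with the multiplication $H*H\to H$ given by $gm\otimes x\mapsto\sum g'm\,\chi(s(g'')x)$ on $L\otimes L$, by $x\otimes t\mapsto\chi(x)t$ and $t\otimes x\mapsto\chi(x)t$ on $L\otimes T$ and $T\otimes L$, and by $g\otimes t\otimes u\mapsto tu\,gm$ on $T*T=S\otimes T\otimes T$. Let $\Pi H$ denote the parity shift of $H$. Then $H$ is an associative unital algebra in $\mathcal{SF}(\mathfrak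 h)$, and: 1. A left $H$-module in $\mathcal{SF}(\mathfrak h)$ is simple if and only if it is isomorphic to $H$ or to $\Pi H$, and $H$ and $\Pi H$ are not isomorphic as $H$-modules. 2. The category ${}_H\mathcal{SF}(\mathfrak h)$ of left $H$-modules is a finite tensor category with respect to the tensor product over $H$. That is: there is a monoidal structure on it, with unit $H$, whose tensor product $M*_HN$ is the coequaliser in $\mathcal{SF}(\mathfrak h)$ of the two maps $M*(H*N)\to M*N$ given by the right action $M*H\to H*M\to M$ (the braiding followed by the left action) and by the left action on $N$, with the left action of $H$ induced from that on $M$, and whose unitors and associators are induced by the actions of $H$ and the associator of $\mathcal{SF}(\mathfrak h)$. With this structure the category is $\mathbb C$-linear abelian with bilinear tensor product, it is rigid, its unit is simple, and it is equivalent as a $\mathbb C$-linear category to the category of finite-dimensional modules over some finite-dimensional $\mathbb C$-algebra. -/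

import Mathlib

open CategoryTheory TensorProduct MonoidalCategory
open scoped ExteriorAlgebra ModuleCat.Algebra

noncomputable section

namespace SymplecticFermion

/-! ### The symmetric algebra of a purely odd vector space -/

/-- `S(𝔥)`: the symmetric algebra of the purely odd super-vector space `𝔥`; as an (ungraded)
algebra it is the exterior algebra of `𝔥`. -/
abbrev S (h : Type) [AddCommGroup h] [Module ℂ h] : Type := ExteriorAlgebra ℂ h

section Basic

variable {h : Type} [AddCommGroup h] [Module ℂ h]

instance finiteDimensional_S [FiniteDimensional ℂ h] : FiniteDimensional ℂ (S h) := by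
  have htop : (⨆ i, (⋀[ℂ]^i h : Submodule ℂ (S h))) = ⊤ :=
    (DirectSum.Decomposition.isInternal (fun i : ℕ => (⋀[ℂ]^i h : Submodule ℂ (S h)))).submodule_iSup_eq_top
  have hbot : ∀ i, Module.finrank ℂ h < i → (⋀[ℂ]^i h : Submodule ℂ (S h)) = ⊥ := by
    intro i hi
    have := exteriorPower.finrank_eq (R := ℂ) (M := h) i
    rw [Nat.choose_eq_zero_of_lt hi] at this
    exact Submodule.finrank_eq_zero.mp this
  have hfin : (⨆ i : Fin (Module.finrank ℂ h + 1), (⋀[ℂ]^(i : ℕ) h : Submodule ℂ (S h))) = ⊤ := by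
    rw [eq_top_iff, ← htop]
    refine iSup_le fun i => ?_
    by_cases hi : i < Module.finrank ℂ h + 1
    · exact le_iSup (fun i : Fin (Module.finrank ℂ h + 1) => (⋀[ℂ]^(i : ℕ) h : Submodule ℂ (S h)))
        ⟨i, hi⟩
    · rw [hbot i (by omega)]; exact bot_le
  refine ⟨?_⟩
  rw [← hfin]
  exact Submodule.fg_iSup _ fun i => (Submodule.fg_top _).mp
    (Module.Finite.fg_top (R := ℂ) (M := ⋀[ℂ]^(i : ℕ) h))

/-- The parity involution of `S(𝔥)`, the algebra map with `a ↦ -a` for `a ∈ 𝔥`. Since `S(𝔥)` is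
(super-)commutative, this is also its antipode as a Hopf algebra in super-vector spaces. -/
def invol : S h →ₐ[ℂ] S h := CliffordAlgebra.involute

lemma invol_ι (a : h) : invol (ExteriorAlgebra.ι ℂ a) = -ExteriorAlgebra.ι ℂ a :=
  CliffordAlgebra.involute_ι _

lemma invol_invol (x : S h) : invol (invol x) = x := CliffordAlgebra.involute_involute x

lemma invol_of_mem {n : ℕ} {x : S h} (hx : x ∈ ⋀[ℂ]^n h) : invol x = (-1 : ℂ) ^ n • x := by
  induction hx using Submodule.pow_induction_on_left' with
  | algebraMap r => simp [AlgHom.commutes]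
  | add x y i hx hy ihx ihy => rw [map_add, ihx, ihy, smul_add]
  | mem_mul m hm i x hx ih =>
    obtain ⟨a, rfl⟩ := hm
    rw [map_mul, ih, invol_ι]
    simp [pow_succ]

end Basic

/-! ### Super-vector spaces and super-representations of `𝔥` -/

/-- A finite-dimensional complex super-vector space: a vector space with its parity involution
`par` (equal to `1` on the even and to `-1` on the odd part). -/
structure SVect where
  V : Type
  [grp : AddCommGroup V]
  [mod : Module ℂ V]
  [fin : FiniteDimensional ℂ V]
  par : V →ₗ[ℂ] V
  par_par : ∀ v, par (par v) = v

attribute [instance] SVect.grp SVect.mod SVect.fin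

/-- A finite-dimensional representation, in super-vector spaces, of `𝔥` regarded as a purely odd
abelian Lie super-algebra: elements of `𝔥` act by odd, pairwise anti-commuting operators. -/
structure SRep (h : Type) [AddCommGroup h] [Module ℂ h] extends SVect where
  act : h →ₗ[ℂ] Module.End ℂ V
  act_act : ∀ a v, act a (act a v) = 0
  act_par : ∀ a v, act a (par v) = -par (act a v)

/-- Tensor product of super-vector spaces. -/
@[reducible] def SVect.tensor (X Y : SVect) : SVect where
  V := X.V ⊗[ℂ] Y.V
  par := TensorProduct.map X.par Y.par
  par_par v := by
    have : TensorProduct.map X.par Y.par ∘ₗ TensorProduct.map X.par Y.par = LinearMap.id := by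
      ext x y; simp [X.par_par, Y.par_par]
    exact LinearMap.congr_fun this v

/-- Direct sum of super-vector spaces. -/
@[reducible] def SVect.sum (X Y : SVect) : SVect where
  V := X.V × Y.V
  par := LinearMap.prodMap X.par Y.par
  par_par v := by simp [X.par_par, Y.par_par]

/-- Parity exchange `Π`. -/
@[reducible] def SVect.shift (X : SVect) : SVect where
  V := X.V
  par := -X.par
  par_par v := by simp [X.par_par]

/-- The symmetric braiding of super-vector spaces, `v ⊗ w ↦ (-1)^{|v||w|} w ⊗ v`. -/
def SVect.flip (X Y : SVect) : X.V ⊗[ℂ] Y.V →ₗ[ℂ] Y.V ⊗[ℂ] X.V :=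
  (TensorProduct.comm ℂ X.V Y.V).toLinearMap ∘ₗ
    ((1 / 2 : ℂ) • (TensorProduct.map LinearMap.id LinearMap.id
      + TensorProduct.map X.par LinearMap.id + TensorProduct.map LinearMap.id Y.par
      - TensorProduct.map X.par Y.par))

section Rep

variable {h : Type} [AddCommGroup h] [Module ℂ h]

/-- The action of the algebra `S(𝔥) = U(𝔥)` on a representation of `𝔥`. -/
def SRep.rho (X : SRep h) : S h →ₐ[ℂ] Module.End ℂ X.V :=
  ExteriorAlgebra.lift ℂ ⟨X.act, fun a => LinearMap.ext fun v => X.act_act a v⟩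

/-- Tensor product of representations: `a.(v ⊗ w) = a.v ⊗ w + (-1)^{|v|} v ⊗ a.w`. -/
@[reducible] def SRep.tensor (X Y : SRep h) : SRep h where
  toSVect := X.toSVect.tensor Y.toSVect
  act := (TensorProduct.mapBilinear (RingHom.id ℂ) X.V Y.V X.V Y.V).flip LinearMap.id ∘ₗ X.act
    + (TensorProduct.mapBilinear (RingHom.id ℂ) X.V Y.V X.V Y.V) X.par ∘ₗ Y.act
  act_act a v := by
    induction v using TensorProduct.induction_on with
    | zero => simp
    | tmul x y => simp [X.act_act, Y.act_act, X.act_par, X.par_par, TensorProduct.neg_tmul]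
    | add x y hx hy => rw [map_add, map_add, hx, hy, add_zero]
  act_par a v := by
    induction v using TensorProduct.induction_on with
    | zero => simp
    | tmul x y =>
      simp [X.act_par, Y.act_par, TensorProduct.neg_tmul, TensorProduct.tmul_neg, add_comm]
    | add x y hx hy => simp only [map_add, hx, hy, neg_add]

/-- Direct sum of representations. -/
@[reducible] def SRep.sum (X Y : SRep h) : SRep h where
  toSVect := X.toSVect.sum Y.toSVect
  act := LinearMap.prodMapLinear ℂ X.V Y.V X.V Y.V ℂ ∘ₗ X.act.prod Y.act
  act_act a v := by simp [X.act_act, Y.act_act]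
  act_par a v := by simp [X.act_par, Y.act_par]

/-- Parity exchange `Π` of a representation (the operators of `𝔥` are unchanged). -/
@[reducible] def SRep.shift (X : SRep h) : SRep h where
  toSVect := X.toSVect.shift
  act := X.act
  act_act := X.act_act
  act_par a v := by simp [X.act_par]

/-- The representation with the action twisted by the antipode of `S(𝔥)`. -/
@[reducible] def SRep.antip (X : SRep h) : SRep h where
  toSVect := X.toSVect
  act := -X.act
  act_act a v := by simp [X.act_act]
  act_par a v := by simp [X.act_par]

/-- A super-vector space with the trivial action of `𝔥`. -/
@[reducible] def SVect.triv (h : Type) [AddCommGroup h] [Module ℂ h] (X : SVect) : SRep h where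
  toSVect := X
  act := 0
  act_act a v := by simp
  act_par a v := by simp

/-- `S(𝔥)` with the left regular action. -/
@[reducible] def reg (h : Type) [AddCommGroup h] [Module ℂ h] [FiniteDimensional ℂ h] :
    SRep h where
  V := S h
  par := invol.toLinearMap
  par_par v := invol_invol v
  act := LinearMap.mul ℂ (S h) ∘ₗ ExteriorAlgebra.ι ℂ
  act_act a v := by simp [← mul_assoc]
  act_par a v := by simp [invol_ι]

end Rep

/-! ### The category `SF(𝔥)` -/

/-- Objects of `SF(𝔥) = SF₀(𝔥) ⊕ SF₁(𝔥)`, where `SF₀(𝔥)` consists of the finite-dimensional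
representations of `𝔥` in super-vector spaces, and `SF₁(𝔥)` of the finite-dimensional
super-vector spaces. -/
structure SF (h : Type) [AddCommGroup h] [Module ℂ h] where
  zero : SRep h
  one : SVect

section Category

variable {h : Type} [AddCommGroup h] [Module ℂ h]

/-- A pair of complex vector spaces. -/
structure Car where
  V₀ : Type
  V₁ : Type
  [grp₀ : AddCommGroup V₀]
  [mod₀ : Module ℂ V₀]
  [grp₁ : AddCommGroup V₁]
  [mod₁ : Module ℂ V₁]

attribute [instance] Car.grp₀ Car.mod₀ Car.grp₁ Car.mod₁

/-- The underlying vector spaces of the two components of an object of `SF(𝔥)`. -/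
@[reducible] def SF.car (X : SF h) : Car := ⟨X.zero.V, X.one.V⟩

/-- Pairs of linear maps. -/
abbrev LMap (X Y : Car) : Type := (X.V₀ →ₗ[ℂ] Y.V₀) × (X.V₁ →ₗ[ℂ] Y.V₁)

/-- Composition of pairs of linear maps, `g` after `f`. -/
def LMap.comp {X Y Z : Car} (g : LMap Y Z) (f : LMap X Y) : LMap X Z :=
  (g.1 ∘ₗ f.1, g.2 ∘ₗ f.2)

/-- The identity. -/
def LMap.id (X : Car) : LMap X X := (LinearMap.id, LinearMap.id)

lemma LMap.comp_assoc {W X Y Z : Car} (e : LMap Y Z) (g : LMap X Y) (f : LMap W X) :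
    (e.comp g).comp f = e.comp (g.comp f) := rfl

lemma LMap.add_comp {X Y Z : Car} (g g' : LMap Y Z) (f : LMap X Y) :
    (g + g').comp f = g.comp f + g'.comp f := rfl

lemma LMap.comp_add {X Y Z : Car} (g : LMap Y Z) (f f' : LMap X Y) :
    g.comp (f + f') = g.comp f + g.comp f' := by
  refine Prod.ext ?_ ?_ <;> simp [LMap.comp, LinearMap.comp_add]

lemma LMap.smul_comp {X Y Z : Car} (r : ℂ) (g : LMap Y Z) (f : LMap X Y) :
    LMap.comp (r • g) f = r • g.comp f := rfl

lemma LMap.comp_smul {X Y Z : Car} (r : ℂ) (g : LMap Y Z) (f : LMap X Y) :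
    g.comp (r • f) = r • g.comp f := by
  refine Prod.ext ?_ ?_ <;> simp [LMap.comp, LinearMap.comp_smul]

/-- The morphisms of `SF(𝔥)`: even linear maps, commuting with the action of `𝔥` in sector 0. -/
def homs (X Y : SF h) : Submodule ℂ (LMap X.car Y.car) where
  carrier := {f | (∀ v, f.1 (X.zero.par v) = Y.zero.par (f.1 v)) ∧
    (∀ a v, f.1 (X.zero.act a v) = Y.zero.act a (f.1 v)) ∧
    ∀ v, f.2 (X.one.par v) = Y.one.par (f.2 v)}
  add_mem' {f g} hf hg := by
    refine ⟨fun v => ?_, fun a v => ?_, fun v => ?_⟩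
    · simp [hf.1, hg.1]
    · simp [hf.2.1, hg.2.1]
    · simp [hf.2.2, hg.2.2]
  zero_mem' := by simp
  smul_mem' c f hf := by
    refine ⟨fun v => ?_, fun a v => ?_, fun v => ?_⟩
    · simp [hf.1]
    · simp [hf.2.1]
    · simp [hf.2.2]

lemma comp_mem_homs {X Y Z : SF h} {g : LMap Y.car Z.car} {f : LMap X.car Y.car}
    (hg : g ∈ homs Y Z) (hf : f ∈ homs X Y) : g.comp f ∈ homs X Z := by
  refine ⟨fun v => ?_, fun a v => ?_, fun v => ?_⟩
  · simp [LMap.comp, hf.1, hg.1]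
  · simp [LMap.comp, hf.2.1, hg.2.1]
  · simp [LMap.comp, hf.2.2, hg.2.2]

lemma id_mem_homs (X : SF h) : LMap.id X.car ∈ homs X X := by
  refine ⟨fun v => ?_, fun a v => ?_, fun v => ?_⟩ <;> simp [LMap.id]

/-- The category `SF(𝔥)`. -/
instance : Category (SF h) where
  Hom X Y := homs X Y
  id X := ⟨LMap.id X.car, id_mem_homs X⟩
  comp f g := ⟨g.1.comp f.1, comp_mem_homs g.2 f.2⟩

/-- Parity exchange on `SF(𝔥)`. -/
@[reducible] def SF.shift (X : SF h) : SF h where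
  zero := X.zero.shift
  one := X.one.shift

/-- The underlying vector spaces of the tensor product `X ∗ Y`, see `SF.star`. -/
@[reducible] def Car.star (X : Car) (h : Type) [AddCommGroup h] [Module ℂ h] (Y : Car) : Car :=
  ⟨(X.V₀ ⊗[ℂ] Y.V₀) × (S h ⊗[ℂ] (X.V₁ ⊗[ℂ] Y.V₁)), (X.V₀ ⊗[ℂ] Y.V₁) × (X.V₁ ⊗[ℂ] Y.V₀)⟩

/-- The tensor product of morphisms of `SF(𝔥)`, or of pairs of linear maps. -/
def LMap.star {X X' Y Y' : Car} (f : LMap X X') (h : Type) [AddCommGroup h] [Module ℂ h]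
    (g : LMap Y Y') : LMap (X.star h Y) (X'.star h Y') :=
  (LinearMap.prodMap (TensorProduct.map f.1 g.1)
      (TensorProduct.map LinearMap.id (TensorProduct.map f.2 g.2)),
    LinearMap.prodMap (TensorProduct.map f.1 g.2) (TensorProduct.map f.2 g.1))

lemma id_star_comp {X Y Y' Y'' : Car} (g : LMap Y' Y'') (f : LMap Y Y') :
    (LMap.id X).star h (g.comp f) = ((LMap.id X).star h g).comp ((LMap.id X).star h f) := by
  refine Prod.ext ?_ ?_
  · refine LinearMap.prod_ext ?_ ?_
    · ext x y <;> simp [LMap.star, LMap.comp, LMap.id]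
    · ext x y z <;> simp [LMap.star, LMap.comp, LMap.id]
  · refine LinearMap.prod_ext ?_ ?_ <;>
    · ext x y <;> simp [LMap.star, LMap.comp, LMap.id]

lemma id_star_id {X Y : Car} : (LMap.id X).star h (LMap.id Y) = LMap.id (X.star h Y) := by
  refine Prod.ext ?_ ?_ <;> simp [LMap.star, LMap.id]

variable [FiniteDimensional ℂ h]

/-- The tensor product `X ∗ Y` of `SF(𝔥)`: on sectors 00, 01, 10 it is the tensor product of
representations or of super-vector spaces, on sector 11 it is `S(𝔥) ⊗ X ⊗ Y` with `S(𝔥)` acting by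
left multiplication on the first factor. -/
@[reducible] def SF.star (X Y : SF h) : SF h where
  zero := (X.zero.tensor Y.zero).sum ((reg h).tensor ((X.one.tensor Y.one).triv h))
  one := (X.zero.toSVect.tensor Y.one).sum (X.one.tensor Y.zero.toSVect)

end Category

/-! ### The data that determine the associator and the braiding -/

/-- A non-zero finite-dimensional symplectic vector space `(𝔥, form)` over `ℂ` together with a
parameter `β` such that `β⁴ = (-1)^{d/2}`, where `d = dim 𝔥`. The form is the one with respect to
which the copairing `C` is dual. -/
structure SympData (h : Type) [AddCommGroup h] [Module ℂ h] [FiniteDimensional ℂ h] where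
  form : LinearMap.BilinForm ℂ h
  alt : form.IsAlt
  nondeg : form.Nondegenerate
  pos : 0 < Module.finrank ℂ h
  β : ℂ
  β_pow : β ^ 4 = (-1) ^ (Module.finrank ℂ h / 2)

section Structure

variable {h : Type} [AddCommGroup h] [Module ℂ h] [FiniteDimensional ℂ h] (D : SympData h)

/-- A basis `bᵢ` of `𝔥`. -/
def SympData.b (_D : SympData h) : Module.Basis (Fin (Module.finrank ℂ h)) ℂ h := Module.finBasis ℂ h

/-- The basis `aᵢ` of `𝔥` with `(aᵢ, bⱼ) = δᵢⱼ`. -/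
def SympData.a : Module.Basis (Fin (Module.finrank ℂ h)) ℂ h := D.form.dualBasis D.nondeg D.b

/-- The exponential series, cut off after the power `dim 𝔥`. It is only applied to multiples of
the operators `C` and `Ĉ` below, whose powers with larger exponent vanish. -/
def expTrunc (h : Type) [AddCommGroup h] [Module ℂ h] {V : Type} [AddCommGroup V] [Module ℂ V]
    (f : Module.End ℂ V) : Module.End ℂ V :=
  ∑ k ∈ Finset.range (Module.finrank ℂ h + 1), (k.factorial : ℂ)⁻¹ • f ^ k

/-- The action of the copairing `C = ∑ᵢ bᵢ ⊗ aᵢ ∈ 𝔥 ⊗ 𝔥 ⊆ S(𝔥) ⊗ S(𝔥)` on `X ⊗ W`, where `𝔥` acts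
on `W` through `actW`; the parity involution is the sign from moving the odd element `aᵢ`
past `X`. -/
def SympData.C (X : SRep h) {W : Type} [AddCommGroup W] [Module ℂ W]
    (actW : h →ₗ[ℂ] Module.End ℂ W) : Module.End ℂ (X.V ⊗[ℂ] W) :=
  ∑ i, TensorProduct.map (X.act (D.b i) ∘ₗ X.par) (actW (D.a i))

/-- The element `Ĉ = ∑ᵢ bᵢ aᵢ` of `S(𝔥)`. -/
def SympData.Chat : S h := ∑ i, ExteriorAlgebra.ι ℂ (D.b i) * ExteriorAlgebra.ι ℂ (D.a i)

/-- The action of `γ = exp(C)` on `X ⊗ W`. -/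
def SympData.gamma (X : SRep h) {W : Type} [AddCommGroup W] [Module ℂ W]
    (actW : h →ₗ[ℂ] Module.End ℂ W) : X.V ⊗[ℂ] W →ₗ[ℂ] X.V ⊗[ℂ] W := expTrunc h (D.C X actW)

/-- The action of `γ⁻¹ = exp(-C)` on `X ⊗ W`. -/
def SympData.gammaInv (X : SRep h) {W : Type} [AddCommGroup W] [Module ℂ W]
    (actW : h →ₗ[ℂ] Module.End ℂ W) : X.V ⊗[ℂ] W →ₗ[ℂ] X.V ⊗[ℂ] W := expTrunc h (-D.C X actW)

/-- The action of `σ = exp(Ĉ/2)` on `X`. -/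
def SympData.sigma (X : SRep h) : X.V →ₗ[ℂ] X.V := expTrunc h ((1 / 2 : ℂ) • X.rho D.Chat)

/-- The action of `σ⁻¹ = exp(-Ĉ/2)` on `X`. -/
def SympData.sigmaInv (X : SRep h) : X.V →ₗ[ℂ] X.V :=
  expTrunc h ((-1 / 2 : ℂ) • X.rho D.Chat)

/-- The linear form on `S(𝔥)` which vanishes in all degrees except the top degree `d = dim 𝔥`,
where it is the determinant with respect to the basis `bᵢ`. -/
def SympData.topForm : S h →ₗ[ℂ] ℂ :=
  ExteriorAlgebra.liftAlternating fun i =>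
    if hi : Module.finrank ℂ h = i then D.b.det.domDomCongr (finCongr hi) else 0

/-- The cointegral `λ` of `S(𝔥)`: the linear form which is non-zero only in the top degree and
satisfies `λ(Ĉ^{d/2}) = 2^{d/2} (d/2)!`. -/
def SympData.lam : S h →ₗ[ℂ] ℂ :=
  ((2 : ℂ) ^ (Module.finrank ℂ h / 2) * ((Module.finrank ℂ h / 2).factorial : ℂ) /
    D.topForm (D.Chat ^ (Module.finrank ℂ h / 2))) • D.topForm

/-- `φ = β² (id ⊗ (λ ∘ μ_S)) ∘ (γ⁻¹ ⊗ id) : S(𝔥) → S(𝔥)`, where `μ_S` is the multiplication: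
`φ(g)` is `β² (id ⊗ λ)` applied to `γ⁻¹.(1 ⊗ g)`. -/
def SympData.phi : S h →ₗ[ℂ] S h :=
  D.β ^ 2 • ((TensorProduct.rid ℂ (S h)).toLinearMap ∘ₗ TensorProduct.map LinearMap.id D.lam ∘ₗ
    D.gammaInv (reg h) (reg h).act ∘ₗ TensorProduct.mk ℂ (S h) (S h) 1)

/-! ### The associator, sector by sector

The sector `ijk` is the component of `X ∗ (Y ∗ Z) → (X ∗ Y) ∗ Z` on `Xᵢ, Yⱼ, Z_k`. -/

/-- The associator of vector spaces. In sectors 000, 001 and 100 this is the associator. -/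
abbrev assocTriv (X Y Z : Type) [AddCommGroup X] [Module ℂ X] [AddCommGroup Y] [Module ℂ Y]
    [AddCommGroup Z] [Module ℂ Z] : X ⊗[ℂ] (Y ⊗[ℂ] Z) →ₗ[ℂ] (X ⊗[ℂ] Y) ⊗[ℂ] Z :=
  (TensorProduct.assoc ℂ X Y Z).symm.toLinearMap

/-- Sector 010: `γ` acts on `X` and `Z`. -/
def SympData.assoc010 (X : SRep h) (Y : SVect) (Z : SRep h) :
    X.V ⊗[ℂ] (Y.V ⊗[ℂ] Z.V) →ₗ[ℂ] (X.V ⊗[ℂ] Y.V) ⊗[ℂ] Z.V :=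
  D.gamma (X.tensor (Y.triv h)) Z.act ∘ₗ assocTriv X.V Y.V Z.V

/-- The map `X ⊗ S(𝔥) → S(𝔥) ⊗ X`, `x ⊗ g ↦ ∑ ± g' ⊗ S(g'').x`, with `S` the antipode and
`∑ g' ⊗ g''` the coproduct of `g`. Here `∑ g' ⊗ S(g'').x` is the result of acting with `g` on the
element `1 ⊗ x` of the tensor product of the regular representation and of `X` twisted by the
antipode. -/
def SRep.moveOut (X : SRep h) : X.V ⊗[ℂ] S h →ₗ[ℂ] S h ⊗[ℂ] X.V :=
  TensorProduct.lift ((LinearMap.lcomp ℂ _ (TensorProduct.mk ℂ (S h) X.V 1)) ∘ₗ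
      ((reg h).tensor X.antip).rho.toLinearMap) ∘ₗ X.toSVect.flip (reg h).toSVect

/-- Sector 011: `x ⊗ g ⊗ y ⊗ z ↦ ∑ ± g' ⊗ S(g'').x ⊗ y ⊗ z`. -/
def assoc011 (X : SRep h) (Y Z : SVect) :
    X.V ⊗[ℂ] (S h ⊗[ℂ] (Y.V ⊗[ℂ] Z.V)) →ₗ[ℂ] S h ⊗[ℂ] ((X.V ⊗[ℂ] Y.V) ⊗[ℂ] Z.V) :=
  TensorProduct.map LinearMap.id (assocTriv X.V Y.V Z.V) ∘ₗ
    (TensorProduct.assoc ℂ (S h) X.V (Y.V ⊗[ℂ] Z.V)).toLinearMap ∘ₗ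
    TensorProduct.map X.moveOut LinearMap.id ∘ₗ assocTriv X.V (S h) (Y.V ⊗[ℂ] Z.V)

/-- Sector 101: `γ` acts on `S(𝔥)` (by multiplication) and on `Y`. -/
def SympData.assoc101 (X : SVect) (Y : SRep h) (Z : SVect) :
    S h ⊗[ℂ] (X.V ⊗[ℂ] (Y.V ⊗[ℂ] Z.V)) →ₗ[ℂ] S h ⊗[ℂ] ((X.V ⊗[ℂ] Y.V) ⊗[ℂ] Z.V) :=
  TensorProduct.map LinearMap.id (assocTriv X.V Y.V Z.V) ∘ₗ
    (TensorProduct.assoc ℂ (S h) X.V (Y.V ⊗[ℂ] Z.V)).toLinearMap ∘ₗ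
    D.gamma ((reg h).tensor (X.triv h)) (Y.tensor (Z.triv h)).act ∘ₗ
    assocTriv (S h) X.V (Y.V ⊗[ℂ] Z.V)

/-- Sector 110: `g ⊗ x ⊗ y ⊗ z ↦ ∑ ± g' ⊗ x ⊗ y ⊗ g''.z`, the result of acting with `g` on the
element `1 ⊗ x ⊗ y ⊗ z` of the representation `(S(𝔥) ⊗ X ⊗ Y) ⊗ Z`. -/
def assoc110 (X Y : SVect) (Z : SRep h) :
    S h ⊗[ℂ] (X.V ⊗[ℂ] (Y.V ⊗[ℂ] Z.V)) →ₗ[ℂ] (S h ⊗[ℂ] (X.V ⊗[ℂ] Y.V)) ⊗[ℂ] Z.V :=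
  TensorProduct.lift
    ((LinearMap.lcomp ℂ _
        (TensorProduct.map (TensorProduct.mk ℂ (S h) (X.V ⊗[ℂ] Y.V) 1) LinearMap.id ∘ₗ
          assocTriv X.V Y.V Z.V)) ∘ₗ
      (((reg h).tensor ((X.tensor Y).triv h)).tensor Z).rho.toLinearMap)

/-- Sector 111: `x ⊗ g ⊗ y ⊗ z ↦ ± φ(g) ⊗ x ⊗ y ⊗ z`. -/
def SympData.assoc111 (X Y Z : SVect) :
    X.V ⊗[ℂ] (S h ⊗[ℂ] (Y.V ⊗[ℂ] Z.V)) →ₗ[ℂ] (S h ⊗[ℂ] (X.V ⊗[ℂ] Y.V)) ⊗[ℂ] Z.V :=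
  assocTriv (S h) (X.V ⊗[ℂ] Y.V) Z.V ∘ₗ
    TensorProduct.map LinearMap.id (assocTriv X.V Y.V Z.V) ∘ₗ
    (TensorProduct.assoc ℂ (S h) X.V (Y.V ⊗[ℂ] Z.V)).toLinearMap ∘ₗ
    TensorProduct.map (TensorProduct.map D.phi LinearMap.id ∘ₗ X.flip (reg h).toSVect)
      LinearMap.id ∘ₗ
    assocTriv X.V (S h) (Y.V ⊗[ℂ] Z.V)

section Assemble

variable {P X₀ Y₀ Z₀ X₁ Y₁ Z₁ : Type} [AddCommGroup P] [Module ℂ P]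
  [AddCommGroup X₀] [Module ℂ X₀] [AddCommGroup Y₀] [Module ℂ Y₀] [AddCommGroup Z₀] [Module ℂ Z₀]
  [AddCommGroup X₁] [Module ℂ X₁] [AddCommGroup Y₁] [Module ℂ Y₁] [AddCommGroup Z₁] [Module ℂ Z₁]

/-- The map `X ∗ (Y ∗ Z) → (X ∗ Y) ∗ Z` in sector 0 with components `k000`, `k011`, `k101`, `k110`
(here `P` stands for `S(𝔥)`). -/
def assemble₀ (k000 : X₀ ⊗[ℂ] (Y₀ ⊗[ℂ] Z₀) →ₗ[ℂ] (X₀ ⊗[ℂ] Y₀) ⊗[ℂ] Z₀)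
    (k011 : X₀ ⊗[ℂ] (P ⊗[ℂ] (Y₁ ⊗[ℂ] Z₁)) →ₗ[ℂ] P ⊗[ℂ] ((X₀ ⊗[ℂ] Y₁) ⊗[ℂ] Z₁))
    (k101 : P ⊗[ℂ] (X₁ ⊗[ℂ] (Y₀ ⊗[ℂ] Z₁)) →ₗ[ℂ] P ⊗[ℂ] ((X₁ ⊗[ℂ] Y₀) ⊗[ℂ] Z₁))
    (k110 : P ⊗[ℂ] (X₁ ⊗[ℂ] (Y₁ ⊗[ℂ] Z₀)) →ₗ[ℂ] (P ⊗[ℂ] (X₁ ⊗[ℂ] Y₁)) ⊗[ℂ] Z₀) :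
    (X₀ ⊗[ℂ] ((Y₀ ⊗[ℂ] Z₀) × (P ⊗[ℂ] (Y₁ ⊗[ℂ] Z₁)))) ×
      (P ⊗[ℂ] (X₁ ⊗[ℂ] ((Y₀ ⊗[ℂ] Z₁) × (Y₁ ⊗[ℂ] Z₀)))) →ₗ[ℂ]
    (((X₀ ⊗[ℂ] Y₀) × (P ⊗[ℂ] (X₁ ⊗[ℂ] Y₁))) ⊗[ℂ] Z₀) ×
      (P ⊗[ℂ] (((X₀ ⊗[ℂ] Y₁) × (X₁ ⊗[ℂ] Y₀)) ⊗[ℂ] Z₁)) :=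
  LinearMap.coprod
    (LinearMap.coprod
        (LinearMap.inl ℂ _ _ ∘ₗ TensorProduct.map (LinearMap.inl ℂ _ _) LinearMap.id ∘ₗ k000)
        (LinearMap.inr ℂ _ _ ∘ₗ TensorProduct.map LinearMap.id
            (TensorProduct.map (LinearMap.inl ℂ _ _) LinearMap.id) ∘ₗ k011) ∘ₗ
      (TensorProduct.prodRight ℂ ℂ _ _ _).toLinearMap)
    (LinearMap.coprod
        (LinearMap.inr ℂ _ _ ∘ₗ TensorProduct.map LinearMap.id
            (TensorProduct.map (LinearMap.inr ℂ _ _) LinearMap.id) ∘ₗ k101)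
        (LinearMap.inl ℂ _ _ ∘ₗ TensorProduct.map (LinearMap.inr ℂ _ _) LinearMap.id ∘ₗ k110) ∘ₗ
      (TensorProduct.prodRight ℂ ℂ _ _ _).toLinearMap ∘ₗ
      TensorProduct.map LinearMap.id (TensorProduct.prodRight ℂ ℂ _ _ _).toLinearMap)

/-- The map `X ∗ (Y ∗ Z) → (X ∗ Y) ∗ Z` in sector 1 with components `k001`, `k010`, `k100`, `k111`
(here `P` stands for `S(𝔥)`). -/
def assemble₁ (k001 : X₀ ⊗[ℂ] (Y₀ ⊗[ℂ] Z₁) →ₗ[ℂ] (X₀ ⊗[ℂ] Y₀) ⊗[ℂ] Z₁)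
    (k010 : X₀ ⊗[ℂ] (Y₁ ⊗[ℂ] Z₀) →ₗ[ℂ] (X₀ ⊗[ℂ] Y₁) ⊗[ℂ] Z₀)
    (k100 : X₁ ⊗[ℂ] (Y₀ ⊗[ℂ] Z₀) →ₗ[ℂ] (X₁ ⊗[ℂ] Y₀) ⊗[ℂ] Z₀)
    (k111 : X₁ ⊗[ℂ] (P ⊗[ℂ] (Y₁ ⊗[ℂ] Z₁)) →ₗ[ℂ] (P ⊗[ℂ] (X₁ ⊗[ℂ] Y₁)) ⊗[ℂ] Z₁) :
    (X₀ ⊗[ℂ] ((Y₀ ⊗[ℂ] Z₁) × (Y₁ ⊗[ℂ] Z₀))) ×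
      (X₁ ⊗[ℂ] ((Y₀ ⊗[ℂ] Z₀) × (P ⊗[ℂ] (Y₁ ⊗[ℂ] Z₁)))) →ₗ[ℂ]
    (((X₀ ⊗[ℂ] Y₀) × (P ⊗[ℂ] (X₁ ⊗[ℂ] Y₁))) ⊗[ℂ] Z₁) ×
      (((X₀ ⊗[ℂ] Y₁) × (X₁ ⊗[ℂ] Y₀)) ⊗[ℂ] Z₀) :=
  LinearMap.coprod
    (LinearMap.coprod
        (LinearMap.inl ℂ _ _ ∘ₗ TensorProduct.map (LinearMap.inl ℂ _ _) LinearMap.id ∘ₗ k001)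
        (LinearMap.inr ℂ _ _ ∘ₗ TensorProduct.map (LinearMap.inl ℂ _ _) LinearMap.id ∘ₗ k010) ∘ₗ
      (TensorProduct.prodRight ℂ ℂ _ _ _).toLinearMap)
    (LinearMap.coprod
        (LinearMap.inr ℂ _ _ ∘ₗ TensorProduct.map (LinearMap.inr ℂ _ _) LinearMap.id ∘ₗ k100)
        (LinearMap.inl ℂ _ _ ∘ₗ TensorProduct.map (LinearMap.inr ℂ _ _) LinearMap.id ∘ₗ k111) ∘ₗ
      (TensorProduct.prodRight ℂ ℂ _ _ _).toLinearMap)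

end Assemble

/-- The associator `α_{X,Y,Z} : X ∗ (Y ∗ Z) → (X ∗ Y) ∗ Z` of `SF(𝔥)`. -/
def SympData.assoc (X Y Z : SF h) :
    LMap (X.car.star h (Y.car.star h Z.car)) ((X.car.star h Y.car).star h Z.car) :=
  (assemble₀ (assocTriv X.zero.V Y.zero.V Z.zero.V) (assoc011 X.zero Y.one Z.one)
      (D.assoc101 X.one Y.zero Z.one) (assoc110 X.one Y.one Z.zero),
    assemble₁ (assocTriv X.zero.V Y.zero.V Z.one.V) (D.assoc010 X.zero Y.one Z.zero)
      (assocTriv X.one.V Y.zero.V Z.zero.V) (D.assoc111 X.one Y.one Z.one))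

/-- The braiding `c_{X,Y} : X ∗ Y → Y ∗ X` of `SF(𝔥)`. With `τ` the symmetric braiding and `ω` the
parity involution of super-vector spaces, its sectors are `τ ∘ γ⁻¹` (sector 00),
`τ ∘ (σ ⊗ id)` (sector 01), `τ ∘ (id ⊗ σ ω)` (sector 10), and
`g ⊗ x ⊗ y ↦ β σ⁻¹ g ⊗ τ(x ⊗ ω y)` (sector 11). -/
def SympData.braid (X Y : SF h) : LMap (X.car.star h Y.car) (Y.car.star h X.car) :=
  ( LinearMap.prodMap
      (X.zero.toSVect.flip Y.zero.toSVect ∘ₗ D.gammaInv X.zero Y.zero.act)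
      (D.β • TensorProduct.map (D.sigmaInv (reg h))
        (X.one.flip Y.one ∘ₗ TensorProduct.map LinearMap.id Y.one.par)),
    LinearMap.coprod
      (LinearMap.inr ℂ _ _ ∘ₗ X.zero.toSVect.flip Y.one ∘ₗ
        TensorProduct.map (D.sigma X.zero) LinearMap.id)
      (LinearMap.inl ℂ _ _ ∘ₗ X.one.flip Y.zero.toSVect ∘ₗ
        TensorProduct.map LinearMap.id (D.sigma Y.zero ∘ₗ Y.zero.par)) )

end Structure

/-! ### Algebras in `SF(𝔥)` and their modules -/

section Algebras

variable {h : Type} [AddCommGroup h] [Module ℂ h] [FiniteDimensional ℂ h]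

/-- An object of `SF(𝔥)` with a multiplication and a unit, no axioms imposed. A morphism from the
tensor unit (the trivial one-dimensional even representation, placed in sector 0) is the same as
an even invariant vector, the image of `1`. -/
structure AlgData (h : Type) [AddCommGroup h] [Module ℂ h] [FiniteDimensional ℂ h] where
  obj : SF h
  mul : LMap (obj.car.star h obj.car) obj.car
  unit : obj.zero.V

/-- `A` is an (associative unital) algebra in the monoidal category `SF(𝔥)`. -/
structure AlgData.IsAlgebra (A : AlgData h) (D : SympData h) : Prop where
  mul_mem : A.mul ∈ homs (A.obj.star A.obj) A.obj
  par_unit : A.obj.zero.par A.unit = A.unit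
  act_unit : ∀ a, A.obj.zero.act a A.unit = 0
  assoc : A.mul.comp ((LMap.id A.obj.car).star h A.mul) =
    (A.mul.comp (A.mul.star h (LMap.id A.obj.car))).comp (D.assoc A.obj A.obj A.obj)
  unit_mul_zero : ∀ x : A.obj.zero.V, A.mul.1 (A.unit ⊗ₜ x, 0) = x
  unit_mul_one : ∀ x : A.obj.one.V, A.mul.2 (A.unit ⊗ₜ x, 0) = x
  mul_unit_zero : ∀ x : A.obj.zero.V, A.mul.1 (x ⊗ₜ A.unit, 0) = x
  mul_unit_one : ∀ x : A.obj.one.V, A.mul.2 (0, x ⊗ₜ A.unit) = x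

/-- A left module in `SF(𝔥)` over `A`. -/
structure Mod (D : SympData h) (A : AlgData h) where
  obj : SF h
  act : LMap (A.obj.car.star h obj.car) obj.car
  act_mem : act ∈ homs (A.obj.star obj) obj
  assoc : act.comp ((LMap.id A.obj.car).star h act) =
    (act.comp (A.mul.star h (LMap.id obj.car))).comp (D.assoc A.obj A.obj obj)
  unit_zero : ∀ x : obj.zero.V, act.1 (A.unit ⊗ₜ x, 0) = x
  unit_one : ∀ x : obj.one.V, act.2 (A.unit ⊗ₜ x, 0) = x

/-- `id ∗ f` depends linearly on `f`. -/
def starLeft (h : Type) [AddCommGroup h] [Module ℂ h] (X : Car) (Y Y' : Car) :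
    LMap Y Y' →ₗ[ℂ] LMap (X.star h Y) (X.star h Y') where
  toFun f := (LMap.id X).star h f
  map_add' f g := by
    refine Prod.ext ?_ ?_
    · refine LinearMap.ext fun v => Prod.ext ?_ ?_ <;>
        simp [LMap.star, LMap.id, TensorProduct.map_add_right]
    · refine LinearMap.ext fun v => Prod.ext ?_ ?_ <;>
        simp [LMap.star, LMap.id, TensorProduct.map_add_right]
  map_smul' r f := by
    refine Prod.ext ?_ ?_
    · refine LinearMap.ext fun v => Prod.ext ?_ ?_ <;>
        simp [LMap.star, LMap.id, TensorProduct.map_smul_right]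
    · refine LinearMap.ext fun v => Prod.ext ?_ ?_ <;>
        simp [LMap.star, LMap.id, TensorProduct.map_smul_right]

variable {D : SympData h} {A : AlgData h}

/-- Morphisms of `A`-modules: the morphisms of `SF(𝔥)` that intertwine the actions of `A`. -/
def Mod.homs (M N : Mod D A) : Submodule ℂ (LMap M.obj.car N.obj.car) where
  carrier := {f | f ∈ SymplecticFermion.homs M.obj N.obj ∧
    LMap.comp f M.act = N.act.comp ((LMap.id A.obj.car).star h f)}
  add_mem' {f g} hf hg := by
    refine ⟨add_mem hf.1 hg.1, ?_⟩
    have := (starLeft h A.obj.car M.obj.car N.obj.car).map_add f g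
    simp only [starLeft, LinearMap.coe_mk, AddHom.coe_mk] at this
    rw [LMap.add_comp, hf.2, hg.2, this, LMap.comp_add]
  zero_mem' := by
    refine ⟨zero_mem _, ?_⟩
    have := (starLeft h A.obj.car M.obj.car N.obj.car).map_zero
    simp only [starLeft, LinearMap.coe_mk, AddHom.coe_mk] at this
    rw [this]
    refine Prod.ext ?_ ?_ <;> simp [LMap.comp]
  smul_mem' r f hf := by
    refine ⟨Submodule.smul_mem _ r hf.1, ?_⟩
    have := (starLeft h A.obj.car M.obj.car N.obj.car).map_smul r f
    simp only [starLeft, LinearMap.coe_mk, AddHom.coe_mk] at this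
    rw [LMap.smul_comp, hf.2, this, LMap.comp_smul]

/-- The category of left `A`-modules in `SF(𝔥)`. -/
instance : Category (Mod D A) where
  Hom M N := Mod.homs M N
  id M := ⟨LMap.id M.obj.car, id_mem_homs M.obj, by rw [id_star_id]; rfl⟩
  comp {M N P} f g := ⟨g.1.comp f.1, comp_mem_homs g.2.1 f.2.1, by
    rw [id_star_comp, LMap.comp_assoc, f.2.2, ← LMap.comp_assoc, g.2.2, LMap.comp_assoc]⟩

instance (M N : Mod D A) : AddCommGroup (M ⟶ N) := inferInstanceAs (AddCommGroup (Mod.homs M N))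

instance (M N : Mod D A) : Module ℂ (M ⟶ N) := inferInstanceAs (Module ℂ (Mod.homs M N))

instance : Preadditive (Mod D A) where
  add_comp _ _ _ f f' g := Subtype.ext (LMap.comp_add g.1 f.1 f'.1)
  comp_add _ _ _ f g g' := Subtype.ext (LMap.add_comp g.1 g'.1 f.1)

instance : Linear ℂ (Mod D A) where
  homModule _ _ := inferInstance
  smul_comp _ _ _ r f g := Subtype.ext (LMap.comp_smul r g.1 f.1)
  comp_smul _ _ _ f r g := Subtype.ext (LMap.smul_comp r g.1 f.1)

/-- An algebra `A`, as a left module over itself. -/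
def Mod.regular (hA : A.IsAlgebra D) : Mod D A where
  obj := A.obj
  act := A.mul
  act_mem := hA.mul_mem
  assoc := hA.assoc
  unit_zero := hA.unit_mul_zero
  unit_one := hA.unit_mul_one

lemma tensor_map_neg {V W : Type} [AddCommGroup V] [Module ℂ V] [AddCommGroup W] [Module ℂ W]
    (p : V →ₗ[ℂ] V) (q : W →ₗ[ℂ] W) : TensorProduct.map p (-q) = -TensorProduct.map p q :=
  (TensorProduct.mapBilinear (RingHom.id ℂ) V W V W p).map_neg q

lemma star_shift_par_zero (X Y : SF h) (v : (X.car.star h Y.car).V₀) :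
    (X.star Y.shift).zero.par v = -(X.star Y).zero.par v := by
  obtain ⟨u, w⟩ := v
  refine Prod.ext ?_ ?_
  · change TensorProduct.map X.zero.par (-Y.zero.par) u = -TensorProduct.map X.zero.par Y.zero.par u
    rw [tensor_map_neg]; rfl
  · change TensorProduct.map invol.toLinearMap (TensorProduct.map X.one.par (-Y.one.par)) w =
      -TensorProduct.map invol.toLinearMap (TensorProduct.map X.one.par Y.one.par) w
    rw [tensor_map_neg, tensor_map_neg]; rfl

lemma star_shift_par_one (X Y : SF h) (v : (X.car.star h Y.car).V₁) :
    (X.star Y.shift).one.par v = -(X.star Y).one.par v := by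
  obtain ⟨u, w⟩ := v
  refine Prod.ext ?_ ?_
  · change TensorProduct.map X.zero.par (-Y.one.par) u = -TensorProduct.map X.zero.par Y.one.par u
    rw [tensor_map_neg]; rfl
  · change TensorProduct.map X.one.par (-Y.zero.par) w = -TensorProduct.map X.one.par Y.zero.par w
    rw [tensor_map_neg]; rfl

/-- The associator `α_{X,Y,Z}` does not involve the parity involution of `Z`. -/
lemma assoc_shift (D : SympData h) (X Y Z : SF h) : D.assoc X Y Z.shift = D.assoc X Y Z := rfl

/-- The parity-exchanged module `ΠM`: the parity involution of the underlying object is replaced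
by its negative, everything else is unchanged. (This is `M ∗ Π𝟙`.) -/
def Mod.shift (M : Mod D A) : Mod D A where
  obj := M.obj.shift
  act := M.act
  act_mem := by
    refine ⟨fun v => ?_, fun a v => M.act_mem.2.1 a v, fun v => ?_⟩
    · refine (congrArg M.act.1 (star_shift_par_zero A.obj M.obj v)).trans ?_
      exact (map_neg M.act.1 _).trans (congrArg Neg.neg (M.act_mem.1 v))
    · refine (congrArg M.act.2 (star_shift_par_one A.obj M.obj v)).trans ?_
      exact (map_neg M.act.2 _).trans (congrArg Neg.neg (M.act_mem.2.2 v))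
  assoc := by
    rw [assoc_shift]
    exact M.assoc
  unit_zero := M.unit_zero
  unit_one := M.unit_one

/-- The right action `M ∗ A → A ∗ M → M` of `A` on a left module, by means of the braiding. -/
def Mod.ract (M : Mod D A) : LMap (M.obj.car.star h A.obj.car) M.obj.car :=
  M.act.comp (D.braid M.obj A.obj)

/-- A pair of maps `M ∗ N → Q` is balanced if it coequalises the right action of `A` on `M` and
the left action of `A` on `N`, which both go from `M ∗ (A ∗ N)` to `M ∗ N`. -/
def Mod.Balanced (M N : Mod D A) {Q : Car} (g : LMap (M.obj.car.star h N.obj.car) Q) : Prop :=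
  g.comp ((M.ract.star h (LMap.id N.obj.car)).comp (D.assoc M.obj A.obj N.obj)) =
    g.comp ((LMap.id M.obj.car).star h N.act)

/-- A monoidal structure on the category of left `A`-modules is *the tensor product over `A`* if
the tensor product `M ⊗ N` of two modules is the coequaliser in `SF(𝔥)` of the two maps
`M ∗ (A ∗ N) → M ∗ N`, with the action of `A` induced from that on `M`, if its unit is `A`, and if
its unitors and associators are induced by the actions of `A` and by the associator of `SF(𝔥)`. -/
structure IsTensorOver (hA : A.IsAlgebra D) [MonoidalCategory (Mod D A)] where
  /-- the canonical projection `M ∗ N → M ⊗ N` -/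
  π : ∀ M N : Mod D A, M.obj.star N.obj ⟶ (M ⊗ N).obj
  balanced : ∀ M N, Mod.Balanced M N (π M N).1
  coequalizer : ∀ (M N : Mod D A) (Q : SF h) (g : M.obj.star N.obj ⟶ Q), Mod.Balanced M N g.1 →
    ∃! k : (M ⊗ N).obj ⟶ Q, π M N ≫ k = g
  act : ∀ M N : Mod D A, (M ⊗ N).act.comp ((LMap.id A.obj.car).star h (π M N).1) =
    LMap.comp (π M N).1 ((M.act.star h (LMap.id N.obj.car)).comp (D.assoc A.obj M.obj N.obj))
  natural : ∀ {M M' N N' : Mod D A} (f : M ⟶ M') (g : N ⟶ N'),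
    LMap.comp (f ⊗ₘ g).1 (π M N).1 = LMap.comp (π M' N').1 (LMap.star f.1 h g.1)
  /-- the unit is the regular module -/
  unit : 𝟙_ (Mod D A) ≅ Mod.regular hA
  leftUnitor : ∀ M : Mod D A,
    LMap.comp ((unit.inv ▷ M) ≫ (λ_ M).hom).1 (π (Mod.regular hA) M).1 = M.act
  rightUnitor : ∀ M : Mod D A,
    LMap.comp ((M ◁ unit.inv) ≫ (ρ_ M).hom).1 (π M (Mod.regular hA)).1 = M.ract
  associator : ∀ M N P : Mod D A,
    LMap.comp (α_ M N P).hom.1 (LMap.comp (π (M ⊗ N) P).1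
      (LMap.comp (LMap.star (π M N).1 h (LMap.id P.obj.car)) (D.assoc M.obj N.obj P.obj))) =
    LMap.comp (π M (N ⊗ P)).1 (LMap.star (LMap.id M.obj.car) h (π N P).1)

end Algebras

/-! ### The algebra `H(𝔣)` -/

section HAlgebra

variable {h : Type} [AddCommGroup h] [Module ℂ h] [FiniteDimensional ℂ h]

/-- A subspace is Lagrangian if it is equal to its orthogonal complement. -/
def SympData.IsLagrangian (D : SympData h) (f : Submodule ℂ h) : Prop := D.form.orthogonal f = f

/-- `Sᵏ(𝔣)`, as a subspace of `S(𝔥)`. -/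
def symPower (f : Submodule ℂ h) (k : ℕ) : Submodule ℂ (S h) :=
  (⋀[ℂ]^k f : Submodule ℂ (S f)).map (ExteriorAlgebra.map f.subtype).toLinearMap

lemma symPower_le (f : Submodule ℂ h) (k : ℕ) : symPower f k ≤ ⋀[ℂ]^k h := by
  rw [symPower, Submodule.map_le_iff_le_comap]
  intro x hx
  induction hx using Submodule.pow_induction_on_left' with
  | algebraMap r =>
    rw [Submodule.mem_comap, AlgHom.toLinearMap_apply, AlgHom.commutes]
    change _ ∈ LinearMap.range (ExteriorAlgebra.ι ℂ) ^ 0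
    rw [pow_zero]
    exact Submodule.algebraMap_mem r
  | add x y i hx hy ihx ihy => exact add_mem ihx ihy
  | mem_mul m hm i x hx ih =>
    obtain ⟨a, rfl⟩ := hm
    rw [Submodule.mem_comap, AlgHom.toLinearMap_apply, map_mul, ExteriorAlgebra.map_apply_ι]
    change _ ∈ LinearMap.range (ExteriorAlgebra.ι ℂ) ^ (i + 1)
    rw [pow_succ']
    exact Submodule.mul_mem_mul ⟨_, rfl⟩ ih

/-- `⟨m⟩ ⊆ S(𝔥)`: the submodule `{g m | g ∈ S(𝔥)}` generated by a homogeneous element `m`. -/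
@[reducible] def genRep (m : S h) (k : ℕ) (hm : m ∈ ⋀[ℂ]^k h) : SRep h where
  V := LinearMap.range (LinearMap.mulRight ℂ m)
  par := invol.toLinearMap.restrict (by
    rintro _ ⟨g, rfl⟩
    exact ⟨(-1 : ℂ) ^ k • invol g, by simp [invol_of_mem hm]⟩)
  par_par v := Subtype.ext (invol_invol _)
  act :=
    { toFun := fun a => (LinearMap.mulLeft ℂ (ExteriorAlgebra.ι ℂ a)).restrict (by
        rintro _ ⟨g, rfl⟩
        exact ⟨ExteriorAlgebra.ι ℂ a * g, by simp [mul_assoc]⟩)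
      map_add' := fun a b => by ext v; simp [add_mul]
      map_smul' := fun r a => by ext v; simp }
  act_act a v := by ext; simp [← mul_assoc]
  act_par a v := by ext; simp [invol_ι]

/-- The choices in the construction of `H(𝔣)` for a Lagrangian subspace `𝔣`: non-zero elements
`m ∈ S^{d/2}(𝔣)` and `1_H ∈ S^d(𝔥)`. The submodule `⟨m⟩` always contains `S^d(𝔥)`, and the second
element is recorded as an element of `⟨m⟩`. -/
structure HChoice (D : SympData h) (f : Submodule ℂ h) where
  m : S h
  m_mem : m ∈ symPower f (Module.finrank ℂ h / 2)
  m_ne : m ≠ 0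
  e : LinearMap.range (LinearMap.mulRight ℂ m)
  e_mem : (e : S h) ∈ ⋀[ℂ]^(Module.finrank ℂ h) h
  e_ne : e ≠ 0

variable {D : SympData h} {f : Submodule ℂ h} (c : HChoice D f)

/-- The representation `L = ⟨m⟩ ⊆ S(𝔥)`. -/
@[reducible] def HChoice.L : SRep h :=
  genRep c.m (Module.finrank ℂ h / 2) (symPower_le f _ c.m_mem)

/-- The surjection `M : S(𝔥) → L`, `g ↦ g m`. -/
def HChoice.M : S h →ₗ[ℂ] c.L.V := (LinearMap.mulRight ℂ c.m).rangeRestrict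

/-- The linear form `χ` on `S(𝔥)` which is non-zero only in the top degree, with `χ(1_H) = 1`. -/
def HChoice.chi : S h →ₗ[ℂ] ℂ := (D.lam c.e)⁻¹ • D.lam

/-- The coproduct of `S(𝔥)`, the algebra map to the super tensor product `S(𝔥) ⊗ S(𝔥)` with
`a ↦ a ⊗ 1 + 1 ⊗ a` for `a ∈ 𝔥`: `Δ(g)` is the result of acting with `g` on `1 ⊗ 1`. -/
def comul (h : Type) [AddCommGroup h] [Module ℂ h] [FiniteDimensional ℂ h] :
    S h →ₗ[ℂ] S h ⊗[ℂ] S h :=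
  LinearMap.applyₗ ((1 : S h) ⊗ₜ[ℂ] (1 : S h)) ∘ₗ ((reg h).tensor (reg h)).rho.toLinearMap

/-- The map `S(𝔥) ⊗ L → L`, `g ⊗ x ↦ ∑ χ(S(g'') x) g' m`, with `∑ g' ⊗ g'' = Δ(g)` and `S` the
antipode. -/
def HChoice.preMul : S h ⊗[ℂ] c.L.V →ₗ[ℂ] c.L.V :=
  (TensorProduct.rid ℂ c.L.V).toLinearMap ∘ₗ
    TensorProduct.map c.M
      (c.chi ∘ₗ TensorProduct.lift ((LinearMap.mul ℂ (S h)).compl₁₂ invol.toLinearMap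
        (LinearMap.range (LinearMap.mulRight ℂ c.m)).subtype)) ∘ₗ
    (TensorProduct.assoc ℂ (S h) (S h) c.L.V).toLinearMap ∘ₗ
    TensorProduct.map (comul h) LinearMap.id

/-- A linear map choosing for each `x ∈ L` an element `g ∈ S(𝔥)` with `g m = x`. -/
def HChoice.lift : c.L.V →ₗ[ℂ] S h :=
  (c.M.exists_rightInverse_of_surjective (LinearMap.range_rangeRestrict _)).choose

/-- The multiplication of `L`, `μ₀₀(g m ⊗ x) = ∑ χ(S(g'') x) g' m`. (The right hand side
depends on `g` only through `g m`.) -/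
def HChoice.mul00 : c.L.V ⊗[ℂ] c.L.V →ₗ[ℂ] c.L.V :=
  c.preMul ∘ₗ TensorProduct.map c.lift LinearMap.id

/-- The super-vector space `ℂ^{1|0}`; placed in sector 1 it is the simple object `T`. -/
@[reducible] def unitSVect : SVect where
  V := ℂ
  par := LinearMap.id
  par_par _ := rfl

/-- The algebra `H(𝔣) = L ⊕ T` in `SF(𝔥)`. Its multiplication is `μ₀₀` on `L ∗ L`, multiplication
with `χ` on `L ∗ T` and on `T ∗ L`, and `g ⊗ x ⊗ y ↦ x y g m` on `T ∗ T = S(𝔥) ⊗ T ⊗ T`; its unit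
is `1_H`. -/
def HChoice.H : AlgData h where
  obj := ⟨c.L, unitSVect⟩
  mul :=
    ( LinearMap.coprod c.mul00
        (c.M ∘ₗ (TensorProduct.rid ℂ (S h)).toLinearMap ∘ₗ
          TensorProduct.map LinearMap.id (LinearMap.mul' ℂ ℂ)),
      LinearMap.coprod
        (LinearMap.mul' ℂ ℂ ∘ₗ TensorProduct.map
          (c.chi ∘ₗ (LinearMap.range (LinearMap.mulRight ℂ c.m)).subtype) LinearMap.id)
        (LinearMap.mul' ℂ ℂ ∘ₗ TensorProduct.map LinearMap.id
          (c.chi ∘ₗ (LinearMap.range (LinearMap.mulRight ℂ c.m)).subtype)) )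
  unit := c.e

end HAlgebra

/-! ### Finite tensor categories -/

/-- A finite tensor category over `ℂ`: a rigid monoidal `ℂ`-linear abelian category (with bilinear
tensor product) whose unit is simple, and which is equivalent as a `ℂ`-linear category to the
category of finite-dimensional modules over a finite-dimensional `ℂ`-algebra. -/
structure IsFiniteTensorCategory (𝒞 : Type 1) [Category.{0} 𝒞] [Preadditive 𝒞] [Linear ℂ 𝒞]
    [MonoidalCategory 𝒞] : Prop where
  abelian : ∃ ab : Abelian 𝒞, ab.toPreadditive = ‹Preadditive 𝒞›
  bilinear : ∃ _ : MonoidalPreadditive 𝒞, MonoidalLinear ℂ 𝒞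
  rigid : Nonempty (RigidCategory 𝒞)
  simple_unit : Simple (𝟙_ 𝒞)
  finite : ∃ (R : Type) (_ : Ring R) (_ : Algebra ℂ R) (_ : FiniteDimensional ℂ R)
    (E : 𝒞 ≌ FGModuleCat.{0} R), Functor.Additive E.functor ∧ Functor.Linear ℂ E.functor

end SymplecticFermion

namespace SymplecticFermion

notation "𝕀" => LinearMap.id

open ExteriorAlgebra (ι)
open TensorProduct (assoc lid rid)
open Module (finrank)
open AlgHom (commutes)
open Algebra (algebraMap_eq_smul_one)

set_option linter.unusedSectionVars false

section SuperAlgebra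

variable {h : Type} [AddCommGroup h] [Module ℂ h]

lemma S.induction {P : S h → Prop} (halg : ∀ r : ℂ, P (algebraMap ℂ (S h) r))
    (hadd : ∀ x y, P x → P y → P (x + y)) (hmul : ∀ a x, P x → P (ι ℂ a * x)) (x : S h) : P x :=
  CliffordAlgebra.left_induction _ halg hadd (fun x a hx => hmul a x hx) x

lemma S.ext_of_mul {W : Type} [AddCommGroup W] [Module ℂ W] {F G : S h →ₗ[ℂ] W}
    (h1 : F 1 = G 1) (hmul : ∀ a x, F x = G x → F (ι ℂ a * x) = G (ι ℂ a * x)) : F = G := by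
  refine LinearMap.ext fun x => ?_
  induction x using S.induction with
  | halg r => rw [algebraMap_eq_smul_one, map_smul, map_smul, h1]
  | hadd x y hx hy => rw [map_add, map_add, hx, hy]
  | hmul a x hx => exact hmul a x hx

lemma invol_ι_mul (a : h) (x : S h) : invol (ι ℂ a * x) = -(ι ℂ a * invol x) := by
  rw [map_mul, invol_ι, neg_mul]

lemma ι_mul_invol (a : h) (x : S h) : ι ℂ a * invol x = x * ι ℂ a := by
  induction x using S.induction with
  | halg r => rw [commutes]; exact (Algebra.commutes r _).symm
  | hadd x y hx hy => rw [map_add, mul_add, hx, hy, add_mul]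
  | hmul b x hx =>
    rw [invol_ι_mul, mul_neg, ← mul_assoc, mul_assoc (ι ℂ b) x, ← hx, ← mul_assoc, ← neg_mul]
    congr 1
    exact neg_eq_of_add_eq_zero_left (ExteriorAlgebra.ι_add_mul_swap b a)

lemma ι_mul_eq (a : h) (x : S h) : ι ℂ a * x = invol x * ι ℂ a := by
  rw [← ι_mul_invol, invol_invol]

lemma ι_mul_ι_comm (a b : h) : ι ℂ a * ι ℂ b = -(ι ℂ b * ι ℂ a) :=
  eq_neg_of_add_eq_zero_left (ExteriorAlgebra.ι_add_mul_swap a b)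

end SuperAlgebra

/-- Anticommuting operators of square zero that preserve a non-zero subspace have a common
kernel vector in it. -/
lemma exists_common_kernel {V I : Type} [AddCommGroup V] [Module ℂ V] (T : I → Module.End ℂ V)
    (hsq : ∀ i v, T i (T i v) = 0) (hanti : ∀ i j v, T i (T j v) = -T j (T i v))
    (J : Submodule ℂ V) (hJ : ∀ i, ∀ v ∈ J, T i v ∈ J) (hne : J ≠ ⊥) (s : Finset I) :
    ∃ v ∈ J, v ≠ 0 ∧ ∀ i ∈ s, T i v = 0 := by
  classical
  induction s using Finset.induction_on with
  | empty =>
    obtain ⟨v, hv, h0⟩ := J.ne_bot_iff.mp hne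
    exact ⟨v, hv, h0, by simp⟩
  | insert i s hi ih =>
    obtain ⟨v, hv, h0, hs⟩ := ih
    by_cases hz : T i v = 0
    · exact ⟨v, hv, h0, by simpa [hz] using hs⟩
    · refine ⟨T i v, hJ i v hv, hz, fun j hj => ?_⟩
      rcases Finset.mem_insert.mp hj with rfl | hj
      · exact hsq _ v
      · rw [hanti, hs j hj, map_zero, neg_zero]

section Contraction

variable {h : Type} [AddCommGroup h] [Module ℂ h] [FiniteDimensional ℂ h] (D : SympData h)

/-- The contraction with the linear form `(v, -)`, an odd derivation of `S(𝔥)`. -/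
def SympData.dd (v : h) : S h →ₗ[ℂ] S h := CliffordAlgebra.contractLeft (D.form v)

lemma dd_ι_mul (v a : h) (x : S h) :
    D.dd v (ι ℂ a * x) = D.form v a • x - ι ℂ a * D.dd v x :=
  CliffordAlgebra.contractLeft_ι_mul _ a x

lemma dd_algebraMap (v : h) (r : ℂ) : D.dd v (algebraMap ℂ (S h) r) = 0 :=
  CliffordAlgebra.contractLeft_algebraMap _ _ r

lemma dd_one (v : h) : D.dd v 1 = 0 := CliffordAlgebra.contractLeft_one _ _

lemma dd_dd (v : h) (x : S h) : D.dd v (D.dd v x) = 0 := CliffordAlgebra.contractLeft_contractLeft _ _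

lemma dd_comm (v w : h) (x : S h) : D.dd v (D.dd w x) = -D.dd w (D.dd v x) :=
  CliffordAlgebra.contractLeft_comm _ _ _

lemma dd_invol (v : h) (x : S h) : D.dd v (invol x) = -invol (D.dd v x) := by
  induction x using S.induction with
  | halg r => simp [commutes, dd_algebraMap]
  | hadd x y hx hy => simp only [map_add, hx, hy, neg_add]
  | hmul a x hx =>
    rw [invol_ι_mul, map_neg, dd_ι_mul, dd_ι_mul, hx, map_sub, map_smul, invol_ι_mul]
    simp

lemma dd_mul (v : h) (x y : S h) : D.dd v (x * y) = D.dd v x * y + invol x * D.dd v y := by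
  induction x using S.induction with
  | halg r =>
    rw [dd_algebraMap, commutes, zero_mul, zero_add, ← Algebra.smul_def, ← Algebra.smul_def, map_smul]
  | hadd x x' hx hx' => simp only [map_add, add_mul, hx, hx']; abel
  | hmul a x hx =>
    rw [mul_assoc, dd_ι_mul, dd_ι_mul, hx, invol_ι_mul]
    simp only [mul_add, sub_mul, neg_mul, mul_assoc, smul_mul_assoc]
    abel

lemma form_neg (v w : h) : D.form v w = -D.form w v := (D.alt.neg_eq w v).symm

lemma form_a_b (i j) : D.form (D.a i) (D.b j) = if j = i then 1 else 0 :=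
  LinearMap.BilinForm.apply_dualBasis_left _ _ _ _

lemma sum_form_b (v : h) : ∑ i, D.form (D.a i) v • D.b i = v := by
  conv_rhs => rw [← D.b.sum_repr v]
  refine Finset.sum_congr rfl fun i _ => ?_
  congr 1
  conv_lhs => rw [← D.b.sum_repr v]
  rw [map_sum]
  simp [-Module.Basis.sum_repr, form_a_b]

lemma sum_form_a (v : h) : ∑ i, D.form v (D.b i) • D.a i = v := by
  conv_rhs => rw [← D.a.sum_repr v]
  refine Finset.sum_congr rfl fun i _ => ?_
  congr 1
  conv_lhs => rw [← D.a.sum_repr v]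
  rw [map_sum, LinearMap.sum_apply]
  simp [-Module.Basis.sum_repr, form_a_b]

/-- The copairing `∑ bᵢ ⊗ aᵢ` intertwines adjoint operators. -/
lemma copairing_adjoint {W : Type} [AddCommGroup W] [Module ℂ W] (B : h →ₗ[ℂ] h →ₗ[ℂ] W)
    (T T' : h →ₗ[ℂ] h) (hT : ∀ a b, D.form (T a) b = D.form a (T' b)) :
    ∑ i, B (D.b i) (T (D.a i)) = ∑ i, B (T' (D.b i)) (D.a i) := by
  have h1 : ∀ i, B (D.b i) (T (D.a i)) =
      ∑ j, D.form (D.a i) (T' (D.b j)) • B (D.b i) (D.a j) := fun i => by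
    conv_lhs => rw [← sum_form_a D (T (D.a i))]
    simp only [map_sum, map_smul, hT]
  have h2 : ∀ j, B (T' (D.b j)) (D.a j) =
      ∑ i, D.form (D.a i) (T' (D.b j)) • B (D.b i) (D.a j) := fun j => by
    conv_lhs => rw [← sum_form_b D (T' (D.b j))]
    simp only [map_sum, map_smul, LinearMap.sum_apply, LinearMap.smul_apply]
  rw [Finset.sum_congr rfl fun i _ => h1 i, Finset.sum_congr rfl fun j _ => h2 j, Finset.sum_comm]

/-- The copairing is (super-)symmetric. -/
lemma copairing_symm {W : Type} [AddCommGroup W] [Module ℂ W] (B : h →ₗ[ℂ] h →ₗ[ℂ] W) :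
    ∑ i, B (D.b i) (D.a i) = -∑ i, B (D.a i) (D.b i) := by
  have h1 : ∀ i, B (D.b i) (D.a i) = ∑ j, D.form (D.a i) (D.b j) • B (D.b i) (D.a j) := fun i => by
    simp [form_a_b]
  have h2 : ∀ i, B (D.b i) (D.a i) = ∑ j, ∑ k, (D.form (D.b i) (D.b j) *
      D.form (D.a k) (D.a i)) • B (D.a j) (D.b k) := fun i => by
    conv_lhs => rw [← sum_form_a D (D.b i), ← sum_form_b D (D.a i)]
    simp only [map_sum, map_smul, LinearMap.sum_apply, LinearMap.smul_apply, Finset.smul_sum, smul_smul]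
    rw [Finset.sum_comm]
    refine (Finset.sum_congr rfl fun j _ => Finset.sum_congr rfl fun k _ => ?_)
    rw [mul_comm]
  rw [Finset.sum_congr rfl fun i _ => h2 i]
  rw [Finset.sum_comm, ← Finset.sum_neg_distrib]
  refine Finset.sum_congr rfl fun j _ => ?_
  rw [Finset.sum_comm]
  have h3 : ∀ k, ∑ i, (D.form (D.b i) (D.b j) * D.form (D.a k) (D.a i)) • B (D.a j) (D.b k) =
      (-if j = k then (1 : ℂ) else 0) • B (D.a j) (D.b k) := fun k => by
    rw [← Finset.sum_smul]
    congr 1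
    rw [← form_a_b]
    conv_rhs => rw [← sum_form_a D (D.b j)]
    simp only [map_sum, map_smul, smul_eq_mul]
    rw [← Finset.sum_neg_distrib]
    refine Finset.sum_congr rfl fun i _ => ?_
    rw [form_neg D (D.b i)]; ring
  rw [Finset.sum_congr rfl fun k _ => h3 k]
  simp

lemma dd_mem {n : ℕ} {x : S h} (hx : x ∈ ⋀[ℂ]^n h) (v : h) :
    D.dd v x ∈ ⋀[ℂ]^(n - 1) h ∧ (n = 0 → D.dd v x = 0) := by
  induction hx using Submodule.pow_induction_on_left' with
  | algebraMap r => rw [dd_algebraMap]; exact ⟨zero_mem _, fun _ => rfl⟩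
  | add x y i hx hy ihx ihy =>
    rw [map_add]
    exact ⟨add_mem ihx.1 ihy.1, fun hi => by rw [ihx.2 hi, ihy.2 hi, add_zero]⟩
  | mem_mul m hm i x hx ih =>
    obtain ⟨a, rfl⟩ := hm
    refine ⟨?_, fun h0 => absurd h0 (by simp)⟩
    rw [dd_ι_mul, Nat.succ_eq_add_one, Nat.add_sub_cancel]
    refine sub_mem (Submodule.smul_mem _ _ hx) ?_
    rcases Nat.eq_zero_or_pos i with rfl | hi
    · rw [ih.2 rfl, mul_zero]; exact zero_mem _
    · have : i = (i - 1) + 1 := by omega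
      rw [this]
      change _ ∈ LinearMap.range (ExteriorAlgebra.ι ℂ) ^ (i - 1 + 1)
      rw [pow_succ']
      exact Submodule.mul_mem_mul ⟨_, rfl⟩ ih.1

/-- The Euler operator. -/
def SympData.euler : S h →ₗ[ℂ] S h :=
  ∑ i, LinearMap.mulLeft ℂ (ι ℂ (D.b i)) ∘ₗ D.dd (D.a i)

lemma euler_ι_mul (a : h) (x : S h) :
    D.euler (ι ℂ a * x) = ι ℂ a * x + ι ℂ a * D.euler x := by
  simp only [SympData.euler, LinearMap.sum_apply, LinearMap.comp_apply, LinearMap.mulLeft_apply,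
    dd_ι_mul, mul_sub, Finset.sum_sub_distrib, Finset.mul_sum]
  rw [sub_eq_add_neg, ← Finset.sum_neg_distrib]
  congr 1
  · conv_rhs => rw [← sum_form_b D a]
    simp [Finset.sum_mul]
  · refine Finset.sum_congr rfl fun i _ => ?_
    rw [← mul_assoc, ← mul_assoc, ι_mul_ι_comm, neg_mul, neg_neg]

lemma euler_of_mem {n : ℕ} {x : S h} (hx : x ∈ ⋀[ℂ]^n h) : D.euler x = (n : ℂ) • x := by
  induction hx using Submodule.pow_induction_on_left' with
  | algebraMap r => simp [SympData.euler, dd_algebraMap]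
  | add x y i hx hy ihx ihy => rw [map_add, ihx, ihy, smul_add]
  | mem_mul m hm i x hx ih =>
    obtain ⟨a, rfl⟩ := hm
    rw [euler_ι_mul, ih, mul_smul_comm, Nat.succ_eq_add_one]
    push_cast
    rw [add_smul, one_smul, add_comm]

lemma decompose_euler (x : S h) (n : ℕ) :
    (DirectSum.decompose (fun i : ℕ => ⋀[ℂ]^i h) (D.euler x) n : S h) =
      (n : ℂ) • (DirectSum.decompose (fun i : ℕ => ⋀[ℂ]^i h) x n : S h) := by
  induction x using DirectSum.Decomposition.inductionOn (fun i : ℕ => ⋀[ℂ]^i h) with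
  | zero => simp
  | @homogeneous i m =>
    rw [euler_of_mem D m.2, DirectSum.decompose_smul]
    by_cases hi : i = n
    · subst hi
      rw [DirectSum.decompose_coe, DirectSum.smul_apply, DirectSum.of_eq_same]
      simp
    · rw [DirectSum.decompose_coe, DirectSum.smul_apply, DirectSum.of_eq_of_ne _ _ _ (Ne.symm hi)]
      simp
  | add x y hx hy =>
    simp only [map_add, DirectSum.decompose_add, DirectSum.add_apply, Submodule.coe_add, hx, hy,
      smul_add]

lemma exists_algebraMap_of_dd_eq_zero {x : S h} (hx : ∀ v, D.dd v x = 0) :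
    ∃ r : ℂ, x = algebraMap ℂ (S h) r := by
  classical
  have h0 : D.euler x = 0 := by simp [SympData.euler, hx]
  have h1 : ∀ n, n ≠ 0 → (DirectSum.decompose (fun i : ℕ => ⋀[ℂ]^i h) x n : S h) = 0 := by
    intro n hn
    have := decompose_euler D x n
    rw [h0, DirectSum.decompose_zero, DirectSum.zero_apply, Submodule.coe_zero] at this
    exact (smul_eq_zero.mp this.symm).resolve_left (Nat.cast_ne_zero.mpr hn)
  have h2 : (DirectSum.decompose (fun i : ℕ => ⋀[ℂ]^i h) x 0 : S h) = x := by
    conv_rhs => rw [← DirectSum.sum_support_decompose (fun i : ℕ => ⋀[ℂ]^i h) x]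
    rw [Finset.sum_eq_single 0]
    · intro n _ hn; exact h1 n hn
    · intro hn
      rw [DFinsupp.notMem_support_iff] at hn
      rw [hn]; rfl
  have h3 : x ∈ LinearMap.range (ι ℂ (M := h)) ^ 0 :=
    h2 ▸ (DirectSum.decompose (fun i : ℕ => ⋀[ℂ]^i h) x 0).2
  rw [pow_zero, Submodule.mem_one] at h3
  obtain ⟨r, hr⟩ := h3
  exact ⟨r, hr.symm⟩

lemma topForm_of_mem {n : ℕ} (hn : n ≠ finrank ℂ h) {x : S h} (hx : x ∈ ⋀[ℂ]^n h) :
    D.topForm x = 0 := by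
  rw [← ExteriorAlgebra.ιMulti_span_fixedDegree] at hx
  induction hx using Submodule.span_induction with
  | mem x hx =>
    obtain ⟨v, rfl⟩ := hx
    rw [SympData.topForm, ExteriorAlgebra.liftAlternating_apply_ιMulti, dif_neg (Ne.symm hn)]
    rfl
  | zero => simp
  | add x y _ _ hx hy => rw [map_add, hx, hy, add_zero]
  | smul c x _ hx => rw [map_smul, hx, smul_zero]

lemma topForm_ne_zero : D.topForm ≠ 0 := by
  intro h0
  have := LinearMap.congr_fun h0 (ExteriorAlgebra.ιMulti ℂ (finrank ℂ h) D.b)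
  rw [SympData.topForm, ExteriorAlgebra.liftAlternating_apply_ιMulti, dif_pos rfl] at this
  exact one_ne_zero (D.b.det_self.symm.trans this)

lemma extPow_eq_bot {i : ℕ} (hi : finrank ℂ h < i) : (⋀[ℂ]^i h : Submodule ℂ (S h)) = ⊥ := by
  have := exteriorPower.finrank_eq (R := ℂ) (M := h) i
  rw [Nat.choose_eq_zero_of_lt hi] at this
  exact Submodule.finrank_eq_zero.mp this

lemma topForm_dd (v : h) (x : S h) : D.topForm (D.dd v x) = 0 := by
  induction x using DirectSum.Decomposition.inductionOn (fun i : ℕ => ⋀[ℂ]^i h) with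
  | zero => simp
  | @homogeneous i m =>
    by_cases hi : i - 1 = finrank ℂ h
    · rcases Nat.eq_zero_or_pos i with h0 | h0
      · rw [(dd_mem D m.2 v).2 h0, map_zero]
      · have := extPow_eq_bot (h := h) (i := i) (by omega)
        have hm : (m : S h) = 0 := (Submodule.mem_bot ℂ).mp (this ▸ m.2)
        rw [hm, map_zero, map_zero]
    · exact topForm_of_mem D hi (dd_mem D m.2 v).1
  | add x y hx hy => rw [map_add, map_add, hx, hy, add_zero]

/-- A subspace of `S(𝔥)` stable under all contractions contains `1` unless it vanishes. -/
lemma one_mem_of_dd_stable (J : Submodule ℂ (S h)) (hJ : ∀ v, ∀ x ∈ J, D.dd v x ∈ J)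
    (hne : J ≠ ⊥) : (1 : S h) ∈ J := by
  obtain ⟨x, hx, h0, hk⟩ := exists_common_kernel (fun i => D.dd (D.a i))
    (fun i v => dd_dd D _ v) (fun i j v => dd_comm D _ _ v) J (fun i => hJ _) hne Finset.univ
  have hk' : ∀ v, D.dd v x = 0 := fun v => by
    have : D.dd v x = ∑ i, D.form v (D.b i) • D.dd (D.a i) x := by
      conv_lhs => rw [← sum_form_a D v]
      simp [SympData.dd]
    rw [this]
    exact Finset.sum_eq_zero fun i _ => by rw [hk i (Finset.mem_univ i), smul_zero]
  obtain ⟨r, rfl⟩ := exists_algebraMap_of_dd_eq_zero D hk'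
  have hr : r ≠ 0 := fun hr => h0 (by rw [hr, map_zero])
  have := J.smul_mem r⁻¹ hx
  rwa [algebraMap_eq_smul_one, smul_smul, inv_mul_cancel₀ hr, one_smul] at this

lemma eq_zero_of_topForm_mul {x : S h} (hx : ∀ g, D.topForm (g * x) = 0) : x = 0 := by
  let J : Submodule ℂ (S h) :=
    { carrier := {x | ∀ g, D.topForm (g * x) = 0}
      add_mem' := fun {x y} hx hy g => by rw [mul_add, map_add, hx, hy, add_zero]
      zero_mem' := fun g => by rw [mul_zero, map_zero]
      smul_mem' := fun c x hx g => by rw [mul_smul_comm, map_smul, hx, smul_zero] }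
  by_contra hne
  have h1 : (1 : S h) ∈ J := by
    refine one_mem_of_dd_stable D J (fun v x hx g => ?_) fun hJ => hne ?_
    · have := topForm_dd D v (invol g * x)
      rwa [dd_mul, map_add, hx, zero_add, invol_invol] at this
    · exact (Submodule.mem_bot ℂ).mp (hJ ▸ (hx : x ∈ J))
  exact topForm_ne_zero D (LinearMap.ext fun g => by have := h1 g; rwa [mul_one] at this)

lemma dd_Chat (v : h) (x : S h) : D.dd v (D.Chat * x) = D.Chat * D.dd v x + 2 • (ι ℂ v * x) := by
  have h1 : ι ℂ v = ∑ i, D.form v (D.b i) • ι ℂ (D.a i) := by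
    conv_lhs => rw [← sum_form_a D v]
    simp
  have h2 : ι ℂ v = -∑ i, D.form v (D.a i) • ι ℂ (D.b i) := by
    conv_lhs => rw [← sum_form_b D v]
    simp [form_neg D v]
  rw [two_smul]
  nth_rw 1 [h1]
  rw [h2]
  simp only [SympData.Chat, Finset.sum_mul, map_sum, mul_assoc, dd_ι_mul, mul_sub, neg_mul]
  simp only [Finset.sum_sub_distrib, smul_mul_assoc, mul_smul_comm]
  abel

lemma Chat_mul_comm (x : S h) : D.Chat * x = x * D.Chat := by
  simp only [SympData.Chat, Finset.sum_mul, Finset.mul_sum]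
  refine Finset.sum_congr rfl fun i _ => ?_
  rw [mul_assoc, ι_mul_eq (D.a i) x, ← mul_assoc, ι_mul_invol, mul_assoc]

lemma Chat_pow_mem (k : ℕ) : D.Chat ^ k ∈ ⋀[ℂ]^(2 * k) h := by
  have h1 : D.Chat ∈ ⋀[ℂ]^2 h := by
    refine Submodule.sum_mem _ fun i _ => ?_
    change _ ∈ LinearMap.range (ι ℂ (M := h)) ^ 2
    rw [pow_two]
    exact Submodule.mul_mem_mul ⟨_, rfl⟩ ⟨_, rfl⟩
  induction k with
  | zero =>
    change _ ∈ LinearMap.range (ι ℂ (M := h)) ^ (2 * 0)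
    rw [mul_zero, pow_zero, pow_zero]
    exact Submodule.one_le.mp le_rfl
  | succ k ih =>
    change _ ∈ LinearMap.range (ι ℂ (M := h)) ^ (2 * (k + 1))
    rw [mul_add, mul_one, pow_add, pow_succ D.Chat]
    exact Submodule.mul_mem_mul ih h1

lemma dd_Chat_pow (v : h) (k : ℕ) :
    D.dd v (D.Chat ^ (k + 1)) = (2 * (k + 1)) • (ι ℂ v * D.Chat ^ k) := by
  induction k with
  | zero => simpa [dd_one] using dd_Chat D v 1
  | succ k ih =>
    rw [pow_succ', dd_Chat, ih, mul_smul_comm, ← mul_assoc, Chat_mul_comm D (ι ℂ v), mul_assoc,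
      ← pow_succ', ← add_smul]
    congr 1

/-- An element killed by `𝔥` is detected by the top form. -/
lemma topForm_ne_zero_of_killed {x : S h} (hx : ∀ a, ι ℂ a * x = 0) (hne : x ≠ 0) :
    D.topForm x ≠ 0 := by
  intro h0
  refine hne (eq_zero_of_topForm_mul D fun g => ?_)
  induction g using S.induction with
  | halg r => rw [← Algebra.smul_def, map_smul, h0, smul_zero]
  | hadd g g' hg hg' => rw [add_mul, map_add, hg, hg', add_zero]
  | hmul a g hg =>
    rw [ι_mul_eq, mul_assoc, hx, mul_zero, map_zero]

lemma topForm_Chat_pow : D.topForm (D.Chat ^ (finrank ℂ h / 2)) ≠ 0 ∧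
    finrank ℂ h = 2 * (finrank ℂ h / 2) := by
  have hex : ∃ k, D.Chat ^ k = 0 := by
    refine ⟨finrank ℂ h + 1, ?_⟩
    have := Chat_pow_mem D (finrank ℂ h + 1)
    rw [extPow_eq_bot (by omega)] at this
    exact (Submodule.mem_bot ℂ).mp this
  classical
  obtain ⟨k, hk, hmin⟩ : ∃ k, D.Chat ^ k = 0 ∧ ∀ j < k, D.Chat ^ j ≠ 0 :=
    ⟨Nat.find hex, Nat.find_spec hex, fun j hj => Nat.find_min hex hj⟩
  have hk0 : k ≠ 0 := by
    rintro rfl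
    rw [pow_zero] at hk
    exact topForm_ne_zero D (LinearMap.ext fun x => by rw [← one_mul x, hk]; simp)
  obtain ⟨k, rfl⟩ := Nat.exists_eq_succ_of_ne_zero hk0
  have hkill : ∀ a, ι ℂ a * D.Chat ^ k = 0 := fun a => by
    have := dd_Chat_pow D a k
    rw [Nat.succ_eq_add_one] at hk
    rw [hk, map_zero] at this
    rw [← Nat.cast_smul_eq_nsmul ℂ] at this
    exact (smul_eq_zero.mp this.symm).resolve_left (Nat.cast_ne_zero.mpr (by omega))
  have htop := topForm_ne_zero_of_killed D hkill (hmin k (Nat.lt_succ_self k))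
  have hd : 2 * k = finrank ℂ h := by
    by_contra hd
    exact htop (topForm_of_mem D hd (Chat_pow_mem D k))
  have : finrank ℂ h / 2 = k := by omega
  rw [this]
  exact ⟨htop, hd.symm⟩

end Contraction

section Exponential

variable (h : Type) [AddCommGroup h] [Module ℂ h]
variable {V W : Type} [AddCommGroup V] [Module ℂ V] [AddCommGroup W] [Module ℂ W]

lemma pow_comp_of_comp {k : V →ₗ[ℂ] W} {f : Module.End ℂ V} {g : Module.End ℂ W}
    (hk : ∀ v, k (f v) = g (k v)) (n : ℕ) (v : V) : k ((f ^ n) v) = (g ^ n) (k v) := by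
  induction n generalizing v with
  | zero => simp
  | succ n ih => rw [pow_succ, pow_succ, Module.End.mul_apply, ih, hk, Module.End.mul_apply]

lemma expTrunc_comm {k : V →ₗ[ℂ] W} {f : Module.End ℂ V} {g : Module.End ℂ W}
    (hk : ∀ v, k (f v) = g (k v)) (v : V) : k (expTrunc h f v) = expTrunc h g (k v) := by
  simp only [expTrunc, LinearMap.sum_apply, LinearMap.smul_apply, map_sum, map_smul, pow_comp_of_comp hk]

lemma expTrunc_zero : expTrunc h (0 : Module.End ℂ V) = 1 := by
  rw [expTrunc, Finset.sum_eq_single_of_mem 0 (by simp)]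
  · simp
  · intro n _ hn
    rw [zero_pow hn, smul_zero]

lemma expTrunc_add {f g : Module.End ℂ V} (hfg : Commute f g)
    (hf : f ^ (finrank ℂ h + 1) = 0) (hg : g ^ (finrank ℂ h + 1) = 0)
    (hs : (f + g) ^ (finrank ℂ h + 1) = 0) :
    expTrunc h (f + g) = expTrunc h f * expTrunc h g := by
  let _ : Module ℚ (Module.End ℂ V) := Module.compHom _ (algebraMap ℚ ℂ)
  have key : ∀ e : Module.End ℂ V, e ^ (finrank ℂ h + 1) = 0 →
      expTrunc h e = IsNilpotent.exp e := fun e he => by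
    rw [IsNilpotent.exp_eq_sum he, expTrunc]
    refine Finset.sum_congr rfl fun k _ => ?_
    change (k.factorial : ℂ)⁻¹ • e ^ k = (algebraMap ℚ ℂ (k.factorial : ℚ)⁻¹) • e ^ k
    simp
  rw [key _ hf, key _ hg, key _ hs, IsNilpotent.exp_add_of_commute hfg ⟨_, hf⟩ ⟨_, hg⟩]

/-- If `[k, f] = c` commutes with the nilpotent operator `f`, then `k eᶠ = eᶠ (k + c)`. -/
lemma expTrunc_bracket {k f c : Module.End ℂ V} (hf : f ^ (finrank ℂ h + 1) = 0)
    (hc : Commute f c) (hk : k * f = f * k + c) :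
    k * expTrunc h f = expTrunc h f * (k + c) := by
  have hpow : ∀ n : ℕ, k * f ^ (n + 1) = f ^ (n + 1) * k + ((n + 1 : ℕ) : ℂ) • (f ^ n * c) := by
    intro n
    induction n with
    | zero => simpa using hk
    | succ n ih =>
      rw [pow_succ f (n + 1), ← mul_assoc, ih, add_mul, mul_assoc, hk, mul_add, smul_mul_assoc,
        mul_assoc (f ^ n) c f, ← hc.eq, ← mul_assoc, ← mul_assoc, ← pow_succ, ← pow_succ, add_assoc]
      congr 1
      push_cast
      module
  have htop : f ^ finrank ℂ h * c = 0 := by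
    have := hpow (finrank ℂ h)
    rw [hf, mul_zero, zero_mul, zero_add] at this
    exact (smul_eq_zero.mp this.symm).resolve_left (Nat.cast_ne_zero.mpr (by omega))
  have h1 : expTrunc h f * c = ∑ n ∈ Finset.range (finrank ℂ h), (n.factorial : ℂ)⁻¹ • (f ^ n * c) := by
    rw [expTrunc, Finset.sum_mul, Finset.sum_range_succ, smul_mul_assoc, htop, smul_zero, add_zero]
    simp only [smul_mul_assoc]
  rw [mul_add, h1, expTrunc, Finset.mul_sum, Finset.sum_mul, Finset.sum_range_succ',
    Finset.sum_range_succ' (fun i => (i.factorial : ℂ)⁻¹ • f ^ i * k)]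
  simp only [mul_smul_comm, hpow, smul_add, Finset.sum_add_distrib, smul_mul_assoc, pow_zero,
    mul_one, one_mul]
  rw [add_assoc, add_assoc, add_comm (∑ _ ∈ _, _) (_ • k)]
  congr 2
  refine Finset.sum_congr rfl fun n _ => ?_
  rw [smul_smul]
  congr 1
  rw [Nat.factorial_succ]
  push_cast
  have : (n.factorial : ℂ) ≠ 0 := Nat.cast_ne_zero.mpr n.factorial_ne_zero
  have : (n + 1 : ℂ) ≠ 0 := Nat.cast_add_one_ne_zero n
  field_simp

lemma sum_pow_eq_zero {I : Type} (P : I → Module.End ℂ V) (hsq : ∀ i, P i * P i = 0)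
    (hcomm : ∀ i j, Commute (P i) (P j)) (s : Finset I) : (∑ i ∈ s, P i) ^ (s.card + 1) = 0 := by
  classical
  induction s using Finset.induction_on with
  | empty => simp
  | insert i s hi ih =>
    rw [Finset.sum_insert hi, Finset.card_insert_of_notMem hi]
    have hc : Commute (P i) (∑ j ∈ s, P j) := Commute.sum_right _ _ _ fun j _ => hcomm i j
    rw [hc.add_pow]
    refine Finset.sum_eq_zero fun n hn => ?_
    rcases n with _ | _ | n
    · have : s.card + 1 + 1 - 0 = (s.card + 1) + 1 := by omega
      rw [this, pow_succ (∑ j ∈ s, P j), ih]; simp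
    · have : s.card + 1 + 1 - (0 + 1) = s.card + 1 := by omega
      rw [this, ih]; simp
    · rw [pow_succ, pow_succ, mul_assoc (P i ^ n), hsq]; simp

lemma sum_fin_pow_eq_zero (P : Fin (finrank ℂ h) → Module.End ℂ V)
    (hsq : ∀ i, P i * P i = 0) (hcomm : ∀ i j, Commute (P i) (P j)) :
    (∑ i, P i) ^ (finrank ℂ h + 1) = 0 := by
  simpa using sum_pow_eq_zero P hsq hcomm Finset.univ

end Exponential

section Representations

variable {h : Type} [AddCommGroup h] [Module ℂ h]

lemma act_anti (X : SRep h) (a b : h) (v : X.V) : X.act a (X.act b v) = -X.act b (X.act a v) := by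
  have := X.act_act (a + b) v
  simp only [map_add, LinearMap.add_apply, X.act_act, zero_add, add_zero] at this
  exact eq_neg_of_add_eq_zero_left ((add_comm _ _).trans this)

@[simp] lemma rho_ι (X : SRep h) (a : h) : X.rho (ι ℂ a) = X.act a :=
  ExteriorAlgebra.lift_ι_apply _ _ _ _

lemma rho_ι_mul (X : SRep h) (a : h) (g : S h) (v : X.V) :
    X.rho (ι ℂ a * g) v = X.act a (X.rho g v) := by
  rw [map_mul, rho_ι, Module.End.mul_apply]

lemma rho_mul (X : SRep h) (g g' : S h) (v : X.V) : X.rho (g * g') v = X.rho g (X.rho g' v) := by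
  rw [map_mul, Module.End.mul_apply]

lemma rho_algebraMap (X : SRep h) (r : ℂ) (v : X.V) : X.rho (algebraMap ℂ _ r) v = r • v := by
  rw [commutes, Module.algebraMap_end_apply]

@[simp] lemma rho_one (X : SRep h) (v : X.V) : X.rho 1 v = v := by
  rw [map_one, Module.End.one_apply]

/-- Linear maps that commute with the action of `𝔥`. -/
def Intertwines (X X' : SRep h) (k : X.V →ₗ[ℂ] X'.V) : Prop := ∀ a v, k (X.act a v) = X'.act a (k v)

/-- Even linear maps. -/
def IsEven (X X' : SVect) (k : X.V →ₗ[ℂ] X'.V) : Prop := ∀ v, k (X.par v) = X'.par (k v)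

lemma rho_natural {X X' : SRep h} {k : X.V →ₗ[ℂ] X'.V} (hk : Intertwines X X' k) (g : S h)
    (v : X.V) : k (X.rho g v) = X'.rho g (k v) := by
  induction g using S.induction generalizing v with
  | halg r => rw [rho_algebraMap, rho_algebraMap, map_smul]
  | hadd g g' hg hg' => rw [map_add, map_add, LinearMap.add_apply, LinearMap.add_apply, map_add, hg, hg']
  | hmul a g hg => rw [rho_ι_mul, rho_ι_mul, hk, hg]

lemma rho_par (X : SRep h) (g : S h) (v : X.V) : X.rho g (X.par v) = X.par (X.rho (invol g) v) := by
  induction g using S.induction with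
  | halg r => rw [commutes invol, rho_algebraMap, rho_algebraMap, map_smul]
  | hadd g g' hg hg' => simp only [map_add, LinearMap.add_apply, hg, hg']
  | hmul a g hg =>
    rw [rho_ι_mul, hg, invol_ι_mul, X.act_par, map_neg, LinearMap.neg_apply, rho_ι_mul, map_neg]

lemma par_rho (X : SRep h) (g : S h) (v : X.V) : X.par (X.rho g v) = X.rho (invol g) (X.par v) := by
  rw [rho_par, invol_invol]

lemma rho_triv (X : SVect) (g : S h) (v : X.V) :
    (X.triv h).rho g v = ExteriorAlgebra.algebraMapInv g • v := by
  induction g using S.induction with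
  | halg r => rw [rho_algebraMap, commutes]; rfl
  | hadd g g' hg hg' => simp only [map_add, LinearMap.add_apply, hg, hg', add_smul]
  | hmul a g hg => rw [rho_ι_mul, map_mul, ExteriorAlgebra.algebraMapInv, ExteriorAlgebra.lift_ι_apply]; simp

/-- The representation with action precomposed with an endomorphism of `𝔥`. -/
@[reducible] def SRep.pull (T : h →ₗ[ℂ] h) (X : SRep h) : SRep h where
  toSVect := X.toSVect
  act := X.act ∘ₗ T
  act_act a v := X.act_act (T a) v
  act_par a v := X.act_par (T a) v

lemma rho_pull (T : h →ₗ[ℂ] h) (X : SRep h) (g : S h) (v : X.V) :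
    (X.pull T).rho g v = X.rho (ExteriorAlgebra.map T g) v := by
  induction g using S.induction with
  | halg r => rw [commutes (ExteriorAlgebra.map T), rho_algebraMap, rho_algebraMap]
  | hadd g g' hg hg' => simp only [map_add, LinearMap.add_apply, hg, hg']
  | hmul a g hg => rw [rho_ι_mul, map_mul, ExteriorAlgebra.map_apply_ι, rho_ι_mul, hg]; rfl

lemma tensor_act (X Y : SRep h) (a : h) (x : X.V) (y : Y.V) :
    (X.tensor Y).act a (x ⊗ₜ y) = X.act a x ⊗ₜ y + X.par x ⊗ₜ Y.act a y := rfl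

lemma tensor_par (X Y : SRep h) (x : X.V) (y : Y.V) :
    (X.tensor Y).par (x ⊗ₜ y) = X.par x ⊗ₜ Y.par y := rfl

lemma intertwines_map {X X' Y Y' : SRep h} {k : X.V →ₗ[ℂ] X'.V} {l : Y.V →ₗ[ℂ] Y'.V}
    (hk : Intertwines X X' k) (hkp : IsEven X.toSVect X'.toSVect k) (hl : Intertwines Y Y' l) :
    Intertwines (X.tensor Y) (X'.tensor Y') (map k l) := by
  intro a v
  induction v using TensorProduct.induction_on with
  | zero => simp
  | tmul x y => simp [hk a x, hl a y, hkp x]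
  | add x y hx hy => rw [map_add, map_add, hx, hy, map_add, map_add]

lemma isEven_map {X X' Y Y' : SVect} {k : X.V →ₗ[ℂ] X'.V} {l : Y.V →ₗ[ℂ] Y'.V}
    (hk : IsEven X X' k) (hl : IsEven Y Y' l) :
    IsEven (X.tensor Y) (X'.tensor Y') (map k l) := by
  intro v
  induction v using TensorProduct.induction_on with
  | zero => simp
  | tmul x y => simp [hk x, hl y]
  | add x y hx hy => rw [map_add, map_add, hx, hy, map_add, map_add]

lemma isEven_map_left {X X' : SVect} (Y : SVect) {k : X.V →ₗ[ℂ] X'.V} (hk : IsEven X X' k) :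
    IsEven (X.tensor Y) (X'.tensor Y) (map k 𝕀) := isEven_map hk fun _ => rfl

lemma isEven_map_right (X : SVect) {Y Y' : SVect} {l : Y.V →ₗ[ℂ] Y'.V} (hl : IsEven Y Y' l) :
    IsEven (X.tensor Y) (X.tensor Y') (map 𝕀 l) := isEven_map (fun _ => rfl) hl

lemma intertwines_map_left {X X' : SRep h} (Y : SRep h) {k : X.V →ₗ[ℂ] X'.V} (hk : Intertwines X X' k)
    (hp : IsEven X.toSVect X'.toSVect k) : Intertwines (X.tensor Y) (X'.tensor Y) (map k 𝕀) :=
  intertwines_map hk hp fun _ _ => rfl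

lemma intertwines_map_right (X : SRep h) {Y Y' : SRep h} {l : Y.V →ₗ[ℂ] Y'.V} (hl : Intertwines Y Y' l) :
    Intertwines (X.tensor Y) (X.tensor Y') (map 𝕀 l) :=
  intertwines_map (fun _ _ => rfl) (fun _ => rfl) hl

lemma intertwines_assoc (X Y Z : SRep h) :
    Intertwines ((X.tensor Y).tensor Z) (X.tensor (Y.tensor Z))
      (assoc ℂ X.V Y.V Z.V).toLinearMap := by
  intro a v
  induction v using TensorProduct.induction_on with
  | zero => simp
  | tmul x z =>
    induction x using TensorProduct.induction_on with
    | zero => simp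
    | tmul x y => simp [tmul_add, add_assoc]
    | add x y hx hy => rw [add_tmul, map_add, map_add, hx, hy, map_add, map_add]
  | add x y hx hy => rw [map_add, map_add, hx, hy, map_add, map_add]

lemma intertwines_assoc_symm (X Y Z : SRep h) :
    Intertwines (X.tensor (Y.tensor Z)) ((X.tensor Y).tensor Z)
      (assoc ℂ X.V Y.V Z.V).symm.toLinearMap := by
  intro a v
  rw [LinearEquiv.coe_coe, LinearEquiv.symm_apply_eq]
  have := intertwines_assoc X Y Z a ((assoc ℂ X.V Y.V Z.V).symm v)
  rw [LinearEquiv.coe_coe, LinearEquiv.apply_symm_apply] at this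
  exact this.symm

lemma isEven_assoc (X Y Z : SVect) :
    IsEven ((X.tensor Y).tensor Z) (X.tensor (Y.tensor Z))
      (assoc ℂ X.V Y.V Z.V).toLinearMap := by
  intro v
  exact LinearMap.congr_fun (TensorProduct.map_map_comp_assoc_eq X.par Y.par Z.par).symm v

lemma isEven_assoc_symm (X Y Z : SVect) :
    IsEven (X.tensor (Y.tensor Z)) ((X.tensor Y).tensor Z)
      (assoc ℂ X.V Y.V Z.V).symm.toLinearMap := by
  intro v
  rw [LinearEquiv.coe_coe, LinearEquiv.symm_apply_eq]
  have := isEven_assoc X Y Z ((assoc ℂ X.V Y.V Z.V).symm v)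
  rw [LinearEquiv.coe_coe, LinearEquiv.apply_symm_apply] at this
  exact this.symm

lemma flip_tmul (X Y : SVect) (x : X.V) (y : Y.V) :
    X.flip Y (x ⊗ₜ y) = (1 / 2 : ℂ) • (y ⊗ₜ x + y ⊗ₜ X.par x + Y.par y ⊗ₜ x - Y.par y ⊗ₜ X.par x) := by
  simp [SVect.flip]

lemma flip_tmul_of_even {X Y : SVect} {x : X.V} (hx : X.par x = x) (y : Y.V) :
    X.flip Y (x ⊗ₜ y) = y ⊗ₜ x := by
  rw [flip_tmul, hx, add_sub_assoc, sub_self, add_zero, ← two_smul ℂ (y ⊗ₜ[ℂ] x), smul_smul]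
  norm_num

lemma flip_tmul_of_odd {X Y : SVect} {x : X.V} (hx : X.par x = -x) (y : Y.V) :
    X.flip Y (x ⊗ₜ y) = Y.par y ⊗ₜ x := by
  rw [flip_tmul, hx, tmul_neg, tmul_neg, sub_neg_eq_add, add_neg_cancel,
    zero_add, ← two_smul ℂ (Y.par y ⊗ₜ[ℂ] x), smul_smul]
  norm_num

lemma flip_tmul_of_even_right {X Y : SVect} (x : X.V) {y : Y.V} (hy : Y.par y = y) :
    X.flip Y (x ⊗ₜ y) = y ⊗ₜ x := by
  rw [flip_tmul, hy, add_sub_assoc, add_assoc, add_comm (y ⊗ₜ[ℂ] X.par x), sub_add_cancel,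
    ← two_smul ℂ (y ⊗ₜ[ℂ] x), smul_smul]
  norm_num

lemma flip_flip (X Y : SVect) (t : X.V ⊗[ℂ] Y.V) : Y.flip X (X.flip Y t) = t := by
  induction t with
  | zero => simp
  | add x y hx hy => rw [map_add, map_add, hx, hy]
  | tmul x y =>
    simp only [flip_tmul, map_smul, map_add, map_sub, X.par_par, Y.par_par]
    module

lemma flip_natural {X X' Y Y' : SVect} {k : X.V →ₗ[ℂ] X'.V} {l : Y.V →ₗ[ℂ] Y'.V}
    (hk : IsEven X X' k) (hl : IsEven Y Y' l) (t : X.V ⊗[ℂ] Y.V) :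
    X'.flip Y' (map k l t) = map l k (X.flip Y t) := by
  induction t with
  | zero => simp
  | add x y hx hy => rw [map_add, map_add, hx, hy, map_add, map_add]
  | tmul x y =>
    rw [map_tmul, flip_tmul, flip_tmul]
    simp only [map_smul, map_add, map_sub, map_tmul, hk x, hl y]

lemma isEven_flip (X Y : SVect) : IsEven (X.tensor Y) (Y.tensor X) (X.flip Y) := fun t =>
  flip_natural (fun _ => rfl) (fun _ => rfl) t

lemma intertwines_flip (X Y : SRep h) :
    Intertwines (X.tensor Y) (Y.tensor X) (X.flip Y.toSVect) := by
  intro a t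
  induction t using TensorProduct.induction_on with
  | zero => simp
  | add x y hx hy => rw [map_add, map_add, hx, hy, map_add, map_add]
  | tmul x y =>
    rw [tensor_act, map_add, flip_tmul, flip_tmul, flip_tmul, map_smul, map_sub, map_add, map_add,
      tensor_act Y X, tensor_act Y X, tensor_act Y X, tensor_act Y X]
    have h1 : X.par (X.act a x) = -X.act a (X.par x) := by rw [X.act_par, neg_neg]
    have h2 : Y.par (Y.act a y) = -Y.act a (Y.par y) := by rw [Y.act_par, neg_neg]
    simp only [h1, h2, X.par_par, Y.par_par, tmul_neg, neg_tmul]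
    module

end Representations

section Families

variable {h : Type} [AddCommGroup h] [Module ℂ h]
variable {V W : Type} [AddCommGroup V] [Module ℂ V] [AddCommGroup W] [Module ℂ W]

/-- Linear families of operators indexed by `𝔥`. -/
abbrev Fam (h V : Type) [AddCommGroup h] [Module ℂ h] [AddCommGroup V] [Module ℂ V] : Type :=
  h →ₗ[ℂ] Module.End ℂ V

/-- Anti-commuting families. -/
def Anti (P Q : Fam h V) : Prop := ∀ a b v, P a (Q b v) = -Q b (P a v)

lemma Anti.symm {P Q : Fam h V} (hPQ : Anti P Q) : Anti Q P := fun a b v => by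
  rw [hPQ, neg_neg]

lemma Anti.add_right {P Q Q' : Fam h V} (h1 : Anti P Q) (h2 : Anti P Q') : Anti P (Q + Q') :=
  fun a b v => by
    simp only [LinearMap.add_apply, map_add, h1 a b v, h2 a b v, neg_add]

lemma Anti.add_left {P P' Q : Fam h V} (h1 : Anti P Q) (h2 : Anti P' Q) : Anti (P + P') Q :=
  (h1.symm.add_right h2.symm).symm

lemma Anti.comp_right {P Q : Fam h V} (h1 : Anti P Q) (T : h →ₗ[ℂ] h) : Anti P (Q ∘ₗ T) :=
  fun a b v => h1 a (T b) v

lemma Anti.comp_left {P Q : Fam h V} (h1 : Anti P Q) (T : h →ₗ[ℂ] h) : Anti (P ∘ₗ T) Q :=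
  fun a b v => h1 (T a) b v

lemma Anti.self_self {P : Fam h V} (hP : Anti P P) (a : h) (v : V) : P a (P a v) = 0 := by
  have h2 : (2 : ℂ) • P a (P a v) = 0 := by
    rw [two_smul]
    exact eq_neg_iff_add_eq_zero.mp (hP a a v)
  exact (smul_eq_zero.mp h2).resolve_left two_ne_zero

lemma SRep.anti (X : SRep h) : Anti X.act X.act := act_anti X

/-- The family `P ⊗ 1`. -/
def Fam.l (P : Fam h V) (W : Type) [AddCommGroup W] [Module ℂ W] : Fam h (V ⊗[ℂ] W) :=
  (mapBilinear (RingHom.id ℂ) V W V W).flip 𝕀 ∘ₗ P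

/-- The family `par ⊗ Q`. -/
def Fam.r (X : SVect) (Q : Fam h W) : Fam h (X.V ⊗[ℂ] W) :=
  (mapBilinear (RingHom.id ℂ) X.V W X.V W) X.par ∘ₗ Q

@[simp] lemma Fam.l_tmul (P : Fam h V) (a : h) (v : V) (w : W) : P.l W a (v ⊗ₜ w) = P a v ⊗ₜ w := rfl

@[simp] lemma Fam.r_tmul (X : SVect) (Q : Fam h W) (a : h) (v : X.V) (w : W) :
    Fam.r X Q a (v ⊗ₜ w) = X.par v ⊗ₜ Q a w := rfl

lemma tensor_act_eq (X Y : SRep h) : (X.tensor Y).act = Fam.l X.act Y.V + Fam.r X.toSVect Y.act := rfl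

lemma Anti.l {P Q : Fam h V} (hPQ : Anti P Q) : Anti (P.l W) (Q.l W) := fun a b t => by
  induction t with
  | zero => simp
  | add x y hx hy => simp only [map_add, hx, hy, neg_add]
  | tmul x y => rw [Fam.l_tmul, Fam.l_tmul, Fam.l_tmul, Fam.l_tmul, hPQ, neg_tmul]

lemma Anti.r (X : SVect) {P Q : Fam h W} (hPQ : Anti P Q) : Anti (Fam.r X P) (Fam.r X Q) :=
  fun a b t => by
    induction t with
    | zero => simp
    | add x y hx hy => simp only [map_add, hx, hy, neg_add]
    | tmul x y => rw [Fam.r_tmul, Fam.r_tmul, Fam.r_tmul, Fam.r_tmul, hPQ, tmul_neg]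

/-- Families of odd operators. -/
def OddFam (X : SVect) (P : Fam h X.V) : Prop := ∀ a v, P a (X.par v) = -X.par (P a v)

lemma SRep.odd (X : SRep h) : OddFam X.toSVect X.act := X.act_par

lemma Anti.l_r {X : SVect} {P : Fam h X.V} (hP : OddFam X P) (Q : Fam h W) :
    Anti (P.l W) (Fam.r X Q) := fun a b t => by
  induction t with
  | zero => simp
  | add x y hx hy => simp only [map_add, hx, hy, neg_add]
  | tmul x y => rw [Fam.l_tmul, Fam.r_tmul, Fam.r_tmul, Fam.l_tmul, hP, neg_tmul]

variable [FiniteDimensional ℂ h] (D : SympData h)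

/-- The quadratic operator `∑ P(bᵢ) Q(aᵢ)`. -/
def SympData.quad (P Q : Fam h V) : Module.End ℂ V := ∑ i, P (D.b i) * Q (D.a i)

/-- The operator `exp(s ∑ P(bᵢ) Q(aᵢ))`. -/
def SympData.gexp (s : ℂ) (P Q : Fam h V) : Module.End ℂ V := expTrunc h (s • D.quad P Q)

lemma quad_apply (P Q : Fam h V) (v : V) : D.quad P Q v = ∑ i, P (D.b i) (Q (D.a i) v) := by
  simp [SympData.quad]

lemma quad_add_right (P Q Q' : Fam h V) : D.quad P (Q + Q') = D.quad P Q + D.quad P Q' := by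
  simp [SympData.quad, mul_add, Finset.sum_add_distrib]

lemma quad_comp_adjoint (P Q : Fam h V) (T T' : h →ₗ[ℂ] h)
    (hT : ∀ a b, D.form (T a) b = D.form a (T' b)) :
    D.quad P (Q ∘ₗ T) = D.quad (P ∘ₗ T') Q :=
  copairing_adjoint D ((LinearMap.mul ℂ (Module.End ℂ V)).compl₁₂ P Q) T T' hT

lemma quad_swap {P Q : Fam h V} (hPQ : Anti P Q) : D.quad P Q = D.quad Q P := by
  have := copairing_symm D ((LinearMap.mul ℂ (Module.End ℂ V)).compl₁₂ P Q)
  refine Eq.trans this ?_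
  rw [SympData.quad, ← Finset.sum_neg_distrib]
  refine Finset.sum_congr rfl fun i _ => ?_
  refine LinearMap.ext fun v => ?_
  have := hPQ (D.a i) (D.b i) v
  simp [this]

lemma quad_pow_eq_zero {P Q : Fam h V} (hP : Anti P P) (hQ : Anti Q Q) (hPQ : Anti P Q) :
    D.quad P Q ^ (finrank ℂ h + 1) = 0 := by
  refine sum_fin_pow_eq_zero h _ (fun i => ?_) fun i j => ?_
  · refine LinearMap.ext fun v => ?_
    simp only [Module.End.mul_apply, LinearMap.zero_apply]
    rw [hPQ.symm (D.a i) (D.b i), map_neg, hP.self_self, neg_zero]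
  · refine LinearMap.ext fun v => ?_
    simp only [Module.End.mul_apply]
    rw [hPQ.symm (D.a i) (D.b j), hQ (D.a i), map_neg, map_neg, map_neg, neg_neg, hP (D.b i),
      hPQ (D.b i) (D.a j), map_neg, neg_neg]

lemma smul_quad_pow_eq_zero (s : ℂ) {P Q : Fam h V} (hP : Anti P P) (hQ : Anti Q Q)
    (hPQ : Anti P Q) : (s • D.quad P Q) ^ (finrank ℂ h + 1) = 0 := by
  rw [smul_pow, quad_pow_eq_zero D hP hQ hPQ, smul_zero]

lemma quad_commute {P Q P' Q' : Fam h V} (h1 : Anti P P') (h2 : Anti P Q') (h3 : Anti Q P')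
    (h4 : Anti Q Q') : Commute (D.quad P Q) (D.quad P' Q') := by
  refine Commute.sum_left _ _ _ fun i _ => Commute.sum_right _ _ _ fun j _ => ?_
  refine LinearMap.ext fun v => ?_
  simp only [Module.End.mul_apply]
  rw [h3, h4, map_neg, map_neg, map_neg, neg_neg, h1, h2, map_neg, neg_neg]

lemma gexp_nat (s : ℂ) {P Q : Fam h V} {P' Q' : Fam h W} {k : V →ₗ[ℂ] W}
    (hk : ∀ b a v, k (P b (Q a v)) = P' b (Q' a (k v))) (v : V) :
    k (D.gexp s P Q v) = D.gexp s P' Q' (k v) := by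
  refine expTrunc_comm h (fun v => ?_) v
  simp only [LinearMap.smul_apply, map_smul, quad_apply, map_sum, hk]

lemma gexp_neg_left (s : ℂ) (P Q : Fam h V) : D.gexp s (-P) Q = D.gexp (-s) P Q := by
  simp [SympData.gexp, SympData.quad]

lemma gexp_of_quad {s : ℂ} {P Q : Fam h V} {v : V} (hv : D.quad P Q v = 0) :
    D.gexp s P Q v = v := by
  rw [SympData.gexp, expTrunc, LinearMap.sum_apply, Finset.sum_eq_single_of_mem 0 (by simp)]
  · simp
  · intro n _ hn
    obtain ⟨n, rfl⟩ := Nat.exists_eq_succ_of_ne_zero hn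
    rw [Nat.succ_eq_add_one, pow_succ]
    simp [hv]

/-- `exp(s ∑ P(bᵢ) Q(aᵢ))` does not change what is annihilated by `Q`. -/
lemma gexp_of_right {s : ℂ} {P Q : Fam h V} {v : V} (hv : ∀ a, Q a v = 0) :
    D.gexp s P Q v = v := gexp_of_quad D (by simp [quad_apply, hv])

lemma gexp_of_left {s : ℂ} {P Q : Fam h V} (hPQ : Anti P Q) {v : V} (hv : ∀ a, P a v = 0) :
    D.gexp s P Q v = v := gexp_of_quad D (by
      rw [quad_apply]; exact Finset.sum_eq_zero fun i _ => by rw [hPQ, hv]; simp)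

/-- A functional annihilating all `P(b)` does not see `exp(s ∑ P(bᵢ) Q(aᵢ))`. -/
lemma map_gexp_of_left {s : ℂ} {P Q : Fam h V} {k : V →ₗ[ℂ] W} (hk : ∀ b v, k (P b v) = 0) (v : V) :
    k (D.gexp s P Q v) = k v := by
  rw [gexp_nat D s (P' := (0 : Fam h W)) (Q' := 0) (fun b a v => by simp [hk]) v]
  exact gexp_of_right D (by simp)

lemma map_gexp_of_right {s : ℂ} {P Q : Fam h V} (hPQ : Anti P Q) {k : V →ₗ[ℂ] W}
    (hk : ∀ b v, k (Q b v) = 0) (v : V) : k (D.gexp s P Q v) = k v := by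
  rw [gexp_nat D s (P' := (0 : Fam h W)) (Q' := 0) (fun b a v => by simp [hPQ b a, hk]) v]
  exact gexp_of_right D (by simp)

lemma gexp_swap (s : ℂ) {P Q : Fam h V} (hPQ : Anti P Q) : D.gexp s P Q = D.gexp s Q P := by
  rw [SympData.gexp, quad_swap D hPQ]; rfl

lemma gexp_zero (P Q : Fam h V) : D.gexp 0 P Q = 1 := by rw [SympData.gexp, zero_smul, expTrunc_zero]

lemma gexp_gexp (s t : ℂ) {P Q : Fam h V} (hP : Anti P P) (hQ : Anti Q Q) (hPQ : Anti P Q) (v : V) :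
    D.gexp s P Q (D.gexp t P Q v) = D.gexp (s + t) P Q v := by
  simp only [SympData.gexp]
  rw [add_smul, expTrunc_add h (((Commute.refl _).smul_right t).smul_left s)
    (smul_quad_pow_eq_zero D s hP hQ hPQ) (smul_quad_pow_eq_zero D t hP hQ hPQ)
    (by rw [← add_smul]; exact smul_quad_pow_eq_zero D _ hP hQ hPQ)]
  rfl

lemma gexp_gexp_neg (s : ℂ) {P Q : Fam h V} (hP : Anti P P) (hQ : Anti Q Q) (hPQ : Anti P Q) (v : V) :
    D.gexp s P Q (D.gexp (-s) P Q v) = v := by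
  rw [gexp_gexp D _ _ hP hQ hPQ, add_neg_cancel, gexp_zero]; rfl

lemma gexp_commute (s t : ℂ) {P Q P' Q' : Fam h V} (h1 : Anti P P') (h2 : Anti P Q')
    (h3 : Anti Q P') (h4 : Anti Q Q') (v : V) :
    D.gexp s P Q (D.gexp t P' Q' v) = D.gexp t P' Q' (D.gexp s P Q v) := by
  refine expTrunc_comm h (k := D.gexp s P Q) (fun v => ?_) v
  refine (expTrunc_comm h (k := t • D.quad P' Q') (fun v => ?_) v).symm
  have := LinearMap.congr_fun (quad_commute D h1 h2 h3 h4) v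
  simp only [LinearMap.smul_apply, map_smul]
  simp only [Module.End.mul_apply] at this
  rw [this, smul_comm]

lemma gexp_add_right (s : ℂ) {P Q Q' : Fam h V} (hP : Anti P P) (hQ : Anti Q Q) (hQ' : Anti Q' Q')
    (h1 : Anti P Q) (h2 : Anti P Q') (h3 : Anti Q Q') (v : V) :
    D.gexp s P (Q + Q') v = D.gexp s P Q (D.gexp s P Q' v) := by
  simp only [SympData.gexp]
  rw [quad_add_right, smul_add, expTrunc_add h _ (smul_quad_pow_eq_zero D s hP hQ h1)
    (smul_quad_pow_eq_zero D s hP hQ' h2)]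
  · rfl
  · rw [← smul_add, ← quad_add_right]
    exact smul_quad_pow_eq_zero D s hP ((hQ.add_left h3.symm).add_right (h3.add_left hQ'))
      (h1.add_right h2)
  · exact (((quad_commute D hP h2 h1.symm h3)).smul_left s).smul_right s

lemma gexp_add_left (s : ℂ) {P P' Q : Fam h V} (hP : Anti P P) (hP' : Anti P' P') (hQ : Anti Q Q)
    (h1 : Anti P Q) (h2 : Anti P' Q) (h3 : Anti P P') (v : V) :
    D.gexp s (P + P') Q v = D.gexp s P Q (D.gexp s P' Q v) := by
  rw [gexp_swap D s (h1.add_left h2), gexp_add_right D s hQ hP hP' h1.symm h2.symm h3,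
    gexp_swap D s h1.symm, gexp_swap D s h2.symm]

/-- `exp(s/2 ∑ (P+Q)(bᵢ) (P+Q)(aᵢ))`. -/
lemma gexp_add_add (s : ℂ) {P Q : Fam h V} (hP : Anti P P) (hQ : Anti Q Q) (hPQ : Anti P Q) (v : V) :
    D.gexp (s / 2) (P + Q) (P + Q) v = D.gexp s P Q (D.gexp (s / 2) P P (D.gexp (s / 2) Q Q v)) := by
  have hs : Anti (P + Q) P := hP.add_left hPQ.symm
  have hs' : Anti (P + Q) Q := hPQ.add_left hQ
  rw [gexp_add_right D _ (hs.add_right hs') hP hQ hs hs' hPQ,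
    gexp_add_left D _ hP hQ hP hP hPQ.symm hPQ, gexp_add_left D _ hP hQ hQ hPQ hQ hPQ,
    gexp_swap D (s / 2) hPQ.symm, gexp_gexp D _ _ hP hQ hPQ, add_halves,
    gexp_commute D _ _ hP hPQ hP hPQ]

lemma gexp_comp_adjoint (s : ℂ) (P Q : Fam h V) (T T' : h →ₗ[ℂ] h)
    (hT : ∀ a b, D.form (T a) b = D.form a (T' b)) :
    D.gexp s P (Q ∘ₗ T) = D.gexp s (P ∘ₗ T') Q := by
  rw [SympData.gexp, quad_comp_adjoint D P Q T T' hT]; rfl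

/-- An operator `k` with `[k, ∑ P(bᵢ) Q(aᵢ)] = c` passes through the exponential. -/
lemma gexp_bracket (s : ℂ) {P Q : Fam h V} (hP : Anti P P) (hQ : Anti Q Q) (hPQ : Anti P Q)
    {k c : Module.End ℂ V} (hc : ∀ v, D.quad P Q (c v) = c (D.quad P Q v))
    (hk : ∀ v, k (D.quad P Q v) = D.quad P Q (k v) + c v) (v : V) :
    k (D.gexp s P Q v) = D.gexp s P Q (k v + s • c v) := by
  have := expTrunc_bracket h (k := k) (f := s • D.quad P Q) (c := s • c)
    (smul_quad_pow_eq_zero D s hP hQ hPQ)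
    (by
      have h1 : Commute (D.quad P Q) c := LinearMap.ext hc
      exact (h1.smul_left s).smul_right s)
    (by ext v; simp [hk])
  exact LinearMap.congr_fun this v

end Families

section Gamma

variable {h : Type} [AddCommGroup h] [Module ℂ h] [FiniteDimensional ℂ h] (D : SympData h)

/-- The action of `exp(s C)` on `X ⊗ W`. -/
def SympData.gam (s : ℂ) (X W : SRep h) : Module.End ℂ (X.V ⊗[ℂ] W.V) :=
  D.gexp s (Fam.l X.act W.V) (Fam.r X.toSVect W.act)

/-- The action of `exp(s Ĉ / 2)` on `X`. -/
def SympData.sig (s : ℂ) (X : SRep h) : Module.End ℂ X.V := D.gexp (s / 2) X.act X.act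

lemma C_eq_quad (X W : SRep h) :
    D.C X W.act = D.quad (Fam.l X.act W.V) (Fam.r X.toSVect W.act) := by
  refine ext' fun x w => ?_
  simp [SympData.C, quad_apply]

lemma gamma_eq (X W : SRep h) : D.gamma X W.act = D.gam 1 X W := by
  rw [SympData.gam, SympData.gexp, one_smul, ← C_eq_quad]; rfl

lemma gammaInv_eq (X W : SRep h) : D.gammaInv X W.act = D.gam (-1) X W := by
  
  rw [SympData.gam, SympData.gexp, ← C_eq_quad, SympData.gammaInv]
  congr 1
  exact (neg_one_smul ℂ _).symm

lemma par_act (X : SRep h) (a : h) (v : X.V) : X.par (X.act a v) = -X.act a (X.par v) := by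
  rw [X.act_par, neg_neg]

lemma rho_Chat (X : SRep h) : X.rho D.Chat = D.quad X.act X.act := by
  simp [SympData.Chat, SympData.quad]

lemma sigma_eq (X : SRep h) : D.sigma X = D.sig 1 X := by
  rw [SympData.sig, SympData.gexp, ← rho_Chat]; rfl

lemma sigmaInv_eq (X : SRep h) : D.sigmaInv X = D.sig (-1) X := by
  rw [SympData.sig, SympData.gexp, ← rho_Chat]; rfl

lemma gam_gam (s t : ℂ) (X W : SRep h) (z : X.V ⊗[ℂ] W.V) :
    D.gam s X W (D.gam t X W z) = D.gam (s + t) X W z :=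
  gexp_gexp D s t X.anti.l (W.anti.r _) (Anti.l_r X.odd _) z

lemma gam_zero (X W : SRep h) : D.gam 0 X W = 1 := gexp_zero D _ _

lemma gam_neg_gam (s : ℂ) (X W : SRep h) (z : X.V ⊗[ℂ] W.V) :
    D.gam (-s) X W (D.gam s X W z) = z := by
  rw [gam_gam, neg_add_cancel, gam_zero]; rfl

lemma gam_gam_neg (s : ℂ) (X W : SRep h) (z : X.V ⊗[ℂ] W.V) :
    D.gam s X W (D.gam (-s) X W z) = z := by
  rw [gam_gam, add_neg_cancel, gam_zero]; rfl

lemma sig_sig (s t : ℂ) (X : SRep h) (x : X.V) : D.sig s X (D.sig t X x) = D.sig (s + t) X x := by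
  rw [SympData.sig, SympData.sig, gexp_gexp D _ _ X.anti X.anti X.anti, ← add_div]; rfl

lemma sig_zero (X : SRep h) : D.sig 0 X = 1 := by rw [SympData.sig, zero_div, gexp_zero]

lemma sig_neg_sig (s : ℂ) (X : SRep h) (x : X.V) : D.sig (-s) X (D.sig s X x) = x := by
  rw [sig_sig, neg_add_cancel, sig_zero]; rfl

lemma sig_sig_neg (s : ℂ) (X : SRep h) (x : X.V) : D.sig s X (D.sig (-s) X x) = x := by
  rw [sig_sig, add_neg_cancel, sig_zero]; rfl

lemma sig_natural (s : ℂ) {X X' : SRep h} {k : X.V →ₗ[ℂ] X'.V} (hk : Intertwines X X' k) (x : X.V) :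
    k (D.sig s X x) = D.sig s X' (k x) := gexp_nat D _ (fun b a v => by rw [hk, hk]) x

lemma sig_par (s : ℂ) (X : SRep h) (x : X.V) : X.par (D.sig s X x) = D.sig s X (X.par x) :=
  gexp_nat D _ (fun b a v => by
    rw [par_act, par_act, map_neg, neg_neg]) x

lemma act_sig (s : ℂ) (X : SRep h) (a : h) (x : X.V) :
    X.act a (D.sig s X x) = D.sig s X (X.act a x) :=
  gexp_nat D _ (k := X.act a) (fun b a' v => by
    rw [act_anti X a b, act_anti X a a', map_neg, neg_neg]) x

lemma sig_of_killed (s : ℂ) (X : SRep h) {x : X.V} (hx : ∀ a, X.act a x = 0) : D.sig s X x = x :=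
  gexp_of_right D hx

lemma sig_tensor (s : ℂ) (X Y : SRep h) (z : X.V ⊗[ℂ] Y.V) :
    D.sig s (X.tensor Y) z = D.gam s X Y (map (D.sig s X) (D.sig s Y) z) := by
  have e1 : ∀ z, map (D.sig s X) 𝕀 z =
      D.gexp (s / 2) (Fam.l X.act Y.V) (Fam.l X.act Y.V) z := fun z => by
    induction z with
    | zero => simp
    | add x y hx hy => rw [map_add, map_add, hx, hy]
    | tmul x y =>
      exact gexp_nat D (s / 2) (k := (mk ℂ X.V Y.V).flip y) (fun b a v => rfl) x
  have e2 : ∀ z, map 𝕀 (D.sig s Y) z =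
      D.gexp (s / 2) (Fam.r X.toSVect Y.act) (Fam.r X.toSVect Y.act) z := fun z => by
    induction z with
    | zero => simp
    | add x y hx hy => rw [map_add, map_add, hx, hy]
    | tmul x y =>
      exact gexp_nat D (s / 2) (k := (mk ℂ X.V Y.V x)) (fun b a v => by
        simp [X.par_par]) y
  have e3 : map (D.sig s X) (D.sig s Y) z = map (D.sig s X) 𝕀 (map 𝕀 (D.sig s Y) z) := by
    rw [← LinearMap.comp_apply, ← map_comp]; rfl
  rw [e3, e1, e2]
  exact gexp_add_add D s X.anti.l (Y.anti.r _) (Anti.l_r X.odd _) z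

lemma gam_natural (s : ℂ) {X X' W W' : SRep h} {k : X.V →ₗ[ℂ] X'.V} {l : W.V →ₗ[ℂ] W'.V}
    (hk : Intertwines X X' k) (hp : IsEven X.toSVect X'.toSVect k) (hl : Intertwines W W' l)
    (z : X.V ⊗[ℂ] W.V) :
    map k l (D.gam s X W z) = D.gam s X' W' (map k l z) :=
  gexp_nat D s (k := map k l) (fun b a v => by
    induction v with
    | zero => simp
    | add x y hx hy => simp only [map_add, hx, hy]
    | tmul x w => simp only [Fam.l_tmul, Fam.r_tmul, map_tmul, hk _ _, hp _, hl _ _]) z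

lemma gam_natural_left (s : ℂ) {X X' : SRep h} (W : SRep h) {k : X.V →ₗ[ℂ] X'.V}
    (hk : Intertwines X X' k) (hp : IsEven X.toSVect X'.toSVect k) (z : X.V ⊗[ℂ] W.V) :
    map k 𝕀 (D.gam s X W z) = D.gam s X' W (map k 𝕀 z) :=
  gam_natural D s hk hp (fun _ _ => rfl) z

lemma gam_natural_right (s : ℂ) (X : SRep h) {W W' : SRep h} {l : W.V →ₗ[ℂ] W'.V}
    (hl : Intertwines W W' l) (z : X.V ⊗[ℂ] W.V) :
    map 𝕀 l (D.gam s X W z) = D.gam s X W' (map 𝕀 l z) :=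
  gam_natural D s (k := 𝕀) (fun _ _ => rfl) (fun _ => rfl) hl z

lemma intertwines_gam (s : ℂ) (X W : SRep h) :
    Intertwines (X.tensor W) (X.tensor W) (D.gam s X W) := fun a z =>
  (gexp_nat D s (k := (X.tensor W).act a) (fun b a' v => by
    have h1 := (X.anti.l (W := W.V)).add_left (Anti.l_r X.odd W.act).symm
    have h2 := (Anti.l_r X.odd W.act).add_left (W.anti.r X.toSVect)
    rw [tensor_act_eq, h1 a b, h2 a a', map_neg, neg_neg]) z).symm

lemma isEven_gam (s : ℂ) (X W : SRep h) :
    IsEven (X.tensor W).toSVect (X.tensor W).toSVect (D.gam s X W) := fun z =>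
  (gexp_nat D s (k := (X.tensor W).par) (fun b a v => by
    induction v using TensorProduct.induction_on with
    | zero => simp
    | add x y hx hy => simp only [map_add, hx, hy]
    | tmul x w =>
      simp [X.act_par, W.act_par, tmul_neg, neg_tmul]) z).symm

lemma gam_par_left (s : ℂ) (X W : SRep h) (z : X.V ⊗[ℂ] W.V) :
    map X.par 𝕀 (D.gam s X W z) = D.gam (-s) X W (map X.par 𝕀 z) := by
  rw [SympData.gam, SympData.gam, ← gexp_neg_left]
  refine gexp_nat D s (k := map X.par 𝕀) (fun b a v => ?_) z
  induction v with
  | tmul x w => simp [X.act_par, neg_tmul]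
  | _ => simp only [map_zero, map_add, *]

lemma flip_l (X Y : SVect) {P : Fam h X.V} (hP : OddFam X P) (a : h) (z : X.V ⊗[ℂ] Y.V) :
    X.flip Y (P.l Y.V a z) = Fam.r Y P a (X.flip Y z) := by
  induction z with
  | tmul x y =>
    have e1 : X.par (P a x) = -P a (X.par x) := by rw [hP, neg_neg]
    simp only [Fam.l_tmul, flip_tmul, map_smul, map_add, map_sub, Fam.r_tmul, e1, Y.par_par, tmul_neg]
    module
  | _ => simp only [map_zero, map_add, *]

lemma flip_r (X Y : SVect) {Q : Fam h Y.V} (hQ : OddFam Y Q) (a : h) (z : X.V ⊗[ℂ] Y.V) :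
    X.flip Y (Fam.r X Q a z) = Fam.l Q X.V a (X.flip Y z) := by
  rw [← flip_flip X Y z]
  generalize X.flip Y z = z'
  rw [← flip_l Y X hQ, flip_flip, flip_flip]

lemma gam_flip (s : ℂ) (X Y : SRep h) (z : X.V ⊗[ℂ] Y.V) :
    X.flip Y.toSVect (D.gam s X Y z) = D.gam s Y X (X.flip Y.toSVect z) := by
  rw [SympData.gam, SympData.gam, gexp_swap D s (Anti.l_r Y.odd _)]
  refine gexp_nat D s (k := X.flip Y.toSVect) (fun b a v => ?_) z
  rw [flip_l _ _ X.odd, flip_r _ _ Y.odd]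

/-- The orbit map `g ↦ g x`. -/
def SRep.orb (X : SRep h) (x : X.V) : S h →ₗ[ℂ] X.V := LinearMap.applyₗ x ∘ₗ X.rho.toLinearMap

@[simp] lemma orb_apply (X : SRep h) (x : X.V) (g : S h) : X.orb x g = X.rho g x := rfl

lemma intertwines_orb (X : SRep h) (x : X.V) : Intertwines (reg h) X (X.orb x) := fun a g =>
  rho_ι_mul X a g x

lemma reg_act (a : h) (g : S h) : @Eq (S h) ((reg h).act a g) (ι ℂ a * g) := rfl

lemma reg_par (g : S h) : @Eq (S h) ((reg h).par g) (invol g) := rfl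

lemma reg_rho (g x : S h) : @Eq (S h) ((reg h).rho g x) (g * x) := by
  induction g using S.induction with
  | halg r => rw [rho_algebraMap, Algebra.smul_def]
  | hadd g g' hg hg' => rw [map_add, LinearMap.add_apply, hg, hg', add_mul]
  | hmul a g hg => rw [rho_ι_mul, hg, reg_act, mul_assoc]

lemma comul_apply (g : S h) : comul h g = ((reg h).tensor (reg h)).rho g (1 ⊗ₜ 1) := rfl

lemma comul_one : comul h (1 : S h) = 1 ⊗ₜ 1 := rho_one _ _

lemma comul_ι_mul (a : h) (g : S h) :
    comul h (ι ℂ a * g) = ((reg h).tensor (reg h)).act a (comul h g) := rho_ι_mul _ _ _ _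

lemma rho_tensor_one (Y : SRep h) (g : S h) (y : Y.V) :
    ((reg h).tensor Y).rho g (1 ⊗ₜ y) = map 𝕀 (Y.orb y) (comul h g) := by
  have := rho_natural (X := (reg h).tensor (reg h)) (X' := (reg h).tensor Y)
    (intertwines_map (k := 𝕀) (fun _ _ => rfl) (fun _ => rfl) (intertwines_orb Y y)) g
    (1 ⊗ₜ 1)
  rw [map_tmul, orb_apply, rho_one] at this
  exact this.symm

lemma comul_dd_left (v : h) (g : S h) :
    comul h (D.dd v g) = map (D.dd v) 𝕀 (comul h g) := by
  have : comul h ∘ₗ D.dd v = map (D.dd v) 𝕀 ∘ₗ comul h := by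
    refine S.ext_of_mul ?_ fun a x hx => ?_
    · simp [dd_one, comul_one]
    · simp only [LinearMap.comp_apply] at hx ⊢
      rw [dd_ι_mul, map_sub, map_smul, comul_ι_mul, comul_ι_mul, hx]
      generalize comul h x = z
      induction z with
      | zero => simp
      | add x y hx hy => simp only [map_add, smul_add, ← hx, ← hy]; abel
      | tmul x y =>
        rw [tensor_act, map_tmul, tensor_act, map_add, map_tmul, map_tmul]
        simp -proj only [reg_act, dd_ι_mul, reg_par, dd_invol, sub_tmul,
          neg_tmul, smul_tmul', LinearMap.id_apply]
        abel
  exact LinearMap.congr_fun this g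

lemma comul_dd_right (v : h) (g : S h) :
    comul h (D.dd v g) = map invol.toLinearMap (D.dd v) (comul h g) := by
  have : comul h ∘ₗ D.dd v = map invol.toLinearMap (D.dd v) ∘ₗ comul h := by
    refine S.ext_of_mul ?_ fun a x hx => ?_
    · simp [dd_one, comul_one]
    · simp only [LinearMap.comp_apply] at hx ⊢
      rw [dd_ι_mul, map_sub, map_smul, comul_ι_mul, comul_ι_mul, hx]
      generalize comul h x = z
      induction z with
      | zero => simp
      | add x y hx hy => simp only [map_add, smul_add, ← hx, ← hy]; abel
      | tmul x y =>
        rw [tensor_act, map_tmul, tensor_act, map_add, map_tmul, map_tmul]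
        simp -proj only [reg_act, dd_ι_mul, reg_par, tmul_sub,
          tmul_smul, AlgHom.toLinearMap_apply, invol_ι_mul, invol_invol,
          neg_tmul]
        abel
  exact LinearMap.congr_fun this g

lemma comul_invol (g : S h) :
    comul h (invol g) = map invol.toLinearMap invol.toLinearMap (comul h g) := by
  have := rho_par ((reg h).tensor (reg h)) (invol g) (1 ⊗ₜ 1)
  rw [tensor_par, reg_par, map_one, invol_invol] at this
  exact this

/-- The counit of `S(𝔥)`. -/
def counit (h : Type) [AddCommGroup h] [Module ℂ h] : S h →ₗ[ℂ] ℂ :=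
  ExteriorAlgebra.algebraMapInv.toLinearMap

lemma counit_algebraMap (r : ℂ) : counit h (algebraMap ℂ (S h) r) = r :=
  ExteriorAlgebra.algebraMap_leftInverse h r

lemma counit_one : counit h 1 = 1 := map_one ExteriorAlgebra.algebraMapInv

lemma counit_ι_mul (a : h) (g : S h) : counit h (ι ℂ a * g) = 0 := by
  change ExteriorAlgebra.algebraMapInv (ι ℂ a * g) = 0
  rw [map_mul, ExteriorAlgebra.algebraMapInv, ExteriorAlgebra.lift_ι_apply]
  simp

lemma counit_invol (g : S h) : counit h (invol g) = counit h g := by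
  induction g using S.induction with
  | halg r => rw [commutes]
  | hadd g g' hg hg' => rw [map_add, map_add, map_add, hg, hg']
  | hmul a g hg => rw [invol_ι_mul, map_neg, counit_ι_mul, counit_ι_mul, neg_zero]

lemma eq_counit_of_dd {x : S h} (hx : ∀ v, D.dd v x = 0) : x = algebraMap ℂ (S h) (counit h x) := by
  obtain ⟨r, rfl⟩ := exists_algebraMap_of_dd_eq_zero D hx
  rw [counit_algebraMap]

/-- `(k ⊗ 1) Δ(g)`. -/
def conv (k : S h →ₗ[ℂ] ℂ) : S h →ₗ[ℂ] S h :=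
  (lid ℂ (S h)).toLinearMap ∘ₗ map k 𝕀 ∘ₗ comul h

lemma counit_conv (k : S h →ₗ[ℂ] ℂ) (g : S h) : counit h (conv k g) = k g := by
  have key : ∀ z : S h ⊗[ℂ] S h, counit h ((lid ℂ (S h)) (map k 𝕀 z)) =
      k (rid ℂ (S h) (map 𝕀 (counit h) z)) := fun z => by
    induction z with
    | tmul x y => simp [mul_comm]
    | _ => simp only [map_zero, map_add, *]
  have h2 : map 𝕀 (counit h) (comul h g) = g ⊗ₜ (1 : ℂ) := by
    have : map 𝕀 (counit h) ∘ₗ comul h = (TensorProduct.mk ℂ (S h) ℂ).flip 1 := by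
      refine S.ext_of_mul ?_ fun a x hx => ?_
      · simp [comul_one, counit_one]
      · simp only [LinearMap.comp_apply] at hx ⊢
        have h3 : ∀ z : S h ⊗[ℂ] S h, map 𝕀 (counit h)
            (((reg h).tensor (reg h)).act a z) =
            map (LinearMap.mulLeft ℂ (ι ℂ a)) 𝕀
              (map 𝕀 (counit h) z) := fun z => by
          induction z with
          | tmul x y =>
            rw [tensor_act, map_add, map_tmul, map_tmul, reg_act, reg_act, counit_ι_mul]
            simp
          | _ => simp only [map_zero, map_add, *]
        rw [comul_ι_mul, h3, hx]
        simp
    exact LinearMap.congr_fun this g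
  change counit h ((lid ℂ (S h)) (map k 𝕀 (comul h g))) = _
  rw [key, h2]
  simp

lemma dd_conv {k : S h →ₗ[ℂ] ℂ} (hk : ∀ g, k (invol g) = k g) (v : h) (g : S h) :
    D.dd v (conv k g) = conv k (D.dd v g) := by
  change D.dd v ((lid ℂ (S h)) (map k 𝕀 (comul h g))) =
    (lid ℂ (S h)) (map k 𝕀 (comul h (D.dd v g)))
  rw [comul_dd_right]
  generalize comul h g = z
  induction z with
  | tmul x y => simp [hk]
  | _ => simp only [map_zero, map_add, *]

lemma conv_dd_eq_zero {k : S h →ₗ[ℂ] ℂ} {v : h} (hk : ∀ g, k (D.dd v g) = 0) (g : S h) :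
    conv k (D.dd v g) = 0 := by
  change (lid ℂ (S h)) (map k 𝕀 (comul h (D.dd v g))) = 0
  rw [comul_dd_left]
  generalize comul h g = z
  induction z with
  | tmul x y => simp [hk]
  | _ => simp_all [add_tmul, tmul_add]

lemma conv_ι_mul {k : S h →ₗ[ℂ] ℂ} (hk : ∀ g, k (invol g) = k g) {a : h}
    (ha : ∀ g, k (ι ℂ a * g) = 0) (g : S h) : conv k (ι ℂ a * g) = ι ℂ a * conv k g := by
  change (lid ℂ (S h)) (map k 𝕀 (comul h (ι ℂ a * g))) =
    ι ℂ a * (lid ℂ (S h)) (map k 𝕀 (comul h g))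
  rw [comul_ι_mul]
  generalize comul h g = z
  induction z with
  | zero => simp
  | add x y hx hy => simp only [map_add, hx, hy, mul_add]
  | tmul x y =>
    rw [tensor_act, map_add, map_tmul, map_tmul, reg_act, reg_act, ha, reg_par, hk]
    simp

lemma conv_invol {k : S h →ₗ[ℂ] ℂ} (hk : ∀ g, k (invol g) = k g) (g : S h) :
    conv k (invol g) = invol (conv k g) := by
  change (lid ℂ (S h)) (map k 𝕀 (comul h (invol g))) =
    invol ((lid ℂ (S h)) (map k 𝕀 (comul h g)))
  rw [comul_invol]
  generalize comul h g = z
  induction z with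
  | tmul x y => simp [hk]
  | _ => simp only [map_zero, map_add, *]

lemma rho_conv (Y : SRep h) (k : S h →ₗ[ℂ] ℂ) (g : S h) (y : Y.V) :
    Y.rho (conv k g) y = lid ℂ Y.V (map k 𝕀 (((reg h).tensor Y).rho g (1 ⊗ₜ y))) := by
  rw [rho_tensor_one]
  change Y.rho ((lid ℂ (S h)) (map k 𝕀 (comul h g))) y = _
  generalize comul h g = z
  induction z with
  | zero => simp
  | add x y hx hy => simp only [map_add, LinearMap.add_apply, hx, hy]
  | tmul x y => simp

include D in
lemma even_finrank : Even (finrank ℂ h) := ⟨finrank ℂ h / 2, by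
  have := (topForm_Chat_pow D).2; omega⟩

lemma topForm_invol (g : S h) : D.topForm (invol g) = D.topForm g := by
  induction g using DirectSum.Decomposition.inductionOn (fun i : ℕ => ⋀[ℂ]^i h) with
  | zero => simp
  | add x y hx hy => rw [map_add, map_add, map_add, hx, hy]
  | @homogeneous i x =>
    rw [invol_of_mem x.2, map_smul]
    by_cases hi : i = finrank ℂ h
    · rw [(hi ▸ even_finrank D : Even i).neg_one_pow, one_smul]
    · rw [topForm_of_mem D hi x.2, smul_zero]

lemma exists_lam : ∃ r : ℂ, r ≠ 0 ∧ D.lam = r • D.topForm := by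
  refine ⟨_, ?_, rfl⟩
  refine div_ne_zero (mul_ne_zero (pow_ne_zero _ two_ne_zero) ?_) (topForm_Chat_pow D).1
  exact Nat.cast_ne_zero.mpr (Nat.factorial_ne_zero _)

lemma lam_invol (g : S h) : D.lam (invol g) = D.lam g := by
  obtain ⟨r, -, hr⟩ := exists_lam D
  rw [hr, LinearMap.smul_apply, LinearMap.smul_apply, topForm_invol]

lemma lam_dd (v : h) (g : S h) : D.lam (D.dd v g) = 0 := by
  obtain ⟨r, -, hr⟩ := exists_lam D
  rw [hr, LinearMap.smul_apply, topForm_dd, smul_zero]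

lemma lam_ne_zero_of_killed {x : S h} (hx : ∀ a, ι ℂ a * x = 0) (hne : x ≠ 0) : D.lam x ≠ 0 := by
  obtain ⟨r, h0, hr⟩ := exists_lam D
  rw [hr]
  exact mul_ne_zero h0 (topForm_ne_zero_of_killed D hx hne)

lemma eq_zero_of_lam_mul {x : S h} (hx : ∀ g, D.lam (g * x) = 0) : x = 0 := by
  obtain ⟨r, h0, hr⟩ := exists_lam D
  refine eq_zero_of_topForm_mul D fun g => ?_
  have := hx g
  rw [hr, LinearMap.smul_apply, smul_eq_zero] at this
  exact this.resolve_left h0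

/-- The element `exp(s Ĉ / 2)` of `S(𝔥)`. -/
def SympData.sg (s : ℂ) : S h := D.sig s (reg h) 1

lemma lam_sg : D.lam (D.sg 1) = 1 := by
  have h1 : D.sg 1 = ∑ k ∈ Finset.range (finrank ℂ h + 1),
      ((k.factorial : ℂ)⁻¹ * (1 / 2 : ℂ) ^ k) • D.Chat ^ k := by
    have h2 : ∀ k : ℕ, ((reg h).rho D.Chat ^ k) 1 = D.Chat ^ k := fun k => by
      rw [← map_pow, reg_rho, mul_one]
    rw [SympData.sg, SympData.sig, SympData.gexp, ← rho_Chat, expTrunc, LinearMap.sum_apply]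
    refine Finset.sum_congr rfl fun k _ => ?_
    rw [LinearMap.smul_apply, smul_pow, LinearMap.smul_apply, h2, smul_smul]
  have h3 := (topForm_Chat_pow D).2
  have h4 : D.lam (D.Chat ^ (finrank ℂ h / 2)) =
      (2 : ℂ) ^ (finrank ℂ h / 2) * ((finrank ℂ h / 2).factorial : ℂ) := by
    rw [SympData.lam, LinearMap.smul_apply, smul_eq_mul, div_mul_cancel₀ _ (topForm_Chat_pow D).1]
  rw [h1, map_sum, Finset.sum_eq_single (finrank ℂ h / 2)]
  · rw [map_smul, h4, smul_eq_mul]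
    have : ((finrank ℂ h / 2).factorial : ℂ) ≠ 0 :=
      Nat.cast_ne_zero.mpr (Nat.factorial_ne_zero _)
    field_simp
    rw [← mul_pow]; norm_num
  · intro k _ hk
    obtain ⟨r, -, hr⟩ := exists_lam D
    rw [map_smul, hr, LinearMap.smul_apply,
      topForm_of_mem D (n := 2 * k) (by omega) (Chat_pow_mem D k), smul_zero, smul_zero]
  · intro hn
    exact absurd (Finset.mem_range.mpr (by omega)) hn

lemma dd_sig (s : ℂ) (v : h) (g : S h) :
    D.dd v (D.sig s (reg h) g) = D.sig s (reg h) (D.dd v g + s • (ι ℂ v * g)) := by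
  have e : ∀ g, D.quad (reg h).act (reg h).act g = D.Chat * g := fun g => by
    rw [← rho_Chat, reg_rho]
  have := gexp_bracket D (s / 2) (reg h).anti (reg h).anti (reg h).anti (k := D.dd v)
    (c := (2 : ℂ) • (reg h).act v)
    (fun g => by
      rw [e, e, LinearMap.smul_apply, LinearMap.smul_apply, reg_act, reg_act, mul_smul_comm,
        Chat_mul_comm, Chat_mul_comm, mul_assoc])
    (fun g => by
      rw [e, e, dd_Chat, LinearMap.smul_apply, reg_act, two_smul, two_smul]) g
  refine this.trans ?_
  rw [LinearMap.smul_apply, smul_smul, div_mul_cancel₀ _ two_ne_zero]; rfl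

lemma counit_sig (s : ℂ) (g : S h) : counit h (D.sig s (reg h) g) = counit h g :=
  map_gexp_of_left D (k := counit h) (fun b v => counit_ι_mul b v) g

/-- `(id ⊗ λ)`. -/
def SympData.idLam : S h ⊗[ℂ] S h →ₗ[ℂ] S h :=
  (rid ℂ (S h)).toLinearMap ∘ₗ map 𝕀 D.lam

@[simp] lemma idLam_tmul (x y : S h) : D.idLam (x ⊗ₜ y) = D.lam y • x := by
  simp [SympData.idLam]

lemma gam_l_reg (s : ℂ) (v : h) (z : S h ⊗[ℂ] S h) : D.gam s (reg h) (reg h) (Fam.l (reg h).act (S h) v z) =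
    Fam.l (reg h).act (S h) v (D.gam s (reg h) (reg h) z) :=
  (gexp_nat D s (k := Fam.l (reg h).act (S h) v) (fun b a z => by
    rw [(reg h).anti.l v b, Anti.l_r (reg h).odd (reg h).act v a, map_neg, neg_neg]) _).symm

lemma gam_dd_right (s : ℂ) (v : h) (z : S h ⊗[ℂ] S h) :
    map invol.toLinearMap (D.dd v) (D.gam s (reg h) (reg h) z) =
      D.gam s (reg h) (reg h) (map invol.toLinearMap (D.dd v) z + s • Fam.l (reg h).act (S h) v z) := by
  refine gexp_bracket D s (reg h).anti.l ((reg h).anti.r _) (Anti.l_r (reg h).odd _)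
    (k := map invol.toLinearMap (D.dd v)) (c := Fam.l (reg h).act (S h) v)
    (fun z => ?_) (fun z => ?_) z
  · rw [quad_apply, quad_apply, map_sum]
    refine Finset.sum_congr rfl fun i _ => ?_
    rw [(Anti.l_r (reg h).odd (reg h).act).symm (D.a i) v, map_neg, (reg h).anti.l (D.b i) v, neg_neg]
  · induction z with
    | zero => simp
    | add x y hx hy => simp only [map_add, hx, hy]; abel
    | tmul x y =>
      change S h at x y
      have e : ι ℂ v = -∑ i, D.form v (D.a i) • ι ℂ (D.b i) := by
        conv_lhs => rw [← sum_form_b D v]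
        rw [map_sum, ← Finset.sum_neg_distrib]
        refine Finset.sum_congr rfl fun i _ => ?_
        rw [form_neg, map_smul, neg_smul]
      rw [quad_apply, map_sum, map_tmul, quad_apply, Fam.l_tmul, reg_act, e, neg_mul,
        Finset.sum_mul, neg_tmul, sum_tmul, ← sub_eq_add_neg,
        ← Finset.sum_sub_distrib]
      refine Finset.sum_congr rfl fun i _ => ?_
      have key : ∀ b a : h, invol (ι ℂ b * invol x) ⊗ₜ[ℂ] D.dd v (ι ℂ a * y) =
          (ι ℂ b * invol (invol x)) ⊗ₜ[ℂ] (ι ℂ a * D.dd v y) -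
            (D.form v a • ι ℂ b * x) ⊗ₜ[ℂ] y := fun b a => by
        rw [invol_ι_mul, invol_invol, dd_ι_mul, tmul_sub, tmul_smul,
          neg_tmul, neg_tmul, smul_mul_assoc, smul_neg,
          sub_neg_eq_add, neg_add_eq_sub, smul_tmul']
      exact key _ _

lemma gam_dd_left (s : ℂ) (v : h) (z : S h ⊗[ℂ] S h) :
    map (D.dd v) 𝕀 (D.gam s (reg h) (reg h) z) = D.gam s (reg h) (reg h) (map (D.dd v) 𝕀 z +
        s • Fam.r (reg h).toSVect (reg h).act v z) := by
  refine gexp_bracket D s (reg h).anti.l ((reg h).anti.r _) (Anti.l_r (reg h).odd _)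
    (k := map (D.dd v) 𝕀) (c := Fam.r (reg h).toSVect (reg h).act v)
    (fun z => ?_) (fun z => ?_) z
  · rw [quad_apply, quad_apply, map_sum]
    refine Finset.sum_congr rfl fun i _ => ?_
    rw [(reg h).anti.r _ (D.a i) v, map_neg, (Anti.l_r (reg h).odd (reg h).act) (D.b i) v, neg_neg]
  · induction z with
    | zero => simp
    | add x y hx hy => simp only [map_add, hx, hy]; abel
    | tmul x y =>
      change S h at x y
      have e : ι ℂ v = ∑ i, D.form v (D.b i) • ι ℂ (D.a i) := by
        conv_lhs => rw [← sum_form_a D v]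
        rw [map_sum]
        exact Finset.sum_congr rfl fun i _ => map_smul _ _ _
      rw [quad_apply, map_sum, map_tmul, quad_apply, Fam.r_tmul, reg_act, e,
        Finset.sum_mul, tmul_sum, ← Finset.sum_add_distrib]
      refine Finset.sum_congr rfl fun i _ => ?_
      have key : ∀ b a : h, D.dd v (ι ℂ b * invol x) ⊗ₜ[ℂ] (ι ℂ a * y) =
          (ι ℂ b * invol (D.dd v x)) ⊗ₜ[ℂ] (ι ℂ a * y) +
            invol x ⊗ₜ[ℂ] (D.form v b • ι ℂ a * y) := fun b a => by
        rw [dd_ι_mul, dd_invol, mul_neg, sub_neg_eq_add, add_tmul, smul_mul_assoc,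
          tmul_smul, smul_tmul', add_comm]
      exact key _ _

variable {D} (hβ : D.β = 1)

include hβ in
lemma phi_eq (g : S h) : D.phi g = D.idLam (D.gam (-1) (reg h) (reg h) (1 ⊗ₜ g)) := by
  rw [← gammaInv_eq, SympData.phi, hβ]; simp [SympData.idLam]

include hβ in
lemma phi_dd (v : h) (g : S h) : D.phi (D.dd v g) = ι ℂ v * D.phi g := by
  have h1 := congrArg D.idLam (gam_dd_right D (-1) v (1 ⊗ₜ g))
  have h2 : ∀ z, D.idLam (map invol.toLinearMap (D.dd v) z) = 0 := fun z => by
    induction z with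
    | tmul x y => simp [lam_dd]
    | _ => simp_all [add_tmul, tmul_add]
  have h3 : ∀ z, D.idLam (Fam.l (reg h).act (S h) v z) = ι ℂ v * D.idLam z := fun z => by
    induction z with
    | zero => simp
    | add x y hx hy => simp only [map_add, hx, hy, mul_add]
    | tmul x y => simp
  have h4 : D.gam (-1) (reg h) (reg h) (Fam.l (reg h).act (S h) v (1 ⊗ₜ g)) =
      Fam.l (reg h).act (S h) v (D.gam (-1) (reg h) (reg h) (1 ⊗ₜ g)) :=
    gam_l_reg D (-1) v _
  rw [h2, map_add, map_smul, h4, map_add, map_smul, h3, ← phi_eq hβ, map_tmul,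
    AlgHom.toLinearMap_apply, map_one, ← phi_eq hβ, neg_one_smul] at h1
  exact eq_of_sub_eq_zero (by rw [sub_eq_add_neg]; exact h1.symm)

include hβ in
lemma phi_ι_mul (v : h) (g : S h) : D.phi (ι ℂ v * g) = -D.dd v (D.phi g) := by
  have h1 := congrArg D.idLam (gam_dd_left D (-1) v (1 ⊗ₜ g))
  have h2 : ∀ z, D.idLam (map (D.dd v) 𝕀 z) = D.dd v (D.idLam z) := fun z => by
    induction z with
    | tmul x y => simp
    | _ => simp only [map_zero, map_add, *]
  rw [h2, ← phi_eq hβ, map_tmul, dd_one, zero_tmul, zero_add, map_smul,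
    Fam.r_tmul, reg_par, map_one, reg_act, map_smul, ← phi_eq hβ, neg_one_smul] at h1
  rw [h1, neg_neg]

include hβ in
lemma counit_phi (g : S h) : counit h (D.phi g) = D.lam g := by
  have h1 := map_gexp_of_left D (s := -1) (P := Fam.l (reg h).act (S h))
    (Q := Fam.r (reg h).toSVect (reg h).act) (k := counit h ∘ₗ D.idLam)
    (fun b z => by
      induction z with
      | zero => simp
      | add x y hx hy => simp only [map_add, hx, hy, add_zero]
      | tmul x y => simp [counit_ι_mul]) (1 ⊗ₜ g)
  rw [phi_eq hβ]
  refine h1.trans ?_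
  simp [counit_one]

include hβ in
lemma phi_invol (g : S h) : D.phi (invol g) = invol (D.phi g) := by
  have h2 : ∀ z, D.idLam (((reg h).tensor (reg h)).par z) = invol (D.idLam z) := fun z => by
    induction z using TensorProduct.induction_on with
    | tmul x y => simp [lam_invol]
    | _ => simp only [map_zero, map_add, *]
  have h3 := isEven_gam D (-1) (reg h) (reg h) (1 ⊗ₜ g)
  rw [tensor_par, reg_par, reg_par, map_one] at h3
  rw [phi_eq hβ, phi_eq hβ, ← h2, h3]

lemma eq_zero_of_contract_eq_zero {V W : Type} [AddCommGroup V] [Module ℂ V] [FiniteDimensional ℂ V]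
    [AddCommGroup W] [Module ℂ W] {z : V ⊗[ℂ] W}
    (hz : ∀ k : V →ₗ[ℂ] ℂ, lid ℂ W (map k 𝕀 z) = 0) : z = 0 := by
  let b := Module.finBasis ℂ V
  have h1 : ∀ z : V ⊗[ℂ] W, z = ∑ i, b i ⊗ₜ[ℂ] lid ℂ W
      (map (b.coord i) 𝕀 z) := fun z => by
    induction z with
    | zero => simp
    | add x y hx hy =>
      simp only [map_add, tmul_add, Finset.sum_add_distrib]
      rw [← hx, ← hy]
    | tmul x y =>
      conv_lhs => rw [← b.sum_repr x, sum_tmul]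
      simp [smul_tmul]
  rw [h1 z]
  simp [hz]

lemma lid_map_counit (k : S h →ₗ[ℂ] ℂ) (z : S h ⊗[ℂ] S h) :
    lid ℂ (S h) (map k 𝕀 (map 𝕀 (Algebra.linearMap ℂ (S h) ∘ₗ counit h) z)) =
      algebraMap ℂ (S h) (counit h (lid ℂ (S h) (map k 𝕀 z))) := by
  induction z with
  | tmul x y =>
    rw [map_tmul, map_tmul, map_tmul, lid_tmul, lid_tmul, map_smul, smul_eq_mul, map_mul]
    exact Algebra.smul_def _ _
  | _ => simp_all [add_tmul, tmul_add]

include hβ in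
/-- `γ⁻¹ (φ ⊗ id) Δ(g) = φ(g) ⊗ 1`. -/
lemma gam_phi_comul (g : S h) :
    D.gam (-1) (reg h) (reg h) (map D.phi 𝕀 (comul h g)) = D.phi g ⊗ₜ 1 := by
  let F : S h →ₗ[ℂ] S h ⊗[ℂ] S h :=
    D.gam (-1) (reg h) (reg h) ∘ₗ map D.phi 𝕀 ∘ₗ comul h
  have h1 : ∀ v g, F (D.dd v g) = Fam.l (reg h).act (S h) v (F g) := fun v g => by
    have e : ∀ z, map D.phi 𝕀 (map (D.dd v) 𝕀 z) =
        Fam.l (reg h).act (S h) v (map D.phi 𝕀 z) := fun z => by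
      induction z with
      | tmul x y => simp [phi_dd hβ]
      | _ => simp_all [add_tmul, tmul_add]
    change D.gam (-1) (reg h) (reg h) (map D.phi 𝕀 (comul h (D.dd v g))) = _
    rw [comul_dd_left, e]
    exact gam_l_reg D (-1) v _
  have h2 : ∀ v g, map invol.toLinearMap (D.dd v) (F g) = 0 := fun v g => by
    have e : ∀ z, map D.phi 𝕀
        (map invol.toLinearMap (D.dd v) z) =
        map invol.toLinearMap (D.dd v) (map D.phi 𝕀 z) :=
      fun z => by
        induction z with
        | tmul x y => simp [phi_invol hβ]
        | _ => simp_all [add_tmul, tmul_add]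
    have e2 : F (D.dd v g) = D.gam (-1) (reg h) (reg h) (map invol.toLinearMap (D.dd v)
        (map D.phi 𝕀 (comul h g))) := by
      change D.gam (-1) (reg h) (reg h) (map D.phi 𝕀 (comul h (D.dd v g))) = _
      rw [comul_dd_right, e]
    have e3 := gam_dd_right D (-1) v (map D.phi 𝕀 (comul h g))
    have e4 : D.gam (-1) (reg h) (reg h) (Fam.l (reg h).act (S h) v
        (map D.phi 𝕀 (comul h g))) = Fam.l (reg h).act (S h) v (F g) :=
      gam_l_reg D (-1) v _
    rw [map_add, map_smul, e4, ← e2, h1, neg_one_smul, add_neg_cancel] at e3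
    exact e3
  have h3 : F g = map 𝕀 (Algebra.linearMap ℂ (S h) ∘ₗ counit h) (F g) := by
    refine eq_of_sub_eq_zero (eq_zero_of_contract_eq_zero fun k => ?_)
    rw [map_sub, map_sub, lid_map_counit, sub_eq_zero]
    refine eq_counit_of_dd D fun v => ?_
    have e2 : ∀ z, D.dd v (lid ℂ (S h) (map k 𝕀 z)) =
        lid ℂ (S h) (map (k ∘ₗ invol.toLinearMap) 𝕀
          (map invol.toLinearMap (D.dd v) z)) := fun z => by
      induction z with
      | tmul x y => simp [invol_invol]
      | _ => simp_all [add_tmul, tmul_add]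
    rw [e2, h2, map_zero, map_zero]
  have h4 : map 𝕀 (Algebra.linearMap ℂ (S h) ∘ₗ counit h) (F g) = D.phi g ⊗ₜ 1 := by
    have e1 := map_gexp_of_right D (s := -1) (P := Fam.l (reg h).act (S h))
      (Q := Fam.r (reg h).toSVect (reg h).act) (Anti.l_r (reg h).odd _)
      (k := map 𝕀 (Algebra.linearMap ℂ (S h) ∘ₗ counit h))
      (fun b z => by
        induction z with
        | zero => simp
        | add x y hx hy => simp only [map_add, hx, hy, add_zero]
        | tmul x y =>
          rw [Fam.r_tmul, map_tmul, LinearMap.comp_apply, reg_act, counit_ι_mul, map_zero, tmul_zero])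
      (map D.phi 𝕀 (comul h g))
    refine e1.trans ?_
    have e2 : map 𝕀 (Algebra.linearMap ℂ (S h) ∘ₗ counit h) (comul h g) = g ⊗ₜ 1 := by
      refine eq_of_sub_eq_zero (eq_zero_of_contract_eq_zero fun k => ?_)
      have e4 := counit_conv k g
      rw [map_sub, map_sub, lid_map_counit, sub_eq_zero]
      refine (congrArg _ e4).trans ?_
      simp [algebraMap_eq_smul_one]
    have e5 : ∀ z, map 𝕀 (Algebra.linearMap ℂ (S h) ∘ₗ counit h)
        (map D.phi 𝕀 z) = map D.phi 𝕀
          (map 𝕀 (Algebra.linearMap ℂ (S h) ∘ₗ counit h) z) := fun z => by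
      induction z with
      | tmul x y => simp
      | _ => simp_all [add_tmul, tmul_add]
    rw [e5, e2]
    simp
  exact h3.trans h4

end Gamma

section Lagrangian

variable {h : Type} [AddCommGroup h] [Module ℂ h] [FiniteDimensional ℂ h]

/-- A projection onto the Lagrangian subspace `f` whose kernel is Lagrangian, too. -/
structure Polarization (D : SympData h) (f : Submodule ℂ h) where
  lag : D.IsLagrangian f
  r : h →ₗ[ℂ] h
  r_mem : ∀ a, r a ∈ f
  r_id : ∀ u ∈ f, r u = u
  adj : ∀ a b, D.form (r a) b + D.form a (r b) = D.form a b

variable {D : SympData h} {f : Submodule ℂ h}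

lemma isotropic (hf : D.IsLagrangian f) {u u' : h} (hu : u ∈ f) (hu' : u' ∈ f) : D.form u u' = 0 := by
  rw [← hf] at hu'
  exact hu' u hu

lemma exists_polarization (hf : D.IsLagrangian f) : Nonempty (Polarization D f) := by
  obtain ⟨p, hp⟩ := f.subtype.exists_leftInverse_of_injective (Submodule.ker_subtype f)
  have hp' : ∀ u ∈ f, (p u : h) = u := fun u hu => by
    have := LinearMap.congr_fun hp ⟨u, hu⟩
    exact congrArg Subtype.val this
  let r0 : h →ₗ[ℂ] h := f.subtype ∘ₗ p
  let r1 : h →ₗ[ℂ] h := D.form.leftAdjointOfNondegenerate D.nondeg r0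
  have h1 : ∀ a b, D.form (r1 a) b = D.form a (r0 b) := fun a b =>
    D.form.isAdjointPairLeftAdjointOfNondegenerate D.nondeg r0 a b
  have h2 : ∀ a b, D.form (r0 a) b = D.form a (r1 b) := fun a b => by
    rw [form_neg, ← h1, form_neg, neg_neg]
  have h3 : ∀ u ∈ f, r1 u = 0 := fun u hu => by
    refine D.nondeg.1 _ fun a => ?_
    rw [h1]
    exact isotropic hf hu (p a).2
  have h4 : ∀ a, a - r1 a ∈ f := fun a => by
    rw [← hf]
    intro u hu
    change D.form u (a - r1 a) = 0
    rw [map_sub, ← h2]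
    change _ - D.form (p u : h) a = 0
    rw [hp' u hu, sub_self]
  refine ⟨⟨hf, (1 / 2 : ℂ) • (r0 + 𝕀 - r1), fun a => ?_, fun u hu => ?_, fun a b => ?_⟩⟩
  · rw [LinearMap.smul_apply, LinearMap.sub_apply, LinearMap.add_apply, add_sub_assoc]
    exact f.smul_mem _ (f.add_mem (p a).2 (h4 a))
  · rw [LinearMap.smul_apply, LinearMap.sub_apply, LinearMap.add_apply, h3 u hu, sub_zero]
    change (1 / 2 : ℂ) • ((p u : h) + u) = u
    rw [hp' u hu, ← two_smul ℂ u, smul_smul]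
    norm_num
  · simp only [LinearMap.smul_apply, LinearMap.sub_apply, LinearMap.add_apply, LinearMap.id_apply,
      map_smul, map_add, map_sub, smul_eq_mul, h1, h2]
    ring

lemma finrank_lagrangian (hf : D.IsLagrangian f) :
    2 * finrank ℂ f = finrank ℂ h := by
  have := LinearMap.BilinForm.finrank_orthogonal D.nondeg f
  have hle := f.finrank_le
  rw [hf] at this
  omega

namespace Polarization

variable (P : Polarization D f)

/-- The complementary projection. -/
def s : h →ₗ[ℂ] h := 𝕀 - P.r

lemma s_apply (a : h) : P.s a = a - P.r a := rfl

lemma r_add_s (a : h) : P.r a + P.s a = a := by rw [s_apply]; abel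

lemma r_s (a : h) : P.r (P.s a) = 0 := by
  rw [s_apply, map_sub, P.r_id _ (P.r_mem a), sub_self]

lemma s_of_mem {u : h} (hu : u ∈ f) : P.s u = 0 := by rw [s_apply, P.r_id u hu, sub_self]

lemma form_r (a b : h) : D.form (P.r a) b = D.form a (P.s b) := by
  rw [s_apply, map_sub, ← P.adj a b, add_sub_cancel_right]

lemma form_s (a b : h) : D.form (P.s a) b = D.form a (P.r b) := by
  rw [s_apply, map_sub, LinearMap.sub_apply, ← P.adj a b, add_sub_cancel_left]

lemma form_s_s (a b : h) : D.form (P.s a) (P.s b) = 0 := by rw [form_s, r_s, map_zero]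

/-- The algebra endomorphism of `S(𝔥)` induced by `r`. -/
def mr : S h →ₐ[ℂ] S h := ExteriorAlgebra.map P.r

/-- The algebra endomorphism of `S(𝔥)` induced by `s`. -/
def ms : S h →ₐ[ℂ] S h := ExteriorAlgebra.map P.s

lemma mr_ι (a : h) : P.mr (ι ℂ a) = ι ℂ (P.r a) := ExteriorAlgebra.map_apply_ι _ _

lemma ms_ι (a : h) : P.ms (ι ℂ a) = ι ℂ (P.s a) := ExteriorAlgebra.map_apply_ι _ _

lemma invol_map (T : h →ₗ[ℂ] h) (g : S h) :
    invol (ExteriorAlgebra.map T g) = ExteriorAlgebra.map T (invol g) := by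
  induction g using S.induction with
  | halg r => simp only [commutes]
  | hadd g g' hg hg' => simp only [map_add, hg, hg']
  | hmul a g hg =>
    rw [map_mul, ExteriorAlgebra.map_apply_ι, invol_ι_mul, hg, invol_ι_mul, map_neg, map_mul,
      ExteriorAlgebra.map_apply_ι]

lemma ms_ms (g : S h) : P.ms (P.ms g) = P.ms g := by
  induction g using S.induction with
  | halg r => simp only [commutes]
  | hadd g g' hg hg' => simp only [map_add, hg, hg']
  | hmul a g hg =>
    have : P.s (P.s a) = P.s a := by rw [s_apply P (P.s a), r_s, sub_zero]
    rw [map_mul, map_mul, ms_ι, ms_ι, hg, this]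

lemma dd_s_ms (a : h) (g : S h) : D.dd (P.s a) (P.ms g) = 0 := by
  induction g using S.induction with
  | halg r => rw [commutes, dd_algebraMap]
  | hadd g g' hg hg' => rw [map_add, map_add, hg, hg', add_zero]
  | hmul b g hg => rw [map_mul, ms_ι, dd_ι_mul, hg, form_s_s, zero_smul, mul_zero, sub_zero]

lemma dd_ms (v : h) (g : S h) : D.dd v (P.ms g) = P.ms (D.dd v (P.ms g)) := by
  induction g using S.induction with
  | halg r => rw [commutes, dd_algebraMap, map_zero]
  | hadd g g' hg hg' => 
    rw [map_add, map_add, map_add, ← hg, ← hg']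
  | hmul b g hg =>
    have : P.s (P.s b) = P.s b := by rw [s_apply P (P.s b), r_s, sub_zero]
    rw [map_mul, ms_ι, dd_ι_mul, map_sub, map_smul, ms_ms, map_mul, ms_ι, this, ← hg]

/-- Two linear maps on `S(𝔥)` that are compatible with the multiplication by elements of `f` are
equal if they agree on `S(ker r)`. -/
lemma ext_on_ms {V : Type} [AddCommGroup V] [Module ℂ V] {F G : S h →ₗ[ℂ] V}
    (op : h → Module.End ℂ V) (hF : ∀ u ∈ f, ∀ g, F (ι ℂ u * g) = op u (F g))
    (hG : ∀ u ∈ f, ∀ g, G (ι ℂ u * g) = op u (G g)) (hFG : ∀ g, F (P.ms g) = G (P.ms g)) :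
    F = G := by
  have key : ∀ g, ∀ y, F (g * P.ms y) = G (g * P.ms y) ∧
      F (invol g * P.ms y) = G (invol g * P.ms y) := fun g => by
    induction g using S.induction with
    | halg r =>
      intro y
      simp only [commutes, ← Algebra.smul_def, map_smul, hFG, and_self]
    | hadd g g' hg hg' =>
      intro y
      simp only [map_add, add_mul, (hg y).1, (hg y).2, (hg' y).1, (hg' y).2, and_self]
    | hmul a g hg =>
      intro y
      have e : ι ℂ a = ι ℂ (P.r a) + P.ms (ι ℂ a) := by rw [ms_ι, ← map_add, r_add_s]
      have e1 : ι ℂ a * g * P.ms y = ι ℂ (P.r a) * (g * P.ms y) + invol g * P.ms (ι ℂ a * y) := by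
        conv_lhs => rw [e]
        rw [add_mul, add_mul, mul_assoc, ms_ι, ι_mul_eq (P.s a) g, map_mul, ms_ι, mul_assoc]
      have e2 : invol (ι ℂ a * g) * P.ms y =
          -(ι ℂ (P.r a) * (invol g * P.ms y) + g * P.ms (ι ℂ a * y)) := by
        rw [invol_ι_mul]
        conv_lhs => rw [e]
        rw [add_mul, neg_mul, add_mul, mul_assoc, ms_ι, ι_mul_invol (P.s a) g, map_mul, ms_ι, mul_assoc]
      rw [e1, e2]
      simp only [map_add, map_neg, hF _ (P.r_mem a), hG _ (P.r_mem a), (hg _).1, (hg _).2, and_self]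
  refine LinearMap.ext fun g => ?_
  have := (key g 1).1
  rwa [map_one, mul_one] at this

end Polarization

end Lagrangian

section Choice

variable {h : Type} [AddCommGroup h] [Module ℂ h] [FiniteDimensional ℂ h]
variable {D : SympData h} {f : Submodule ℂ h} (P : Polarization D f) (c : HChoice D f)

lemma M_coe (g : S h) : (c.M g : S h) = g * c.m := rfl

lemma exists_M (l : c.L.V) : ∃ g, c.M g = l := by
  obtain ⟨_, g, rfl⟩ := l
  exact ⟨g, rfl⟩

lemma M_lift (l : c.L.V) : c.M (c.lift l) = l :=
  LinearMap.congr_fun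
    (c.M.exists_rightInverse_of_surjective (LinearMap.range_rangeRestrict _)).choose_spec l

lemma L_act_coe (a : h) (l : c.L.V) : (c.L.act a l : S h) = ι ℂ a * l := rfl

lemma L_par_coe (l : c.L.V) : (c.L.par l : S h) = invol l := rfl

lemma intertwines_M : Intertwines (reg h) c.L c.M := fun a g => Subtype.ext (mul_assoc _ _ _)

lemma L_rho_M (g x : S h) : c.L.rho g (c.M x) = c.M (g * x) := by
  rw [← rho_natural (intertwines_M c), reg_rho]

include P in
lemma ι_mul_m {u : h} (hu : u ∈ f) : ι ℂ u * c.m = 0 := by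
  obtain ⟨x, hx, hxm⟩ := c.m_mem
  have h1 : ι ℂ (⟨u, hu⟩ : f) * x ∈ ⋀[ℂ]^(finrank ℂ h / 2 + 1) f := by
    change _ ∈ LinearMap.range (ι ℂ (M := f)) ^ _
    rw [pow_succ']
    exact Submodule.mul_mem_mul ⟨_, rfl⟩ hx
  have h2 := finrank_lagrangian P.lag
  rw [extPow_eq_bot (by omega), Submodule.mem_bot] at h1
  rw [← hxm, AlgHom.toLinearMap_apply]
  have := congrArg (ExteriorAlgebra.map f.subtype) h1
  rwa [map_mul, ExteriorAlgebra.map_apply_ι, map_zero] at this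

include P in
lemma dd_m {u : h} (hu : u ∈ f) : D.dd u c.m = 0 := by
  obtain ⟨x, hx, hxm⟩ := c.m_mem
  rw [← hxm, AlgHom.toLinearMap_apply]
  clear hxm hx
  induction x using S.induction with
  | halg r => rw [commutes, dd_algebraMap]
  | hadd g g' hg hg' => rw [map_add, map_add, hg, hg', add_zero]
  | hmul b g hg =>
    rw [map_mul, ExteriorAlgebra.map_apply_ι, dd_ι_mul, hg, mul_zero, sub_zero,
      show D.form u (f.subtype b) = 0 from isotropic P.lag hu (Submodule.coe_mem b), zero_smul]

include P in
lemma L_act_of_mem {u : h} (hu : u ∈ f) (l : c.L.V) : c.L.act u l = 0 := by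
  obtain ⟨g, rfl⟩ := exists_M c l
  refine Subtype.ext ?_
  rw [L_act_coe, M_coe, ← mul_assoc, ι_mul_eq, mul_assoc, ι_mul_m P c hu, mul_zero]; rfl

lemma L_act_s (a : h) (l : c.L.V) : c.L.act (P.s a) l = c.L.act a l := by
  rw [P.s_apply, map_sub, LinearMap.sub_apply, L_act_of_mem P c (P.r_mem a), sub_zero]

lemma L_act_comp_s : c.L.act ∘ₗ P.s = c.L.act := by
  ext a l; exact congrArg Subtype.val (L_act_s P c a l)

lemma M_ms (g : S h) : c.M (P.ms g) = c.M g := by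
  induction g using S.induction with
  | halg r => rw [commutes]
  | hadd g g' hg hg' => simp only [map_add, hg, hg']
  | hmul a g hg =>
    have := intertwines_M c a g
    have h2 := intertwines_M c (P.s a) (P.ms g)
    rw [map_mul, P.ms_ι]
    exact h2.trans ((congrArg _ hg).trans ((L_act_s P c a _).trans this.symm))

lemma e_killed (a : h) : ι ℂ a * (c.e : S h) = 0 := by
  have h1 : ι ℂ a * (c.e : S h) ∈ ⋀[ℂ]^(finrank ℂ h + 1) h := by
    change _ ∈ LinearMap.range (ι ℂ (M := h)) ^ _
    rw [pow_succ']
    exact Submodule.mul_mem_mul ⟨_, rfl⟩ c.e_mem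
  rwa [extPow_eq_bot (Nat.lt_succ_self _), Submodule.mem_bot] at h1

lemma L_act_e (a : h) : c.L.act a c.e = 0 := Subtype.ext (e_killed c a)

lemma lam_e_ne : D.lam c.e ≠ 0 :=
  lam_ne_zero_of_killed D (e_killed c) fun h0 => c.e_ne (Subtype.ext h0)

lemma chi_apply (x : S h) : c.chi x = (D.lam c.e)⁻¹ * D.lam x := rfl

lemma chi_e : c.chi c.e = 1 := by rw [chi_apply, inv_mul_cancel₀ (lam_e_ne c)]

lemma chi_dd (v : h) (x : S h) : c.chi (D.dd v x) = 0 := by rw [chi_apply, lam_dd, mul_zero]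

lemma chi_invol (x : S h) : c.chi (invol x) = c.chi x := by rw [chi_apply, lam_invol, chi_apply]

lemma eq_zero_of_chi_mul {x : S h} (hx : ∀ g, c.chi (g * x) = 0) : x = 0 :=
  eq_zero_of_lam_mul D fun g => (mul_eq_zero.mp (hx g)).resolve_left (inv_ne_zero (lam_e_ne c))

lemma eq_e_of_killed {l : c.L.V} (hl : ∀ a, c.L.act a l = 0) (h1 : c.chi l = 1) : l = c.e := by
  by_contra hne
  refine lam_ne_zero_of_killed D (x := (l : S h) - c.e) (fun a => ?_)
    (fun h0 => hne (Subtype.ext (sub_eq_zero.mp h0))) ?_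
  · rw [mul_sub, e_killed, sub_zero]
    exact congrArg Subtype.val (hl a)
  · have : c.chi ((l : S h) - c.e) = 0 := by rw [map_sub, h1, chi_e, sub_self]
    exact (mul_eq_zero.mp this).resolve_left (inv_ne_zero (lam_e_ne c))

lemma L_par_e : c.L.par c.e = c.e := by
  refine eq_e_of_killed c (fun a => ?_) ?_
  · rw [c.L.act_par, L_act_e, map_zero, neg_zero]
  · rw [L_par_coe, chi_invol, chi_e]

section Beta

variable (hβ : D.β = 1)

include hβ in
lemma even_half : Even (finrank ℂ h / 2) := by
  have := D.β_pow
  rw [hβ, one_pow] at this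
  by_contra hodd
  rw [(Nat.not_even_iff_odd.mp hodd).neg_one_pow] at this
  norm_num at this

include hβ in
lemma invol_m : invol c.m = c.m := by
  rw [invol_of_mem (symPower_le f _ c.m_mem), (even_half hβ).neg_one_pow, one_smul]

/-- The linear form `g ↦ χ(g m)`. -/
def HChoice.theta : S h →ₗ[ℂ] ℂ := c.chi ∘ₗ LinearMap.mulRight ℂ c.m

lemma theta_apply (g : S h) : c.theta g = c.chi (g * c.m) := rfl

lemma chi_M (g : S h) : c.chi (c.M g) = c.theta g := rfl

include hβ in
lemma isEven_M : IsEven (reg h).toSVect c.L.toSVect c.M := fun g => Subtype.ext (by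
  change invol g * c.m = invol (g * c.m)
  rw [map_mul, invol_m c hβ])

include hβ in
lemma theta_invol (g : S h) : c.theta (invol g) = c.theta g := by
  have := chi_invol c (g * c.m)
  rwa [map_mul, invol_m c hβ] at this

include P in
lemma theta_ι_mul {u : h} (hu : u ∈ f) (g : S h) : c.theta (ι ℂ u * g) = 0 := by
  rw [theta_apply, ι_mul_eq, mul_assoc, ι_mul_m P c hu, mul_zero, map_zero]

include P in
lemma theta_dd {u : h} (hu : u ∈ f) (g : S h) : c.theta (D.dd u g) = 0 := by
  have := chi_dd c u (g * c.m)
  rw [dd_mul, dd_m P c hu, mul_zero, add_zero] at this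
  exact this

lemma theta_ms (g : S h) : c.theta (P.ms g) = c.theta g := by rw [← chi_M, M_ms, chi_M]

/-- An element `g₁` of `S(ker r)` with `g₁ m = 1_H`. -/
def gOne : S h := P.ms (c.lift c.e)

lemma ms_gOne : P.ms (gOne P c) = gOne P c := P.ms_ms _

lemma M_gOne : c.M (gOne P c) = c.e := by rw [gOne, M_ms, M_lift]

lemma theta_gOne : c.theta (gOne P c) = 1 := by rw [← chi_M, M_gOne, chi_e]

/-- The projection `E(g) = ∑ χ(g' m) g''` of `S(𝔥)` onto `S(f)`. -/
def HChoice.E : S h →ₗ[ℂ] S h := conv c.theta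

include hβ in
lemma dd_E (v : h) (g : S h) : D.dd v (c.E g) = c.E (D.dd v g) := dd_conv D (theta_invol c hβ) v g

include P hβ in
lemma E_ι_mul {u : h} (hu : u ∈ f) (g : S h) : c.E (ι ℂ u * g) = ι ℂ u * c.E g :=
  conv_ι_mul (theta_invol c hβ) (theta_ι_mul P c hu) g

include P in
lemma E_dd {u : h} (hu : u ∈ f) (g : S h) : c.E (D.dd u g) = 0 :=
  conv_dd_eq_zero D (theta_dd P c hu) g

lemma counit_E (g : S h) : counit h (c.E g) = c.theta g := counit_conv _ g

include hβ in
lemma E_invol (g : S h) : c.E (invol g) = invol (c.E g) := conv_invol (theta_invol c hβ) g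

include hβ in
lemma E_ms (g : S h) : c.E (P.ms g) = algebraMap ℂ (S h) (c.theta g) := by
  have h1 := eq_counit_of_dd D (x := c.E (P.ms g)) fun v => by
    rw [dd_E c hβ]
    have : D.dd v (P.ms g) = D.dd (P.r v) (P.ms g) := by
      conv_lhs => rw [← P.r_add_s v]
      have e : D.dd (P.r v + P.s v) = D.dd (P.r v) + D.dd (P.s v) := by simp [SympData.dd]
      rw [e, LinearMap.add_apply, P.dd_s_ms, add_zero]
    rw [this, E_dd P c (P.r_mem v)]
  rw [h1, counit_E, theta_ms]

include hβ in
lemma mr_E (g : S h) : P.mr (c.E g) = c.E g := by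
  have : P.mr.toLinearMap ∘ₗ c.E = c.E := by
    refine P.ext_on_ms (fun u => LinearMap.mulLeft ℂ (ι ℂ u)) (fun u hu g => ?_)
      (fun u hu g => E_ι_mul P c hβ hu g) fun g => ?_
    · simp only [LinearMap.comp_apply, AlgHom.toLinearMap_apply, LinearMap.mulLeft_apply]
      rw [E_ι_mul P c hβ hu, map_mul, P.mr_ι, P.r_id u hu]
    · simp only [LinearMap.comp_apply, AlgHom.toLinearMap_apply]
      rw [E_ms P c hβ, commutes]
  exact LinearMap.congr_fun this g

include hβ in
lemma E_gOne : c.E (gOne P c) = 1 := by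
  rw [← ms_gOne, E_ms P c hβ, theta_gOne, map_one]

include hβ in
lemma E_ι_mul_gOne {u : h} (hu : u ∈ f) : c.E (ι ℂ u * gOne P c) = ι ℂ u := by
  rw [E_ι_mul P c hβ hu, E_gOne P c hβ, mul_one]

include hβ in
lemma eq_zero_of_M_ms {g : S h} (hg : c.M (P.ms g) = 0) : P.ms g = 0 := by
  let J : Submodule ℂ (S h) := LinearMap.ker (𝕀 - P.ms.toLinearMap) ⊓ LinearMap.ker c.M
  have hJ : J = ⊥ := by
    by_contra hne
    have h1 := one_mem_of_dd_stable D J (fun v x hx => ?_) hne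
    · have h2 : c.M 1 = 0 := h1.2
      exact c.m_ne ((one_mul c.m).symm.trans (congrArg Subtype.val h2))
    · have hx1 : P.ms x = x := by
        have : x - P.ms x = 0 := hx.1
        exact (sub_eq_zero.mp this).symm
      have hx2 : x * c.m = 0 := congrArg Subtype.val (show c.M x = 0 from hx.2)
      have hr : D.dd v x = D.dd (P.r v) x := by
        conv_lhs => rw [← P.r_add_s v]
        have e : D.dd (P.r v + P.s v) = D.dd (P.r v) + D.dd (P.s v) := by simp [SympData.dd]
        have e2 := P.dd_s_ms v x
        rw [hx1] at e2
        rw [e, LinearMap.add_apply, e2, add_zero]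
      refine ⟨?_, ?_⟩
      · change D.dd v x - P.ms (D.dd v x) = 0
        have := P.dd_ms v x
        rw [hx1] at this
        rw [← this, sub_self]
      · refine Subtype.ext ?_
        change D.dd v x * c.m = 0
        have := congrArg (D.dd (P.r v)) hx2
        rwa [dd_mul, dd_m P c (P.r_mem v), mul_zero, add_zero, map_zero, ← hr] at this
  have : P.ms g ∈ J := ⟨by change P.ms g - P.ms (P.ms g) = 0; rw [P.ms_ms, sub_self], hg⟩
  rwa [hJ, Submodule.mem_bot] at this

include hβ in
lemma invol_gOne : invol (gOne P c) = gOne P c := by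
  have h1 : invol (gOne P c) - gOne P c = P.ms (invol (c.lift c.e) - c.lift c.e) := by
    rw [map_sub]
    exact congrArg (· - _) (Polarization.invol_map P.s _)
  rw [← sub_eq_zero, h1]
  refine eq_zero_of_M_ms P c hβ ?_
  rw [← h1, map_sub, M_gOne, sub_eq_zero]
  have := isEven_M c hβ (gOne P c)
  rw [M_gOne, L_par_e] at this
  exact this

include P in
lemma sig_L (s : ℂ) (l : c.L.V) : D.sig s c.L l = l := by
  refine gexp_of_quad D ?_
  have h1 := quad_comp_adjoint D c.L.act c.L.act P.s P.r P.form_s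
  rw [L_act_comp_s] at h1
  rw [h1, quad_apply]
  exact Finset.sum_eq_zero fun i _ => L_act_of_mem P c (P.r_mem _) _

include P in
lemma M_sig (s : ℂ) (g : S h) : c.M (D.sig s (reg h) g) = c.M g := by
  rw [sig_natural D s (intertwines_M c)]
  exact sig_L P c s _

include P in
lemma theta_sig (s : ℂ) (g : S h) : c.theta (D.sig s (reg h) g) = c.theta g := by
  rw [← chi_M, M_sig P, chi_M]

/-- The operator `σ φ σ`. -/
def SympData.psi (D : SympData h) : S h →ₗ[ℂ] S h := D.sig 1 (reg h) ∘ₗ D.phi ∘ₗ D.sig 1 (reg h)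

lemma ι_mul_sig (s : ℂ) (a : h) (g : S h) :
    ι ℂ a * D.sig s (reg h) g = D.sig s (reg h) (ι ℂ a * g) := act_sig D s (reg h) a g

include hβ in
lemma dd_psi (v : h) (g : S h) : D.dd v (D.psi g) = D.psi (D.dd v g) := by
  change D.dd v (D.sig 1 (reg h) (D.phi (D.sig 1 (reg h) g))) =
    D.sig 1 (reg h) (D.phi (D.sig 1 (reg h) (D.dd v g)))
  have e1 : D.sig 1 (reg h) (D.dd v g) = D.dd v (D.sig 1 (reg h) g) - ι ℂ v * D.sig 1 (reg h) g := by
    rw [dd_sig, one_smul, map_add, ι_mul_sig, add_sub_cancel_right]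
  rw [dd_sig, one_smul, e1, map_sub, phi_dd hβ, phi_ι_mul hβ, sub_neg_eq_add, add_comm]

include hβ in
lemma psi_ι_mul (w : h) (g : S h) : D.psi (ι ℂ w * g) = ι ℂ w * D.psi g - D.dd w (D.psi g) := by
  change D.sig 1 (reg h) (D.phi (D.sig 1 (reg h) (ι ℂ w * g))) =
    ι ℂ w * D.sig 1 (reg h) (D.phi (D.sig 1 (reg h) g)) -
      D.dd w (D.sig 1 (reg h) (D.phi (D.sig 1 (reg h) g)))
  rw [← ι_mul_sig, phi_ι_mul hβ, dd_sig, one_smul, map_add, ι_mul_sig, map_neg]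
  abel

include hβ in
lemma psi_one : D.psi 1 = 1 := by
  rw [eq_counit_of_dd D (x := D.psi 1) fun v => by rw [dd_psi hβ, dd_one, map_zero]]
  change algebraMap ℂ _ (counit h (D.sig 1 (reg h) (D.phi (D.sg 1)))) = 1
  rw [counit_sig, counit_phi hβ, lam_sg, map_one]

include hβ in
lemma psi_ms (g : S h) : D.psi (P.ms g) = P.ms g := by
  induction g using S.induction with
  | halg r =>
    rw [commutes, algebraMap_eq_smul_one, map_smul, psi_one hβ]
  | hadd g g' hg hg' => simp only [map_add, hg, hg']
  | hmul a g hg => rw [map_mul, P.ms_ι, psi_ι_mul hβ, hg, P.dd_s_ms, sub_zero]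

include P hβ in
lemma E_psi (g : S h) : c.E (D.psi g) = c.E g := by
  have : c.E ∘ₗ D.psi = c.E := by
    refine P.ext_on_ms (fun u => LinearMap.mulLeft ℂ (ι ℂ u)) (fun u hu g => ?_)
      (fun u hu g => E_ι_mul P c hβ hu g) fun g => ?_
    · simp only [LinearMap.comp_apply, LinearMap.mulLeft_apply]
      rw [psi_ι_mul hβ, map_sub, E_dd P c hu, sub_zero, E_ι_mul P c hβ hu]
    · simp only [LinearMap.comp_apply]
      rw [psi_ms P hβ]
  exact LinearMap.congr_fun this g

include P hβ in
lemma E_sig_phi (g : S h) : c.E (D.sig 1 (reg h) (D.phi g)) = c.E (D.sig (-1) (reg h) g) := by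
  rw [← E_psi P c hβ (D.sig (-1) (reg h) g)]
  change _ = c.E (D.sig 1 (reg h) (D.phi (D.sig 1 (reg h) (D.sig (-1) (reg h) g))))
  rw [sig_sig_neg]

include P hβ in
lemma theta_phi (g : S h) : c.theta (D.phi g) = c.theta g := by
  rw [← theta_sig P c 1 (D.phi g), ← counit_E, E_sig_phi P c hβ, counit_E, theta_sig P]

include P c hβ in
lemma phi_phi (g : S h) : D.phi (D.phi g) = invol g := by
  obtain ⟨r, hr⟩ := exists_algebraMap_of_dd_eq_zero D (x := D.phi (D.phi 1)) fun v => by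
    have := phi_ι_mul hβ v (D.phi 1)
    rw [← phi_dd hβ, dd_one, map_zero, map_zero] at this
    rw [← neg_eq_zero, ← this]
  have h1 : D.phi ∘ₗ D.phi = r • invol.toLinearMap := by
    refine S.ext_of_mul ?_ fun a x hx => ?_
    · simp [hr, algebraMap_eq_smul_one]
    · simp only [LinearMap.comp_apply, LinearMap.smul_apply, AlgHom.toLinearMap_apply] at hx ⊢
      rw [phi_ι_mul hβ, map_neg, phi_dd hβ, hx, invol_ι_mul, mul_smul_comm, smul_neg]
  have h2 : r = 1 := by
    have e1 := congrArg c.theta (LinearMap.congr_fun h1 (gOne P c))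
    rw [LinearMap.comp_apply, theta_phi P c hβ, theta_phi P c hβ, LinearMap.smul_apply, map_smul,
      AlgHom.toLinearMap_apply, theta_invol c hβ, theta_gOne, smul_eq_mul, mul_one] at e1
    exact e1.symm
  rw [h2, one_smul] at h1
  exact LinearMap.congr_fun h1 g

include hβ in
lemma M_phi_gOne : c.M (D.phi (gOne P c)) = c.e := by
  refine eq_e_of_killed c (fun a => ?_) ?_
  · rw [← L_act_s P]
    refine (intertwines_M c (P.s a) (D.phi (gOne P c))).symm.trans ?_
    change c.M (ι ℂ (P.s a) * D.phi (gOne P c)) = 0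
    rw [← phi_dd hβ, ← ms_gOne, P.dd_s_ms, map_zero, map_zero]
  · rw [chi_M, theta_phi P c hβ, theta_gOne]

/-- The element `∑ χ(l') l''` of `S(𝔥)`, where `∑ l' ⊗ l''` is the result of acting with `γ` on
`l ⊗ 1`. -/
def HChoice.j : c.L.V →ₗ[ℂ] S h :=
  (lid ℂ (S h)).toLinearMap ∘ₗ
    map (c.chi ∘ₗ (LinearMap.range (LinearMap.mulRight ℂ c.m)).subtype) 𝕀 ∘ₗ
    D.gam 1 c.L (reg h) ∘ₗ (TensorProduct.mk ℂ c.L.V (S h)).flip 1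

/-- The restriction of `χ` to `L`. -/
def HChoice.chiL : c.L.V →ₗ[ℂ] ℂ := c.chi ∘ₗ (LinearMap.range (LinearMap.mulRight ℂ c.m)).subtype

lemma chiL_apply (l : c.L.V) : c.chiL l = c.chi l := rfl

lemma j_eq (l : c.L.V) : c.j l = lid ℂ (S h)
    (map c.chiL 𝕀 (D.gam 1 c.L (reg h) (l ⊗ₜ 1))) := rfl

/-- `(χ ⊗ 1) γ(l ⊗ x) = j(l) x`. -/
lemma rho_j (X : SRep h) (l : c.L.V) (x : X.V) :
    X.rho (c.j l) x = lid ℂ X.V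
      (map c.chiL 𝕀 (D.gam 1 c.L X (l ⊗ₜ x))) := by
  have h1 := gam_natural D 1 (k := 𝕀) (fun _ _ => rfl) (fun _ => rfl)
    (intertwines_orb X x) (X := c.L) (X' := c.L) (l ⊗ₜ 1)
  rw [map_tmul, orb_apply, rho_one, LinearMap.id_apply] at h1
  rw [← h1, j_eq]
  generalize D.gam 1 c.L (reg h) (l ⊗ₜ 1) = z
  induction z with
  | zero => simp
  | add x y hx hy => simp only [map_add, LinearMap.add_apply, hx, hy]
  | tmul x y =>
    rw [map_tmul, map_tmul, map_tmul, lid_tmul, lid_tmul, map_smul]; rfl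

include P hβ in
lemma j_M_phi (g : S h) : c.j (c.M (D.phi g)) = c.E g := by
  have h1 := gam_natural_left D 1 (reg h) (intertwines_M c) (isEven_M c hβ) (D.phi g ⊗ₜ 1)
  have h2 : ∀ z, lid ℂ (S h) (map c.chiL 𝕀
      (map c.M 𝕀 z)) =
      lid ℂ (S h) (map c.theta 𝕀 z) := fun z => by
    rw [← LinearMap.comp_apply (map _ _), ← map_comp]; rfl
  rw [map_tmul, LinearMap.id_apply] at h1
  rw [j_eq, ← h1, h2, ← gam_phi_comul hβ, gam_gam_neg]
  change _ = lid ℂ (S h) (map c.theta 𝕀 (comul h g))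
  generalize comul h g = z
  induction z with
  | tmul x y => simp [theta_phi P c hβ]
  | _ => simp only [map_zero, map_add, *]

end Beta

end Choice

section Evaluation

variable {h : Type} [AddCommGroup h] [Module ℂ h] [FiniteDimensional ℂ h]

section Cars

variable {X Y Z X' Y' Q : Car}

@[simp] lemma comp_fst (g : LMap Y Z) (f : LMap X Y) (v : X.V₀) : (g.comp f).1 v = g.1 (f.1 v) := rfl

@[simp] lemma comp_snd (g : LMap Y Z) (f : LMap X Y) (v : X.V₁) : (g.comp f).2 v = g.2 (f.2 v) := rfl

@[simp] lemma star_fst_l (f : LMap X X') (g : LMap Y Y') (t : X.V₀ ⊗[ℂ] Y.V₀) :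
    (f.star h g).1 (t, 0) = (map f.1 g.1 t, 0) :=
  Prod.ext rfl (map_zero (map (LinearMap.id (M := S h)) (map f.2 g.2)))

@[simp] lemma star_fst_r (f : LMap X X') (g : LMap Y Y') (t : S h ⊗[ℂ] (X.V₁ ⊗[ℂ] Y.V₁)) :
    (f.star h g).1 (0, t) = (0, map 𝕀 (map f.2 g.2) t) :=
  Prod.ext (map_zero (map f.1 g.1)) rfl

@[simp] lemma star_snd_l (f : LMap X X') (g : LMap Y Y') (t : X.V₀ ⊗[ℂ] Y.V₁) :
    (f.star h g).2 (t, 0) = (map f.1 g.2 t, 0) :=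
  Prod.ext rfl (map_zero (map f.2 g.1))

@[simp] lemma star_snd_r (f : LMap X X') (g : LMap Y Y') (t : X.V₁ ⊗[ℂ] Y.V₀) :
    (f.star h g).2 (0, t) = (0, map f.2 g.1 t) :=
  Prod.ext (map_zero (map f.1 g.2)) rfl

lemma star_ext₀ {W : Type} [AddCommGroup W] [Module ℂ W] {A B : (X.star h Y).V₀ →ₗ[ℂ] W}
    (h00 : ∀ x y, A (x ⊗ₜ y, 0) = B (x ⊗ₜ y, 0))
    (h11 : ∀ g x y, A (0, g ⊗ₜ (x ⊗ₜ y)) = B (0, g ⊗ₜ (x ⊗ₜ y))) : A = B :=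
  LinearMap.prod_ext (ext' h00) (TensorProduct.ext (LinearMap.ext fun g => ext' (h11 g)))

lemma star_ext₁ {W : Type} [AddCommGroup W] [Module ℂ W] {A B : (X.star h Y).V₁ →ₗ[ℂ] W}
    (h01 : ∀ x y, A (x ⊗ₜ y, 0) = B (x ⊗ₜ y, 0))
    (h10 : ∀ x y, A (0, x ⊗ₜ y) = B (0, x ⊗ₜ y)) : A = B :=
  LinearMap.prod_ext (ext' h01) (ext' h10)

lemma tensor_ext {U V W : Type} [AddCommGroup U] [Module ℂ U] [AddCommGroup V] [Module ℂ V]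
    [AddCommGroup W] [Module ℂ W] {A B : U ⊗[ℂ] V →ₗ[ℂ] W}
    (hu : ∀ u, A ∘ₗ TensorProduct.mk ℂ U V u = B ∘ₗ TensorProduct.mk ℂ U V u) : A = B :=
  TensorProduct.ext (LinearMap.ext hu)

lemma star_star_ext₀ {W : Type} [AddCommGroup W] [Module ℂ W]
    {A B : (X.star h (Y.star h Z)).V₀ →ₗ[ℂ] W}
    (h000 : ∀ x y z, A (x ⊗ₜ (y ⊗ₜ z, 0), 0) = B (x ⊗ₜ (y ⊗ₜ z, 0), 0))
    (h011 : ∀ g x y z, A (x ⊗ₜ (0, g ⊗ₜ (y ⊗ₜ z)), 0) = B (x ⊗ₜ (0, g ⊗ₜ (y ⊗ₜ z)), 0))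
    (h101 : ∀ g x y z, A (0, g ⊗ₜ (x ⊗ₜ (y ⊗ₜ z, 0))) = B (0, g ⊗ₜ (x ⊗ₜ (y ⊗ₜ z, 0))))
    (h110 : ∀ g x y z, A (0, g ⊗ₜ (x ⊗ₜ (0, y ⊗ₜ z))) = B (0, g ⊗ₜ (x ⊗ₜ (0, y ⊗ₜ z)))) :
    A = B :=
  LinearMap.prod_ext
    (tensor_ext fun x => LinearMap.prod_ext (ext' (h000 x)) (tensor_ext fun g => ext' (h011 g x)))
    (tensor_ext fun g => tensor_ext fun x => LinearMap.prod_ext (ext' (h101 g x)) (ext' (h110 g x)))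

lemma star_star_ext₁ {W : Type} [AddCommGroup W] [Module ℂ W]
    {A B : (X.star h (Y.star h Z)).V₁ →ₗ[ℂ] W}
    (h001 : ∀ x y z, A (x ⊗ₜ (y ⊗ₜ z, 0), 0) = B (x ⊗ₜ (y ⊗ₜ z, 0), 0))
    (h010 : ∀ x y z, A (x ⊗ₜ (0, y ⊗ₜ z), 0) = B (x ⊗ₜ (0, y ⊗ₜ z), 0))
    (h100 : ∀ x y z, A (0, x ⊗ₜ (y ⊗ₜ z, 0)) = B (0, x ⊗ₜ (y ⊗ₜ z, 0)))
    (h111 : ∀ g x y z, A (0, x ⊗ₜ (0, g ⊗ₜ (y ⊗ₜ z))) = B (0, x ⊗ₜ (0, g ⊗ₜ (y ⊗ₜ z)))) :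
    A = B :=
  LinearMap.prod_ext
    (tensor_ext fun x => LinearMap.prod_ext (ext' (h001 x)) (ext' (h010 x)))
    (tensor_ext fun x => LinearMap.prod_ext (ext' (h100 x)) (tensor_ext fun g => ext' (h111 g x)))

end Cars

lemma tensor_triv_act (X : SRep h) (Y : SVect) (a : h) (t : X.V ⊗[ℂ] Y.V) :
    (X.tensor (Y.triv h)).act a t = Fam.l X.act Y.V a t := by
  induction t with
  | zero => simp
  | tmul x y => rw [tensor_act, Fam.l_tmul]; exact (congrArg _ (tmul_zero _ _)).trans (add_zero _)
  | add s t hs ht => rw [map_add, map_add, hs, ht]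

lemma star_act (X Y : SF h) (a : h) (s : X.zero.V ⊗[ℂ] Y.zero.V) (t : S h ⊗[ℂ] (X.one.V ⊗[ℂ] Y.one.V)) :
    (X.star Y).zero.act a (s, t) =
      ((X.zero.tensor Y.zero).act a s, Fam.l (reg h).act (X.one.V ⊗[ℂ] Y.one.V) a t) :=
  Prod.ext rfl (tensor_triv_act (reg h) (X.one.tensor Y.one) a t)

/-- Equivariant maps out of `X ∗ (Y ∗ Z)` are determined by their values on generators. -/
lemma star_star_ext_equivariant {X Y Z Q : SF h} {A B : (X.star (Y.star Z)).zero.V →ₗ[ℂ] Q.zero.V}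
    (hA : Intertwines (X.star (Y.star Z)).zero Q.zero A)
    (hB : Intertwines (X.star (Y.star Z)).zero Q.zero B)
    (h000 : ∀ x y z, A (x ⊗ₜ (y ⊗ₜ z, 0), 0) = B (x ⊗ₜ (y ⊗ₜ z, 0), 0))
    (h011 : ∀ x y z, A (x ⊗ₜ (0, 1 ⊗ₜ (y ⊗ₜ z)), 0) = B (x ⊗ₜ (0, 1 ⊗ₜ (y ⊗ₜ z)), 0))
    (h101 : ∀ x y z, A (0, 1 ⊗ₜ (x ⊗ₜ (y ⊗ₜ z, 0))) = B (0, 1 ⊗ₜ (x ⊗ₜ (y ⊗ₜ z, 0))))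
    (h110 : ∀ x y z, A (0, 1 ⊗ₜ (x ⊗ₜ (0, y ⊗ₜ z))) = B (0, 1 ⊗ₜ (x ⊗ₜ (0, y ⊗ₜ z)))) :
    A = B := by
  have key : ∀ w g, A (0, (1 : S h) ⊗ₜ w) = B (0, (1 : S h) ⊗ₜ w) → A (0, g ⊗ₜ w) = B (0, g ⊗ₜ w) := by
    refine fun w g hw => LinearMap.congr_fun (S.ext_of_mul
      (F := A ∘ₗ LinearMap.inr ℂ _ _ ∘ₗ (TensorProduct.mk ℂ (S h) _).flip w)
      (G := B ∘ₗ LinearMap.inr ℂ _ _ ∘ₗ (TensorProduct.mk ℂ (S h) _).flip w) hw fun a g hg => ?_) g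
    have e : ((0, (ι ℂ a * g) ⊗ₜ w) : (X.star (Y.star Z)).zero.V) =
        (X.star (Y.star Z)).zero.act a (0, g ⊗ₜ w) := by
      rw [star_act]
      exact Prod.ext (map_zero _).symm rfl
    exact (congrArg A e).trans ((hA a _).trans ((congrArg (Q.zero.act a) hg).trans
      ((hB a _).symm.trans (congrArg B e).symm)))
  refine star_star_ext₀ (h := h) (X := X.car) (Y := Y.car) (Z := Z.car) (A := A) (B := B) h000
    (fun g x y z => ?_) (fun g x y z => key (x ⊗ₜ (y ⊗ₜ z, 0)) g (h101 x y z))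
    (fun g x y z => key (x ⊗ₜ (0, y ⊗ₜ z)) g (h110 x y z))
  refine LinearMap.congr_fun (LinearMap.congr_fun (S.ext_of_mul
    (F := ((TensorProduct.mk ℂ _ _).compr₂ (A ∘ₗ LinearMap.inl ℂ _ _)).flip ∘ₗ LinearMap.inr ℂ _ _ ∘ₗ
      (TensorProduct.mk ℂ (S h) _).flip (y ⊗ₜ z))
    (G := ((TensorProduct.mk ℂ _ _).compr₂ (B ∘ₗ LinearMap.inl ℂ _ _)).flip ∘ₗ LinearMap.inr ℂ _ _ ∘ₗ
      (TensorProduct.mk ℂ (S h) _).flip (y ⊗ₜ z))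
    (LinearMap.ext fun x => h011 x y z) fun a g hg => LinearMap.ext fun x => ?_) g) x
  have e : ((x ⊗ₜ (0, (ι ℂ a * g) ⊗ₜ (y ⊗ₜ z)), 0) : (X.star (Y.star Z)).zero.V) =
      (X.star (Y.star Z)).zero.act a (X.zero.par x ⊗ₜ (0, g ⊗ₜ (y ⊗ₜ z)), 0) -
        (X.zero.act a (X.zero.par x) ⊗ₜ (0, g ⊗ₜ (y ⊗ₜ z)), 0) := by
    rw [star_act X (Y.star Z)]
    refine Prod.ext ?_ ?_
    · change _ = (X.zero.act a (X.zero.par x) ⊗ₜ _ + X.zero.par (X.zero.par x) ⊗ₜ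
        (Y.star Z).zero.act a (0, g ⊗ₜ (y ⊗ₜ z))) - _
      refine Eq.trans ?_ (add_sub_cancel_left _ _).symm
      rw [X.zero.par_par, star_act]
      exact congrArg (x ⊗ₜ[ℂ] ·) (Prod.ext (map_zero _).symm rfl)
    · exact ((congrArg (· - _) (map_zero _)).trans (sub_zero 0)).symm
  have hg' : ∀ x, A (x ⊗ₜ (0, g ⊗ₜ (y ⊗ₜ z)), 0) = B (x ⊗ₜ (0, g ⊗ₜ (y ⊗ₜ z)), 0) :=
    LinearMap.congr_fun hg
  change A (x ⊗ₜ (0, (ι ℂ a * g) ⊗ₜ (y ⊗ₜ z)), 0) = B (x ⊗ₜ (0, (ι ℂ a * g) ⊗ₜ (y ⊗ₜ z)), 0)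
  rw [e, map_sub, map_sub, hA, hB, hg', hg']

variable (D : SympData h)

section Assoc

variable (X Y Z : SF h)

lemma assoc_000 (x : X.zero.V) (y : Y.zero.V) (z : Z.zero.V) :
    (D.assoc X Y Z).1 (x ⊗ₜ (y ⊗ₜ z, 0), 0) = ((x ⊗ₜ y, 0) ⊗ₜ z, 0) := by
  simp [SympData.assoc, assemble₀]

lemma assoc_011 (x : X.zero.V) (t : S h ⊗[ℂ] (Y.one.V ⊗[ℂ] Z.one.V)) :
    (D.assoc X Y Z).1 (x ⊗ₜ (0, t), 0) = (0, map 𝕀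
      (map (LinearMap.inl ℂ _ _) 𝕀) (assoc011 X.zero Y.one Z.one (x ⊗ₜ t))) := by
  simp [SympData.assoc, assemble₀]

lemma assoc_101 (g : S h) (x : X.one.V) (t : Y.zero.V ⊗[ℂ] Z.one.V) :
    (D.assoc X Y Z).1 (0, g ⊗ₜ (x ⊗ₜ (t, 0))) = (0, map 𝕀
      (map (LinearMap.inr ℂ _ _) 𝕀)
        (D.assoc101 X.one Y.zero Z.one (g ⊗ₜ (x ⊗ₜ t)))) := by
  simp [SympData.assoc, assemble₀]

lemma assoc_110 (g : S h) (x : X.one.V) (t : Y.one.V ⊗[ℂ] Z.zero.V) :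
    (D.assoc X Y Z).1 (0, g ⊗ₜ (x ⊗ₜ (0, t))) = (map (LinearMap.inr ℂ _ _) 𝕀
        (assoc110 X.one Y.one Z.zero (g ⊗ₜ (x ⊗ₜ t))), 0) := by
  simp [SympData.assoc, assemble₀]

lemma assoc_001 (x : X.zero.V) (y : Y.zero.V) (z : Z.one.V) :
    (D.assoc X Y Z).2 (x ⊗ₜ (y ⊗ₜ z, 0), 0) = ((x ⊗ₜ y, 0) ⊗ₜ z, 0) := by
  simp [SympData.assoc, assemble₁]

lemma assoc_010 (x : X.zero.V) (t : Y.one.V ⊗[ℂ] Z.zero.V) :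
    (D.assoc X Y Z).2 (x ⊗ₜ (0, t), 0) = (0, map (LinearMap.inl ℂ _ _) 𝕀
        (D.assoc010 X.zero Y.one Z.zero (x ⊗ₜ t))) := by
  simp [SympData.assoc, assemble₁]

lemma assoc_100 (x : X.one.V) (y : Y.zero.V) (z : Z.zero.V) :
    (D.assoc X Y Z).2 (0, x ⊗ₜ (y ⊗ₜ z, 0)) = (0, (0, x ⊗ₜ y) ⊗ₜ z) := by
  simp [SympData.assoc, assemble₁]

lemma assoc_111 (x : X.one.V) (t : S h ⊗[ℂ] (Y.one.V ⊗[ℂ] Z.one.V)) :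
    (D.assoc X Y Z).2 (0, x ⊗ₜ (0, t)) = (map (LinearMap.inr ℂ _ _) 𝕀
        (D.assoc111 X.one Y.one Z.one (x ⊗ₜ t)), 0) := by
  simp [SympData.assoc, assemble₁]

lemma assoc011_one (X : SRep h) (Y Z : SVect) (x : X.V) (y : Y.V) (z : Z.V) :
    assoc011 X Y Z (x ⊗ₜ (1 ⊗ₜ (y ⊗ₜ z))) = 1 ⊗ₜ ((x ⊗ₜ y) ⊗ₜ z) := by
  have h1 : X.moveOut (x ⊗ₜ 1) = 1 ⊗ₜ x := by
    rw [SRep.moveOut, LinearMap.comp_apply, flip_tmul_of_even_right _ (map_one invol),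
      TensorProduct.lift.tmul]
    exact rho_one ((reg h).tensor X.antip) _
  simp [assoc011, h1]

lemma assoc101_apply (X : SVect) (Y : SRep h) (Z : SVect) (g : S h) (x : X.V) (y : Y.V) (z : Z.V) :
    D.assoc101 X Y Z (g ⊗ₜ (x ⊗ₜ (y ⊗ₜ z))) =
      map 𝕀 (assocTriv X.V Y.V Z.V) (assoc ℂ (S h) X.V (Y.V ⊗[ℂ] Z.V)
        (D.gam 1 ((reg h).tensor (X.triv h)) (Y.tensor (Z.triv h)) ((g ⊗ₜ x) ⊗ₜ (y ⊗ₜ z)))) := by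
  rw [← gamma_eq]; rfl

lemma assoc110_one (X Y : SVect) (Z : SRep h) (x : X.V) (y : Y.V) (z : Z.V) :
    assoc110 X Y Z (1 ⊗ₜ (x ⊗ₜ (y ⊗ₜ z))) = (1 ⊗ₜ (x ⊗ₜ y)) ⊗ₜ z :=
  rho_one (((reg h).tensor ((X.tensor Y).triv h)).tensor Z) _

lemma assoc110_apply (X Y : SVect) (Z : SRep h) (g : S h) (x : X.V) (y : Y.V) (z : Z.V) :
    assoc110 X Y Z (g ⊗ₜ (x ⊗ₜ (y ⊗ₜ z))) =
      (((reg h).tensor ((X.tensor Y).triv h)).tensor Z).rho g ((1 ⊗ₜ (x ⊗ₜ y)) ⊗ₜ z) := rfl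

lemma assoc010_apply (X : SRep h) (Y : SVect) (Z : SRep h) (x : X.V) (y : Y.V) (z : Z.V) :
    D.assoc010 X Y Z (x ⊗ₜ (y ⊗ₜ z)) = D.gam 1 (X.tensor (Y.triv h)) Z ((x ⊗ₜ y) ⊗ₜ z) := by
  rw [← gamma_eq]; rfl

lemma assoc111_apply (X Y Z : SVect) (g : S h) (x : X.V) (y : Y.V) (z : Z.V) :
    D.assoc111 X Y Z (x ⊗ₜ (g ⊗ₜ (y ⊗ₜ z))) =
      assocTriv (S h) (X.V ⊗[ℂ] Y.V) Z.V (map 𝕀 (assocTriv X.V Y.V Z.V)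
        (assoc ℂ (S h) X.V (Y.V ⊗[ℂ] Z.V)
          (map D.phi 𝕀 (X.flip (reg h).toSVect (x ⊗ₜ g)) ⊗ₜ (y ⊗ₜ z)))) := rfl

lemma moveOut_equivariant (X : SRep h) (a : h) (t : X.V ⊗[ℂ] S h) :
    X.moveOut ((X.tensor (reg h)).act a t) = Fam.l (reg h).act X.V a (X.moveOut t) := by
  rw [SRep.moveOut, LinearMap.comp_apply, LinearMap.comp_apply, intertwines_flip X (reg h)]
  generalize X.flip (reg h).toSVect t = z
  induction z with
  | zero => simp
  | add x y hx hy => simp only [map_add, hx, hy]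
  | tmul g x =>
    have e1 : ∀ g x, TensorProduct.lift ((LinearMap.lcomp ℂ _ (TensorProduct.mk ℂ (S h) X.V 1)) ∘ₗ
      ((reg h).tensor X.antip).rho.toLinearMap) (g ⊗ₜ[ℂ] x) =
        ((reg h).tensor X.antip).rho g (1 ⊗ₜ x) := fun g x => rfl
    rw [tensor_act, map_add, e1, e1, e1]
    have e2 : ((reg h).tensor X.antip).rho ((reg h).act a g) (1 ⊗ₜ x) =
        ((reg h).tensor X.antip).act a (((reg h).tensor X.antip).rho g (1 ⊗ₜ x)) := rho_ι_mul _ _ _ _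
    have e3 : ((reg h).tensor X.antip).rho ((reg h).par g) (1 ⊗ₜ X.act a x) =
        Fam.r (reg h).toSVect X.act a (((reg h).tensor X.antip).rho g (1 ⊗ₜ x)) := by
      change ((reg h).tensor X.antip).rho (invol g) (1 ⊗ₜ X.act a x) = _
      clear e2
      induction g using S.induction with
      | halg r =>
        rw [commutes, rho_algebraMap, rho_algebraMap, map_smul, Fam.r_tmul, reg_par, map_one]
      | hadd g g' hg hg' => simp only [map_add, LinearMap.add_apply, hg, hg']
      | hmul b g hg =>
        rw [invol_ι_mul, map_neg, LinearMap.neg_apply, rho_ι_mul, rho_ι_mul, hg]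
        have h1 : Anti (Fam.r (reg h).toSVect X.act) ((reg h).tensor X.antip).act := by
          rw [tensor_act_eq]
          refine (Anti.l_r (reg h).odd X.act).symm.add_right (Anti.r _ fun a b v => ?_)
          change X.act a (-(X.act b v)) = - -X.act b (X.act a v)
          rw [map_neg, act_anti, neg_neg]
        rw [h1]
    have e4 : ∀ z, ((reg h).tensor X.antip).act a z =
        Fam.l (reg h).act X.V a z - Fam.r (reg h).toSVect X.act a z := fun z => by
      induction z using TensorProduct.induction_on with
      | zero => simp
      | add x y hx hy => simp only [map_add, hx, hy]; abel
      | tmul x y =>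
        rw [tensor_act, sub_eq_add_neg, Fam.l_tmul, Fam.r_tmul, ← tmul_neg]; rfl
    rw [e2, e3, e4, sub_add_cancel]

lemma map_id_l {V V' : Type} [AddCommGroup V] [Module ℂ V] [AddCommGroup V'] [Module ℂ V']
    (k : V →ₗ[ℂ] V') (a : h) (t : S h ⊗[ℂ] V) :
    map 𝕀 k (Fam.l (reg h).act V a t) = Fam.l (reg h).act V' a (map 𝕀 k t) := by
  induction t with
  | zero => simp
  | tmul u v => simp
  | add s t hs ht => simp only [map_add, hs, ht]

set_option maxHeartbeats 1000000 in
/-- The associator is equivariant. -/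
lemma intertwines_assoc_star :
    Intertwines (X.star (Y.star Z)).zero ((X.star Y).star Z).zero (D.assoc X Y Z).1 := by
  intro a v
  have e5 : ∀ t, ((X.star Y).star Z).zero.act a (0, t) = (0, Fam.l (reg h).act _ a t) := fun t => by
    rw [star_act (X.star Y) Z, map_zero]
  have key : (D.assoc X Y Z).1 ∘ₗ (X.star (Y.star Z)).zero.act a =
      ((X.star Y).star Z).zero.act a ∘ₗ (D.assoc X Y Z).1 := by
    refine star_star_ext₀ (h := h) (X := X.car) (Y := Y.car) (Z := Z.car)
      (W := ((X.star Y).star Z).zero.V) (fun x y z => ?_) (fun g x y z => ?_) (fun g x y z => ?_)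
      fun g x y z => ?_
    · have e1 : (X.star (Y.star Z)).zero.act a (x ⊗ₜ (y ⊗ₜ z, 0), 0) =
          (X.zero.act a x ⊗ₜ (y ⊗ₜ z, 0), 0) + ((X.zero.par x ⊗ₜ (Y.zero.act a y ⊗ₜ z, 0), 0) +
            (X.zero.par x ⊗ₜ (Y.zero.par y ⊗ₜ Z.zero.act a z, 0), 0)) := by
        rw [star_act X (Y.star Z), tensor_act, star_act Y Z, tensor_act, map_zero, map_zero]
        refine Prod.ext ?_ (by simp)
        simp only [Prod.fst_add, ← tmul_add]
        simp
      have e2 : ((X.star Y).star Z).zero.act a ((x ⊗ₜ y, 0) ⊗ₜ z, 0) =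
          ((X.zero.act a x ⊗ₜ y, 0) ⊗ₜ z, 0) + (((X.zero.par x ⊗ₜ Y.zero.act a y, 0) ⊗ₜ z, 0) +
            ((X.zero.par x ⊗ₜ Y.zero.par y, 0) ⊗ₜ Z.zero.act a z, 0)) := by
        rw [star_act (X.star Y) Z, tensor_act, star_act X Y, tensor_act, map_zero, map_zero]
        refine Prod.ext ?_ (by simp)
        simp only [Prod.fst_add, ← add_assoc, ← add_tmul]
        simp
      refine (congrArg (D.assoc X Y Z).1 e1).trans (Eq.trans ?_
        (congrArg (((X.star Y).star Z).zero.act a) (assoc_000 D X Y Z x y z)).symm)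
      rw [e2, map_add, map_add, assoc_000, assoc_000, assoc_000]
    · have e1 : (X.star (Y.star Z)).zero.act a (x ⊗ₜ (0, g ⊗ₜ (y ⊗ₜ z)), 0) =
          (X.zero.act a x ⊗ₜ (0, g ⊗ₜ (y ⊗ₜ z)), 0) +
            (X.zero.par x ⊗ₜ (0, (ι ℂ a * g) ⊗ₜ (y ⊗ₜ z)), 0) := by
        rw [star_act X (Y.star Z), tensor_act, star_act Y Z, map_zero, map_zero, Fam.l_tmul, reg_act]
        exact Prod.ext rfl (add_zero 0).symm
      let Θ : S h ⊗[ℂ] X.zero.V →ₗ[ℂ] S h ⊗[ℂ] ((X.zero.V ⊗[ℂ] Y.one.V) ⊗[ℂ] Z.one.V) :=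
        map 𝕀 ((TensorProduct.mk ℂ _ _).flip z ∘ₗ (TensorProduct.mk ℂ _ _).flip y)
      have e2 : ∀ x g, assoc011 X.zero Y.one Z.one (x ⊗ₜ (g ⊗ₜ (y ⊗ₜ z))) =
          Θ (X.zero.moveOut (x ⊗ₜ g)) := fun x g => by
        simp only [assoc011, LinearMap.comp_apply, LinearEquiv.coe_coe, assoc_symm_tmul,
          map_tmul, LinearMap.id_apply]
        generalize X.zero.moveOut (x ⊗ₜ g) = t
        induction t with
        | zero => simp
        | tmul u v => simp [Θ]
        | add s t hs ht => rw [add_tmul, map_add, map_add, map_add, hs, ht]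
      have e3 := map_id_l ((TensorProduct.mk ℂ _ Z.one.V).flip z ∘ₗ
        (TensorProduct.mk ℂ X.zero.V Y.one.V).flip y) a
      have e6 := moveOut_equivariant X.zero a (x ⊗ₜ g)
      rw [tensor_act, map_add, reg_act] at e6
      refine (congrArg (D.assoc X Y Z).1 e1).trans (Eq.trans ?_
        (congrArg (((X.star Y).star Z).zero.act a) (assoc_011 D X Y Z x (g ⊗ₜ (y ⊗ₜ z)))).symm)
      rw [map_add, assoc_011, assoc_011, e5, e2, e2, e2, ← map_id_l, ← e3, ← e6, map_add, map_add]
      exact Prod.ext (add_zero 0) rfl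
    · have e1 : (X.star (Y.star Z)).zero.act a (0, g ⊗ₜ (x ⊗ₜ (y ⊗ₜ z, 0))) =
          (0, (ι ℂ a * g) ⊗ₜ (x ⊗ₜ (y ⊗ₜ z, 0))) := by
        rw [star_act X (Y.star Z), map_zero, Fam.l_tmul, reg_act]
      have e6 : D.gam 1 ((reg h).tensor (X.one.triv h)) (Y.zero.tensor (Z.one.triv h))
          (((ι ℂ a * g) ⊗ₜ x) ⊗ₜ (y ⊗ₜ z)) =
          Fam.l ((reg h).tensor (X.one.triv h)).act _ a
            (D.gam 1 ((reg h).tensor (X.one.triv h)) (Y.zero.tensor (Z.one.triv h))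
              ((g ⊗ₜ x) ⊗ₜ (y ⊗ₜ z))) := by
        have h1 : ((ι ℂ a * g) ⊗ₜ[ℂ] x) ⊗ₜ[ℂ] (y ⊗ₜ[ℂ] z) =
            Fam.l ((reg h).tensor (X.one.triv h)).act _ a ((g ⊗ₜ x) ⊗ₜ (y ⊗ₜ z)) := by
          rw [Fam.l_tmul, tensor_triv_act, Fam.l_tmul, reg_act]
        rw [h1]
        refine (gexp_nat D 1 (k := Fam.l ((reg h).tensor (X.one.triv h)).act _ a) (fun b a' v => ?_) _).symm
        rw [((reg h).tensor (X.one.triv h)).anti.l,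
          Anti.l_r ((reg h).tensor (X.one.triv h)).odd _ a a', map_neg, neg_neg]
      have e7 : ∀ t, map 𝕀 (assocTriv X.one.V Y.zero.V Z.one.V)
          (assoc ℂ (S h) X.one.V (Y.zero.V ⊗[ℂ] Z.one.V)
            (Fam.l ((reg h).tensor (X.one.triv h)).act _ a t)) =
          Fam.l (reg h).act _ a (map 𝕀 (assocTriv X.one.V Y.zero.V Z.one.V)
            (assoc ℂ (S h) X.one.V (Y.zero.V ⊗[ℂ] Z.one.V) t)) := fun t => by
        induction t with
        | zero => rw [map_zero, map_zero, map_zero, map_zero]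
        | tmul u v =>
          induction u using TensorProduct.induction_on with
          | zero => rw [zero_tmul, map_zero, map_zero, map_zero, map_zero]
          | tmul u x =>
            rw [Fam.l_tmul, tensor_triv_act, Fam.l_tmul, assoc_tmul,
              assoc_tmul, map_tmul, map_tmul, Fam.l_tmul]
            rfl
          | add s t hs ht => rw [add_tmul]; simp only [map_add, hs, ht]
        | add s t hs ht => simp only [map_add, hs, ht]
      refine (congrArg (D.assoc X Y Z).1 e1).trans (Eq.trans ?_
        (congrArg (((X.star Y).star Z).zero.act a) (assoc_101 D X Y Z g x (y ⊗ₜ z))).symm)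
      rw [assoc_101, assoc101_apply, assoc101_apply, e5, ← map_id_l, e6, e7]
    · have e1 : (X.star (Y.star Z)).zero.act a (0, g ⊗ₜ (x ⊗ₜ (0, y ⊗ₜ z))) =
          (0, (ι ℂ a * g) ⊗ₜ (x ⊗ₜ (0, y ⊗ₜ z))) := by
        rw [star_act X (Y.star Z), map_zero, Fam.l_tmul, reg_act]
      have h1 : Intertwines (((reg h).tensor ((X.one.tensor Y.one).triv h)).tensor Z.zero)
          ((X.star Y).zero.tensor Z.zero) (map (LinearMap.inr ℂ _ _) 𝕀) := by
        refine intertwines_map (fun a v => ?_) (fun v => ?_) fun _ _ => rfl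
        · exact Prod.ext (map_zero ((X.zero.tensor Y.zero).act a)).symm rfl
        · exact Prod.ext (map_zero (X.zero.tensor Y.zero).par).symm rfl
      have e5 : ∀ t, ((X.star Y).star Z).zero.act a (t, 0) =
          (((X.star Y).zero.tensor Z.zero).act a t, 0) := fun t => by
        rw [star_act (X.star Y) Z, map_zero]
      refine (congrArg (D.assoc X Y Z).1 e1).trans (Eq.trans ?_
        (congrArg (((X.star Y).star Z).zero.act a) (assoc_110 D X Y Z g x (y ⊗ₜ z))).symm)
      rw [assoc_110, e5, assoc110_apply, assoc110_apply, rho_ι_mul, h1]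
  exact LinearMap.congr_fun key v

end Assoc

end Evaluation

section Contractions

variable {V W V' W' : Type} [AddCommGroup V] [Module ℂ V] [AddCommGroup W] [Module ℂ W]
  [AddCommGroup V'] [Module ℂ V'] [AddCommGroup W'] [Module ℂ W']

/-- `v ⊗ w ↦ k(v) l(w)`. -/
def ctr (k : V →ₗ[ℂ] ℂ) (l : W →ₗ[ℂ] W') : V ⊗[ℂ] W →ₗ[ℂ] W' :=
  (lid ℂ W').toLinearMap ∘ₗ map k l

/-- `v ⊗ w ↦ k(w) l(v)`. -/
def ctrR (l : V →ₗ[ℂ] V') (k : W →ₗ[ℂ] ℂ) : V ⊗[ℂ] W →ₗ[ℂ] V' :=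
  (rid ℂ V').toLinearMap ∘ₗ map l k

@[simp] lemma ctr_tmul (k : V →ₗ[ℂ] ℂ) (l : W →ₗ[ℂ] W') (v : V) (w : W) :
    ctr k l (v ⊗ₜ w) = k v • l w := rfl

@[simp] lemma ctrR_tmul (l : V →ₗ[ℂ] V') (k : W →ₗ[ℂ] ℂ) (v : V) (w : W) :
    ctrR l k (v ⊗ₜ w) = k w • l v := rfl

lemma map_ctr {U : Type} [AddCommGroup U] [Module ℂ U] (k : V →ₗ[ℂ] ℂ) (l : W →ₗ[ℂ] W')
    (n : W' →ₗ[ℂ] U) (z : V ⊗[ℂ] W) : n (ctr k l z) = ctr k (n ∘ₗ l) z := by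
  induction z with
  | zero => simp
  | tmul x y => simp
  | add x y hx hy => simp only [map_add, hx, hy]

lemma ctr_flip {X Y : SVect} {k : Y.V →ₗ[ℂ] ℂ} (hk : ∀ y, k (Y.par y) = k y) (l : X.V →ₗ[ℂ] W)
    (z : X.V ⊗[ℂ] Y.V) : ctr k l (X.flip Y z) = ctrR l k z := by
  induction z with
  | tmul x y =>
    rw [flip_tmul, map_smul, map_sub, map_add, map_add, ctr_tmul, ctr_tmul, ctr_tmul, ctr_tmul, hk,
      ctrR_tmul]
    module
  | _ => simp only [map_zero, map_add, *]

end Contractions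

section Killed

variable {h : Type} [AddCommGroup h] [Module ℂ h] [FiniteDimensional ℂ h]

lemma rho_map_of_killed (X : SRep h) {T : h →ₗ[ℂ] h} {x : X.V} (hx : ∀ a, X.act (T a) x = 0) (g : S h) :
    X.rho (ExteriorAlgebra.map T g) x = counit h g • x := by
  induction g using S.induction with
  | halg r => rw [commutes (ExteriorAlgebra.map T), rho_algebraMap, counit_algebraMap]
  | hadd g g' hg hg' => simp only [map_add, LinearMap.add_apply, hg, hg', add_smul]
  | hmul a g hg =>
    rw [map_mul, ExteriorAlgebra.map_apply_ι, rho_ι_mul, hg, map_smul, hx, counit_ι_mul, smul_zero,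
      zero_smul]

lemma rho_tensor_of_killed (X Y : SRep h) {T : h →ₗ[ℂ] h} {y : Y.V} (hy : ∀ a, Y.act (T a) y = 0)
    (g : S h) (x : X.V) : (X.tensor Y).rho (ExteriorAlgebra.map T g) (x ⊗ₜ y) =
      X.rho (ExteriorAlgebra.map T g) x ⊗ₜ y := by
  induction g using S.induction with
  | halg r =>
    rw [commutes (ExteriorAlgebra.map T), rho_algebraMap, rho_algebraMap, smul_tmul']
  | hadd g g' hg hg' => simp only [map_add, LinearMap.add_apply, hg, hg', add_tmul]
  | hmul a g hg =>
    rw [map_mul, ExteriorAlgebra.map_apply_ι, rho_ι_mul, hg, tensor_act, hy, tmul_zero,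
      add_zero, rho_ι_mul]

lemma rho_antip (X : SRep h) (g : S h) (x : X.V) : X.antip.rho g x = X.rho (invol g) x := by
  induction g using S.induction with
  | halg r => rw [commutes invol, rho_algebraMap, rho_algebraMap]
  | hadd g g' hg hg' => simp only [map_add, LinearMap.add_apply, hg, hg']
  | hmul a g hg =>
    rw [rho_ι_mul, hg, invol_ι_mul, map_neg]
    exact congrArg Neg.neg (rho_ι_mul X a (invol g) x).symm

lemma map_id_S (g : S h) : ExteriorAlgebra.map (𝕀 : h →ₗ[ℂ] h) g = g := by
  rw [ExteriorAlgebra.map_id]; rfl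

lemma moveOut_flip (X : SRep h) (g : S h) (x : X.V) :
    X.moveOut ((reg h).toSVect.flip X.toSVect (g ⊗ₜ x)) = ((reg h).tensor X.antip).rho g (1 ⊗ₜ x) := by
  rw [SRep.moveOut, LinearMap.comp_apply, flip_flip]
  rfl

lemma isEven_moveOut (X : SRep h) :
    IsEven (X.toSVect.tensor (reg h).toSVect) ((reg h).toSVect.tensor X.toSVect) X.moveOut := by
  intro t
  rw [← flip_flip X.toSVect (reg h).toSVect t, ← isEven_flip]
  generalize X.flip (reg h).toSVect t = z
  induction z with
  | tmul g x =>
    have e1 := moveOut_flip X (invol g) (X.par x)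
    have e2 := par_rho ((reg h).tensor X.antip) g (1 ⊗ₜ x)
    rw [tensor_par, reg_par, map_one] at e2
    exact e1.trans (e2.symm.trans (congrArg _ (moveOut_flip X g x).symm))
  | _ => simp only [map_zero, map_add, *]

end Killed

section ConvolutionIdentities

variable {h : Type} [AddCommGroup h] [Module ℂ h] [FiniteDimensional ℂ h]
variable {D : SympData h} {f : Submodule ℂ h} (P : Polarization D f) (c : HChoice D f)
  (hβ : D.β = 1)

lemma chiL_par (l : c.L.V) : c.chiL (c.L.par l) = c.chiL l := by
  rw [chiL_apply, L_par_coe, chi_invol, chiL_apply]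

lemma intertwines_comul : Intertwines (reg h) ((reg h).tensor (reg h)) (comul h) := fun a g =>
  comul_ι_mul a g

lemma isEven_comul : IsEven (reg h).toSVect ((reg h).tensor (reg h)).toSVect (comul h) := fun g =>
  comul_invol g

include P hβ in
/-- `∑ χ(g' l) E(g'') = χ(l) E(g)`. -/
lemma ctr_E (g : S h) (l : c.L.V) :
    ctr c.chiL c.E ((c.L.tensor (reg h)).rho g (l ⊗ₜ 1)) = c.chiL l • c.E g := by
  have e1 : (reg h).toSVect.flip c.L.toSVect ((1 : S h) ⊗ₜ l) = l ⊗ₜ (1 : S h) :=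
    flip_tmul_of_even (map_one invol) l
  have e2 : ∀ w : S h ⊗[ℂ] c.L.V, ctrR c.E c.chiL w = ctr c.theta (ctrR 𝕀 c.chiL)
      (assoc ℂ (S h) (S h) c.L.V (map (comul h) 𝕀 w)) := fun w => by
    induction w with
    | tmul x l =>
      rw [ctrR_tmul, map_tmul, LinearMap.id_apply]
      change _ • ctr c.theta 𝕀 (comul h x) = _
      generalize comul h x = t
      induction t with
      | tmul x y =>
        rw [ctr_tmul, assoc_tmul, ctr_tmul, ctrR_tmul, smul_comm]
      | _ => simp_all [add_tmul, tmul_add]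
    | _ => simp only [map_zero, map_add, *]
  have e3 : map (comul h) 𝕀 (((reg h).tensor c.L).rho g (1 ⊗ₜ l)) =
      (((reg h).tensor (reg h)).tensor c.L).rho g ((1 ⊗ₜ 1) ⊗ₜ l) := by
    have := rho_natural (intertwines_map_left c.L intertwines_comul isEven_comul) g ((1 : S h) ⊗ₜ l)
    rw [map_tmul, comul_one] at this
    exact this
  have e4 := rho_natural (intertwines_assoc (reg h) (reg h) c.L) g (((1 : S h) ⊗ₜ (1 : S h)) ⊗ₜ l)
  have e5 := rho_conv ((reg h).tensor c.L) c.theta g ((1 : S h) ⊗ₜ l)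
  have e6 : ((reg h).tensor c.L).rho (c.E g) ((1 : S h) ⊗ₜ l) = c.E g ⊗ₜ l := by
    rw [← mr_E P c hβ]
    refine (rho_tensor_of_killed (reg h) c.L (T := P.r) (fun a => L_act_of_mem P c (P.r_mem a) l) _ _).trans ?_
    exact congrArg (· ⊗ₜ[ℂ] l) ((reg_rho _ _).trans (mul_one _))
  rw [← e1, ← rho_natural (intertwines_flip (reg h) c.L)]
  refine (ctr_flip (X := (reg h).toSVect) (Y := c.L.toSVect) (chiL_par c) c.E _).trans ?_
  rw [e2, e3]
  refine (congrArg _ e4).trans ?_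
  have e7 := congrArg (ctrR 𝕀 c.chiL) e5
  have e8 := map_ctr c.theta 𝕀 (ctrR 𝕀 c.chiL)
    (((reg h).tensor ((reg h).tensor c.L)).rho g (1 ⊗ₜ (1 ⊗ₜ l)))
  refine Eq.trans (e8.symm.trans e7.symm) ?_
  exact congrArg (ctrR 𝕀 c.chiL) e6

include P hβ in
lemma E_mul_ι {u : h} (hu : u ∈ f) (g : S h) : c.E (g * ι ℂ u) = c.E g * ι ℂ u := by
  have e1 : ∀ x : S h, x * ι ℂ u = ι ℂ u * invol x := fun x => by rw [ι_mul_eq, invol_invol]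
  rw [e1, e1, E_ι_mul P c hβ hu, E_invol c hβ]

include P hβ in
lemma exists_M_phi (l : c.L.V) : ∃ g, c.M (D.phi g) = l := by
  obtain ⟨g, rfl⟩ := exists_M c l
  exact ⟨D.phi (invol g), by rw [phi_phi P c hβ, invol_invol]⟩

include hβ in
lemma mr_j (l : c.L.V) : P.mr (c.j l) = c.j l := by
  obtain ⟨g, rfl⟩ := exists_M_phi P c hβ l
  rw [j_M_phi P c hβ, mr_E P c hβ]

include P hβ in
lemma counit_j (l : c.L.V) : counit h (c.j l) = c.chiL l := by
  obtain ⟨g, rfl⟩ := exists_M_phi P c hβ l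
  rw [j_M_phi P c hβ, counit_E, chiL_apply, chi_M, theta_phi P c hβ]

include P hβ in
lemma j_par (l : c.L.V) : c.j (c.L.par l) = invol (c.j l) := by
  obtain ⟨g, rfl⟩ := exists_M_phi P c hβ l
  rw [← isEven_M c hβ]
  change c.j (c.M (invol _)) = _
  rw [← phi_invol hβ, j_M_phi P c hβ, j_M_phi P c hβ, E_invol c hβ]

lemma j_e : c.j c.e = 1 := by
  rw [j_eq, SympData.gam, gexp_of_left D (Anti.l_r c.L.odd _) fun a => by
    rw [Fam.l_tmul, L_act_e, zero_tmul], map_tmul, lid_tmul]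
  exact (congrArg (· • (1 : S h)) (chi_e c)).trans (one_smul _ _)

end ConvolutionIdentities

section Multiplication

variable {h : Type} [AddCommGroup h] [Module ℂ h] [FiniteDimensional ℂ h]
variable {D : SympData h} {f : Submodule ℂ h} (P : Polarization D f) (c : HChoice D f)
  (hβ : D.β = 1)

lemma preMul_eq (g : S h) (x : c.L.V) :
    c.preMul (g ⊗ₜ x) = ctrR c.M c.chiL (((reg h).tensor c.L.antip).rho g (1 ⊗ₜ x)) := by
  have e1 := rho_tensor_one c.L.antip g x
  rw [e1]
  simp only [HChoice.preMul, LinearMap.comp_apply, LinearEquiv.coe_coe, map_tmul, LinearMap.id_apply]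
  generalize comul h g = t
  induction t with
  | zero => simp
  | add s t hs ht => simp only [add_tmul, map_add, hs, ht]
  | tmul y z =>
    rw [assoc_tmul, map_tmul, rid_tmul, map_tmul, ctrR_tmul, orb_apply, rho_antip]
    congr 1
    obtain ⟨w, rfl⟩ := exists_M c x
    rw [L_rho_M]
    change c.chi (invol z * (w * c.m)) = c.chi (invol z * w * c.m)
    rw [mul_assoc]

lemma preMul_eq_moveOut (t : S h ⊗[ℂ] c.L.V) :
    c.preMul t = ctrR c.M c.chiL (c.L.moveOut ((reg h).toSVect.flip c.L.toSVect t)) := by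
  induction t with
  | tmul y z => rw [preMul_eq, moveOut_flip]
  | _ => simp only [map_zero, map_add, *]

lemma intertwines_preMul : Intertwines ((reg h).tensor c.L) c.L c.preMul := by
  intro a t
  rw [preMul_eq_moveOut, intertwines_flip (reg h) c.L, moveOut_equivariant, preMul_eq_moveOut]
  generalize c.L.moveOut _ = z
  induction z with
  | tmul y z =>
    rw [Fam.l_tmul, ctrR_tmul, ctrR_tmul, intertwines_M, map_smul]
  | _ => simp only [map_zero, map_add, *]

include hβ in
lemma isEven_preMul : IsEven ((reg h).toSVect.tensor c.L.toSVect) c.L.toSVect c.preMul := by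
  intro t
  rw [preMul_eq_moveOut, isEven_flip, isEven_moveOut, preMul_eq_moveOut]
  generalize c.L.moveOut _ = z
  induction z with
  | tmul y z =>
    rw [map_tmul, ctrR_tmul, ctrR_tmul, chiL_par, isEven_M c hβ, map_smul]
  | _ => simp only [map_zero, map_add, *]

include P in
lemma preMul_ms (g : S h) (x : c.L.V) : c.preMul (P.ms g ⊗ₜ x) = c.preMul (g ⊗ₜ x) := by
  have h0 : ∀ u ∈ f, ∀ g, c.preMul ((ι ℂ u * g) ⊗ₜ x) = 0 := fun u hu g => by
    have := intertwines_preMul c u (g ⊗ₜ x)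
    rw [tensor_act, map_add, L_act_of_mem P c hu, L_act_of_mem P c hu, tmul_zero, map_zero,
      add_zero] at this
    exact this
  have := P.ext_on_ms (F := c.preMul ∘ₗ (mk ℂ (S h) c.L.V).flip x)
    (G := c.preMul ∘ₗ (mk ℂ (S h) c.L.V).flip x ∘ₗ P.ms.toLinearMap) (fun _ => 0)
    (fun u hu g => h0 u hu g) (fun u hu g => by
      change c.preMul (P.ms (ι ℂ u * g) ⊗ₜ x) = 0
      rw [map_mul, P.ms_ι, P.s_of_mem hu, map_zero, zero_mul, zero_tmul, map_zero])
    fun g => by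
      change c.preMul (P.ms g ⊗ₜ x) = c.preMul (P.ms (P.ms g) ⊗ₜ x)
      rw [P.ms_ms]
  exact (LinearMap.congr_fun this g).symm

include P hβ in
lemma mul00_M (g : S h) (x : c.L.V) : c.mul00 (c.M g ⊗ₜ x) = c.preMul (g ⊗ₜ x) := by
  change c.preMul (c.lift (c.M g) ⊗ₜ x) = _
  rw [← sub_eq_zero, ← map_sub, ← sub_tmul, ← preMul_ms P,
    eq_zero_of_M_ms P c hβ (by rw [M_ms, map_sub, M_lift, sub_self]), zero_tmul, map_zero]

include P hβ in
lemma mul00_map_M (t : S h ⊗[ℂ] c.L.V) :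
    c.mul00 (map c.M 𝕀 t) = c.preMul t := by
  induction t with
  | tmul y z => rw [map_tmul]; exact mul00_M P c hβ y z
  | _ => simp only [map_zero, map_add, *]

lemma exists_map_M {W : Type} [AddCommGroup W] [Module ℂ W] (t : c.L.V ⊗[ℂ] W) :
    ∃ s, map c.M 𝕀 s = t :=
  ⟨map c.lift 𝕀 t, by
    induction t with
    | zero => simp only [map_zero]
    | add s t hs ht => simp only [map_add, hs, ht]
    | tmul y z => rw [map_tmul, map_tmul, M_lift]; rfl⟩

include P hβ in
lemma intertwines_mul00 : Intertwines (c.L.tensor c.L) c.L c.mul00 := by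
  intro a t
  obtain ⟨s, rfl⟩ := exists_map_M c t
  rw [← intertwines_map_left c.L (X := reg h) (intertwines_M c) (isEven_M c hβ), mul00_map_M P c hβ, mul00_map_M P c hβ, intertwines_preMul]

include P hβ in
lemma isEven_mul00 : IsEven (c.L.tensor c.L).toSVect c.L.toSVect c.mul00 := by
  intro t
  obtain ⟨s, rfl⟩ := exists_map_M c t
  rw [← isEven_map_left c.L.toSVect (X := (reg h).toSVect) (isEven_M c hβ), mul00_map_M P c hβ, mul00_map_M P c hβ, isEven_preMul c hβ]

include P hβ in
lemma chiL_mul00 (l l' : c.L.V) : c.chiL (c.mul00 (l ⊗ₜ l')) = c.chiL l * c.chiL l' := by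
  obtain ⟨g, rfl⟩ := exists_M c l
  have e1 : ∀ w : S h ⊗[ℂ] c.L.V, c.chiL (ctrR c.M c.chiL w) = c.chiL (ctr c.theta 𝕀 w) :=
    fun w => by
      induction w with
      | tmul y z =>
        rw [ctrR_tmul, ctr_tmul, map_smul, map_smul, chiL_apply c (c.M y), chi_M, smul_eq_mul,
          smul_eq_mul, mul_comm]
        rfl
      | _ => simp only [map_zero, map_add, *]
  have e2 := rho_conv c.L.antip c.theta g l'
  rw [mul00_M P c hβ, preMul_eq, e1]
  refine (congrArg c.chiL e2.symm).trans ?_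
  change c.chiL (c.L.antip.rho (c.E g) l') = _
  rw [← mr_E P c hβ, rho_antip, Polarization.mr, Polarization.invol_map]
  rw [rho_map_of_killed c.L (fun a => L_act_of_mem P c (P.r_mem a) l'), counit_invol, counit_E, map_smul,
    smul_eq_mul, chiL_apply c (c.M g), chi_M]

include P hβ in
lemma mul00_e (x : c.L.V) : c.mul00 (x ⊗ₜ c.e) = x := by
  obtain ⟨g, rfl⟩ := exists_M c x
  have e1 := rho_tensor_of_killed (reg h) c.L.antip (T := 𝕀) (y := c.e) (fun a => by
    change -(c.L.act a c.e) = 0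
    rw [L_act_e, neg_zero]) g 1
  rw [map_id_S] at e1
  rw [mul00_M P c hβ, preMul_eq, e1, ctrR_tmul, chiL_apply, chi_e, one_smul]
  exact congrArg c.M ((reg_rho _ _).trans (mul_one _))

/-- Two contractions with `χ` of `γ_{L ⊗ L, X}`. -/
lemma ctr_ctr_gam (X : SRep h) (l l' : c.L.V) (x : X.V) :
    ctr (c.chiL) (ctr c.chiL 𝕀) (assoc ℂ c.L.V c.L.V X.V
      (D.gam 1 (c.L.tensor c.L) X ((l ⊗ₜ l') ⊗ₜ x))) = X.rho (c.j l) (X.rho (c.j l') x) := by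
  have e1 : D.gam 1 (c.L.tensor c.L) X ((l ⊗ₜ l') ⊗ₜ x) =
      D.gexp 1 (Fam.l (Fam.l c.L.act c.L.V) X.V) (Fam.r (c.L.tensor c.L).toSVect X.act)
        (D.gexp 1 (Fam.l (Fam.r c.L.toSVect c.L.act) X.V) (Fam.r (c.L.tensor c.L).toSVect X.act)
          ((l ⊗ₜ l') ⊗ₜ x)) := by
    have hs : Fam.l (c.L.tensor c.L).act X.V =
        Fam.l (Fam.l c.L.act c.L.V) X.V + Fam.l (Fam.r c.L.toSVect c.L.act) X.V := by
      rw [tensor_act_eq]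
      exact LinearMap.comp_add _ _ _
    have ho1 : OddFam (c.L.tensor c.L).toSVect (Fam.l c.L.act c.L.V) := fun a t => by
      induction t using TensorProduct.induction_on with
      | zero => simp only [map_zero, neg_zero]
      | add s t hs ht => simp only [map_add, hs, ht, neg_add]
      | tmul y z =>
        rw [tensor_par, Fam.l_tmul, Fam.l_tmul, tensor_par, c.L.act_par, neg_tmul]
    have ho2 : OddFam (c.L.tensor c.L).toSVect (Fam.r c.L.toSVect c.L.act) := fun a t => by
      induction t using TensorProduct.induction_on with
      | zero => simp only [map_zero, neg_zero]
      | add s t hs ht => simp only [map_add, hs, ht, neg_add]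
      | tmul y z =>
        rw [tensor_par, Fam.r_tmul, Fam.r_tmul, tensor_par, c.L.act_par, tmul_neg]
    rw [SympData.gam, hs]
    exact gexp_add_left D 1 c.L.anti.l.l (c.L.anti.r _).l (X.anti.r _) (Anti.l_r ho1 _)
      (Anti.l_r ho2 _) (Anti.l_r c.L.odd _).l _
  have e2 : assoc ℂ c.L.V c.L.V X.V
      (D.gexp 1 (Fam.l (Fam.r c.L.toSVect c.L.act) X.V) (Fam.r (c.L.tensor c.L).toSVect X.act)
          ((l ⊗ₜ l') ⊗ₜ x)) = l ⊗ₜ D.gam 1 c.L X (l' ⊗ₜ x) := by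
    have := gexp_nat D 1 (P := Fam.l c.L.act X.V) (Q := Fam.r c.L.toSVect X.act)
      (k := (assoc ℂ c.L.V c.L.V X.V).symm.toLinearMap ∘ₗ TensorProduct.mk ℂ _ _ l)
      (P' := Fam.l (Fam.r c.L.toSVect c.L.act) X.V) (Q' := Fam.r (c.L.tensor c.L).toSVect X.act)
      (fun b a v => by
        induction v with
        | zero => simp only [map_zero]
        | add s t hs ht => simp only [map_add, hs, ht]
        | tmul y z =>
          rw [Fam.r_tmul, Fam.l_tmul, LinearMap.comp_apply, LinearMap.comp_apply, mk_apply,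
            mk_apply, LinearEquiv.coe_coe, assoc_symm_tmul,
            assoc_symm_tmul, Fam.r_tmul, tensor_par, Fam.l_tmul, Fam.r_tmul, c.L.par_par])
      (l' ⊗ₜ x)
    rw [← LinearEquiv.eq_symm_apply]
    exact this.symm
  have e3 : ∀ t, map 𝕀 (ctr c.chiL 𝕀) (assoc ℂ c.L.V c.L.V X.V
      (D.gexp 1 (Fam.l (Fam.l c.L.act c.L.V) X.V) (Fam.r (c.L.tensor c.L).toSVect X.act) t)) =
      D.gam 1 c.L X (map 𝕀 (ctr c.chiL 𝕀)
        (assoc ℂ c.L.V c.L.V X.V t)) := fun t => by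
    let k : (c.L.V ⊗[ℂ] c.L.V) ⊗[ℂ] X.V →ₗ[ℂ] c.L.V ⊗[ℂ] X.V :=
      map 𝕀 (ctr c.chiL 𝕀) ∘ₗ (assoc ℂ c.L.V c.L.V X.V).toLinearMap
    refine gexp_nat D 1 (W := c.L.V ⊗[ℂ] X.V) (k := k) (fun b a v => ?_) t
    induction v with
    | tmul y z =>
      induction y with
      | zero => rw [zero_tmul]; simp only [map_zero]
      | add s t hs ht => rw [add_tmul]; simp only [map_add, hs, ht]
      | tmul y y' =>
        rw [Fam.r_tmul, tensor_par, Fam.l_tmul, Fam.l_tmul]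
        change c.L.act b (c.L.par y) ⊗ₜ (c.chiL (c.L.par y') • X.act a z) =
          c.L.act b (c.L.par y) ⊗ₜ X.act a (c.chiL y' • z)
        rw [chiL_par, map_smul]
    | _ => simp_all [add_tmul, tmul_add]
  have e4 : ∀ t, ctr (c.chiL) (ctr c.chiL 𝕀) t = ctr c.chiL 𝕀
      (map 𝕀 (ctr c.chiL (LinearMap.id (M := X.V))) t) := fun t => by
    induction t with
    | tmul y z => rfl
    | _ => simp_all [add_tmul, tmul_add]
  rw [e1, e4, e3, e2, rho_j, rho_j]
  rfl

include P hβ in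
lemma rho_j_mul00 (X : SRep h) (l l' : c.L.V) (x : X.V) :
    X.rho (c.j (c.mul00 (l ⊗ₜ l'))) x = X.rho (c.j l) (X.rho (c.j l') x) := by
  rw [← ctr_ctr_gam, rho_j]
  have e1 := gam_natural_left D 1 X (X := c.L.tensor c.L) (intertwines_mul00 P c hβ) (isEven_mul00 P c hβ) ((l ⊗ₜ l') ⊗ₜ x)
  rw [map_tmul] at e1
  refine (congrArg (ctr c.chiL 𝕀) e1.symm).trans ?_
  generalize D.gam 1 (c.L.tensor c.L) X ((l ⊗ₜ l') ⊗ₜ x) = t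
  induction t with
  | tmul y z =>
    induction y using TensorProduct.induction_on with
    | zero => rw [zero_tmul]; simp only [map_zero]
    | add s t hs ht => rw [add_tmul]; simp only [map_add, hs, ht]
    | tmul y y' =>
      rw [map_tmul, ctr_tmul, assoc_tmul, ctr_tmul, ctr_tmul, chiL_mul00 P c hβ, mul_smul]
      rfl
  | _ => simp only [map_zero, map_add, *]

end Multiplication

section Coprod

variable {A B W : Type} [AddCommMonoid A] [Module ℂ A] [AddCommMonoid B] [Module ℂ B]
  [AddCommMonoid W] [Module ℂ W]

lemma coprod_l (k : A →ₗ[ℂ] W) (l : B →ₗ[ℂ] W) (a : A) : k.coprod l (a, 0) = k a := by simp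

lemma coprod_r (k : A →ₗ[ℂ] W) (l : B →ₗ[ℂ] W) (b : B) : k.coprod l (0, b) = l b := by simp

variable {h : Type} [AddCommGroup h] [Module ℂ h] [FiniteDimensional ℂ h] (X Y : SF h)

lemma star_par_zero_l (t : X.zero.V ⊗[ℂ] Y.zero.V) :
    (X.star Y).zero.par (t, 0) = ((X.zero.tensor Y.zero).par t, 0) :=
  Prod.ext rfl (map_zero ((reg h).tensor ((X.one.tensor Y.one).triv h)).par)

lemma star_par_zero_r (t : S h ⊗[ℂ] (X.one.V ⊗[ℂ] Y.one.V)) :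
    (X.star Y).zero.par (0, t) = (0, ((reg h).tensor ((X.one.tensor Y.one).triv h)).par t) :=
  Prod.ext (map_zero (X.zero.tensor Y.zero).par) rfl

lemma star_par_one_l (t : X.zero.V ⊗[ℂ] Y.one.V) :
    (X.star Y).one.par (t, 0) = ((X.zero.toSVect.tensor Y.one).par t, 0) :=
  Prod.ext rfl (map_zero (X.one.tensor Y.zero.toSVect).par)

lemma star_par_one_r (t : X.one.V ⊗[ℂ] Y.zero.V) :
    (X.star Y).one.par (0, t) = (0, (X.one.tensor Y.zero.toSVect).par t) :=
  Prod.ext (map_zero (X.zero.toSVect.tensor Y.one).par) rfl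

end Coprod

section AlgebraH

variable {h : Type} [AddCommGroup h] [Module ℂ h] [FiniteDimensional ℂ h]
variable {D : SympData h} {f : Submodule ℂ h} (c : HChoice D f)

/-- The object underlying `H(f)`. -/
@[reducible] def HChoice.O : SF h := ⟨c.L, unitSVect⟩

/-- The multiplication of `H(f)`. -/
def HChoice.mul : LMap (c.O.car.star h c.O.car) c.O.car := c.H.mul

lemma mul_zero_l (t : c.L.V ⊗[ℂ] c.L.V) : c.mul.1 (t, 0) = c.mul00 t :=
  coprod_l c.mul00 _ t

lemma mul_zero_r (g : S h) (s t : ℂ) : c.mul.1 (0, g ⊗ₜ (s ⊗ₜ t)) = (s * t) • c.M g := by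
  refine (coprod_r c.mul00 _ _).trans ?_
  exact map_smul c.M (s * t) g

lemma mul_one_l (l : c.L.V) (t : ℂ) : c.mul.2 (l ⊗ₜ t, 0) = c.chiL l * t :=
  coprod_l _ _ (l ⊗ₜ[ℂ] t)

lemma mul_one_r (t : ℂ) (l : c.L.V) : c.mul.2 (0, t ⊗ₜ l) = t * c.chiL l :=
  coprod_r _ _ (t ⊗ₜ[ℂ] l)

end AlgebraH

section Cores

variable {h : Type} [AddCommGroup h] [Module ℂ h] [FiniteDimensional ℂ h]
variable {D : SympData h} {f : Submodule ℂ h}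

/-- The data that determine a left `H(f)`-module: `p` is the action of `1 ∈ T` on sector 0, `q` its
action on sector 1, and `a00` the action of `L` on sector 0. -/
structure Core (P : Polarization D f) (c : HChoice D f) where
  zero : SRep h
  one : SRep h
  one_r : ∀ a v, one.act (P.r a) v = one.act a v
  p : zero.V →ₗ[ℂ] one.V
  q : one.V →ₗ[ℂ] zero.V
  a00 : c.L.V ⊗[ℂ] zero.V →ₗ[ℂ] zero.V
  p_par : IsEven zero.toSVect one.toSVect p
  p_act : ∀ u ∈ f, ∀ m, p (zero.act u m) = one.act u (p m)
  sep : ∀ m, (∀ g, p (zero.rho g m) = 0) → m = 0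
  a00_act : Intertwines (c.L.tensor zero) zero a00
  a00_par : IsEven (c.L.tensor zero).toSVect zero.toSVect a00
  p_a00 : ∀ l m, p (a00 (l ⊗ₜ m)) = c.chiL l • p m
  q_par : IsEven one.toSVect zero.toSVect q
  p_q : ∀ g y, p (zero.rho g (q y)) = one.rho (c.E g) y

namespace Core

variable {P : Polarization D f} {c : HChoice D f} (N : Core P c)

lemma sep_ext {X : SRep h} {A B : X.V →ₗ[ℂ] N.zero.V} (hA : Intertwines X N.zero A)
    (hB : Intertwines X N.zero B) (hAB : ∀ x, N.p (A x) = N.p (B x)) (x : X.V) : A x = B x := by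
  rw [← sub_eq_zero]
  refine N.sep _ fun g => ?_
  rw [map_sub, map_sub, ← rho_natural hA, ← rho_natural hB, hAB, sub_self]

lemma p_rho_mr (z : S h) (m : N.zero.V) :
    N.p (N.zero.rho (P.mr z) m) = N.one.rho (P.mr z) (N.p m) := by
  induction z using S.induction with
  | halg r => rw [commutes P.mr, rho_algebraMap, rho_algebraMap, map_smul]
  | hadd g g' hg hg' => simp only [map_add, LinearMap.add_apply, hg, hg']
  | hmul a g hg => rw [map_mul, P.mr_ι, rho_ι_mul, N.p_act _ (P.r_mem a), hg, rho_ι_mul]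

variable (hβ : D.β = 1)

include hβ in
lemma q_act {u : h} (hu : u ∈ f) (y : N.one.V) : N.q (N.one.act u y) = N.zero.act u (N.q y) := by
  rw [← sub_eq_zero]
  refine N.sep _ fun g => ?_
  rw [map_sub, map_sub, ← rho_ι N.zero, ← rho_mul, N.p_q, N.p_q, E_mul_ι P c hβ hu, rho_mul, rho_ι,
    sub_self]

include hβ in
lemma q_rho_mr (z : S h) (y : N.one.V) :
    N.q (N.one.rho (P.mr z) y) = N.zero.rho (P.mr z) (N.q y) := by
  induction z using S.induction with
  | halg r => rw [commutes P.mr, rho_algebraMap, rho_algebraMap, map_smul]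
  | hadd g g' hg hg' => simp only [map_add, LinearMap.add_apply, hg, hg']
  | hmul a g hg => rw [map_mul, P.mr_ι, rho_ι_mul, N.q_act hβ (P.r_mem a), hg, rho_ι_mul]

lemma p_a00' (t : c.L.V ⊗[ℂ] N.zero.V) : N.p (N.a00 t) = ctr c.chiL N.p t := by
  induction t with
  | tmul l m => rw [N.p_a00, ctr_tmul]
  | _ => simp only [map_zero, map_add, *]

lemma a00_e (m : N.zero.V) : N.a00 (c.e ⊗ₜ m) = m := by
  refine N.sep_ext (A := N.a00 ∘ₗ TensorProduct.mk ℂ _ _ c.e) (B := 𝕀) (X := N.zero)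
    (fun a m => ?_) (fun a m => rfl) (fun m => ?_) m
  · have := N.a00_act a (c.e ⊗ₜ m)
    rw [tensor_act, L_act_e, zero_tmul, zero_add, L_par_e] at this
    exact this
  · change N.p (N.a00 (c.e ⊗ₜ m)) = N.p m
    rw [N.p_a00, chiL_apply, chi_e, one_smul]

include hβ in
lemma a00_q (l : c.L.V) (y : N.one.V) : N.a00 (l ⊗ₜ N.q y) = c.chiL l • N.q y := by
  rw [← sub_eq_zero]
  refine N.sep _ fun g => ?_
  have e1 := rho_natural (intertwines_map_right c.L (intertwines_orb N.zero (N.q y))) g (l ⊗ₜ (1 : S h))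
  rw [map_tmul, orb_apply, rho_one] at e1
  have e2 : ∀ w : c.L.V ⊗[ℂ] S h, ctr c.chiL N.p (map 𝕀 (N.zero.orb (N.q y)) w) =
      N.one.rho (ctr c.chiL c.E w) y := fun w => by
    induction w with
    | zero => simp
    | add s t hs ht => simp only [map_add, hs, ht, LinearMap.add_apply]
    | tmul l m =>
      rw [map_tmul, ctr_tmul, ctr_tmul, orb_apply, N.p_q, map_smul]
      rfl
  rw [map_sub, map_sub, map_smul, map_smul, N.p_q, ← rho_natural N.a00_act, N.p_a00']
  have e3 := congrArg (ctr c.chiL N.p) e1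
  refine sub_eq_zero.mpr (e3.symm.trans ((e2 _).trans ?_))
  rw [ctr_E P c hβ, map_smul]
  rfl

include hβ in
lemma q_p (m : N.zero.V) : N.q (N.p m) = N.a00 (c.M 1 ⊗ₜ m) := by
  rw [← sub_eq_zero]
  refine N.sep _ fun g => ?_
  have e1 := rho_natural (intertwines_map_left N.zero (intertwines_M c) (isEven_M c hβ)) g ((1 : S h) ⊗ₜ m)
  rw [map_tmul] at e1
  have e2 := congrArg N.p (rho_conv N.zero c.theta g m)
  have e3 : N.p (N.zero.rho (c.E g) m) = N.one.rho (c.E g) (N.p m) := by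
    rw [← mr_E P c hβ, N.p_rho_mr]
  rw [map_sub, map_sub, N.p_q, ← rho_natural N.a00_act, N.p_a00']
  refine sub_eq_zero.mpr (e3.symm.trans (e2.trans ?_))
  refine Eq.trans ?_ (congrArg (ctr c.chiL N.p) e1)
  refine (map_ctr c.theta 𝕀 N.p _).trans ?_
  generalize ((reg h).tensor N.zero).rho g ((1 : S h) ⊗ₜ m) = t
  induction t using TensorProduct.induction_on with
  | tmul l m => rfl
  | _ => simp only [map_zero, map_add, *]

/-- The object underlying the module. -/
@[reducible] def obj : SF h := ⟨N.zero, N.one.toSVect⟩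

/-- The action of `T` on sector 1, `g ⊗ t ⊗ y ↦ t g q(y)`. -/
def a11 : S h ⊗[ℂ] (ℂ ⊗[ℂ] N.one.V) →ₗ[ℂ] N.zero.V :=
  TensorProduct.lift N.zero.rho.toLinearMap ∘ₗ map 𝕀 (N.q ∘ₗ (lid ℂ N.one.V).toLinearMap)

lemma a11_tmul (g : S h) (t : ℂ) (y : N.one.V) :
    N.a11 (g ⊗ₜ (t ⊗ₜ y)) = t • N.zero.rho g (N.q y) := by
  change N.zero.rho g (N.q (t • y)) = _
  rw [map_smul, map_smul]

/-- The action of `L` on sector 1, `l ⊗ y ↦ j(l) y`. -/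
def a01 : c.L.V ⊗[ℂ] N.one.V →ₗ[ℂ] N.one.V :=
  TensorProduct.lift (N.one.rho.toLinearMap ∘ₗ c.j)

lemma a01_tmul (l : c.L.V) (y : N.one.V) : N.a01 (l ⊗ₜ y) = N.one.rho (c.j l) y := rfl

/-- The action of `H(f)`. -/
def act : LMap (c.O.car.star h N.obj.car) N.obj.car :=
  (LinearMap.coprod N.a00 N.a11,
    LinearMap.coprod N.a01 (N.p ∘ₗ (lid ℂ N.zero.V).toLinearMap))

lemma act_zero_l (t : c.L.V ⊗[ℂ] N.zero.V) : N.act.1 (t, 0) = N.a00 t :=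
  coprod_l N.a00 N.a11 t

lemma act_zero_r (g : S h) (t : ℂ) (y : N.one.V) :
    N.act.1 (0, g ⊗ₜ (t ⊗ₜ y)) = t • N.zero.rho g (N.q y) :=
  (coprod_r N.a00 N.a11 _).trans (N.a11_tmul g t y)

lemma act_one_l (l : c.L.V) (y : N.one.V) : N.act.2 (l ⊗ₜ y, 0) = N.one.rho (c.j l) y :=
  coprod_l N.a01 _ _

lemma act_one_r (t : ℂ) (m : N.zero.V) : N.act.2 (0, t ⊗ₜ m) = t • N.p m :=
  (coprod_r N.a01 _ _).trans (map_smul N.p t m)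

include hβ in
lemma act_mem : N.act ∈ homs (c.O.star N.obj) N.obj := by
  refine ⟨fun v => ?_, fun a v => ?_, fun v => ?_⟩
  · refine LinearMap.congr_fun (f := N.act.1 ∘ₗ (c.O.star N.obj).zero.par)
      (g := N.obj.zero.par ∘ₗ N.act.1) (star_ext₀ (X := c.O.car) (Y := N.obj.car) (h := h)
        (fun x y => ?_) fun g x y => ?_) v
    · have e1 := star_par_zero_l c.O N.obj (x ⊗ₜ y)
      refine (congrArg N.act.1 e1).trans ((N.act_zero_l _).trans ?_)
      exact (N.a00_par (x ⊗ₜ y)).trans (congrArg N.zero.par (N.act_zero_l _).symm)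
    · have e1 := star_par_zero_r c.O N.obj (g ⊗ₜ (x ⊗ₜ y))
      refine (congrArg N.act.1 e1).trans ((N.act_zero_r _ _ _).trans ?_)
      refine Eq.trans ?_ (congrArg N.zero.par (N.act_zero_r _ _ _).symm)
      rw [map_smul, par_rho, ← N.q_par]
      rfl
  · refine LinearMap.congr_fun (f := N.act.1 ∘ₗ (c.O.star N.obj).zero.act a)
      (g := N.obj.zero.act a ∘ₗ N.act.1) (star_ext₀ (X := c.O.car) (Y := N.obj.car) (h := h)
        (fun x y => ?_) fun g x y => ?_) v
    · have e1 : (c.O.star N.obj).zero.act a (x ⊗ₜ y, 0) = ((c.L.tensor N.zero).act a (x ⊗ₜ y), 0) := by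
        rw [star_act c.O N.obj, map_zero]
      refine (congrArg N.act.1 e1).trans ((N.act_zero_l _).trans ?_)
      exact (N.a00_act a (x ⊗ₜ y)).trans (congrArg (N.zero.act a) (N.act_zero_l _).symm)
    · have e1 : (c.O.star N.obj).zero.act a (0, g ⊗ₜ (x ⊗ₜ y)) = (0, (ι ℂ a * g) ⊗ₜ (x ⊗ₜ y)) := by
        rw [star_act c.O N.obj, map_zero]
        rfl
      refine (congrArg N.act.1 e1).trans ((N.act_zero_r _ _ _).trans ?_)
      refine Eq.trans ?_ (congrArg (N.zero.act a) (N.act_zero_r _ _ _).symm)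
      rw [map_smul, rho_ι_mul]
  · refine LinearMap.congr_fun (f := N.act.2 ∘ₗ (c.O.star N.obj).one.par)
      (g := N.obj.one.par ∘ₗ N.act.2) (star_ext₁ (X := c.O.car) (Y := N.obj.car) (h := h)
        (fun x y => ?_) fun x y => ?_) v
    · have e1 := star_par_one_l c.O N.obj (x ⊗ₜ y)
      refine (congrArg N.act.2 e1).trans ((N.act_one_l _ _).trans ?_)
      refine Eq.trans ?_ (congrArg N.one.par (N.act_one_l _ _).symm)
      rw [j_par P c hβ, par_rho]
    · have e1 := star_par_one_r c.O N.obj (x ⊗ₜ y)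
      refine (congrArg N.act.2 e1).trans ((N.act_one_r _ _).trans ?_)
      refine Eq.trans ?_ (congrArg N.one.par (N.act_one_r _ _).symm)
      rw [map_smul, N.p_par]
      rfl

end Core

end Cores

section StarHoms

variable {h : Type} [AddCommGroup h] [Module ℂ h] [FiniteDimensional ℂ h]

lemma star_mem_homs {X X' Y Y' : SF h} {k : LMap X.car X'.car} {l : LMap Y.car Y'.car}
    (hk : k ∈ homs X X') (hl : l ∈ homs Y Y') : k.star h l ∈ homs (X.star Y) (X'.star Y') := by
  refine ⟨fun v => ?_, fun a v => ?_, fun v => ?_⟩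
  · exact Prod.ext (isEven_map (X := X.zero.toSVect) (Y := Y.zero.toSVect) hk.1 hl.1 v.1)
      (isEven_map_right ((reg h).toSVect) (Y := X.one.tensor Y.one) (isEven_map (X := X.one) (Y := Y.one) hk.2.2 hl.2.2) v.2)
  · exact Prod.ext (intertwines_map (X := X.zero) (Y := Y.zero) hk.2.1 hk.1 hl.2.1 a v.1)
      (intertwines_map_right (reg h) (Y := (X.one.tensor Y.one).triv h) (Y' := (X'.one.tensor Y'.one).triv h) (fun _ _ => map_zero (map k.2 l.2)) a v.2)
  · exact Prod.ext (isEven_map (X := X.zero.toSVect) (Y := Y.one) hk.1 hl.2.2 v.1)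
      (isEven_map (X := X.one) (Y := Y.zero.toSVect) hk.2.2 hl.1 v.2)

end StarHoms

section

variable {h : Type} [AddCommGroup h] [Module ℂ h] [FiniteDimensional ℂ h]
variable {D : SympData h} {f : Submodule ℂ h}

variable (D) in
lemma gam_triv_tensor (s : ℂ) (X W : SRep h) {Y : SVect} {y : Y.V} (hy : Y.par y = y)
    (t : X.V ⊗[ℂ] W.V) :
    map ((mk ℂ X.V Y.V).flip y) 𝕀 (D.gam s X W t) = D.gam s (X.tensor (Y.triv h)) W
        (map ((mk ℂ X.V Y.V).flip y) 𝕀 t) := by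
  refine gexp_nat D s (k := map ((mk ℂ X.V Y.V).flip y) 𝕀)
    (fun b a v => ?_) t
  induction v with
  | tmul l m =>
    rw [Fam.r_tmul, Fam.l_tmul, map_tmul, map_tmul, Fam.r_tmul, Fam.l_tmul, tensor_triv_act]
    change (X.act b (X.par l) ⊗ₜ y) ⊗ₜ W.act a m = (X.act b (X.par l) ⊗ₜ Y.par y) ⊗ₜ W.act a m
    rw [hy]
  | _ => simp only [map_zero, map_add, *]

variable (D) in
lemma gam_tensor_triv (s : ℂ) (X W : SRep h) {Y : SVect} {y : Y.V} (hy : Y.par y = y) (Z : SVect)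
    (z : Z.V) (t : X.V ⊗[ℂ] W.V) :
    map ((mk ℂ X.V Y.V).flip y) ((mk ℂ W.V Z.V).flip z)
        (D.gam s X W t) =
      D.gam s (X.tensor (Y.triv h)) (W.tensor (Z.triv h))
        (map ((mk ℂ X.V Y.V).flip y) ((mk ℂ W.V Z.V).flip z)
          t) := by
  refine gexp_nat D s (k := map ((mk ℂ X.V Y.V).flip y)
    ((mk ℂ W.V Z.V).flip z)) (fun b a v => ?_) t
  induction v with
  | tmul l m =>
    rw [Fam.r_tmul, Fam.l_tmul, map_tmul, map_tmul, Fam.r_tmul, Fam.l_tmul,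
      tensor_triv_act, tensor_triv_act]
    change (X.act b (X.par l) ⊗ₜ y) ⊗ₜ (W.act a m ⊗ₜ z) =
      (X.act b (X.par l) ⊗ₜ Y.par y) ⊗ₜ (W.act a m ⊗ₜ z)
    rw [hy]
  | _ => simp only [map_zero, map_add, *]

lemma ctrR_gam (c : HChoice D f) (l : c.L.V) :
    ctrR 𝕀 c.chiL (D.gam 1 (reg h) c.L ((1 : S h) ⊗ₜ l)) = c.j l := by
  have e1 : (reg h).toSVect.flip c.L.toSVect ((1 : S h) ⊗ₜ l) = l ⊗ₜ (1 : S h) :=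
    flip_tmul_of_even (map_one invol) l
  have e2 := ctr_flip (X := (reg h).toSVect) (Y := c.L.toSVect) (chiL_par c) 𝕀
    (D.gam 1 (reg h) c.L ((1 : S h) ⊗ₜ l))
  rw [← e2, gam_flip, e1]
  rfl

/-- The algebra `H(f)`, as a core. -/
@[reducible] def hCore (P : Polarization D f) (c : HChoice D f) (hβ : D.β = 1) : Core P c where
  zero := c.L
  one := unitSVect.triv h
  one_r _ _ := rfl
  p := c.chiL
  q := LinearMap.toSpanSingleton ℂ c.L.V (c.M 1)
  a00 := c.mul00
  p_par := chiL_par c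
  p_act u hu m := by
    rw [L_act_of_mem P c hu, map_zero]
    rfl
  sep m hm := by
    refine Subtype.ext (eq_zero_of_chi_mul c fun g => ?_)
    have := hm g
    obtain ⟨x, rfl⟩ := exists_M c m
    rw [L_rho_M] at this
    rw [M_coe, ← mul_assoc]
    exact this
  a00_act := intertwines_mul00 P c hβ
  a00_par := isEven_mul00 P c hβ
  p_a00 := chiL_mul00 P c hβ
  q_par y := by
    change y • c.M 1 = c.L.par (y • c.M 1)
    rw [map_smul, ← isEven_M c hβ]
    exact congrArg (fun z => y • c.M z) (map_one invol).symm
  p_q g y := by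
    rw [rho_triv]
    change c.chiL (c.L.rho g (y • c.M 1)) = counit h (c.E g) • y
    rw [map_smul, map_smul, counit_E, L_rho_M, mul_one, chiL_apply, chi_M, smul_eq_mul, smul_eq_mul,
      mul_comm]

lemma hCore_act (P : Polarization D f) (c : HChoice D f) (hβ : D.β = 1) :
    (hCore P c hβ).act = c.mul := by
  refine Prod.ext (star_ext₀ (X := c.O.car) (Y := c.O.car) (fun x y => ?_) fun g x y => ?_)
    (star_ext₁ (X := c.O.car) (Y := c.O.car) (fun x y => ?_) fun x y => ?_)
  · exact ((hCore P c hβ).act_zero_l _).trans (mul_zero_l c _).symm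
  · refine ((hCore P c hβ).act_zero_r g x y).trans (Eq.trans ?_ (mul_zero_r c g x y).symm)
    change x • c.L.rho g (y • c.M 1) = _
    rw [map_smul, L_rho_M, mul_one, smul_smul]
  · refine ((hCore P c hβ).act_one_l x y).trans (Eq.trans ?_ (mul_one_l c x y).symm)
    rw [rho_triv]
    change counit h (c.j x) • y = _
    rw [counit_j P c hβ, smul_eq_mul]
  · exact ((hCore P c hβ).act_one_r x y).trans (mul_one_r c x y).symm

lemma mul_mem (P : Polarization D f) (c : HChoice D f) (hβ : D.β = 1) :
    c.mul ∈ homs (c.O.star c.O) c.O := by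
  rw [← hCore_act P c hβ]
  exact (hCore P c hβ).act_mem hβ

namespace Core

variable {P : Polarization D f} {c : HChoice D f} (N : Core P c) (hβ : D.β = 1)

include hβ in
lemma a00_a00 (x y : c.L.V) (z : N.zero.V) :
    N.a00 (x ⊗ₜ N.a00 (y ⊗ₜ z)) = N.a00 (c.mul00 (x ⊗ₜ y) ⊗ₜ z) := by
  refine N.sep_ext (X := c.L.tensor (c.L.tensor N.zero))
    (A := N.a00 ∘ₗ map 𝕀 N.a00)
    (B := N.a00 ∘ₗ map c.mul00 𝕀 ∘ₗ
      (assoc ℂ c.L.V c.L.V N.zero.V).symm.toLinearMap) (fun a t => ?_) (fun a t => ?_)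
    (fun t => ?_) (x ⊗ₜ (y ⊗ₜ z))
  · have := intertwines_map_right c.L N.a00_act a t
    exact (congrArg N.a00 this).trans (N.a00_act a _)
  · have e1 := intertwines_assoc_symm c.L c.L N.zero a t
    have e2 := intertwines_map_left N.zero (intertwines_mul00 P c hβ) (isEven_mul00 P c hβ) a ((assoc ℂ c.L.V c.L.V N.zero.V).symm t)
    exact (congrArg (fun w => N.a00 (map c.mul00 𝕀 w)) e1).trans
      ((congrArg N.a00 e2).trans (N.a00_act a _))
  · simp only [LinearMap.comp_apply]
    rw [N.p_a00', N.p_a00']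
    induction t using TensorProduct.induction_on with
    | tmul x t =>
      induction t using TensorProduct.induction_on with
      | zero => rw [tmul_zero]; simp only [map_zero]
      | add s t hs ht => rw [tmul_add]; simp only [map_add, hs, ht]
      | tmul y z =>
        rw [map_tmul, ctr_tmul, N.p_a00, LinearEquiv.coe_coe, assoc_symm_tmul,
          map_tmul, ctr_tmul, chiL_mul00 P c hβ, mul_smul]
        rfl
    | _ => simp_all [add_tmul, tmul_add]

include hβ in
lemma p_rho_j (l : c.L.V) (m : N.zero.V) :
    ctr c.chiL N.p (D.gam 1 c.L N.zero (l ⊗ₜ m)) = N.one.rho (c.j l) (N.p m) := by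
  rw [← mr_j P c hβ, ← p_rho_mr, mr_j P c hβ, rho_j]
  exact (map_ctr c.chiL 𝕀 N.p _).symm

set_option maxHeartbeats 600000 in
include hβ in
lemma act_assoc : N.act.comp ((LMap.id c.O.car).star h N.act) =
    (N.act.comp (c.mul.star h (LMap.id N.obj.car))).comp (D.assoc c.O c.O N.obj) := by
  have hL : N.act.comp ((LMap.id c.O.car).star h N.act) ∈ homs (c.O.star (c.O.star N.obj)) N.obj :=
    comp_mem_homs (Y := c.O.star N.obj) (N.act_mem hβ) (star_mem_homs (id_mem_homs c.O) (N.act_mem hβ))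
  have hR : N.act.comp (c.mul.star h (LMap.id N.obj.car)) ∈ homs ((c.O.star c.O).star N.obj) N.obj :=
    comp_mem_homs (Y := c.O.star N.obj) (N.act_mem hβ)
      (star_mem_homs (mul_mem P c hβ) (id_mem_homs N.obj))
  refine Prod.ext (star_star_ext_equivariant (X := c.O) (Y := c.O) (Z := N.obj) (Q := N.obj) hL.2.1
    (fun a v => ?_) (fun x y z => ?_) (fun x y z => ?_) (fun x y z => ?_) fun x y z => ?_)
    (star_star_ext₁ (X := c.O.car) (Y := c.O.car) (Z := N.obj.car) (h := h) (fun x y z => ?_)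
      (fun x y z => ?_) (fun x y z => ?_) fun g x y z => ?_)
  · exact (congrArg (N.act.comp (c.mul.star h (LMap.id N.obj.car))).1
      (intertwines_assoc_star D c.O c.O N.obj a v)).trans (hR.2.1 a _)
  · refine Eq.trans (b := N.a00 (x ⊗ₜ N.a00 (y ⊗ₜ z))) ?_ ((N.a00_a00 hβ x y z).trans ?_)
    · rw [comp_fst, star_fst_l, map_tmul]
      refine (N.act_zero_l _).trans ?_
      exact congrArg (fun w => N.a00 (x ⊗ₜ w)) (N.act_zero_l _)
    · rw [comp_fst, assoc_000, comp_fst, star_fst_l, map_tmul]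
      refine Eq.symm ((N.act_zero_l _).trans ?_)
      exact congrArg (fun w => N.a00 (w ⊗ₜ z)) (mul_zero_l c _)
  · refine Eq.trans (b := N.a00 (x ⊗ₜ N.q (y • z))) ?_ ((N.a00_q hβ x (y • z)).trans ?_)
    · rw [comp_fst, star_fst_l, map_tmul]
      refine (N.act_zero_l _).trans ?_
      refine congrArg (fun w => N.a00 (x ⊗ₜ w)) ((N.act_zero_r _ _ _).trans ?_)
      rw [rho_one, map_smul]
    · rw [comp_fst, assoc_011, assoc011_one, comp_fst, map_tmul, star_fst_r,
        map_tmul, map_tmul, map_tmul]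
      refine Eq.symm ((congrArg (fun w => N.act.1 (0, (1 : S h) ⊗ₜ (w ⊗ₜ z))) (mul_one_l c x y)).trans ?_)
      refine (N.act_zero_r _ _ _).trans ?_
      rw [rho_one, map_smul, smul_smul]
  · let T : S h ⊗[ℂ] c.L.V →ₗ[ℂ] (S h ⊗[ℂ] ℂ) ⊗[ℂ] (c.L.V ⊗[ℂ] N.one.V) :=
      map ((TensorProduct.mk ℂ (S h) ℂ).flip x) ((TensorProduct.mk ℂ c.L.V N.one.V).flip z)
    have e1 : D.gam 1 ((reg h).tensor (unitSVect.triv h)) (c.L.tensor (N.one.toSVect.triv h))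
        ((1 ⊗ₜ x) ⊗ₜ (y ⊗ₜ z)) = T (D.gam 1 (reg h) c.L ((1 : S h) ⊗ₜ y)) :=
      (gam_tensor_triv D 1 (reg h) c.L (Y := unitSVect) (y := x) rfl N.one.toSVect z ((1 : S h) ⊗ₜ y)).symm
    let U : (S h ⊗[ℂ] ℂ) ⊗[ℂ] (c.L.V ⊗[ℂ] N.one.V) →ₗ[ℂ] N.zero.V :=
      (N.act.comp (c.mul.star h (LMap.id N.obj.car))).1 ∘ₗ LinearMap.inr ℂ _ _ ∘ₗ
        map 𝕀 (map (LinearMap.inr ℂ _ _) 𝕀) ∘ₗ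
        map 𝕀 (assocTriv ℂ c.L.V N.one.V) ∘ₗ
        (assoc ℂ (S h) ℂ (c.L.V ⊗[ℂ] N.one.V)).toLinearMap
    have e2 : ∀ t, U (T t) = x • N.zero.rho (ctrR 𝕀 c.chiL t) (N.q z) := fun t => by
      induction t with
      | zero => simp only [map_zero, LinearMap.zero_apply, smul_zero]
      | add s t hs ht => simp only [map_add, LinearMap.add_apply, smul_add, hs, ht]
      | tmul g l =>
        change (N.act.comp (c.mul.star h (LMap.id N.obj.car))).1 (0, g ⊗ₜ ((0, x ⊗ₜ l) ⊗ₜ z)) =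
          x • N.zero.rho (c.chiL l • g) (N.q z)
        rw [comp_fst, star_fst_r, map_tmul, map_tmul]
        refine (congrArg (fun w => N.act.1 (0, g ⊗ₜ (w ⊗ₜ z))) (mul_one_r c x l)).trans ?_
        refine (N.act_zero_r _ _ _).trans ?_
        rw [map_smul, LinearMap.smul_apply, smul_smul]
    refine Eq.trans (b := x • N.q (N.one.rho (c.j y) z)) ?_ (Eq.trans ?_ (congrArg
      (N.act.comp (c.mul.star h (LMap.id N.obj.car))).1 (assoc_101 D c.O c.O N.obj 1 x (y ⊗ₜ z))).symm)
    · rw [comp_fst, star_fst_r, map_tmul, map_tmul]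
      refine (congrArg (fun w => N.act.1 (0, (1 : S h) ⊗ₜ (x ⊗ₜ w))) (N.act_one_l _ _)).trans ?_
      refine (N.act_zero_r _ _ _).trans ?_
      rw [rho_one]
    · have e3 := e2 (D.gam 1 (reg h) c.L ((1 : S h) ⊗ₜ y))
      rw [ctrR_gam, ← mr_j P c hβ, ← N.q_rho_mr hβ, mr_j P c hβ] at e3
      rw [assoc101_apply, e1]
      exact e3.symm
  · refine Eq.trans (b := (x * y) • N.q (N.p z)) ?_ ?_
    · rw [comp_fst, star_fst_r, map_tmul, map_tmul]
      refine (congrArg (fun w => N.act.1 (0, (1 : S h) ⊗ₜ (x ⊗ₜ w))) (N.act_one_r _ _)).trans ?_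
      refine (N.act_zero_r _ _ _).trans ?_
      rw [rho_one, map_smul, smul_smul]
    · rw [comp_fst, assoc_110, assoc110_one, comp_fst, map_tmul, star_fst_l, map_tmul, N.q_p hβ]
      refine Eq.symm ((congrArg (fun w => N.act.1 (w ⊗ₜ z, 0)) (mul_zero_r c 1 x y)).trans ?_)
      refine (N.act_zero_l _).trans ?_
      rw [← smul_tmul', map_smul]
  · refine Eq.trans (b := N.one.rho (c.j x) (N.one.rho (c.j y) z)) ?_ ?_
    · rw [comp_snd, star_snd_l, map_tmul]
      refine (congrArg (fun w => N.act.2 (x ⊗ₜ w, 0)) (N.act_one_l _ _)).trans ?_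
      exact N.act_one_l _ _
    · rw [comp_snd, assoc_001, comp_snd, star_snd_l, map_tmul, ← rho_j_mul00 P c hβ]
      refine Eq.symm ((congrArg (fun w => N.act.2 (w ⊗ₜ z, 0)) (mul_zero_l c _)).trans ?_)
      exact N.act_one_l _ _
  · let T : c.L.V ⊗[ℂ] N.zero.V →ₗ[ℂ] (c.L.V ⊗[ℂ] ℂ) ⊗[ℂ] N.zero.V :=
      map ((TensorProduct.mk ℂ c.L.V ℂ).flip y) 𝕀
    have e1 : D.gam 1 (c.L.tensor (unitSVect.triv h)) N.zero ((x ⊗ₜ y) ⊗ₜ z) =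
        T (D.gam 1 c.L N.zero (x ⊗ₜ z)) :=
      (gam_triv_tensor D 1 c.L N.zero (Y := unitSVect) (y := y) rfl (x ⊗ₜ z)).symm
    let U : (c.L.V ⊗[ℂ] ℂ) ⊗[ℂ] N.zero.V →ₗ[ℂ] N.one.V :=
      (N.act.comp (c.mul.star h (LMap.id N.obj.car))).2 ∘ₗ LinearMap.inr ℂ _ _ ∘ₗ
        map (LinearMap.inl ℂ _ _) 𝕀
    have e2 : ∀ t, U (T t) = y • ctr c.chiL N.p t := fun t => by
      induction t with
      | tmul l m =>
        change (N.act.comp (c.mul.star h (LMap.id N.obj.car))).2 (0, (l ⊗ₜ y, 0) ⊗ₜ m) =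
          y • c.chiL l • N.p m
        rw [comp_snd, star_snd_r, map_tmul]
        refine (congrArg (fun w => N.act.2 (0, w ⊗ₜ m)) (mul_one_l c l y)).trans ?_
        refine (N.act_one_r _ _).trans ?_
        rw [smul_smul, mul_comm]
      | _ => simp_all [add_tmul, tmul_add]
    refine Eq.trans (b := y • N.one.rho (c.j x) (N.p z)) ?_ (Eq.trans ?_ (congrArg
      (N.act.comp (c.mul.star h (LMap.id N.obj.car))).2 (assoc_010 D c.O c.O N.obj x (y ⊗ₜ z))).symm)
    · rw [comp_snd, star_snd_l, map_tmul]
      refine (congrArg (fun w => N.act.2 (x ⊗ₜ w, 0)) (N.act_one_r _ _)).trans ?_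
      refine (N.act_one_l _ _).trans ?_
      rw [map_smul]
    · have e3 := e2 (D.gam 1 c.L N.zero (x ⊗ₜ z))
      rw [N.p_rho_j hβ] at e3
      rw [assoc010_apply, e1]
      exact e3.symm
  · refine Eq.trans (b := (x * c.chiL y) • N.p z) ?_ ?_
    · rw [comp_snd, star_snd_r, map_tmul]
      refine (congrArg (fun w => N.act.2 (0, x ⊗ₜ w)) (N.act_zero_l _)).trans ?_
      refine (N.act_one_r _ _).trans ?_
      rw [N.p_a00, smul_smul]
    · rw [comp_snd, assoc_100, comp_snd, star_snd_r, map_tmul]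
      refine Eq.symm ((congrArg (fun w => N.act.2 (0, w ⊗ₜ z)) (mul_one_r c x y)).trans ?_)
      exact N.act_one_r _ _
  · refine Eq.trans (b := (x * y) • N.one.rho (c.E g) z) ?_ (Eq.trans ?_ (congrArg
      (N.act.comp (c.mul.star h (LMap.id N.obj.car))).2 (assoc_111 D c.O c.O N.obj x (g ⊗ₜ (y ⊗ₜ z)))).symm)
    · rw [comp_snd, star_snd_r, map_tmul]
      have e0 := N.act_zero_r g y z
      refine (congrArg (fun w : N.zero.V => N.act.2 (0, x ⊗ₜ[ℂ] w)) e0).trans ?_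
      refine (N.act_one_r _ _).trans ?_
      rw [map_smul, N.p_q, smul_smul]
    · have e1 := flip_tmul_of_even (X := unitSVect) (Y := (reg h).toSVect) (x := x) rfl g
      rw [assoc111_apply, e1]
      change _ = (N.act.comp (c.mul.star h (LMap.id N.obj.car))).2 ((0, D.phi g ⊗ₜ (x ⊗ₜ y)) ⊗ₜ z, 0)
      rw [comp_snd, star_snd_l, map_tmul]
      refine Eq.symm ((congrArg (fun w => N.act.2 (w ⊗ₜ z, 0)) (mul_zero_r c _ x y)).trans ?_)
      refine (N.act_one_l _ _).trans ?_
      rw [map_smul, map_smul, LinearMap.smul_apply, j_M_phi P c hβ]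

/-- The module determined by a core. -/
def toMod : Mod D c.H where
  obj := N.obj
  act := N.act
  act_mem := N.act_mem hβ
  assoc := N.act_assoc hβ
  unit_zero x := (N.act_zero_l _).trans (N.a00_e x)
  unit_one x := (N.act_one_l _ _).trans
    ((congrArg (fun g => N.one.rho g x) (j_e c)).trans (rho_one _ _))

end Core

/-- `H(f)` is an algebra in `SF(h)`. -/
lemma isAlgebra_H (P : Polarization D f) (c : HChoice D f) (hβ : D.β = 1) : c.H.IsAlgebra D where
  mul_mem := mul_mem P c hβ
  par_unit := L_par_e c
  act_unit := L_act_e c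
  assoc := by
    have := (hCore P c hβ).act_assoc hβ
    rw [hCore_act] at this
    exact this
  unit_mul_zero x := (mul_zero_l c _).trans ((hCore P c hβ).a00_e x)
  unit_mul_one x := (mul_one_l c _ _).trans ((congrArg (fun r : ℂ => (r • x : ℂ)) (chi_e c)).trans (one_smul ℂ x))
  mul_unit_zero x := (mul_zero_l c _).trans (mul00_e P c hβ x)
  mul_unit_one x := by
    refine (mul_one_r c _ _).trans ((mul_comm _ _).trans ?_)
    exact (congrArg (fun r : ℂ => (r • x : ℂ)) (chi_e c)).trans (one_smul ℂ x)

/-- The maps `F : S(h) → V` that commute with the action of `f`. -/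
def coindSub (f : Submodule ℂ h) (V : SRep h) : Submodule ℂ (S h →ₗ[ℂ] V.V) where
  carrier := {F | ∀ u ∈ f, ∀ g, F (ι ℂ u * g) = V.act u (F g)}
  add_mem' {F G} hF hG u hu g := by rw [LinearMap.add_apply, LinearMap.add_apply, hF u hu, hG u hu, map_add]
  zero_mem' u hu g := by rw [LinearMap.zero_apply, LinearMap.zero_apply, map_zero]
  smul_mem' r F hF u hu g := by rw [LinearMap.smul_apply, LinearMap.smul_apply, hF u hu, map_smul]

/-- The coinduced representation, with `(a F)(g) = F(g a)`. -/
@[reducible] def coind (f : Submodule ℂ h) (V : SRep h) : SRep h where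
  V := coindSub f V
  par := LinearMap.restrict
    ((LinearMap.compRight ℂ V.par) ∘ₗ LinearMap.lcomp ℂ V.V invol.toLinearMap) fun F hF u hu g => by
      change V.par (F (invol (ι ℂ u * g))) = V.act u (V.par (F (invol g)))
      rw [invol_ι_mul, map_neg, hF u hu, V.act_par, map_neg]
  par_par F := Subtype.ext (LinearMap.ext fun g => by
    change V.par (V.par (F.1 (invol (invol g)))) = F.1 g
    rw [V.par_par, invol_invol])
  act :=
    { toFun := fun a => LinearMap.restrict (LinearMap.lcomp ℂ V.V (LinearMap.mulRight ℂ (ι ℂ a)))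
        fun F hF u hu g => by
          change F (ι ℂ u * g * ι ℂ a) = V.act u (F (g * ι ℂ a))
          rw [mul_assoc, hF u hu]
      map_add' := fun a b => LinearMap.ext fun F => Subtype.ext (LinearMap.ext fun g => by
        change F.1 (g * ι ℂ (a + b)) = F.1 (g * ι ℂ a) + F.1 (g * ι ℂ b)
        rw [map_add, mul_add, map_add])
      map_smul' := fun r a => LinearMap.ext fun F => Subtype.ext (LinearMap.ext fun g => by
        change F.1 (g * ι ℂ (r • a)) = r • F.1 (g * ι ℂ a)
        rw [map_smul, mul_smul_comm, map_smul]) }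
  act_act a F := Subtype.ext (LinearMap.ext fun g => by
    change F.1 (g * ι ℂ a * ι ℂ a) = 0
    rw [mul_assoc, ExteriorAlgebra.ι_sq_zero, mul_zero, map_zero])
  act_par a F := Subtype.ext (LinearMap.ext fun g => by
    change V.par (F.1 (invol (g * ι ℂ a))) = -V.par (F.1 (invol g * ι ℂ a))
    rw [map_mul, invol_ι, mul_neg, map_neg, map_neg])

lemma coind_act_apply (V : SRep h) (a : h) (F : (coind f V).V) (g : S h) :
    ((coind f V).act a F).1 g = F.1 (g * ι ℂ a) := rfl

lemma coind_par_apply (V : SRep h) (F : (coind f V).V) (g : S h) :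
    ((coind f V).par F).1 g = V.par (F.1 (invol g)) := rfl

lemma coind_rho_apply (V : SRep h) (z : S h) (F : (coind f V).V) (g : S h) :
    ((coind f V).rho z F).1 g = F.1 (g * z) := by
  induction z using S.induction generalizing g with
  | halg r =>
    rw [rho_algebraMap, algebraMap_eq_smul_one, mul_smul_comm, mul_one, map_smul]
    rfl
  | hadd z z' hz hz' =>
    rw [map_add, mul_add, map_add, ← hz, ← hz']
    rfl
  | hmul a z hz => rw [rho_ι_mul, coind_act_apply, hz, mul_assoc]

/-- The map to a coinduced representation determined by an `f`-equivariant map. -/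
def coindLift {V X : SRep h} (k : X.V →ₗ[ℂ] V.V) (hk : ∀ u ∈ f, ∀ x, k (X.act u x) = V.act u (k x)) :
    X.V →ₗ[ℂ] (coind f V).V :=
  LinearMap.codRestrict (coindSub f V)
    { toFun := fun x => k ∘ₗ X.orb x
      map_add' := fun x y => LinearMap.ext fun g => by
        change k (X.rho g (x + y)) = k (X.rho g x) + k (X.rho g y)
        rw [map_add, map_add]
      map_smul' := fun r x => LinearMap.ext fun g => by
        change k (X.rho g (r • x)) = r • k (X.rho g x)
        rw [map_smul, map_smul] }
    fun x u hu g => by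
      change k (X.rho (ι ℂ u * g) x) = _
      rw [rho_ι_mul, hk u hu]
      rfl

lemma coindLift_apply {V X : SRep h} (k : X.V →ₗ[ℂ] V.V)
    (hk : ∀ u ∈ f, ∀ x, k (X.act u x) = V.act u (k x)) (x : X.V) (g : S h) :
    (coindLift k hk x).1 g = k (X.rho g x) := rfl

lemma intertwines_coindLift {V X : SRep h} (k : X.V →ₗ[ℂ] V.V)
    (hk : ∀ u ∈ f, ∀ x, k (X.act u x) = V.act u (k x)) : Intertwines X (coind f V) (coindLift k hk) :=
  fun a x => Subtype.ext (LinearMap.ext fun g => by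
    rw [coind_act_apply, coindLift_apply, coindLift_apply, rho_mul, rho_ι])

lemma isEven_coindLift {V X : SRep h} (k : X.V →ₗ[ℂ] V.V)
    (hk : ∀ u ∈ f, ∀ x, k (X.act u x) = V.act u (k x)) (hp : IsEven X.toSVect V.toSVect k) :
    IsEven X.toSVect (coind f V).toSVect (coindLift k hk) :=
  fun x => Subtype.ext (LinearMap.ext fun g => by
    rw [coind_par_apply, coindLift_apply, coindLift_apply, rho_par, hp])

/-- The core with a given sector 1. -/
@[reducible] def coindCore (P : Polarization D f) (c : HChoice D f) (hβ : D.β = 1) (V : SRep h)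
    (hV : ∀ a v, V.act (P.r a) v = V.act a v) : Core P c where
  zero := coind f V
  one := V
  one_r := hV
  p := LinearMap.applyₗ 1 ∘ₗ (coindSub f V).subtype
  q := LinearMap.codRestrict (coindSub f V)
    { toFun := fun y => V.orb y ∘ₗ c.E
      map_add' := fun x y => LinearMap.ext fun g => by
        change V.rho (c.E g) (x + y) = V.rho (c.E g) x + V.rho (c.E g) y
        rw [map_add]
      map_smul' := fun r x => LinearMap.ext fun g => by
        change V.rho (c.E g) (r • x) = r • V.rho (c.E g) x
        rw [map_smul] } fun y u hu g => by
      change V.rho (c.E (ι ℂ u * g)) y = _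
      rw [E_ι_mul P c hβ hu, rho_ι_mul]
      rfl
  a00 := coindLift (X := c.L.tensor (coind f V)) (ctr c.chiL (LinearMap.applyₗ 1 ∘ₗ (coindSub f V).subtype)) fun u hu t => by
    induction t using TensorProduct.induction_on with
    | tmul l F =>
      rw [tensor_act, L_act_of_mem P c hu, zero_tmul, zero_add, ctr_tmul, ctr_tmul, chiL_par, map_smul]
      have := F.2 u hu 1
      rw [mul_one] at this
      exact congrArg (c.chiL l • ·) ((congrArg F.1 (one_mul _)).trans this)
    | _ => simp only [map_zero, map_add, *]
  p_par F := by
    change V.par (F.1 (invol 1)) = V.par (F.1 1)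
    rw [map_one]
  p_act u hu F := by
    change F.1 (1 * ι ℂ u) = V.act u (F.1 1)
    rw [one_mul, ← F.2 u hu, mul_one]
  sep F hF := Subtype.ext (LinearMap.ext fun g => by
    have := hF g
    change ((coind f V).rho g F).1 1 = 0 at this
    rw [coind_rho_apply, one_mul] at this
    exact this)
  a00_act := intertwines_coindLift (X := c.L.tensor (coind f V)) _ _
  a00_par := isEven_coindLift (X := c.L.tensor (coind f V)) _ _ fun t => by
    induction t using TensorProduct.induction_on with
    | tmul l F =>
      rw [tensor_par, ctr_tmul, ctr_tmul, chiL_par, map_smul]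
      change _ • V.par (F.1 (invol 1)) = _ • V.par (F.1 1)
      rw [map_one]
    | _ => simp only [map_zero, map_add, *]
  p_a00 l F := by
    change ctr c.chiL _ ((c.L.tensor (coind f V)).rho 1 (l ⊗ₜ F)) = _
    rw [rho_one]
    rfl
  q_par y := Subtype.ext (LinearMap.ext fun g => by
    change V.rho (c.E g) (V.par y) = V.par (V.rho (c.E (invol g)) y)
    rw [E_invol c hβ, rho_par])
  p_q g y := by
    refine (coind_rho_apply V g _ 1).trans ?_
    rw [one_mul]
    rfl

namespace Core

variable {P : Polarization D f} {c : HChoice D f} (N : Core P c) (hβ : D.β = 1)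

/-- The module spanned by the image of `S(h) ⊗ N₁`. -/
def gen : Submodule ℂ N.zero.V := Submodule.span ℂ {m | ∃ g y, m = N.zero.rho g (N.q y)}

lemma gen_act (a : h) {m : N.zero.V} (hm : m ∈ N.gen) : N.zero.act a m ∈ N.gen := by
  induction hm using Submodule.span_induction with
  | mem m hm =>
    obtain ⟨g, y, rfl⟩ := hm
    rw [← rho_ι_mul]
    exact Submodule.subset_span ⟨_, _, rfl⟩
  | zero => rw [map_zero]; exact zero_mem _
  | add m m' _ _ hm hm' => rw [map_add]; exact add_mem hm hm'
  | smul r m _ hm => rw [map_smul]; exact Submodule.smul_mem _ r hm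

lemma gen_par {m : N.zero.V} (hm : m ∈ N.gen) : N.zero.par m ∈ N.gen := by
  induction hm using Submodule.span_induction with
  | mem m hm =>
    obtain ⟨g, y, rfl⟩ := hm
    rw [par_rho, ← N.q_par]
    exact Submodule.subset_span ⟨_, _, rfl⟩
  | zero => rw [map_zero]; exact zero_mem _
  | add m m' _ _ hm hm' => rw [map_add]; exact add_mem hm hm'
  | smul r m _ hm => rw [map_smul]; exact Submodule.smul_mem _ r hm

end Core

/-- An equivariant even map `κ : S(h) ⊗ X → Y` that maps `1 ⊗ X'` into a submodule `K` maps
`S(h) ⊗ X'` into it, for submodules `X' ⊆ X` and `K ⊆ Y`. -/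
lemma mem_of_one_tmul {X Y : SRep h} {κ : S h ⊗[ℂ] X.V →ₗ[ℂ] Y.V}
    (hκ : Intertwines ((reg h).tensor X) Y κ) (hp : IsEven ((reg h).tensor X).toSVect Y.toSVect κ)
    (X' : Submodule ℂ X.V) (K : Submodule ℂ Y.V) (hX : ∀ a, ∀ x ∈ X', X.act a x ∈ X')
    (hXp : ∀ x ∈ X', X.par x ∈ X') (hK : ∀ a, ∀ y ∈ K, Y.act a y ∈ K) (hKp : ∀ y ∈ K, Y.par y ∈ K)
    (h1 : ∀ x ∈ X', κ (1 ⊗ₜ x) ∈ K) (g : S h) (x : X.V) (hx : x ∈ X') : κ (g ⊗ₜ x) ∈ K := by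
  induction g using S.induction generalizing x with
  | halg r =>
    rw [algebraMap_eq_smul_one, ← smul_tmul', map_smul]
    exact K.smul_mem r (h1 x hx)
  | hadd g g' hg hg' => rw [add_tmul, map_add]; exact K.add_mem (hg x hx) (hg' x hx)
  | hmul a g hg =>
    have e1 := hκ a (g ⊗ₜ x)
    rw [tensor_act, map_add, reg_act, reg_par] at e1
    have e2 := hp (g ⊗ₜ X.par (X.act a x))
    rw [tensor_par, reg_par, X.par_par] at e2
    rw [eq_sub_of_add_eq e1, e2]
    exact K.sub_mem (hK a _ (hg x hx)) (hKp _ (hg _ (hXp _ (hX a _ hx))))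

namespace Core

variable {P : Polarization D f} {c : HChoice D f} (N : Core P c) (hβ : D.β = 1)

include hβ in
lemma gen_eq_top : N.gen = ⊤ := by
  rw [eq_top_iff]
  intro m _
  have e1 := mem_of_one_tmul (X := N.zero) (Y := N.zero)
    (κ := N.a00 ∘ₗ map c.M 𝕀) (fun a t => by
      have := intertwines_map_left N.zero (intertwines_M c) (isEven_M c hβ) a t
      exact (congrArg N.a00 this).trans (N.a00_act a _)) (fun t => by
      have := isEven_map_left N.zero.toSVect (isEven_M c hβ) t
      exact (congrArg N.a00 this).trans (N.a00_par _)) ⊤ N.gen (fun _ _ _ => trivial)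
    (fun _ _ => trivial) (fun a _ hm => N.gen_act a hm) (fun _ hm => N.gen_par hm) (fun x _ => by
      refine Submodule.subset_span ⟨1, N.p x, ?_⟩
      rw [rho_one, N.q_p hβ]
      rfl) (gOne P c) m trivial
  have e2 : (N.a00 ∘ₗ map c.M 𝕀) (gOne P c ⊗ₜ m) = m := by
    change N.a00 (c.M (gOne P c) ⊗ₜ m) = m
    rw [M_gOne, N.a00_e]
  rwa [e2] at e1

include hβ in
lemma gen_induction {C : N.zero.V → Prop} (h0 : C 0) (hadd : ∀ m m', C m → C m' → C (m + m'))
    (hq : ∀ g y, C (N.zero.rho g (N.q y))) (m : N.zero.V) : C m := by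
  have hm : m ∈ N.gen := by rw [N.gen_eq_top hβ]; trivial
  have key : ∀ r : ℂ, C (r • m) := by
    induction hm using Submodule.span_induction with
    | mem m hm => obtain ⟨g, y, rfl⟩ := hm; intro r; rw [← map_smul, ← map_smul]; exact hq _ _
    | zero => intro r; rw [smul_zero]; exact h0
    | add m m' _ _ hm hm' => intro r; rw [smul_add]; exact hadd _ _ (hm r) (hm' r)
    | smul s m _ hm => intro r; rw [smul_smul]; exact hm _
  rw [← one_smul ℂ m]
  exact key 1

/-- The comparison with the coinduced representation. -/
def toCoind : N.zero.V →ₗ[ℂ] (coind f N.one).V := coindLift N.p N.p_act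

lemma toCoind_injective : Function.Injective N.toCoind := by
  rw [injective_iff_map_eq_zero]
  intro m hm
  exact N.sep m fun g => congrArg (fun F : (coind f N.one).V => F.1 g) hm

include hβ in
lemma toCoind_surjective : Function.Surjective N.toCoind := fun F => by
  refine (coindCore P c hβ N.one N.one_r).gen_induction hβ (C := fun F => ∃ m, N.toCoind m = F)
    ⟨0, map_zero _⟩ ?_ (fun g y => ⟨N.zero.rho g (N.q y), ?_⟩) F
  · rintro _ _ ⟨m, rfl⟩ ⟨m', rfl⟩
    exact ⟨m + m', map_add _ _ _⟩
  · rw [toCoind, rho_natural (intertwines_coindLift _ _)]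
    congr 1
    exact Subtype.ext (LinearMap.ext fun g => N.p_q g y)

/-- Sector 0 is coinduced from sector 1. -/
def equivCoind : N.zero.V ≃ₗ[ℂ] (coind f N.one).V :=
  LinearEquiv.ofBijective N.toCoind ⟨N.toCoind_injective, N.toCoind_surjective hβ⟩

/-- The map to sector 0 determined by an `f`-equivariant map to sector 1. -/
def hat {X : SRep h} (k : X.V →ₗ[ℂ] N.one.V) (hk : ∀ u ∈ f, ∀ x, k (X.act u x) = N.one.act u (k x)) :
    X.V →ₗ[ℂ] N.zero.V := (N.equivCoind hβ).symm.toLinearMap ∘ₗ coindLift k hk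

variable {X : SRep h} (k : X.V →ₗ[ℂ] N.one.V) (hk : ∀ u ∈ f, ∀ x, k (X.act u x) = N.one.act u (k x))

lemma toCoind_hat (x : X.V) : N.toCoind (N.hat hβ k hk x) = coindLift k hk x :=
  (N.equivCoind hβ).apply_symm_apply _

lemma p_hat (x : X.V) : N.p (N.hat hβ k hk x) = k x := by
  have := congrArg (fun F : (coind f N.one).V => F.1 1) (N.toCoind_hat hβ k hk x)
  change N.p (N.zero.rho 1 _) = k (X.rho 1 x) at this
  rwa [rho_one, rho_one] at this

lemma intertwines_hat : Intertwines X N.zero (N.hat hβ k hk) := fun a x => by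
  apply N.toCoind_injective
  rw [toCoind_hat, intertwines_coindLift, ← N.toCoind_hat hβ k hk]
  exact (intertwines_coindLift N.p N.p_act a _).symm

lemma isEven_hat (hp : IsEven X.toSVect N.one.toSVect k) :
    IsEven X.toSVect N.zero.toSVect (N.hat hβ k hk) := fun x => by
  apply N.toCoind_injective
  rw [toCoind_hat, isEven_coindLift k hk hp, ← N.toCoind_hat hβ k hk]
  exact (isEven_coindLift N.p N.p_act N.p_par _).symm

end Core

end

section ModulesToCores

variable {h : Type} [AddCommGroup h] [Module ℂ h] [FiniteDimensional ℂ h]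
variable {D : SympData h} {f : Submodule ℂ h} {c : HChoice D f}

namespace Mod

variable (M : Mod D c.H)

/-- The action of `H(f)` on a module. -/
def actO : LMap (c.O.car.star h M.obj.car) M.obj.car := M.act

lemma actO_mem : M.actO ∈ SymplecticFermion.homs (c.O.star M.obj) M.obj := M.act_mem

lemma actO_assoc : M.actO.comp ((LMap.id c.O.car).star h M.actO) =
    (M.actO.comp (c.mul.star h (LMap.id M.obj.car))).comp (D.assoc c.O c.O M.obj) := M.assoc

/-- The action of `1 ∈ T` on sector 0. -/
def p : M.obj.zero.V →ₗ[ℂ] M.obj.one.V :=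
  M.actO.2 ∘ₗ LinearMap.inr ℂ _ _ ∘ₗ TensorProduct.mk ℂ ℂ M.obj.zero.V 1

lemma p_apply (m : M.obj.zero.V) : M.p m = M.actO.2 (0, (1 : ℂ) ⊗ₜ m) := rfl

/-- The action of `1 ∈ T` on sector 1. -/
def q : M.obj.one.V →ₗ[ℂ] M.obj.zero.V :=
  M.actO.1 ∘ₗ LinearMap.inr ℂ _ _ ∘ₗ TensorProduct.mk ℂ (S h) (ℂ ⊗[ℂ] M.obj.one.V) 1 ∘ₗ
    TensorProduct.mk ℂ ℂ M.obj.one.V 1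

lemma q_apply (y : M.obj.one.V) : M.q y = M.actO.1 (0, (1 : S h) ⊗ₜ ((1 : ℂ) ⊗ₜ y)) := rfl

/-- The action of `L` on sector 0. -/
def a00 : c.L.V ⊗[ℂ] M.obj.zero.V →ₗ[ℂ] M.obj.zero.V := M.actO.1 ∘ₗ LinearMap.inl ℂ _ _

lemma a00_apply (t : c.L.V ⊗[ℂ] M.obj.zero.V) : M.a00 t = M.actO.1 (t, 0) := rfl

/-- The action of `L` on sector 1. -/
def a01 : c.L.V ⊗[ℂ] M.obj.one.V →ₗ[ℂ] M.obj.one.V := M.actO.2 ∘ₗ LinearMap.inl ℂ _ _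

lemma act_r (s : ℂ) (m : M.obj.zero.V) : M.actO.2 (0, s ⊗ₜ m) = s • M.p m := by
  rw [p_apply, ← map_smul]
  refine congrArg M.actO.2 (Prod.ext (smul_zero _).symm ?_)
  change s ⊗ₜ m = s • ((1 : ℂ) ⊗ₜ[ℂ] m)
  rw [smul_tmul', smul_eq_mul, mul_one]

lemma act_rr (g : S h) (s : ℂ) (y : M.obj.one.V) :
    M.actO.1 (0, g ⊗ₜ (s ⊗ₜ y)) = s • M.obj.zero.rho g (M.q y) := by
  have e1 : ∀ g, M.actO.1 (0, g ⊗ₜ ((1 : ℂ) ⊗ₜ y)) = M.obj.zero.rho g (M.q y) := fun g => by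
    induction g using S.induction with
    | halg r =>
      rw [rho_algebraMap, q_apply, ← map_smul]
      refine congrArg M.actO.1 (Prod.ext (smul_zero _).symm ?_)
      change algebraMap ℂ (S h) r ⊗ₜ _ = r • ((1 : S h) ⊗ₜ[ℂ] ((1 : ℂ) ⊗ₜ[ℂ] y))
      rw [smul_tmul', algebraMap_eq_smul_one]
    | hadd g g' hg hg' =>
      rw [map_add, LinearMap.add_apply, ← hg, ← hg', ← map_add]
      refine congrArg M.actO.1 (Prod.ext (add_zero _).symm ?_)
      exact add_tmul _ _ _
    | hmul a g hg =>
      rw [rho_ι_mul, ← hg, ← M.actO_mem.2.1]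
      refine congrArg M.actO.1 ?_
      rw [star_act c.O M.obj, map_zero]
      rfl
  rw [← e1, ← map_smul]
  refine congrArg M.actO.1 (Prod.ext (smul_zero _).symm ?_)
  change g ⊗ₜ (s ⊗ₜ y) = s • (g ⊗ₜ[ℂ] ((1 : ℂ) ⊗ₜ[ℂ] y))
  rw [← tmul_smul, smul_tmul', smul_eq_mul, mul_one]

lemma p_a00 (l : c.L.V) (m : M.obj.zero.V) : M.p (M.a00 (l ⊗ₜ m)) = c.chiL l • M.p m := by
  have e := LinearMap.congr_fun (congrArg Prod.snd M.actO_assoc)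
    (0, (1 : ℂ) ⊗ₜ[ℂ] (l ⊗ₜ[ℂ] m, 0))
  rw [comp_snd, star_snd_r, map_tmul, comp_snd, assoc_100, comp_snd, star_snd_r, map_tmul] at e
  refine Eq.trans ?_ (e.trans ?_)
  · exact (M.p_apply _).trans (congrArg (fun w => M.actO.2 (0, (1 : ℂ) ⊗ₜ w)) (M.a00_apply _))
  · refine (congrArg (fun w : ℂ => M.actO.2 (0, w ⊗ₜ[ℂ] m)) (mul_one_r c 1 l)).trans ?_
    rw [one_mul]
    exact M.act_r _ _

lemma q_p (m : M.obj.zero.V) : M.q (M.p m) = M.a00 (c.M 1 ⊗ₜ m) := by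
  have e := LinearMap.congr_fun (congrArg Prod.fst M.actO_assoc)
    (0, (1 : S h) ⊗ₜ[ℂ] ((1 : ℂ) ⊗ₜ[ℂ] (0, (1 : ℂ) ⊗ₜ[ℂ] m)))
  rw [comp_fst, star_fst_r, map_tmul, map_tmul, comp_fst, assoc_110,
    assoc110_one, comp_fst, map_tmul, star_fst_l, map_tmul] at e
  refine Eq.trans ?_ (e.trans ?_)
  · exact congrArg (fun w => M.actO.1 (0, (1 : S h) ⊗ₜ ((1 : ℂ) ⊗ₜ w))) (M.p_apply _)
  · refine (congrArg (fun w => M.actO.1 (w ⊗ₜ m, 0)) (mul_zero_r c 1 1 1)).trans ?_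
    rw [one_mul, one_smul]
    rfl

lemma p_rho_q_eq (g : S h) (y : M.obj.one.V) :
    M.p (M.obj.zero.rho g (M.q y)) = M.a01 (c.M (D.phi g) ⊗ₜ y) := by
  have e := LinearMap.congr_fun (congrArg Prod.snd M.actO_assoc)
    (0, (1 : ℂ) ⊗ₜ[ℂ] (0, g ⊗ₜ[ℂ] ((1 : ℂ) ⊗ₜ[ℂ] y)))
  rw [comp_snd, star_snd_r, map_tmul, comp_snd, assoc_111, assoc111_apply] at e
  have e1 := flip_tmul_of_even (X := unitSVect) (Y := (reg h).toSVect) (x := (1 : ℂ)) rfl g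
  rw [e1] at e
  refine Eq.trans ?_ (e.trans ?_)
  · have e2 := M.act_rr g 1 y
    rw [one_smul] at e2
    exact (M.p_apply _).trans (congrArg (fun w => M.actO.2 (0, (1 : ℂ) ⊗ₜ w)) e2.symm)
  · change (M.actO.comp (c.mul.star h (LMap.id M.obj.car))).2
      ((0, D.phi g ⊗ₜ ((1 : ℂ) ⊗ₜ (1 : ℂ))) ⊗ₜ y, 0) = _
    rw [comp_snd, star_snd_l, map_tmul]
    refine (congrArg (fun w => M.actO.2 (w ⊗ₜ y, 0)) (mul_zero_r c (D.phi g) 1 1)).trans ?_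
    rw [one_mul, one_smul]
    rfl

lemma a00_act : Intertwines (c.L.tensor M.obj.zero) M.obj.zero M.a00 := fun a t => by
  rw [a00_apply, a00_apply, ← M.actO_mem.2.1]
  refine congrArg M.actO.1 ?_
  rw [star_act c.O M.obj, map_zero]

lemma a00_par : IsEven (c.L.tensor M.obj.zero).toSVect M.obj.zero.toSVect M.a00 := fun t => by
  rw [a00_apply, a00_apply, ← M.actO_mem.1]
  exact congrArg M.actO.1 (star_par_zero_l c.O M.obj t).symm

lemma p_par : IsEven M.obj.zero.toSVect M.obj.one M.p := fun m => by
  rw [p_apply, p_apply, ← M.actO_mem.2.2]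
  exact congrArg M.actO.2 (star_par_one_r c.O M.obj ((1 : ℂ) ⊗ₜ[ℂ] m)).symm

lemma q_par : IsEven M.obj.one M.obj.zero.toSVect M.q := fun y => by
  rw [q_apply, q_apply, ← M.actO_mem.1]
  refine congrArg M.actO.1 (Eq.trans ?_ (star_par_zero_r c.O M.obj _).symm)
  refine Prod.ext rfl ?_
  change _ = (invol 1 : S h) ⊗ₜ[ℂ] ((1 : ℂ) ⊗ₜ[ℂ] M.obj.one.par y)
  rw [map_one]

lemma p_rho_q_p (hβ : D.β = 1) (g : S h) (m : M.obj.zero.V) :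
    M.p (M.obj.zero.rho g (M.q (M.p m))) = M.p (M.obj.zero.rho (c.E g) m) := by
  have e1 := rho_natural (intertwines_map_left M.obj.zero (intertwines_M c) (isEven_M c hβ)) g ((1 : S h) ⊗ₜ m)
  rw [map_tmul] at e1
  have e2 := congrArg M.p (rho_conv M.obj.zero c.theta g m)
  rw [M.q_p, ← rho_natural M.a00_act]
  refine Eq.trans (congrArg (fun w => M.p (M.a00 w)) e1.symm) (Eq.trans ?_ e2.symm)
  refine Eq.trans ?_ (map_ctr c.theta 𝕀 M.p _).symm
  generalize ((reg h).tensor M.obj.zero).rho g ((1 : S h) ⊗ₜ m) = t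
  induction t using TensorProduct.induction_on with
  | tmul l m => rw [map_tmul, M.p_a00]; rfl
  | _ => simp only [map_zero, map_add, *]

variable (P : Polarization D f) (hβ : D.β = 1)

include hβ P in
lemma p_gOne (y : M.obj.one.V) : M.p (M.obj.zero.rho (gOne P c) (M.q y)) = y := by
  rw [p_rho_q_eq, M_phi_gOne P c hβ]
  exact M.unit_one y

include hβ P in
lemma p_surjective : Function.Surjective M.p := fun y => ⟨_, M.p_gOne P hβ y⟩

/-- The operators on sector 1 by which `f` acts there. -/
def actOne : h →ₗ[ℂ] Module.End ℂ M.obj.one.V where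
  toFun a := M.p ∘ₗ M.obj.zero.rho (ι ℂ (P.r a) * gOne P c) ∘ₗ M.q
  map_add' a b := by
    rw [map_add, map_add, add_mul, map_add, LinearMap.add_comp, LinearMap.comp_add]
  map_smul' s a := by
    rw [map_smul, map_smul, smul_mul_assoc, map_smul, LinearMap.smul_comp, LinearMap.comp_smul]
    rfl

include hβ in
lemma actOne_p (a : h) (m : M.obj.zero.V) :
    M.actOne P a (M.p m) = M.p (M.obj.zero.act (P.r a) m) := by
  change M.p (M.obj.zero.rho _ (M.q (M.p m))) = _
  rw [M.p_rho_q_p hβ, E_ι_mul_gOne P c hβ (P.r_mem a), rho_ι]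

/-- Sector 1 of a module, as a representation of `h` on which the kernel of the projection to `f`
acts by zero. -/
@[reducible] def oneRep : SRep h where
  toSVect := M.obj.one
  act := M.actOne P
  act_act a v := by
    obtain ⟨m, rfl⟩ := M.p_surjective P hβ v
    rw [actOne_p M P hβ, actOne_p M P hβ, M.obj.zero.act_act, map_zero]
  act_par a v := by
    obtain ⟨m, rfl⟩ := M.p_surjective P hβ v
    rw [← M.p_par, actOne_p M P hβ, M.obj.zero.act_par, map_neg, actOne_p M P hβ, M.p_par]

lemma p_rho_mr (z : S h) (m : M.obj.zero.V) :
    M.p (M.obj.zero.rho (P.mr z) m) = (M.oneRep P hβ).rho (P.mr z) (M.p m) := by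
  induction z using S.induction with
  | halg r => rw [commutes P.mr, rho_algebraMap, rho_algebraMap, map_smul]
  | hadd g g' hg hg' => simp only [map_add, LinearMap.add_apply, hg, hg']
  | hmul a g hg =>
    have e : (M.oneRep P hβ).act (P.r a) = M.actOne P (P.r a) := rfl
    rw [map_mul, P.mr_ι, rho_ι_mul, rho_ι_mul, ← hg, e, M.actOne_p P hβ, P.r_id _ (P.r_mem a)]

/-- The core of a module. -/
@[reducible] def core : Core P c where
  zero := M.obj.zero
  one := M.oneRep P hβ
  one_r a v := by
    change M.p (M.obj.zero.rho (ι ℂ (P.r (P.r a)) * gOne P c) (M.q v)) = _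
    rw [P.r_id _ (P.r_mem a)]
    rfl
  p := M.p
  q := M.q
  a00 := M.a00
  p_par := M.p_par
  p_act u hu m := by
    have e := M.actOne_p P hβ u m
    rw [P.r_id _ hu] at e
    exact e.symm
  sep m hm := by
    let K : Submodule ℂ M.obj.zero.V :=
      { carrier := {m | ∀ g, M.p (M.obj.zero.rho g m) = 0}
        add_mem' := fun {x y} hx hy g => by rw [map_add, map_add, hx, hy, add_zero]
        zero_mem' := fun g => by rw [map_zero, map_zero]
        smul_mem' := fun r x hx g => by rw [map_smul, map_smul, hx, smul_zero] }
    have e1 := mem_of_one_tmul (X := M.obj.zero) (Y := M.obj.zero)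
      (κ := M.a00 ∘ₗ map c.M 𝕀) (fun a t => by
        have := intertwines_map_left M.obj.zero (intertwines_M c) (isEven_M c hβ) a t
        exact (congrArg M.a00 this).trans (M.a00_act a _)) (fun t => by
        have := isEven_map_left M.obj.zero.toSVect (isEven_M c hβ) t
        exact (congrArg M.a00 this).trans (M.a00_par _)) K ⊥
      (fun a x hx g => by
        have := hx (g * ι ℂ a)
        rwa [rho_mul, rho_ι] at this)
      (fun x hx g => by rw [rho_par, M.p_par, hx, map_zero])
      (fun a y hy => by rw [(Submodule.mem_bot ℂ).mp hy, map_zero]; exact zero_mem _)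
      (fun y hy => by rw [(Submodule.mem_bot ℂ).mp hy, map_zero]; exact zero_mem _)
      (fun x hx => by
        refine (Submodule.mem_bot ℂ).mpr ?_
        change M.a00 (c.M 1 ⊗ₜ x) = 0
        have := hx 1
        rw [rho_one] at this
        rw [← M.q_p, this, map_zero]) (gOne P c) m hm
    have e2 : (M.a00 ∘ₗ map c.M 𝕀) (gOne P c ⊗ₜ m) = m := by
      change M.a00 (c.M (gOne P c) ⊗ₜ m) = m
      rw [M_gOne]
      exact M.unit_zero m
    rw [e2] at e1
    exact (Submodule.mem_bot ℂ).mp e1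
  a00_act := M.a00_act
  a00_par := M.a00_par
  p_a00 := M.p_a00
  q_par := M.q_par
  p_q g y := by
    obtain ⟨m, rfl⟩ := M.p_surjective P hβ y
    rw [M.p_rho_q_p hβ, ← mr_E P c hβ, M.p_rho_mr P hβ]

lemma core_act : (M.core P hβ).act = M.actO := by
  refine Prod.ext (star_ext₀ (X := c.O.car) (Y := M.obj.car) (h := h) (fun x y => ?_) fun g x y => ?_)
    (star_ext₁ (X := c.O.car) (Y := M.obj.car) (h := h) (fun x y => ?_) fun x y => ?_)
  · exact (M.core P hβ).act_zero_l _
  · exact ((M.core P hβ).act_zero_r g x y).trans (M.act_rr g x y).symm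
  · obtain ⟨g, rfl⟩ := exists_M_phi P c hβ x
    refine ((M.core P hβ).act_one_l _ y).trans ?_
    rw [j_M_phi P c hβ, ← (M.core P hβ).p_q]
    exact M.p_rho_q_eq g y
  · exact ((M.core P hβ).act_one_r x y).trans (M.act_r x y).symm

end Mod

end ModulesToCores

section ModuleHoms

variable {h : Type} [AddCommGroup h] [Module ℂ h] [FiniteDimensional ℂ h]
variable {D : SympData h} {f : Submodule ℂ h} {c : HChoice D f} {P : Polarization D f}

namespace Core

/-- A homomorphism between the modules determined by two cores, given by its component in
sector 1. -/
structure Hom (A B : Core P c) where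
  k : A.one.V →ₗ[ℂ] B.one.V
  even : IsEven A.one.toSVect B.one.toSVect k
  equi : Intertwines A.one B.one k

variable {A B : Core P c} (hβ : D.β = 1) (k : Hom A B)

/-- The component in sector 0. -/
def Hom.zero : A.zero.V →ₗ[ℂ] B.zero.V :=
  B.hat hβ (k.k ∘ₗ A.p) fun u hu m => (congrArg k.k (A.p_act u hu m)).trans (k.equi u _)

lemma Hom.p_zero (m : A.zero.V) : B.p (k.zero hβ m) = k.k (A.p m) := B.p_hat hβ _ _ m

lemma Hom.zero_intertwines : Intertwines A.zero B.zero (k.zero hβ) := B.intertwines_hat hβ _ _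

lemma Hom.zero_even : IsEven A.zero.toSVect B.zero.toSVect (k.zero hβ) :=
  B.isEven_hat hβ _ _ fun m => (congrArg k.k (A.p_par m)).trans (k.even _)

lemma Hom.zero_q (y : A.one.V) : k.zero hβ (A.q y) = B.q (k.k y) := by
  rw [← sub_eq_zero]
  refine B.sep _ fun g => ?_
  rw [map_sub, map_sub, ← rho_natural (k.zero_intertwines hβ), k.p_zero, A.p_q, B.p_q,
    rho_natural k.equi, sub_self]

lemma Hom.zero_a00 (l : c.L.V) (m : A.zero.V) :
    k.zero hβ (A.a00 (l ⊗ₜ m)) = B.a00 (l ⊗ₜ k.zero hβ m) := by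
  refine B.sep_ext (X := c.L.tensor A.zero) (A := k.zero hβ ∘ₗ A.a00)
    (B := B.a00 ∘ₗ map 𝕀 (k.zero hβ)) (fun a t => ?_) (fun a t => ?_)
    (fun t => ?_) (l ⊗ₜ m)
  · exact (congrArg (k.zero hβ) (A.a00_act a t)).trans (k.zero_intertwines hβ a _)
  · have := intertwines_map_right c.L (k.zero_intertwines hβ) a t
    exact (congrArg B.a00 this).trans (B.a00_act a _)
  · simp only [LinearMap.comp_apply]
    induction t using TensorProduct.induction_on with
    | tmul l m =>
      rw [map_tmul, B.p_a00, k.p_zero, k.p_zero, A.p_a00, map_smul]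
      rfl
    | _ => simp_all [add_tmul, tmul_add]

/-- The pair of components. -/
def Hom.pair : LMap A.obj.car B.obj.car := (k.zero hβ, k.k)

lemma Hom.pair_mem : k.pair hβ ∈ homs A.obj B.obj :=
  ⟨k.zero_even hβ, k.zero_intertwines hβ, k.even⟩

lemma Hom.pair_act : (k.pair hβ).comp A.act = B.act.comp ((LMap.id c.O.car).star h (k.pair hβ)) := by
  refine Prod.ext (star_ext₀ (X := c.O.car) (Y := A.obj.car) (h := h) (fun x y => ?_) fun g x y => ?_)
    (star_ext₁ (X := c.O.car) (Y := A.obj.car) (h := h) (fun x y => ?_) fun x y => ?_)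
  · rw [comp_fst, comp_fst, star_fst_l, map_tmul]
    refine (congrArg (k.zero hβ) (A.act_zero_l _)).trans ((k.zero_a00 hβ x y).trans ?_)
    exact (B.act_zero_l _).symm
  · rw [comp_fst, comp_fst, star_fst_r, map_tmul, map_tmul]
    refine (congrArg (k.zero hβ) (A.act_zero_r _ _ _)).trans (Eq.trans ?_ (B.act_zero_r g x (k.k y)).symm)
    rw [map_smul, rho_natural (k.zero_intertwines hβ), k.zero_q]
  · rw [comp_snd, comp_snd, star_snd_l, map_tmul]
    refine (congrArg k.k (A.act_one_l _ _)).trans (Eq.trans ?_ (B.act_one_l x (k.k y)).symm)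
    exact rho_natural k.equi _ _
  · rw [comp_snd, comp_snd, star_snd_r, map_tmul]
    refine (congrArg k.k (A.act_one_r _ _)).trans (Eq.trans ?_ (B.act_one_r x (k.zero hβ y)).symm)
    rw [map_smul, k.p_zero]

end Core

namespace Mod

variable {M N : Mod D c.H} (P) (hβ : D.β = 1)

/-- The component of a homomorphism in sector 0. -/
def fst (k : M ⟶ N) : M.obj.zero.V →ₗ[ℂ] N.obj.zero.V := k.1.1

/-- The component of a homomorphism in sector 1. -/
def snd (k : M ⟶ N) : M.obj.one.V →ₗ[ℂ] N.obj.one.V := k.1.2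

lemma p_fst (k : M ⟶ N) (m : M.obj.zero.V) : N.p (fst k m) = snd k (M.p m) := by
  have e := LinearMap.congr_fun (congrArg Prod.snd k.2.2) (0, (1 : ℂ) ⊗ₜ[ℂ] m)
  exact e.symm

lemma intertwines_fst (k : M ⟶ N) : Intertwines M.obj.zero N.obj.zero (fst k) := k.2.1.2.1

lemma isEven_snd (k : M ⟶ N) : IsEven M.obj.one N.obj.one (snd k) := k.2.1.2.2

lemma intertwines_snd (k : M ⟶ N) : Intertwines (M.oneRep P hβ) (N.oneRep P hβ) (snd k) :=
  fun a y => by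
    obtain ⟨m, rfl⟩ := M.p_surjective P hβ y
    have e1 := M.actOne_p P hβ a m
    have e2 := N.actOne_p P hβ a (fst k m)
    refine (congrArg (snd k) e1).trans ?_
    rw [← p_fst, intertwines_fst, ← e2, p_fst]

include P hβ in
lemma hom_ext {k k' : M ⟶ N} (hk : ∀ y, snd k y = snd k' y) : k = k' := by
  refine Subtype.ext (Prod.ext (LinearMap.ext fun m => ?_) (LinearMap.ext hk))
  refine (N.core P hβ).sep_ext (X := M.obj.zero) (A := fst k) (B := fst k') (intertwines_fst k)
    (intertwines_fst k') (fun x => ?_) m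
  exact (p_fst k x).trans ((hk _).trans (p_fst k' x).symm)

end Mod

/-- A homomorphism of modules, given by its component in sector 1. -/
def Mod.ofSnd (hβ : D.β = 1) {M N : Mod D c.H} (k : Core.Hom (M.core P hβ) (N.core P hβ)) : M ⟶ N :=
  ⟨k.pair hβ, k.pair_mem hβ, by
    have e := k.pair_act hβ
    rw [M.core_act P hβ, N.core_act P hβ] at e
    exact e⟩

end ModuleHoms

section ModuleCategory

variable {h : Type} [AddCommGroup h] [Module ℂ h] [FiniteDimensional ℂ h]
variable {D : SympData h} {f : Submodule ℂ h} {c : HChoice D f}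

lemma Core.oneRep_act {P : Polarization D f} (A : Core P c) (hβ : D.β = 1) (a : h) (y : A.one.V) :
    ((A.toMod hβ).oneRep P hβ).act a y = A.one.act a y := by
  obtain ⟨m, rfl⟩ : ∃ m, (A.toMod hβ).p m = y := (A.toMod hβ).p_surjective P hβ y
  have e1 : ∀ m, (A.toMod hβ).p m = A.p m := fun m => (A.act_one_r 1 m).trans (one_smul _ _)
  refine ((A.toMod hβ).actOne_p P hβ a m).trans ?_
  rw [e1, e1]
  exact (A.p_act _ (P.r_mem a) m).trans (A.one_r _ _)

namespace Mod

variable (P : Polarization D f) (hβ : D.β = 1)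

lemma snd_comp {M N Q : Mod D c.H} (k : M ⟶ N) (l : N ⟶ Q) (y : M.obj.one.V) :
    snd (k ≫ l) y = snd l (snd k y) := rfl

/-- The homomorphism with a given component in sector 1. -/
def lift {M N : Mod D c.H} (k : M.obj.one.V →ₗ[ℂ] N.obj.one.V) (even : IsEven M.obj.one N.obj.one k)
    (equi : Intertwines (M.oneRep P hβ) (N.oneRep P hβ) k) : M ⟶ N :=
  ofSnd hβ (P := P) ⟨k, even, equi⟩

/-- The isomorphism with a given component in sector 1. -/
def liftIso {M N : Mod D c.H} (k : M.obj.one.V ≃ₗ[ℂ] N.obj.one.V)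
    (even : IsEven M.obj.one N.obj.one k.toLinearMap)
    (equi : Intertwines (M.oneRep P hβ) (N.oneRep P hβ) k.toLinearMap) : M ≅ N where
  hom := lift P hβ k.toLinearMap even equi
  inv := lift P hβ k.symm.toLinearMap
    (fun y => by
      apply k.injective
      have := even (k.symm y)
      simp only [LinearEquiv.coe_coe, LinearEquiv.apply_symm_apply] at this ⊢
      exact this.symm)
    (fun a y => by
      apply k.injective
      have := equi a (k.symm y)
      simp only [LinearEquiv.coe_coe, LinearEquiv.apply_symm_apply] at this ⊢
      exact this.symm)
  hom_inv_id := hom_ext P hβ fun y => k.symm_apply_apply y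
  inv_hom_id := hom_ext P hβ fun y => k.apply_symm_apply y

include P hβ in
lemma mono_of_injective {M N : Mod D c.H} {k : M ⟶ N} (hk : Function.Injective (snd k)) : Mono k where
  right_cancellation a b hab := hom_ext P hβ fun y =>
    hk (LinearMap.congr_fun (congrArg snd hab) y)

include P hβ in
lemma isIso_of_bijective {M N : Mod D c.H} {k : M ⟶ N} (hk : Function.Bijective (snd k)) :
    IsIso k := by
  have : k = (liftIso P hβ (LinearEquiv.ofBijective (snd k) hk) (isEven_snd k)
      (intertwines_snd P hβ k)).hom := hom_ext P hβ fun y => rfl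
  rw [this]
  infer_instance

/-- The kernel of an even equivariant map. -/
@[reducible] def kerRep {X Y : SRep h} (k : X.V →ₗ[ℂ] Y.V) (hp : IsEven X.toSVect Y.toSVect k)
    (hk : Intertwines X Y k) : SRep h where
  V := LinearMap.ker k
  par := X.par.restrict fun v hv => by
    rw [LinearMap.mem_ker] at hv ⊢
    rw [hp, hv, map_zero]
  par_par v := Subtype.ext (X.par_par _)
  act :=
    { toFun := fun a => (X.act a).restrict fun v hv => by
        rw [LinearMap.mem_ker] at hv ⊢
        rw [hk, hv, map_zero]
      map_add' := fun a b => LinearMap.ext fun v => Subtype.ext (by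
        change X.act (a + b) v = X.act a v + X.act b v
        rw [map_add, LinearMap.add_apply])
      map_smul' := fun r a => LinearMap.ext fun v => Subtype.ext (by
        change X.act (r • a) v = r • X.act a v
        rw [map_smul, LinearMap.smul_apply]) }
  act_act a v := Subtype.ext (X.act_act _ _)
  act_par a v := Subtype.ext (X.act_par _ _)

lemma oneRep_act_r (M : Mod D c.H) (a : h) (y : M.obj.one.V) :
    (M.oneRep P hβ).act (P.r a) y = (M.oneRep P hβ).act a y := (M.core P hβ).one_r a y

include P hβ in
lemma injective_of_mono {M N : Mod D c.H} (k : M ⟶ N) [Mono k] : Function.Injective (snd k) := by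
  let K : SRep h := kerRep (X := M.oneRep P hβ) (Y := N.oneRep P hβ) (snd k) (isEven_snd k)
    (intertwines_snd P hβ k)
  let A : Core P c := coindCore P c hβ K fun a v => Subtype.ext (M.oneRep_act_r P hβ a _)
  let i : A.toMod hβ ⟶ M := lift P hβ (LinearMap.ker (snd k)).subtype (fun y => rfl) fun a y =>
    congrArg (LinearMap.ker (snd k)).subtype (A.oneRep_act hβ a y)
  have e : i ≫ k = 0 := hom_ext P hβ fun y => LinearMap.mem_ker.mp (Subtype.property (p := (· ∈ LinearMap.ker (snd k))) y)
  have e' : i = 0 := by rwa [← cancel_mono k, Limits.zero_comp]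
  rw [← LinearMap.ker_eq_bot, eq_bot_iff]
  intro y hy
  exact (Submodule.mem_bot ℂ).mpr (LinearMap.congr_fun (congrArg snd e') (⟨y, hy⟩ : LinearMap.ker (snd k)))

include P hβ in
lemma simple_of_finrank (M : Mod D c.H) (hM : finrank ℂ M.obj.one.V = 1) : Simple M where
  mono_isIso_iff_nonzero {N} k _ := by
    have hinj := injective_of_mono P hβ k
    constructor
    · intro _ h0
      have e0 : inv k ≫ k = 0 := (congrArg (fun l => inv k ≫ l) h0).trans Limits.comp_zero
      have e : snd (inv k ≫ k) = 0 := congrArg snd e0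
      rw [IsIso.inv_hom_id] at e
      have : Subsingleton M.obj.one.V := ⟨fun x y =>
        (LinearMap.congr_fun e x).trans (LinearMap.congr_fun e y).symm⟩
      rw [Module.finrank_zero_of_subsingleton] at hM
      exact zero_ne_one hM
    · intro h0
      refine isIso_of_bijective P hβ ⟨hinj, ?_⟩
      obtain ⟨y, hy⟩ : ∃ y, snd k y ≠ 0 := by
        by_contra! hy
        exact h0 (hom_ext P hβ hy)
      intro z
      obtain ⟨r, hr⟩ := (finrank_eq_one_iff_of_nonzero' (snd k y) hy).mp hM z
      exact ⟨r • y, by rw [map_smul, hr]⟩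

lemma isEven_zero_of_odd {M N : Mod D c.H} (hM : ∀ y, M.obj.one.par y = y)
    (hN : ∀ y, N.obj.one.par y = -y) (k : M ⟶ N) (y : M.obj.one.V) : snd k y = 0 := by
  have e := isEven_snd k y
  rw [hM, hN, eq_neg_iff_add_eq_zero, ← two_smul ℂ] at e
  exact (smul_eq_zero.mp e).resolve_left two_ne_zero

section Regular

variable (hH : c.H.IsAlgebra D)

lemma not_iso_shift : ¬ Nonempty (Mod.regular hH ≅ (Mod.regular hH).shift) := by
  rintro ⟨e⟩
  have e1 : ∀ y, snd (e.hom ≫ e.inv) y = 0 := fun y => by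
    rw [snd_comp, isEven_zero_of_odd (fun _ => rfl) (fun _ => rfl) e.hom, map_zero]
  rw [e.hom_inv_id] at e1
  exact one_ne_zero (α := ℂ) (e1 (1 : ℂ))

lemma oneRep_zero (M : Mod D c.H) (hM : finrank ℂ M.obj.one.V = 1) (a : h) (y : M.obj.one.V) :
    (M.oneRep P hβ).act a y = 0 := by
  by_cases hy : y = 0
  · rw [hy, map_zero]
  · obtain ⟨r, hr⟩ := (finrank_eq_one_iff_of_nonzero' y hy).mp hM ((M.oneRep P hβ).act a y)
    have e := (M.oneRep P hβ).act_act a y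
    rw [← hr, map_smul, ← hr, smul_smul] at e
    have h0 := (smul_eq_zero.mp e).resolve_right hy
    rw [← hr, mul_self_eq_zero.mp h0, zero_smul]

/-- The homomorphism from a module with one-dimensional sector 1 determined by an invariant vector. -/
def ofInvariant {M N : Mod D c.H} (e : M.obj.one.V ≃ₗ[ℂ] ℂ) (y : N.obj.one.V)
    (hp : ∀ m, e (M.obj.one.par m) • y = e m • N.obj.one.par y)
    (hy : ∀ a, (N.oneRep P hβ).act a y = 0) : M ⟶ N :=
  lift P hβ (LinearMap.toSpanSingleton ℂ _ y ∘ₗ e.toLinearMap)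
    (fun m => (hp m).trans (map_smul N.obj.one.par _ _).symm) fun a m => by
      rw [oneRep_zero P hβ M (e.finrank_eq.trans (Module.finrank_self ℂ)), map_zero]
      exact ((map_smul ((N.oneRep P hβ).act a) (e m) y).trans (by rw [hy, smul_zero])).symm

include P hβ in
lemma exists_iso_of_invariant {M N : Mod D c.H} [Simple N] (e : M.obj.one.V ≃ₗ[ℂ] ℂ) (y : N.obj.one.V)
    (hp : ∀ m, e (M.obj.one.par m) • y = e m • N.obj.one.par y)
    (hy : ∀ a, (N.oneRep P hβ).act a y = 0) (hne : y ≠ 0) : Nonempty (N ≅ M) := by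
  let k := ofInvariant P hβ e y hp hy
  have hk : ∀ m, snd k m = e m • y := fun m => rfl
  have : Mono k := mono_of_injective P hβ fun m m' hm => by
    rw [hk, hk] at hm
    exact e.injective (smul_left_injective ℂ hne hm)
  have : IsIso k := (Simple.mono_isIso_iff_nonzero k).mpr fun h0 => by
    have := hk (e.symm 1)
    rw [h0, e.apply_symm_apply, one_smul] at this
    exact hne this.symm
  exact ⟨(asIso k).symm⟩

include P hβ in
lemma simple_iff (M : Mod D c.H) : Simple M ↔
    (Nonempty (M ≅ Mod.regular hH) ∨ Nonempty (M ≅ (Mod.regular hH).shift)) := by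
  constructor
  · intro hM
    obtain ⟨v, -, hv, hk⟩ := exists_common_kernel (V := M.obj.one.V)
      (fun i : Fin (finrank ℂ h) => (M.oneRep P hβ).act (Module.finBasis ℂ h i))
      (fun i v => (M.oneRep P hβ).act_act _ v) (fun i j v => act_anti (M.oneRep P hβ) _ _ v) ⊤
      (fun _ _ _ => trivial) (fun h0 => by
        refine id_nonzero M (hom_ext P hβ fun y => ?_)
        exact (Submodule.mem_bot ℂ).mp (h0 ▸ Submodule.mem_top (x := y))) Finset.univ
    have hk' : ∀ a, (M.oneRep P hβ).act a v = 0 := fun a => by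
      rw [← (Module.finBasis ℂ h).sum_repr a, map_sum, LinearMap.sum_apply]
      exact Finset.sum_eq_zero fun i _ => by
        rw [map_smul, LinearMap.smul_apply, hk i (Finset.mem_univ i), smul_zero]
    have hp : ∀ a, (M.oneRep P hβ).act a (M.obj.one.par v) = 0 := fun a =>
      ((M.oneRep P hβ).act_par a v).trans (by rw [hk', map_zero, neg_zero])
    by_cases h0 : v + M.obj.one.par v = 0
    · right
      have e : M.obj.one.par v = -v := (neg_eq_of_add_eq_zero_right h0).symm
      refine exists_iso_of_invariant P hβ (M := (Mod.regular hH).shift) (LinearEquiv.refl ℂ ℂ) v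
        (fun m : ℂ => ?_) hk' hv
      rw [e]
      exact (neg_smul m v).trans (smul_neg m v).symm
    · left
      refine exists_iso_of_invariant P hβ (M := Mod.regular hH) (LinearEquiv.refl ℂ ℂ) _
        (fun m => ?_) (fun a => ?_) h0
      · rw [map_add, M.obj.one.par_par, add_comm]
        rfl
      · rw [map_add, hk', hp, add_zero]
  · rintro (⟨⟨e⟩⟩ | ⟨⟨e⟩⟩)
    · have := simple_of_finrank P hβ (Mod.regular hH) (Module.finrank_self ℂ)
      exact Simple.of_iso e
    · have := simple_of_finrank P hβ (Mod.regular hH).shift (Module.finrank_self ℂ)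
      exact Simple.of_iso e

end Regular

end Mod

end ModuleCategory

section UnitObject

variable {h : Type} [AddCommGroup h] [Module ℂ h]

lemma lid_even (X : SVect) : IsEven (unitSVect.tensor X) X (lid ℂ X.V).toLinearMap :=
  fun v => by
    induction v using TensorProduct.induction_on with
    | tmul x y => exact (map_smul X.par x y).symm
    | _ => simp only [map_zero, map_add, *]

lemma rid_even (X : SVect) : IsEven (X.tensor unitSVect) X (rid ℂ X.V).toLinearMap :=
  fun v => by
    induction v using TensorProduct.induction_on with
    | tmul x y => exact (map_smul X.par y x).symm
    | _ => simp only [map_zero, map_add, *]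

lemma lid_intertwines (X : SRep h) :
    Intertwines ((unitSVect.triv h).tensor X) X (lid ℂ X.V).toLinearMap := fun a v => by
  induction v using TensorProduct.induction_on with
  | tmul x y =>
    rw [tensor_act, LinearMap.zero_apply, LinearMap.zero_apply, zero_tmul, zero_add]
    exact (map_smul (X.act a) x y).symm
  | _ => simp only [map_zero, map_add, *]

lemma rid_intertwines (X : SRep h) :
    Intertwines (X.tensor (unitSVect.triv h)) X (rid ℂ X.V).toLinearMap := fun a v => by
  induction v using TensorProduct.induction_on with
  | tmul x y =>
    rw [tensor_act, LinearMap.zero_apply, LinearMap.zero_apply, tmul_zero, add_zero]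
    exact (map_smul (X.act a) y x).symm
  | _ => simp only [map_zero, map_add, *]

end UnitObject

section TensorStructure

variable {h : Type} [AddCommGroup h] [Module ℂ h] [FiniteDimensional ℂ h]
variable {D : SympData h} {f : Submodule ℂ h} {c : HChoice D f}

namespace Mod

variable (P : Polarization D f) (hβ : D.β = 1)

lemma tensor_oneRep_r (M N : Mod D c.H) (a : h) (v : M.obj.one.V ⊗[ℂ] N.obj.one.V) :
    ((M.oneRep P hβ).tensor (N.oneRep P hβ)).act (P.r a) v =
      ((M.oneRep P hβ).tensor (N.oneRep P hβ)).act a v := by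
  induction v with
  | tmul x y => rw [tensor_act, tensor_act, oneRep_act_r, oneRep_act_r]
  | _ => simp only [map_zero, map_add, *]

/-- The core of the tensor product of two modules. -/
@[reducible] def tensorCore (M N : Mod D c.H) : Core P c :=
  coindCore P c hβ ((M.oneRep P hβ).tensor (N.oneRep P hβ)) (tensor_oneRep_r P hβ M N)

/-- The tensor product of two modules. -/
def tens (M N : Mod D c.H) : Mod D c.H := (tensorCore P hβ M N).toMod hβ

lemma tens_act (M N : Mod D c.H) (a : h) (v : M.obj.one.V ⊗[ℂ] N.obj.one.V) :
    ((tens P hβ M N).oneRep P hβ).act a v = ((M.oneRep P hβ).tensor (N.oneRep P hβ)).act a v :=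
  (tensorCore P hβ M N).oneRep_act hβ a v

variable {P hβ} in
/-- The tensor product of homomorphisms. -/
def tensHom {M M' N N' : Mod D c.H} (k : M ⟶ M') (l : N ⟶ N') : tens P hβ M N ⟶ tens P hβ M' N' :=
  lift P hβ (map (snd k) (snd l)) (isEven_map (isEven_snd k) (isEven_snd l)) fun a v =>
    (congrArg (map (snd k) (snd l)) (tens_act P hβ M N a v)).trans
      ((intertwines_map (X := M.oneRep P hβ) (Y := N.oneRep P hβ) (X' := M'.oneRep P hβ)
        (Y' := N'.oneRep P hβ) (intertwines_snd P hβ k) (isEven_snd k) (intertwines_snd P hβ l) a v).trans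
        (tens_act P hβ M' N' a _).symm)

/-- The unit module. -/
def unitMod (c : HChoice D f) (P : Polarization D f) (hβ : D.β = 1) : Mod D c.H :=
  Mod.regular (isAlgebra_H P c hβ)

lemma unit_act (a : h) (t : ℂ) : ((unitMod c P hβ).oneRep P hβ).act a t = 0 :=
  oneRep_zero P hβ (unitMod c P hβ) (Module.finrank_self ℂ) a t

lemma tens_act_left (M N Q : Mod D c.H) (a : h) (v : (M.obj.one.V ⊗[ℂ] N.obj.one.V) ⊗[ℂ] Q.obj.one.V) :
    ((tens P hβ (tens P hβ M N) Q).oneRep P hβ).act a v =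
      (((M.oneRep P hβ).tensor (N.oneRep P hβ)).tensor (Q.oneRep P hβ)).act a v :=
  (tens_act P hβ (tens P hβ M N) Q a v).trans <|
    congrArg (fun T : Module.End ℂ (M.obj.one.V ⊗[ℂ] N.obj.one.V) =>
      map T (LinearMap.id (M := Q.obj.one.V)) v +
        map (M.obj.one.tensor N.obj.one).par ((Q.oneRep P hβ).act a) v)
      (LinearMap.ext (tens_act P hβ M N a))

lemma tens_act_right (M N Q : Mod D c.H) (a : h) (v : M.obj.one.V ⊗[ℂ] (N.obj.one.V ⊗[ℂ] Q.obj.one.V)) :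
    ((tens P hβ M (tens P hβ N Q)).oneRep P hβ).act a v =
      ((M.oneRep P hβ).tensor ((N.oneRep P hβ).tensor (Q.oneRep P hβ))).act a v :=
  (tens_act P hβ M (tens P hβ N Q) a v).trans <|
    congrArg (fun T : Module.End ℂ (N.obj.one.V ⊗[ℂ] Q.obj.one.V) =>
      map ((M.oneRep P hβ).act a) (LinearMap.id (M := N.obj.one.V ⊗[ℂ] Q.obj.one.V)) v +
        map M.obj.one.par T v)
      (LinearMap.ext (tens_act P hβ N Q a))

lemma tens_unit_act (M : Mod D c.H) (a : h) (v : ℂ ⊗[ℂ] M.obj.one.V) :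
    ((tens P hβ (unitMod c P hβ) M).oneRep P hβ).act a v =
      ((unitSVect.triv h).tensor (M.oneRep P hβ)).act a v :=
  (tens_act P hβ (unitMod c P hβ) M a v).trans <|
    congrArg (fun T : Module.End ℂ ℂ =>
      map T (LinearMap.id (M := M.obj.one.V)) v + map 𝕀 ((M.oneRep P hβ).act a) v)
      (LinearMap.ext (unit_act P hβ a) : ((unitMod c P hβ).oneRep P hβ).act a = (unitSVect.triv h).act a)

lemma tens_act_unit (M : Mod D c.H) (a : h) (v : M.obj.one.V ⊗[ℂ] ℂ) :
    ((tens P hβ M (unitMod c P hβ)).oneRep P hβ).act a v =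
      ((M.oneRep P hβ).tensor (unitSVect.triv h)).act a v :=
  (tens_act P hβ M (unitMod c P hβ) a v).trans <|
    congrArg (fun T : Module.End ℂ ℂ =>
      map ((M.oneRep P hβ).act a) (LinearMap.id (M := ℂ)) v + map M.obj.one.par T v)
      (LinearMap.ext (unit_act P hβ a) : ((unitMod c P hβ).oneRep P hβ).act a = (unitSVect.triv h).act a)

/-- The associator. -/
def tensAssoc (M N Q : Mod D c.H) : tens P hβ (tens P hβ M N) Q ≅ tens P hβ M (tens P hβ N Q) :=
  liftIso P hβ (TensorProduct.assoc ℂ M.obj.one.V N.obj.one.V Q.obj.one.V)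
    (isEven_assoc M.obj.one N.obj.one Q.obj.one) fun a v =>
    (congrArg (TensorProduct.assoc ℂ M.obj.one.V N.obj.one.V Q.obj.one.V)
      (tens_act_left P hβ M N Q a v)).trans
      ((intertwines_assoc (M.oneRep P hβ) (N.oneRep P hβ) (Q.oneRep P hβ) a v).trans
        (tens_act_right P hβ M N Q a _).symm)

/-- The left unitor. -/
def tensLeft (M : Mod D c.H) : tens P hβ (unitMod c P hβ) M ≅ M :=
  liftIso P hβ (lid ℂ M.obj.one.V) (lid_even M.obj.one) fun a v =>
    (congrArg (lid ℂ M.obj.one.V) (tens_unit_act P hβ M a v)).trans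
      (lid_intertwines (M.oneRep P hβ) a v)

/-- The right unitor. -/
def tensRight (M : Mod D c.H) : tens P hβ M (unitMod c P hβ) ≅ M :=
  liftIso P hβ (rid ℂ M.obj.one.V) (rid_even M.obj.one) fun a v =>
    (congrArg (rid ℂ M.obj.one.V) (tens_act_unit P hβ M a v)).trans
      (rid_intertwines (M.oneRep P hβ) a v)

/-- Sector 1, as a vector space. -/
def sectorOne (c : HChoice D f) : Mod D c.H ⥤ ModuleCat.{0} ℂ where
  obj M := ModuleCat.of ℂ M.obj.one.V
  map k := ModuleCat.ofHom (snd k)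

include P hβ in
lemma sectorOne_faithful : (sectorOne c).Faithful where
  map_injective {M N k l} hkl := hom_ext P hβ fun y =>
    LinearMap.congr_fun (congrArg ModuleCat.Hom.hom hkl) y

/-- The tensor product over `H(f)`: the operations. -/
@[reducible] def tensorStruct : MonoidalCategoryStruct (Mod D c.H) where
  tensorObj M N := tens P hβ M N
  whiskerLeft M _ _ k := tensHom (𝟙 M) k
  whiskerRight k M := tensHom k (𝟙 M)
  tensorHom k l := tensHom k l
  tensorUnit := unitMod c P hβ
  associator M N Q := tensAssoc P hβ M N Q
  leftUnitor M := tensLeft P hβ M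
  rightUnitor M := tensRight P hβ M

/-- The comparison of the tensor product over `H(f)` with that of vector spaces. -/
def tensorInducing : letI := tensorStruct (c := c) P hβ; Monoidal.InducingFunctorData (sectorOne c) :=
  letI := tensorStruct (c := c) P hβ
  { μIso := fun M N => Iso.refl (ModuleCat.of ℂ (M.obj.one.V ⊗[ℂ] N.obj.one.V))
    whiskerLeft_eq := fun M N N' k => ModuleCat.hom_ext (ext' fun x y => rfl)
    whiskerRight_eq := fun k M => ModuleCat.hom_ext (ext' fun x y => rfl)
    tensorHom_eq := fun k l => ModuleCat.hom_ext (ext' fun x y => rfl)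
    εIso := Iso.refl (ModuleCat.of ℂ ℂ)
    associator_eq := fun M N Q => ModuleCat.hom_ext (ext_threefold fun x y z => rfl)
    leftUnitor_eq := fun M => ModuleCat.hom_ext (ext' fun x y => rfl)
    rightUnitor_eq := fun M => ModuleCat.hom_ext (ext' fun x y => rfl) }

/-- The tensor product over `H(f)`. -/
@[reducible] def monoidal : MonoidalCategory (Mod D c.H) :=
  letI := tensorStruct (c := c) P hβ
  haveI := sectorOne_faithful (c := c) P hβ
  Monoidal.induced (sectorOne c) (tensorInducing P hβ)

end Mod

end TensorStructure

section Duals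

variable {V : Type} [AddCommGroup V] [Module ℂ V] [FiniteDimensional ℂ V]

lemma coevaluation_adjoint (T : Module.End ℂ V) :
    map T 𝕀 (coevaluation ℂ V 1) = map 𝕀 T.dualMap (coevaluation ℂ V 1) := by
  have key : Function.Injective
      (dualTensorHom ℂ V V ∘ₗ (TensorProduct.comm ℂ V (Module.Dual ℂ V)).toLinearMap) :=
    (dualTensorHomEquiv ℂ V V).injective.comp (TensorProduct.comm ℂ V _).injective
  apply key
  refine LinearMap.ext fun w => ?_
  simp only [coevaluation_apply_one, map_sum, LinearMap.comp_apply, LinearEquiv.coe_coe,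
    map_tmul, comm_tmul, LinearMap.sum_apply, dualTensorHom_apply,
    LinearMap.id_apply, LinearMap.dualMap_apply, Module.Basis.coord_apply]
  rw [Module.Basis.sum_repr]
  simp only [← map_smul, ← map_sum]
  rw [Module.Basis.sum_repr]

variable {h : Type} [AddCommGroup h] [Module ℂ h]

/-- The dual of a representation, the action being given by `a α = ε α ∘ ω ∘ a`, with `ω` the
parity involution. -/
@[reducible] def SRep.dual (ε : ℂ) (X : SRep h) : SRep h where
  V := Module.Dual ℂ X.V
  par := X.par.dualMap
  par_par α := LinearMap.ext fun v => congrArg α (X.par_par v)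
  act :=
    { toFun := fun a => ε • (X.par ∘ₗ X.act a).dualMap
      map_add' := fun a b => LinearMap.ext fun α => LinearMap.ext fun v => by
        change ε * α (X.par (X.act (a + b) v)) = ε * α (X.par (X.act a v)) + ε * α (X.par (X.act b v))
        rw [map_add, LinearMap.add_apply, map_add, map_add, mul_add]
      map_smul' := fun r a => LinearMap.ext fun α => LinearMap.ext fun v => by
        change ε * α (X.par (X.act (r • a) v)) = r * (ε * α (X.par (X.act a v)))
        rw [map_smul, LinearMap.smul_apply, map_smul, map_smul, smul_eq_mul, mul_left_comm] }
  act_act a α := LinearMap.ext fun v => by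
    change ε * (ε * α (X.par (X.act a (X.par (X.act a v))))) = 0
    rw [X.act_par, X.act_act, map_zero, neg_zero, map_zero, map_zero, mul_zero, mul_zero]
  act_par a α := LinearMap.ext fun v => by
    change ε * α (X.par (X.par (X.act a v))) = -(ε * α (X.par (X.act a (X.par v))))
    rw [X.act_par, map_neg, map_neg, mul_neg, neg_neg]

lemma dual_act (ε : ℂ) (X : SRep h) (a : h) (α : Module.Dual ℂ X.V) :
    (X.dual ε).act a α = ε • (X.act a).dualMap (X.par.dualMap α) := rfl

lemma coevaluation_killed (X : SRep h) (a : h) :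
    (X.tensor (X.dual (-1))).act a (coevaluation ℂ X.V 1) = 0 := by
  have e : (X.tensor (X.dual (-1))).act a = map (X.act a) 𝕀 -
      map X.par 𝕀 ∘ₗ map 𝕀 (X.par ∘ₗ X.act a).dualMap := by
    refine ext' fun x α => ?_
    rw [tensor_act, dual_act, neg_one_smul, tmul_neg, ← sub_eq_add_neg]
    rfl
  rw [e, LinearMap.sub_apply, LinearMap.comp_apply, ← coevaluation_adjoint, map_map]
  have e1 : X.par ∘ₗ X.par ∘ₗ X.act a = X.act a := LinearMap.ext fun v => X.par_par _
  rw [e1, LinearMap.comp_id, sub_self]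

lemma coevaluation_even (X : SVect) :
    map X.par X.par.dualMap (coevaluation ℂ X.V 1) = coevaluation ℂ X.V 1 := by
  have e : map X.par X.par.dualMap = map X.par 𝕀 ∘ₗ map 𝕀 X.par.dualMap := by
    rw [← map_comp, LinearMap.comp_id, LinearMap.id_comp]
  have e1 : X.par ∘ₗ X.par = 𝕀 := LinearMap.ext X.par_par
  rw [e, LinearMap.comp_apply, ← coevaluation_adjoint, ← LinearMap.comp_apply, ← map_comp,
    e1, LinearMap.comp_id, map_id, LinearMap.id_apply]

/-- The coevaluation with the tensor factors exchanged. -/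
def coevaluationSwap (V : Type) [AddCommGroup V] [Module ℂ V] [FiniteDimensional ℂ V] :
    ℂ →ₗ[ℂ] Module.Dual ℂ V ⊗[ℂ] V := (TensorProduct.comm ℂ V _).toLinearMap ∘ₗ coevaluation ℂ V

lemma coevaluationSwap_killed (X : SRep h) (a : h) :
    ((X.dual 1).tensor X).act a (coevaluationSwap X.V 1) = 0 := by
  have e : ((X.dual 1).tensor X).act a ∘ₗ (TensorProduct.comm ℂ X.V _).toLinearMap =
      (TensorProduct.comm ℂ X.V _).toLinearMap ∘ₗ (map 𝕀 (X.par ∘ₗ X.act a).dualMap +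
        map (X.act a) 𝕀 ∘ₗ map 𝕀 X.par.dualMap) := by
    refine ext' fun x α => ?_
    change ((X.dual 1).tensor X).act a (α ⊗ₜ x) = _
    rw [tensor_act, dual_act, one_smul]
    rfl
  change (((X.dual 1).tensor X).act a ∘ₗ (TensorProduct.comm ℂ X.V _).toLinearMap) (coevaluation ℂ X.V 1) = 0
  rw [e, LinearMap.comp_apply, LinearMap.add_apply, LinearMap.comp_apply, ← coevaluation_adjoint,
    ← coevaluation_adjoint, map_map, LinearMap.comp_id, ← LinearMap.add_apply,
    ← map_add_left]
  have e1 : X.par ∘ₗ X.act a + X.act a ∘ₗ X.par = 0 := LinearMap.ext fun v => by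
    rw [LinearMap.add_apply, LinearMap.comp_apply, LinearMap.comp_apply, X.act_par, add_neg_cancel]
    rfl
  rw [e1, map_zero_left, LinearMap.zero_apply, map_zero]

lemma coevaluationSwap_even (X : SVect) :
    map X.par.dualMap X.par (coevaluationSwap X.V 1) = coevaluationSwap X.V 1 := by
  refine Eq.trans ?_ (congrArg (TensorProduct.comm ℂ X.V _) (coevaluation_even X))
  change _ = (TensorProduct.comm ℂ X.V _) ((map X.par X.par.dualMap) _)
  rw [← TensorProduct.map_comm]
  rfl

/-- The evaluation with the tensor factors exchanged. -/
def contractRightSwap (V : Type) [AddCommGroup V] [Module ℂ V] : V ⊗[ℂ] Module.Dual ℂ V →ₗ[ℂ] ℂ :=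
  contractLeft ℂ V ∘ₗ (TensorProduct.comm ℂ V _).toLinearMap

lemma contractRightSwap_assoc :
    map (contractRightSwap V) 𝕀 ∘ₗ (assoc ℂ _ _ _).symm.toLinearMap ∘ₗ
          map (LinearMap.id (M := V)) (coevaluationSwap V) =
      (lid ℂ _).symm.toLinearMap ∘ₗ (rid ℂ _).toLinearMap := by
  refine TensorProduct.ext (LinearMap.ext fun v => LinearMap.ext_ring ?_)
  simp only [LinearMap.compr₂ₛₗ_apply, mk_apply, LinearMap.comp_apply, LinearEquiv.coe_coe,
    map_tmul, coevaluationSwap, contractRightSwap, coevaluation_apply_one, map_sum,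
    comm_tmul, tmul_sum, assoc_symm_tmul, contractLeft_apply,
    rid_tmul, lid_symm_apply, LinearMap.id_apply, one_smul,
    Module.Basis.coord_apply]
  have e : ∀ i, ((Module.Basis.ofVectorSpace ℂ V).repr v) i ⊗ₜ[ℂ] (Module.Basis.ofVectorSpace ℂ V) i =
      (1 : ℂ) ⊗ₜ[ℂ] (((Module.Basis.ofVectorSpace ℂ V).repr v) i • (Module.Basis.ofVectorSpace ℂ V) i) := fun i => by
    rw [tmul_smul, smul_tmul', smul_eq_mul, mul_one]
  simp only [e]
  rw [← tmul_sum, Module.Basis.sum_repr]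

lemma contractRightSwap_assoc' :
    map (LinearMap.id (M := Module.Dual ℂ V)) (contractRightSwap V) ∘ₗ (assoc ℂ _ _ _).toLinearMap ∘ₗ
          map (coevaluationSwap V) 𝕀 =
      (rid ℂ _).symm.toLinearMap ∘ₗ (lid ℂ _).toLinearMap := by
  refine TensorProduct.ext (LinearMap.ext_ring (LinearMap.ext fun α => ?_))
  simp only [LinearMap.compr₂ₛₗ_apply, mk_apply, LinearMap.comp_apply, LinearEquiv.coe_coe,
    map_tmul, coevaluationSwap, contractRightSwap, coevaluation_apply_one, map_sum,
    comm_tmul, sum_tmul, assoc_tmul, contractLeft_apply,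
    lid_tmul, rid_symm_apply, LinearMap.id_apply, one_smul]
  have e : ∀ i, (Module.Basis.ofVectorSpace ℂ V).coord i ⊗ₜ[ℂ] α ((Module.Basis.ofVectorSpace ℂ V) i) =
      (α ((Module.Basis.ofVectorSpace ℂ V) i) • (Module.Basis.ofVectorSpace ℂ V).coord i) ⊗ₜ[ℂ] (1 : ℂ) := fun i => by
    rw [← smul_tmul', ← tmul_smul, smul_eq_mul, mul_one]
  simp only [e]
  rw [← sum_tmul]
  congr 1
  refine LinearMap.ext fun v => ?_
  rw [LinearMap.sum_apply]
  conv_rhs => rw [← (Module.Basis.ofVectorSpace ℂ V).sum_repr v, map_sum]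
  refine Finset.sum_congr rfl fun i _ => ?_
  rw [LinearMap.smul_apply, map_smul, Module.Basis.coord_apply, smul_eq_mul, smul_eq_mul, mul_comm]

end Duals

section FiniteTensor

variable {h : Type} [AddCommGroup h] [Module ℂ h] [FiniteDimensional ℂ h]
variable {D : SympData h} {f : Submodule ℂ h} {c : HChoice D f}

namespace Mod

variable (P : Polarization D f) (hβ : D.β = 1)

/-- The core of a dual of a module. -/
@[reducible] def dualCore (ε : ℂ) (M : Mod D c.H) : Core P c :=
  coindCore P c hβ ((M.oneRep P hβ).dual ε) fun a α => LinearMap.ext fun y => by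
    rw [dual_act, dual_act]
    exact congrArg (fun z => ε * α (M.obj.one.par z)) (M.oneRep_act_r P hβ a y)

/-- A dual of a module. -/
def dual (ε : ℂ) (M : Mod D c.H) : Mod D c.H := (dualCore P hβ ε M).toMod hβ

lemma dual_oneRep_act (ε : ℂ) (M : Mod D c.H) (a : h) (α : Module.Dual ℂ M.obj.one.V) :
    ((dual P hβ ε M).oneRep P hβ).act a α = ((M.oneRep P hβ).dual ε).act a α :=
  (dualCore P hβ ε M).oneRep_act hβ a α

lemma tens_dual_act (ε : ℂ) (M : Mod D c.H) (a : h) (v : M.obj.one.V ⊗[ℂ] Module.Dual ℂ M.obj.one.V) :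
    ((tens P hβ M (dual P hβ ε M)).oneRep P hβ).act a v =
      ((M.oneRep P hβ).tensor ((M.oneRep P hβ).dual ε)).act a v :=
  (tens_act P hβ M (dual P hβ ε M) a v).trans <|
    congrArg (fun T : Module.End ℂ (Module.Dual ℂ M.obj.one.V) =>
      map ((M.oneRep P hβ).act a) (LinearMap.id (M := Module.Dual ℂ M.obj.one.V)) v +
        map M.obj.one.par T v)
      (LinearMap.ext (dual_oneRep_act P hβ ε M a))

lemma dual_tens_act (ε : ℂ) (M : Mod D c.H) (a : h) (v : Module.Dual ℂ M.obj.one.V ⊗[ℂ] M.obj.one.V) :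
    ((tens P hβ (dual P hβ ε M) M).oneRep P hβ).act a v =
      (((M.oneRep P hβ).dual ε).tensor (M.oneRep P hβ)).act a v :=
  (tens_act P hβ (dual P hβ ε M) M a v).trans <|
    congrArg (fun T : Module.End ℂ (Module.Dual ℂ M.obj.one.V) =>
      map T (LinearMap.id (M := M.obj.one.V)) v + map M.obj.one.par.dualMap ((M.oneRep P hβ).act a) v)
      (LinearMap.ext (dual_oneRep_act P hβ ε M a))

/-- A homomorphism from the unit. -/
def fromUnit {N : Mod D c.H} (k : ℂ →ₗ[ℂ] N.obj.one.V) (hp : N.obj.one.par (k 1) = k 1)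
    (hk : ∀ a, (N.oneRep P hβ).act a (k 1) = 0) : unitMod c P hβ ⟶ N :=
  lift P hβ k
    (fun t : ℂ => by
      have e : k t = t • k 1 := by rw [← map_smul, smul_eq_mul, mul_one]
      refine e.trans (Eq.trans ?_ (congrArg N.obj.one.par e).symm)
      rw [map_smul, hp])
    (fun a (t : ℂ) => by
      have e : k t = t • k 1 := by rw [← map_smul, smul_eq_mul, mul_one]
      refine (congrArg k (unit_act P hβ a t)).trans ((map_zero k).trans ?_)
      exact ((congrArg ((N.oneRep P hβ).act a) e).trans (by rw [map_smul, hk, smul_zero])).symm)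

/-- A homomorphism to the unit. -/
def toUnit {N : Mod D c.H} (k : N.obj.one.V →ₗ[ℂ] ℂ) (hp : ∀ y, k (N.obj.one.par y) = k y)
    (hk : ∀ a y, k ((N.oneRep P hβ).act a y) = 0) : N ⟶ unitMod c P hβ :=
  lift P hβ k hp fun a y => (hk a y).trans (unit_act P hβ a _).symm

/-- The coevaluation of the right dual. -/
def rightCoev (M : Mod D c.H) : unitMod c P hβ ⟶ tens P hβ M (dual P hβ (-1) M) :=
  fromUnit P hβ (N := tens P hβ M (dual P hβ (-1) M)) (coevaluation ℂ M.obj.one.V)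
    (coevaluation_even M.obj.one) fun a =>
    (tens_dual_act P hβ (-1) M a (coevaluation ℂ M.obj.one.V 1)).trans
      (coevaluation_killed (M.oneRep P hβ) a)

/-- The evaluation of the right dual. -/
def rightEv (M : Mod D c.H) : tens P hβ (dual P hβ (-1) M) M ⟶ unitMod c P hβ :=
  toUnit P hβ (contractLeft ℂ M.obj.one.V)
    (fun v => LinearMap.congr_fun (f := contractLeft ℂ M.obj.one.V ∘ₗ
        map M.obj.one.par.dualMap M.obj.one.par) (g := contractLeft ℂ M.obj.one.V)
      (ext' fun α y => congrArg α (M.obj.one.par_par y)) v)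
    fun a v => (congrArg (contractLeft ℂ M.obj.one.V) (dual_tens_act P hβ (-1) M a v)).trans <|
      LinearMap.congr_fun (f := contractLeft ℂ M.obj.one.V ∘ₗ
        (((M.oneRep P hβ).dual (-1)).tensor (M.oneRep P hβ)).act a) (g := 0)
      (ext' fun α y => by
        rw [LinearMap.comp_apply, tensor_act, map_add, contractLeft_apply, contractLeft_apply]
        change (-1) * α (M.obj.one.par ((M.oneRep P hβ).act a y)) +
          α (M.obj.one.par ((M.oneRep P hβ).act a y)) = 0
        ring) v

/-- The coevaluation of the left dual. -/
def leftCoev (M : Mod D c.H) : unitMod c P hβ ⟶ tens P hβ (dual P hβ 1 M) M :=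
  fromUnit P hβ (coevaluationSwap M.obj.one.V) (coevaluationSwap_even M.obj.one) fun a =>
    (dual_tens_act P hβ 1 M a _).trans (coevaluationSwap_killed (M.oneRep P hβ) a)

/-- The evaluation of the left dual. -/
def leftEv (M : Mod D c.H) : tens P hβ M (dual P hβ 1 M) ⟶ unitMod c P hβ :=
  toUnit P hβ (contractRightSwap M.obj.one.V)
    (fun v => LinearMap.congr_fun (f := contractRightSwap M.obj.one.V ∘ₗ
        map M.obj.one.par M.obj.one.par.dualMap) (g := contractRightSwap M.obj.one.V)
      (ext' fun y α => congrArg α (M.obj.one.par_par y)) v)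
    fun a v => (congrArg (contractRightSwap M.obj.one.V) (tens_dual_act P hβ 1 M a v)).trans <|
      LinearMap.congr_fun (f := contractRightSwap M.obj.one.V ∘ₗ
        ((M.oneRep P hβ).tensor ((M.oneRep P hβ).dual 1)).act a) (g := 0)
      (ext' fun y α => by
        rw [LinearMap.comp_apply, tensor_act, map_add]
        change α ((M.oneRep P hβ).act a y) +
          1 * α (M.obj.one.par ((M.oneRep P hβ).act a (M.obj.one.par y))) = 0
        have e := (M.oneRep P hβ).act_par a y
        rw [e, map_neg, M.obj.one.par_par, map_neg, one_mul, add_neg_cancel]) v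

/-- Right duality. -/
def rightPairing (M : Mod D c.H) : letI := monoidal (c := c) P hβ; ExactPairing M (dual P hβ (-1) M) :=
  letI := monoidal (c := c) P hβ
  { coevaluation' := rightCoev P hβ M
    evaluation' := rightEv P hβ M
    coevaluation_evaluation' := hom_ext P hβ fun v =>
      LinearMap.congr_fun (contractLeft_assoc_coevaluation ℂ M.obj.one.V) v
    evaluation_coevaluation' := hom_ext P hβ fun v =>
      LinearMap.congr_fun (contractLeft_assoc_coevaluation' ℂ M.obj.one.V) v }

/-- Left duality. -/
def leftPairing (M : Mod D c.H) : letI := monoidal (c := c) P hβ; ExactPairing (dual P hβ 1 M) M :=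
  letI := monoidal (c := c) P hβ
  { coevaluation' := leftCoev P hβ M
    evaluation' := leftEv P hβ M
    coevaluation_evaluation' := hom_ext P hβ fun v =>
      LinearMap.congr_fun (contractRightSwap_assoc (V := M.obj.one.V)) v
    evaluation_coevaluation' := hom_ext P hβ fun v =>
      LinearMap.congr_fun (contractRightSwap_assoc' (V := M.obj.one.V)) v }

/-- The tensor product over `H(f)` is rigid. -/
@[reducible] def rigid : letI := monoidal (c := c) P hβ; RigidCategory (Mod D c.H) :=
  letI := monoidal (c := c) P hβ
  { rightDual := fun M => { rightDual := dual P hβ (-1) M, exact := rightPairing P hβ M }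
    leftDual := fun M => { leftDual := dual P hβ 1 M, exact := leftPairing P hβ M } }

lemma hom_ext_tens {M N Q : Mod D c.H} {k l : tens P hβ M N ⟶ Q}
    (hkl : ∀ x y, snd k (x ⊗ₜ[ℂ] y) = snd l (x ⊗ₜ[ℂ] y)) : k = l :=
  hom_ext P hβ fun v => LinearMap.congr_fun
    (ext' (g := (snd k : M.obj.one.V ⊗[ℂ] N.obj.one.V →ₗ[ℂ] Q.obj.one.V))
      (h := (snd l : M.obj.one.V ⊗[ℂ] N.obj.one.V →ₗ[ℂ] Q.obj.one.V)) hkl) v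

variable {P hβ}

lemma tensHom_zero (M : Mod D c.H) {N Q : Mod D c.H} :
    tensHom (P := P) (hβ := hβ) (𝟙 M) (0 : N ⟶ Q) = 0 :=
  hom_ext_tens P hβ fun x _ => tmul_zero _ x

lemma zero_tensHom (M : Mod D c.H) {N Q : Mod D c.H} :
    tensHom (P := P) (hβ := hβ) (0 : N ⟶ Q) (𝟙 M) = 0 :=
  hom_ext_tens P hβ fun _ y => zero_tmul _ y

lemma tensHom_add (M : Mod D c.H) {N Q : Mod D c.H} (k l : N ⟶ Q) :
    tensHom (P := P) (hβ := hβ) (𝟙 M) (k + l) = tensHom (𝟙 M) k + tensHom (𝟙 M) l :=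
  hom_ext_tens P hβ fun x y => tmul_add x (snd k y) (snd l y)

lemma add_tensHom (M : Mod D c.H) {N Q : Mod D c.H} (k l : N ⟶ Q) :
    tensHom (P := P) (hβ := hβ) (k + l) (𝟙 M) = tensHom k (𝟙 M) + tensHom l (𝟙 M) :=
  hom_ext_tens P hβ fun x y => add_tmul (snd k x) (snd l x) y

lemma tensHom_smul (M : Mod D c.H) {N Q : Mod D c.H} (r : ℂ) (k : N ⟶ Q) :
    tensHom (P := P) (hβ := hβ) (𝟙 M) (r • k) = r • tensHom (𝟙 M) k :=
  hom_ext_tens P hβ fun x y => tmul_smul r x (snd k y)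

lemma smul_tensHom (M : Mod D c.H) {N Q : Mod D c.H} (r : ℂ) (k : N ⟶ Q) :
    tensHom (P := P) (hβ := hβ) (r • k) (𝟙 M) = r • tensHom k (𝟙 M) :=
  hom_ext_tens P hβ fun x y => (smul_tmul' r (snd k x) y).symm

variable (P hβ)

lemma bilinear : letI := monoidal (c := c) P hβ;
    ∃ _ : MonoidalPreadditive (Mod D c.H), MonoidalLinear ℂ (Mod D c.H) := by
  letI := monoidal (c := c) P hβ
  haveI : MonoidalPreadditive (Mod D c.H) :=
    { whiskerLeft_zero := fun {M _ _} => tensHom_zero M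
      zero_whiskerRight := fun {M _ _} => zero_tensHom M
      whiskerLeft_add := fun {M _ _} k l => tensHom_add M k l
      add_whiskerRight := fun {M _ _} k l => add_tensHom M k l }
  exact ⟨this,
    { whiskerLeft_smul := fun M {_ _} r k => tensHom_smul M r k
      smul_whiskerRight := fun r {_ _} k M => smul_tensHom M r k }⟩

lemma simple_unit : letI := monoidal (c := c) P hβ; Simple (𝟙_ (Mod D c.H)) :=
  simple_of_finrank P hβ (unitMod c P hβ) (Module.finrank_self ℂ)

end Mod

/-- The quadratic form `(u, r) ↦ r²` on `f × ℂ`. -/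
def parForm (f : Submodule ℂ h) : QuadraticForm ℂ (f × ℂ) :=
  QuadraticMap.sq.comp (LinearMap.snd ℂ f ℂ)

/-- The algebra generated by the exterior algebra of `f` and an involution that anticommutes with
the elements of `f`. -/
abbrev parAlg (f : Submodule ℂ h) : Type := CliffordAlgebra (parForm f)

instance : FiniteDimensional ℂ (parAlg f) :=
  haveI : Invertible (2 : ℂ) := invertibleOfNonzero two_ne_zero
  LinearEquiv.finiteDimensional (CliffordAlgebra.equivExterior (parForm f)).symm

namespace Mod

variable (P : Polarization D f) (hβ : D.β = 1) (M : Mod D c.H)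

/-- The representation of the algebra on sector 1. -/
def parRep : parAlg f →ₐ[ℂ] Module.End ℂ M.obj.one.V :=
  CliffordAlgebra.lift (parForm f)
    ⟨LinearMap.coprod ((M.oneRep P hβ).act ∘ₗ f.subtype)
        (LinearMap.toSpanSingleton ℂ (Module.End ℂ M.obj.one.V) M.obj.one.par), fun v => by
      obtain ⟨u, r⟩ := v
      refine LinearMap.ext fun y => ?_
      have e1 := (M.oneRep P hβ).act_act u y
      have e2 := (M.oneRep P hβ).act_par u y
      change (M.oneRep P hβ).act u ((M.oneRep P hβ).act u y + r • M.obj.one.par y) +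
        r • M.obj.one.par ((M.oneRep P hβ).act u y + r • M.obj.one.par y) = (r * r) • y
      rw [map_add, map_add, map_smul, map_smul, e1, e2, M.obj.one.par_par, smul_add, smul_smul]
      change 0 + r • -M.obj.one.par ((M.oneRep P hβ).act u y) + _ = _
      rw [zero_add, smul_neg, neg_add_cancel_left]⟩

lemma parRep_ι (u : f) (r : ℂ) (y : M.obj.one.V) :
    M.parRep P hβ (CliffordAlgebra.ι (parForm f) (u, r)) y =
      (M.oneRep P hβ).act u y + r • M.obj.one.par y := by
  rw [parRep, CliffordAlgebra.lift_ι_apply]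
  rfl

/-- Sector 1, as a module over the algebra. -/
def ParMod (_ : Polarization D f) (_ : D.β = 1) (M : Mod D c.H) : Type := M.obj.one.V

instance : AddCommGroup (ParMod P hβ M) := inferInstanceAs (AddCommGroup M.obj.one.V)

instance : Module ℂ (ParMod P hβ M) := inferInstanceAs (Module ℂ M.obj.one.V)

instance : FiniteDimensional ℂ (ParMod P hβ M) := inferInstanceAs (FiniteDimensional ℂ M.obj.one.V)

instance : Module (parAlg f) (ParMod P hβ M) := Module.compHom M.obj.one.V (M.parRep P hβ).toRingHom

lemma ParMod.smul_def (x : parAlg f) (y : ParMod P hβ M) : x • y = M.parRep P hβ x y := rfl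

instance : IsScalarTower ℂ (parAlg f) (ParMod P hβ M) where
  smul_assoc r x y := by
    rw [ParMod.smul_def, map_smul]
    rfl

instance : Module.Finite (parAlg f) (ParMod P hβ M) := Module.Finite.of_restrictScalars_finite ℂ _ _

variable {M}

lemma parRep_snd {N : Mod D c.H} (k : M ⟶ N) (x : parAlg f) (y : M.obj.one.V) :
    snd k (M.parRep P hβ x y) = N.parRep P hβ x (snd k y) := by
  induction x using CliffordAlgebra.induction generalizing y with
  | algebraMap r => rw [commutes, commutes]; exact map_smul (snd k) r y
  | ι v =>
    obtain ⟨u, r⟩ := v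
    rw [parRep_ι, parRep_ι, map_add, map_smul, isEven_snd, intertwines_snd P hβ k]
  | mul x x' hx hx' => rw [map_mul, map_mul, Module.End.mul_apply, Module.End.mul_apply, hx, hx']
  | add x x' hx hx' => rw [map_add, map_add, LinearMap.add_apply, LinearMap.add_apply, map_add, hx, hx']

/-- Sector 1, as a functor to the modules over the algebra. -/
def parFunctor (c : HChoice D f) : Mod D c.H ⥤ FGModuleCat.{0} (parAlg f) where
  obj M := FGModuleCat.of (parAlg f) (ParMod P hβ M)
  map {M N} k := FGModuleCat.ofHom
    { toFun := fun y => (snd k y : N.obj.one.V)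
      map_add' := map_add (snd k)
      map_smul' := fun x y => parRep_snd P hβ k x y }

instance : (parFunctor P hβ c).Additive where

lemma ParMod.complex_smul (r : ℂ) (y : ParMod P hβ M) : r • y = algebraMap ℂ (parAlg f) r • y := by
  rw [ParMod.smul_def, commutes]
  rfl

instance : (parFunctor P hβ c).Linear ℂ where
  map_smul {M N} k r := FGModuleCat.hom_ext (LinearMap.ext fun (y : ParMod P hβ M) =>
    ParMod.complex_smul P hβ (M := N) r (snd k y))

instance : (parFunctor P hβ c).Faithful where
  map_injective {M N k l} hkl := hom_ext P hβ fun y =>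
    LinearMap.congr_fun (congrArg (fun t => t.hom.hom) hkl) (show ParMod P hβ M from y)

instance : (parFunctor P hβ c).Full where
  map_surjective {M N} k := by
    let k' : M.obj.one.V →ₗ[ℂ] N.obj.one.V :=
      { toFun := fun y => (k.hom.hom (show ParMod P hβ M from y) : ParMod P hβ N)
        map_add' := fun x y => k.hom.hom.map_add' x y
        map_smul' := fun r y => by
          refine (congrArg k.hom.hom (ParMod.complex_smul P hβ (M := M) r y)).trans ?_
          refine (k.hom.hom.map_smul' (algebraMap ℂ (parAlg f) r) y).trans ?_
          exact (ParMod.complex_smul P hβ (M := N) r _).symm }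
    have hk : ∀ (u : f) (r : ℂ) (y : M.obj.one.V), k' ((M.oneRep P hβ).act u y + r • M.obj.one.par y) =
          (N.oneRep P hβ).act u (k' y) + r • N.obj.one.par (k' y) := fun u r y => by
      rw [← parRep_ι, ← parRep_ι]
      exact k.hom.hom.map_smul' (CliffordAlgebra.ι (parForm f) (u, r)) y
    refine ⟨lift P hβ k' (fun y => ?_) (fun a y => ?_), rfl⟩
    · have := hk 0 1 y
      rw [Submodule.coe_zero, map_zero, map_zero, LinearMap.zero_apply, LinearMap.zero_apply, zero_add,
        zero_add, one_smul, one_smul] at this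
      exact this
    · have := hk ⟨P.r a, P.r_mem a⟩ 0 y
      rw [zero_smul, zero_smul, add_zero, add_zero] at this
      rwa [oneRep_act_r, oneRep_act_r] at this

/-- The representation of `h` determined by a module over the algebra. -/
@[reducible] def ofParMod (N : FGModuleCat.{0} (parAlg f)) : SRep h where
  V := N.obj
  fin := Module.Finite.trans (parAlg f) N.obj
  par := Algebra.lsmul ℂ ℂ N.obj (CliffordAlgebra.ι (parForm f) (0, 1))
  par_par v := by
    rw [← Module.End.mul_apply, ← map_mul, CliffordAlgebra.ι_sq_scalar, commutes]
    change (1 * 1 : ℂ) • v = v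
    rw [one_mul, one_smul]
  act := (Algebra.lsmul ℂ ℂ N.obj).toLinearMap ∘ₗ CliffordAlgebra.ι (parForm f) ∘ₗ
    LinearMap.inl ℂ f ℂ ∘ₗ P.r.codRestrict f P.r_mem
  act_act a v := by
    change Algebra.lsmul ℂ ℂ N.obj (CliffordAlgebra.ι (parForm f) _)
      (Algebra.lsmul ℂ ℂ N.obj (CliffordAlgebra.ι (parForm f) _) v) = 0
    rw [← Module.End.mul_apply, ← map_mul, CliffordAlgebra.ι_sq_scalar, commutes]
    change (0 * 0 : ℂ) • v = 0
    rw [zero_mul, zero_smul]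
  act_par a v := by
    rw [eq_neg_iff_add_eq_zero]
    change Algebra.lsmul ℂ ℂ N.obj (CliffordAlgebra.ι (parForm f) (P.r.codRestrict f P.r_mem a, 0))
      (Algebra.lsmul ℂ ℂ N.obj (CliffordAlgebra.ι (parForm f) (0, 1)) v) +
      Algebra.lsmul ℂ ℂ N.obj (CliffordAlgebra.ι (parForm f) (0, 1))
      (Algebra.lsmul ℂ ℂ N.obj (CliffordAlgebra.ι (parForm f) (P.r.codRestrict f P.r_mem a, 0)) v) = 0
    rw [← Module.End.mul_apply, ← Module.End.mul_apply, ← map_mul (Algebra.lsmul ℂ ℂ N.obj),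
      ← map_mul (Algebra.lsmul ℂ ℂ N.obj), ← LinearMap.add_apply, ← map_add (Algebra.lsmul ℂ ℂ N.obj), CliffordAlgebra.ι_mul_ι_add_swap, commutes]
    have : QuadraticMap.polar (parForm f) (P.r.codRestrict f P.r_mem a, (0 : ℂ)) (0, 1) = 0 := by
      change (0 + 1) * (0 + 1) - 0 * 0 - 1 * 1 = (0 : ℂ)
      ring
    rw [this, map_zero, LinearMap.zero_apply]

lemma ofParMod_r (N : FGModuleCat.{0} (parAlg f)) (a : h) (v : (ofParMod P N).V) :
    (ofParMod P N).act (P.r a) v = (ofParMod P N).act a v := by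
  have : P.r.codRestrict f P.r_mem (P.r a) = P.r.codRestrict f P.r_mem a :=
    Subtype.ext (P.r_id _ (P.r_mem a))
  change Algebra.lsmul ℂ ℂ N.obj (CliffordAlgebra.ι (parForm f) (P.r.codRestrict f P.r_mem (P.r a), 0)) v = _
  rw [this]
  rfl

lemma ofParMod_act_add (N : FGModuleCat.{0} (parAlg f)) (u : f) (r : ℂ) (y : N.obj) :
    (ofParMod P N).act u y + r • (ofParMod P N).par y = CliffordAlgebra.ι (parForm f) (u, r) • y := by
  have e : P.r.codRestrict f P.r_mem u = u := Subtype.ext (P.r_id _ u.2)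
  change CliffordAlgebra.ι (parForm f) (P.r.codRestrict f P.r_mem u, 0) • y + r •
    (CliffordAlgebra.ι (parForm f) (0, 1) • y) = _
  rw [e, ← smul_assoc, ← map_smul, ← add_smul, ← map_add, Prod.smul_mk, Prod.mk_add_mk, smul_zero,
    add_zero, zero_add, smul_eq_mul, mul_one]

/-- The core determined by a module over the algebra. -/
@[reducible] def parCore (N : FGModuleCat.{0} (parAlg f)) : Core P c :=
  coindCore P c hβ (ofParMod P N) (ofParMod_r P N)

variable {P} in
lemma parRep_toMod (A : Core P c) (u : f) (r : ℂ) (y : A.one.V) :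
    (A.toMod hβ).parRep P hβ (CliffordAlgebra.ι (parForm f) (u, r)) y =
      A.one.act u y + r • A.one.par y :=
  (parRep_ι P hβ (A.toMod hβ) u r y).trans
    (congrArg (fun w : A.one.V => w + r • A.one.par y) (A.oneRep_act hβ u y))

lemma parRep_parCore (N : FGModuleCat.{0} (parAlg f)) (x : parAlg f) (y : N.obj) :
    ((parCore (c := c) P hβ N).toMod hβ).parRep P hβ x y = x • y := by
  induction x using CliffordAlgebra.induction generalizing y with
  | algebraMap r => rw [commutes]; exact (algebraMap_smul (parAlg f) r y).symm
  | ι v =>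
    obtain ⟨u, r⟩ := v
    exact (parRep_toMod hβ (parCore (c := c) P hβ N) u r y).trans (ofParMod_act_add P N u r y)
  | mul x x' hx hx' =>
    rw [map_mul, mul_smul, ← hx']
    exact hx _
  | add x x' hx hx' =>
    rw [map_add, add_smul]
    exact congrArg₂ (fun v w : N.obj => v + w) (hx y) (hx' y)

instance : (parFunctor P hβ c).EssSurj where
  mem_essImage N := ⟨(parCore P hβ N).toMod hβ, ⟨LinearEquiv.toFGModuleCatIso
    (V := ParMod P hβ ((parCore (c := c) P hβ N).toMod hβ)) (W := N.obj)
    { toFun := fun y => y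
      invFun := fun y => y
      map_add' := fun _ _ => rfl
      map_smul' := parRep_parCore P hβ N
      left_inv := fun _ => rfl
      right_inv := fun _ => rfl }⟩⟩

instance : (parFunctor P hβ c).IsEquivalence where

include P hβ in
lemma finite : ∃ (R : Type) (_ : Ring R) (_ : Algebra ℂ R) (_ : FiniteDimensional ℂ R)
    (E : Mod D c.H ≌ FGModuleCat.{0} R), Functor.Additive E.functor ∧ Functor.Linear ℂ E.functor :=
  ⟨parAlg f, inferInstance, inferInstance, inferInstance, (parFunctor P hβ c).asEquivalence,
    inferInstanceAs (parFunctor P hβ c).Additive, inferInstanceAs ((parFunctor P hβ c).Linear ℂ)⟩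

include P hβ in
lemma abelian : ∃ ab : Abelian (Mod D c.H),
    ab.toPreadditive = (inferInstance : Preadditive (Mod D c.H)) := by
  haveI : IsNoetherianRing (parAlg f) := isNoetherian_of_tower ℂ inferInstance
  haveI : Limits.HasFiniteProducts (Mod D c.H) := ⟨fun n =>
    Adjunction.hasLimitsOfShape_of_equivalence (parFunctor P hβ c)⟩
  exact ⟨abelianOfEquivalence (parFunctor P hβ c), rfl⟩

lemma isFiniteTensor : letI := monoidal (c := c) P hβ; IsFiniteTensorCategory (Mod D c.H) :=
  letI := monoidal (c := c) P hβ
  { abelian := abelian P hβ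
    bilinear := bilinear P hβ
    rigid := ⟨rigid P hβ⟩
    simple_unit := simple_unit P hβ
    finite := finite P hβ }

end Mod

end FiniteTensor

section Homogeneous

variable {h : Type} [AddCommGroup h] [Module ℂ h]

/-- Linear maps that agree on homogeneous vectors are equal. -/
lemma eq_of_homogeneous {X : SVect} {W : Type} [AddCommGroup W] [Module ℂ W] {F G : X.V →ₗ[ℂ] W}
    (hFG : ∀ (ε : ℂ) (x : X.V), ε * ε = 1 → X.par x = ε • x → F x = G x) (x : X.V) : F x = G x := by
  have h1 := hFG 1 (x + X.par x) (one_mul 1) (by rw [map_add, X.par_par, one_smul, add_comm])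
  have h2 := hFG (-1) (x - X.par x) (by norm_num) (by rw [map_sub, X.par_par, neg_smul, one_smul, neg_sub])
  rw [map_add, map_add] at h1
  rw [map_sub, map_sub] at h2
  have h3 : (2 : ℂ) • F x = (2 : ℂ) • G x := by
    calc (2 : ℂ) • F x = (F x + F (X.par x)) + (F x - F (X.par x)) := by rw [two_smul]; abel
      _ = (2 : ℂ) • G x := by rw [h1, h2, two_smul]; abel
  exact smul_right_injective W (two_ne_zero (α := ℂ)) h3

lemma intertwines_map_twist {X X' W W' : SRep h} {k : X.V →ₗ[ℂ] X'.V} {l : W.V →ₗ[ℂ] W'.V} {ε : ℂ}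
    (hk : Intertwines X X' k) (hp : ∀ x, X'.par (k x) = ε • k (X.par x)) (hl : Intertwines W W' l) :
    Intertwines (X.tensor (W.pull (ε • 𝕀))) (X'.tensor W') (map k l) :=
  fun a z => by
    induction z using TensorProduct.induction_on with
    | zero => simp
    | add x y hx hy => simp only [map_add, hx, hy]
    | tmul x w =>
      rw [tensor_act, map_add, map_tmul, map_tmul, map_tmul,
        tensor_act, hk, hp, smul_tmul, LinearMap.comp_apply, LinearMap.smul_apply,
        LinearMap.id_apply, map_smul, LinearMap.smul_apply, map_smul, hl]

variable [FiniteDimensional ℂ h] (D : SympData h)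

lemma gam_natural_twist (s : ℂ) {X X' W W' : SRep h} {k : X.V →ₗ[ℂ] X'.V} {l : W.V →ₗ[ℂ] W'.V} {ε : ℂ}
    (hk : Intertwines X X' k) (hp : ∀ x, X'.par (k x) = ε • k (X.par x)) (hl : Intertwines W W' l)
    (z : X.V ⊗[ℂ] W.V) :
    map k l (D.gam s X (W.pull (ε • 𝕀)) z) = D.gam s X' W' (map k l z) :=
  gexp_nat D s (k := map k l) (fun b a v => by
    induction v with
    | zero => simp
    | add x y hx hy => simp only [map_add, hx, hy]
    | tmul x w =>
      rw [Fam.r_tmul, Fam.l_tmul, map_tmul, map_tmul, Fam.r_tmul,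
        Fam.l_tmul, hk, hp, map_smul, smul_tmul, LinearMap.comp_apply,
        LinearMap.smul_apply, LinearMap.id_apply, map_smul, LinearMap.smul_apply, map_smul, hl]) z

lemma par_orb {A : SRep h} {w : A.V} {ε : ℂ} (hw : A.par w = ε • w) (g : S h) :
    A.par (A.orb w g) = ε • A.orb w (invol g) := by
  rw [orb_apply, orb_apply, par_rho, hw, map_smul]

lemma orb_sig (s : ℂ) (A : SRep h) (w : A.V) (g : S h) :
    A.orb (D.sig s A w) g = A.orb w (D.sig s (reg h) g) := by
  rw [sig_natural D s (intertwines_orb A w) g]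
  exact (rho_natural (X := A) (X' := A) (k := D.sig s A) (fun a x => (act_sig D s A a x).symm) g w).symm

lemma rho_tmul_homogeneous {A : SRep h} (W : SRep h) {w : A.V} {ε : ℂ} (hw : A.par w = ε • w) (g : S h)
    (n : W.V) : (A.tensor W).rho g (w ⊗ₜ n) = map (A.orb w) 𝕀
      (((reg h).tensor (W.pull (ε • 𝕀))).rho g (1 ⊗ₜ n)) := by
  have := rho_natural (intertwines_map_twist (W := W) (l := 𝕀) (intertwines_orb A w)
    (par_orb hw) (fun _ _ => rfl)) g ((1 : S h) ⊗ₜ n)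
  refine (congrArg ((A.tensor W).rho g) ?_).trans this.symm
  rw [map_tmul, orb_apply, rho_one]
  rfl

variable {D} in
lemma gam_phi_tmul (hβ : D.β = 1) (W : SRep h) (g : S h) (n : W.V) :
    D.gam 1 (reg h) W (D.phi g ⊗ₜ n) = map D.phi 𝕀 (((reg h).tensor W).rho g (1 ⊗ₜ n)) := by
  have h1 := gam_natural_right D 1 (reg h) (W := reg h) (W' := W) (l := W.orb n) (intertwines_orb W n) (D.phi g ⊗ₜ 1)
  rw [← gam_phi_comul hβ g] at h1
  have h2 := gam_gam_neg D 1 (reg h) (reg h) (map D.phi 𝕀 (comul h g))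
  rw [h2, gam_phi_comul hβ g, map_tmul, orb_apply, rho_one] at h1
  refine Eq.trans h1.symm ?_
  rw [rho_tensor_one]
  generalize comul h g = z
  induction z with
  | tmul x y => rfl
  | _ => simp only [map_zero, map_add, *]

variable {D} in
lemma gam_rho_phi (hβ : D.β = 1) {A : SRep h} (W : SRep h) {w : A.V} {ε : ℂ} (hw : A.par w = ε • w)
    (g : S h) (n : W.V) :
    D.gam 1 A W (A.rho (D.phi g) w ⊗ₜ n) = map (A.orb w ∘ₗ D.phi) 𝕀
        (((reg h).tensor (W.pull (ε • 𝕀))).rho g (1 ⊗ₜ n)) := by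
  have h1 := gam_natural_twist D 1 (W := W) (l := 𝕀) (intertwines_orb A w)
    (par_orb hw) (fun _ _ => rfl) ((D.phi g : S h) ⊗ₜ[ℂ] n)
  refine Eq.trans h1.symm ?_
  refine (congrArg (map (A.orb w) 𝕀)
    (gam_phi_tmul hβ (W.pull (ε • 𝕀)) g n)).trans ?_
  rw [map_map]
  rfl

variable {D} in
lemma gam_sig_rho_phi (hβ : D.β = 1) {A : SRep h} (W : SRep h) {w : A.V} {ε : ℂ} (hw : A.par w = ε • w)
    (g : S h) (n : W.V) :
    D.gam 1 A W (D.sig 1 A (A.rho (D.phi g) w) ⊗ₜ n) = map (A.orb w ∘ₗ D.sig 1 (reg h) ∘ₗ D.phi) 𝕀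
        (((reg h).tensor (W.pull (ε • 𝕀))).rho g (1 ⊗ₜ n)) := by
  have hw' : A.par (D.sig 1 A w) = ε • D.sig 1 A w := by rw [sig_par, hw, map_smul]
  have e1 : A.orb (D.sig 1 A w) = A.orb w ∘ₗ D.sig 1 (reg h) := LinearMap.ext fun g => orb_sig D 1 A w g
  have e2 : D.sig 1 A (A.rho (D.phi g) w) = A.rho (D.phi g) (D.sig 1 A w) :=
    rho_natural (X := A) (X' := A) (k := D.sig 1 A) (fun a x => (act_sig D 1 A a x).symm) _ _
  rw [e2, gam_rho_phi hβ W hw', e1]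
  rfl

lemma rho_map_smul_tmul (W : SRep h) (ε : ℂ) (g : S h) (n : W.V) :
    ((reg h).tensor W).rho (ExteriorAlgebra.map (ε • 𝕀) g) (1 ⊗ₜ n) =
      map (ExteriorAlgebra.map (ε • 𝕀 : h →ₗ[ℂ] h)).toLinearMap 𝕀
        (((reg h).tensor (W.pull (ε • 𝕀))).rho g (1 ⊗ₜ n)) := by
  have hk : Intertwines (reg h) ((reg h).pull (ε • 𝕀))
      (ExteriorAlgebra.map (ε • 𝕀 : h →ₗ[ℂ] h)).toLinearMap := fun a x => by
    change ExteriorAlgebra.map (ε • 𝕀 : h →ₗ[ℂ] h) (ι ℂ a * x) =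
      ι ℂ ((ε • 𝕀 : h →ₗ[ℂ] h) a) * ExteriorAlgebra.map (ε • 𝕀 : h →ₗ[ℂ] h) x
    rw [map_mul, ExteriorAlgebra.map_apply_ι]
  have hp : IsEven (reg h).toSVect ((reg h).pull (ε • 𝕀)).toSVect
      (ExteriorAlgebra.map (ε • 𝕀 : h →ₗ[ℂ] h)).toLinearMap := fun x =>
    (Polarization.invol_map (ε • 𝕀 : h →ₗ[ℂ] h) x).symm
  have h1 := rho_natural (intertwines_map (X := reg h) (X' := (reg h).pull (ε • 𝕀)) (Y := W.pull (ε • 𝕀))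
    (Y' := W.pull (ε • 𝕀)) (l := (𝕀 : W.V →ₗ[ℂ] W.V)) hk hp (fun _ _ => rfl)) g
    ((1 : S h) ⊗ₜ n)
  have h2 : (1 : S h) ⊗ₜ[ℂ] n = map (ExteriorAlgebra.map (ε • 𝕀 : h →ₗ[ℂ] h)).toLinearMap
      𝕀 ((1 : S h) ⊗ₜ[ℂ] n) := by
    rw [map_tmul, AlgHom.toLinearMap_apply, map_one]; rfl
  rw [h1, ← h2, ← rho_pull]
  rfl

end Homogeneous

section Triples

variable {h : Type} [AddCommGroup h] [Module ℂ h] (A B C : SRep h)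

/-- The action on the first factor of a triple tensor product. -/
def fam₁ : Fam h (A.V ⊗[ℂ] (B.V ⊗[ℂ] C.V)) := Fam.l A.act (B.V ⊗[ℂ] C.V)

/-- The action on the second factor of a triple tensor product. -/
def fam₂ : Fam h (A.V ⊗[ℂ] (B.V ⊗[ℂ] C.V)) := Fam.r A.toSVect (Fam.l B.act C.V)

/-- The action on the third factor of a triple tensor product. -/
def fam₃ : Fam h (A.V ⊗[ℂ] (B.V ⊗[ℂ] C.V)) := Fam.r A.toSVect (Fam.r B.toSVect C.act)

lemma anti₁₁ : Anti (fam₁ A B C) (fam₁ A B C) := A.anti.l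
lemma anti₂₂ : Anti (fam₂ A B C) (fam₂ A B C) := B.anti.l.r _
lemma anti₃₃ : Anti (fam₃ A B C) (fam₃ A B C) := (C.anti.r _).r _
lemma anti₁₂ : Anti (fam₁ A B C) (fam₂ A B C) := Anti.l_r A.odd _
lemma anti₁₃ : Anti (fam₁ A B C) (fam₃ A B C) := Anti.l_r A.odd _
lemma anti₂₃ : Anti (fam₂ A B C) (fam₃ A B C) := (Anti.l_r B.odd _).r _

variable {A B C} in
lemma triple_ext {W : Type} [AddCommGroup W] [Module ℂ W] {F G : (A.V ⊗[ℂ] B.V) ⊗[ℂ] C.V →ₗ[ℂ] W}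
    (hFG : ∀ x y z, F ((x ⊗ₜ y) ⊗ₜ z) = G ((x ⊗ₜ y) ⊗ₜ z)) (t : (A.V ⊗[ℂ] B.V) ⊗[ℂ] C.V) : F t = G t :=
  LinearMap.congr_fun (ext_threefold hFG) t

variable [FiniteDimensional ℂ h] (D : SympData h) (s : ℂ)

lemma gam_tensor_right (v : A.V ⊗[ℂ] (B.V ⊗[ℂ] C.V)) : D.gam s A (B.tensor C) v =
    D.gexp s (fam₁ A B C) (fam₂ A B C) (D.gexp s (fam₁ A B C) (fam₃ A B C) v) := by
  have hs : Fam.r A.toSVect (B.tensor C).act = fam₂ A B C + fam₃ A B C := by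
    rw [tensor_act_eq]
    exact LinearMap.comp_add _ _ _
  rw [SympData.gam, hs]
  exact gexp_add_right D s (anti₁₁ A B C) (anti₂₂ A B C) (anti₃₃ A B C) (anti₁₂ A B C) (anti₁₃ A B C)
    (anti₂₃ A B C) v

lemma assoc_gam_tensor_left (v : (A.V ⊗[ℂ] B.V) ⊗[ℂ] C.V) :
    assoc ℂ A.V B.V C.V (D.gam s (A.tensor B) C v) =
      D.gexp s (fam₁ A B C) (fam₃ A B C) (D.gexp s (fam₂ A B C) (fam₃ A B C)
        (assoc ℂ A.V B.V C.V v)) := by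
  rw [← gexp_add_left D s (anti₁₁ A B C) (anti₂₂ A B C) (anti₃₃ A B C) (anti₁₃ A B C) (anti₂₃ A B C)
    (anti₁₂ A B C)]
  refine gexp_nat D s (k := (assoc ℂ A.V B.V C.V).toLinearMap) (fun b a v => ?_) v
  refine triple_ext (A := A) (B := B) (C := C) (F := (assoc ℂ A.V B.V C.V).toLinearMap ∘ₗ
    (Fam.l (A.tensor B).act C.V b) ∘ₗ Fam.r (A.tensor B).toSVect C.act a) (G :=
      (fam₁ A B C + fam₂ A B C) b ∘ₗ fam₃ A B C a ∘ₗ (assoc ℂ A.V B.V C.V).toLinearMap)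
    (fun x y z => ?_) v
  change assoc ℂ A.V B.V C.V ((A.tensor B).act b (A.par x ⊗ₜ B.par y) ⊗ₜ C.act a z) =
    A.act b (A.par x) ⊗ₜ (B.par y ⊗ₜ C.act a z) + A.par (A.par x) ⊗ₜ (B.act b (B.par y) ⊗ₜ C.act a z)
  rw [tensor_act, add_tmul, map_add]
  rfl

lemma assoc_gam_triv (v : (A.V ⊗[ℂ] B.V) ⊗[ℂ] C.V) :
    assoc ℂ A.V B.V C.V (D.gam s (A.tensor (B.toSVect.triv h)) C v) =
      D.gexp s (fam₁ A B C) (fam₃ A B C) (assoc ℂ A.V B.V C.V v) := by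
  refine (assoc_gam_tensor_left A (B.toSVect.triv h) C D s v).trans ?_
  refine congrArg (D.gexp s (fam₁ A B C) (fam₃ A B C)) ?_
  refine gexp_of_left D (anti₂₃ A (B.toSVect.triv h) C) (fun a => ?_)
  have : fam₂ A (B.toSVect.triv h) C a = 0 := by
    refine ext' fun x w => ?_
    induction w with
    | zero => simp only [tmul_zero, map_zero]
    | add u v hu hv => rw [tmul_add, map_add, hu, hv, map_add]
    | tmul y z => exact (congrArg (A.par x ⊗ₜ[ℂ] ·) (zero_tmul _ z)).trans (tmul_zero _ _)
  rw [this]; rfl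

lemma assoc_map_gam (v : (A.V ⊗[ℂ] B.V) ⊗[ℂ] C.V) :
    assoc ℂ A.V B.V C.V (map (D.gam s A B) 𝕀 v) =
      D.gexp s (fam₁ A B C) (fam₂ A B C) (assoc ℂ A.V B.V C.V v) := by
  refine LinearMap.congr_fun (f := (assoc ℂ A.V B.V C.V).toLinearMap ∘ₗ
    map (D.gam s A B) 𝕀) (g := D.gexp s (fam₁ A B C) (fam₂ A B C) ∘ₗ
      (assoc ℂ A.V B.V C.V).toLinearMap) (ext' fun t z => ?_) v
  refine gexp_nat D s (k := (assoc ℂ A.V B.V C.V).toLinearMap ∘ₗ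
    (TensorProduct.mk ℂ (A.V ⊗[ℂ] B.V) C.V).flip z) (fun b a v => ?_) t
  induction v with
  | tmul x y => rfl
  | _ => simp only [map_zero, map_add, *]

lemma map_id_gam (v : A.V ⊗[ℂ] (B.V ⊗[ℂ] C.V)) :
    map 𝕀 (D.gam s B C) v = D.gexp s (fam₂ A B C) (fam₃ A B C) v := by
  refine LinearMap.congr_fun (f := map 𝕀 (D.gam s B C))
    (g := D.gexp s (fam₂ A B C) (fam₃ A B C)) (ext' fun x t => ?_) v
  refine gexp_nat D s (k := mk ℂ A.V (B.V ⊗[ℂ] C.V) x) (fun b a v => ?_) t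
  induction v with
  | tmul y z =>
    change x ⊗ₜ[ℂ] (B.act b (B.par y) ⊗ₜ[ℂ] C.act a z) =
      A.par (A.par x) ⊗ₜ[ℂ] (B.act b (B.par y) ⊗ₜ[ℂ] C.act a z)
    rw [A.par_par]
  | _ => simp only [map_zero, map_add, *]

lemma gam_cocycle_pull (T : h →ₗ[ℂ] h) (v : (A.V ⊗[ℂ] B.V) ⊗[ℂ] C.V) :
    assoc ℂ A.V B.V C.V (D.gam s (A.tensor (B.pull T)) C
      (map (D.gam s A B) 𝕀 v)) =
    map 𝕀 (D.gam s (B.pull T) C)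
      (D.gam s A (B.tensor C) (assoc ℂ A.V B.V C.V v)) := by
  set w := assoc ℂ A.V B.V C.V v with hw
  have e1 : assoc ℂ A.V B.V C.V (D.gam s (A.tensor (B.pull T)) C
      (map (D.gam s A B) 𝕀 v)) =
      D.gexp s (fam₁ A B C) (fam₃ A B C) (D.gexp s (fam₂ A B C ∘ₗ T) (fam₃ A B C)
        (D.gexp s (fam₁ A B C) (fam₂ A B C) w)) :=
    (assoc_gam_tensor_left A (B.pull T) C D s (map (D.gam s A B) 𝕀 v)).trans
      (congrArg (fun t => D.gexp s (fam₁ A B C) (fam₃ A B C) (D.gexp s (fam₂ A B C ∘ₗ T) (fam₃ A B C) t))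
        (assoc_map_gam A B C D s v))
  have e2 : map 𝕀 (D.gam s (B.pull T) C) (D.gam s A (B.tensor C) w) =
      D.gexp s (fam₂ A B C ∘ₗ T) (fam₃ A B C) (D.gexp s (fam₁ A B C) (fam₂ A B C)
        (D.gexp s (fam₁ A B C) (fam₃ A B C) w)) :=
    (map_id_gam A (B.pull T) C D s (D.gam s A (B.tensor C) w)).trans
      (congrArg (D.gexp s (fam₂ A B C ∘ₗ T) (fam₃ A B C)) (gam_tensor_right A B C D s w))
  have a12 := anti₁₂ A B C
  have a13 := anti₁₃ A B C
  have a23 := anti₂₃ A B C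
  rw [e1, e2, gexp_commute D s s (anti₁₁ A B C) a13 a12.symm a23 w,
    gexp_commute D s s (a12.comp_right T) a13 (a23.comp_left T).symm (anti₃₃ A B C)]

lemma gam_cocycle (v : (A.V ⊗[ℂ] B.V) ⊗[ℂ] C.V) :
    assoc ℂ A.V B.V C.V (D.gam s (A.tensor B) C
      (map (D.gam s A B) 𝕀 v)) =
    map 𝕀 (D.gam s B C)
      (D.gam s A (B.tensor C) (assoc ℂ A.V B.V C.V v)) :=
  gam_cocycle_pull A B C D s 𝕀 v

lemma gam_tensor_triv_map (v : (A.V ⊗[ℂ] B.V) ⊗[ℂ] C.V) :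
    D.gam s A (B.tensor C) (assoc ℂ A.V B.V C.V v) = assoc ℂ A.V B.V C.V (map (D.gam s A B) 𝕀
        (D.gam s (A.tensor (B.toSVect.triv h)) C v)) := by
  rw [assoc_map_gam, assoc_gam_triv, gam_tensor_right]

lemma gam_map_tensor_triv (v : (A.V ⊗[ℂ] B.V) ⊗[ℂ] C.V) :
    D.gam s A (B.tensor C) (assoc ℂ A.V B.V C.V v) =
      assoc ℂ A.V B.V C.V (D.gam s (A.tensor (B.toSVect.triv h)) C
        (map (D.gam s A B) 𝕀 v)) := by
  rw [assoc_gam_triv, assoc_map_gam, gam_tensor_right]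
  exact gexp_commute D s s (anti₁₁ A B C) (anti₁₃ A B C) (anti₁₂ A B C).symm (anti₂₃ A B C) _

end Triples

section Preparation

variable {h : Type} [AddCommGroup h] [Module ℂ h] [FiniteDimensional ℂ h]

lemma map_smul_id {ε : ℂ} (x : S h) : (ε = 1 → ExteriorAlgebra.map (ε • 𝕀 : h →ₗ[ℂ] h) x = x) ∧
    (ε = -1 → ExteriorAlgebra.map (ε • 𝕀 : h →ₗ[ℂ] h) x = invol x) := by
  constructor
  · rintro rfl
    rw [one_smul]; exact map_id_S x
  · rintro rfl
    induction x using S.induction with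
    | halg r => rw [commutes, commutes]
    | hadd x y hx hy => rw [map_add, hx, hy, map_add]
    | hmul a x hx =>
      rw [map_mul, hx, ExteriorAlgebra.map_apply_ι, map_mul, invol_ι, LinearMap.smul_apply,
        LinearMap.id_apply, neg_one_smul, map_neg]

lemma flip_tmul_homogeneous {X : SVect} {x : X.V} {ε : ℂ} (hε : ε * ε = 1) (hx : X.par x = ε • x) (g : S h) :
    X.flip (reg h).toSVect (x ⊗ₜ g) = ExteriorAlgebra.map (ε • 𝕀 : h →ₗ[ℂ] h) g ⊗ₜ x := by
  rcases mul_self_eq_one_iff.mp hε with rfl | rfl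
  · rw [(map_smul_id (ε := 1) g).1 rfl]
    exact flip_tmul_of_even (X := X) (Y := (reg h).toSVect) (hx.trans (one_smul ℂ x)) g
  · rw [(map_smul_id (ε := -1) g).2 rfl]
    exact flip_tmul_of_odd (X := X) (Y := (reg h).toSVect) (hx.trans (neg_one_smul ℂ x)) g

variable (D : SympData h)

lemma gam_par_right (s : ℂ) (X W : SRep h) (z : X.V ⊗[ℂ] W.V) :
    map 𝕀 W.par (D.gam s X W z) = D.gam (-s) X W (map 𝕀 W.par z) := by
  rw [SympData.gam, SympData.gam, ← gexp_neg_left]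
  refine gexp_nat D s (k := map 𝕀 W.par) (fun b a v => ?_) z
  induction v with
  | tmul x w => simp [W.act_par, tmul_neg, neg_tmul]
  | _ => simp only [map_zero, map_add, *]

lemma gam_pull_right (s : ℂ) (A B : SRep h) {T T' : h →ₗ[ℂ] h}
    (hT : ∀ a b, D.form (T a) b = D.form a (T' b)) : D.gam s A (B.pull T) = D.gam s (A.pull T') B :=
  gexp_comp_adjoint D s (Fam.l A.act B.V) (Fam.r A.toSVect B.act) T T' hT

lemma gam_split (s : ℂ) (A B : SRep h) {T T' : h →ₗ[ℂ] h} (hT : ∀ a, T a + T' a = a) (v : A.V ⊗[ℂ] B.V) :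
    D.gam s A B v = D.gam s (A.pull T) B (D.gam s (A.pull T') B v) := by
  have hs : Fam.l A.act B.V = Fam.l A.act B.V ∘ₗ T + Fam.l A.act B.V ∘ₗ T' := LinearMap.ext fun a => by
    rw [LinearMap.add_apply, LinearMap.comp_apply, LinearMap.comp_apply, ← map_add, hT]
  have hA : Anti (Fam.l A.act B.V) (Fam.l A.act B.V) := A.anti.l
  have hAB := Anti.l_r A.odd (W := B.V) B.act
  have := gexp_add_left D s ((hA.comp_left T).comp_right T) ((hA.comp_left T').comp_right T')
    (B.anti.r A.toSVect) (hAB.comp_left T) (hAB.comp_left T') ((hA.comp_left T).comp_right T') v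
  rw [← hs] at this
  exact this

variable {D} in
lemma phi_sig_phi (hβ : D.β = 1) (g : S h) :
    D.phi (D.sig 1 (reg h) (D.phi g)) = D.sig (-1) (reg h) (D.phi (D.sig (-1) (reg h) g)) := by
  have h1 : D.phi (D.sig 1 (reg h) (1 : S h)) = D.sig (-1) (reg h) (1 : S h) := by
    have := sig_neg_sig D 1 (reg h) (D.phi (D.sig 1 (reg h) (1 : S h)))
    rw [← this]
    exact congrArg _ (psi_one hβ)
  have key : D.psi ∘ₗ D.phi ∘ₗ D.sig 1 (reg h) = D.phi := by
    refine S.ext_of_mul ?_ fun a x hx => ?_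
    · change D.psi (D.phi (D.sig 1 (reg h) (1 : S h))) = _
      rw [h1]
      change D.sig 1 (reg h) (D.phi (D.sig 1 (reg h) (D.sig (-1) (reg h) (1 : S h)))) = _
      rw [sig_sig_neg]
      exact sig_of_killed D 1 (reg h) fun a => by
        have := phi_dd hβ a (1 : S h)
        rw [dd_one, map_zero] at this
        exact this.symm
    · change D.psi (D.phi (D.sig 1 (reg h) (ι ℂ a * x))) = _
      rw [← ι_mul_sig, phi_ι_mul hβ, map_neg, ← dd_psi hβ, phi_ι_mul hβ]
      exact congrArg (fun t => -D.dd a t) hx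
  have h2 := LinearMap.congr_fun key (D.sig (-1) (reg h) g)
  rw [← h2]
  change _ = D.sig (-1) (reg h) (D.sig 1 (reg h) (D.phi (D.sig 1 (reg h) (D.phi (D.sig 1 (reg h)
    (D.sig (-1) (reg h) g))))))
  rw [sig_neg_sig, sig_sig_neg]

variable {D} {f : Submodule ℂ h} (P : Polarization D f) (c : HChoice D f) (hβ : D.β = 1)

lemma comul_conv (k : S h →ₗ[ℂ] ℂ) (g : S h) :
    comul h (conv k g) = map (conv k) 𝕀 (comul h g) := by
  have e3 : map (comul h) 𝕀 (comul h g) =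
      (((reg h).tensor (reg h)).tensor (reg h)).rho g ((1 ⊗ₜ 1) ⊗ₜ 1) := by
    have := rho_natural (intertwines_map_left (reg h) intertwines_comul isEven_comul) g ((1 : S h) ⊗ₜ[ℂ] (1 : S h))
    rw [map_tmul, comul_one, ← comul_apply] at this
    exact this
  have e4 := rho_natural (intertwines_assoc (reg h) (reg h) (reg h)) g
    (((1 : S h) ⊗ₜ[ℂ] (1 : S h)) ⊗ₜ[ℂ] (1 : S h))
  have e5 := rho_conv ((reg h).tensor (reg h)) k g ((1 : S h) ⊗ₜ[ℂ] (1 : S h))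
  rw [comul_apply, e5]
  have e6 := e4.symm.trans rfl
  refine (congrArg (fun t => lid ℂ (S h ⊗[ℂ] S h) (map k 𝕀 t)) e4.symm).trans ?_
  rw [← e3]
  generalize comul h g = t
  induction t with
  | tmul x y =>
    rw [map_tmul, map_tmul, conv, LinearMap.comp_apply, LinearMap.comp_apply]
    generalize comul h x = t
    induction t with
    | tmul x z =>
      simp [smul_tmul']
    | _ => simp_all [add_tmul, tmul_add]
  | _ => simp only [map_zero, map_add, *]

include hβ in
/-- `E` commutes with the coaction on the second factor. -/
lemma map_E_rho (X : SRep h) (x : X.V) (g : S h) :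
    map 𝕀 c.E ((X.tensor (reg h)).rho g (x ⊗ₜ 1)) = (X.tensor (reg h)).rho (c.E g) (x ⊗ₜ 1) := by
  have e1 : (reg h).toSVect.flip X.toSVect ((1 : S h) ⊗ₜ x) = x ⊗ₜ (1 : S h) :=
    flip_tmul_of_even (map_one invol) x
  rw [← e1, ← rho_natural (intertwines_flip (reg h) X), ← rho_natural (intertwines_flip (reg h) X)]
  rw [← flip_natural (X := (reg h).toSVect) (X' := (reg h).toSVect) (Y := X.toSVect) (Y' := X.toSVect)
    (k := c.E) (l := 𝕀) (fun g => (E_invol c hβ g)) (fun _ => rfl)]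
  refine congrArg _ ?_
  rw [rho_tensor_one, rho_tensor_one, HChoice.E, comul_conv]
  generalize comul h g = t
  induction t with
  | tmul x y => rfl
  | _ => simp only [map_zero, map_add, *]

end Preparation

section OrbitTriple

variable {h : Type} [AddCommGroup h] [Module ℂ h] [FiniteDimensional ℂ h] (D : SympData h)

/-- The map `(g ⊗ x) ⊗ (n ⊗ z) ↦ g.(j x n ⊗ z)` for an operator `j` on `A ⊗ B`. -/
lemma orbit_gam {B Z : SRep h} {X Y : SVect} {V : Type} [AddCommGroup V] [Module ℂ V]
    (R : Fam h Z.V) (hR : Anti R Z.act) (j : X.V →ₗ[ℂ] B.V →ₗ[ℂ] Y.V →ₗ[ℂ] Z.V)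
    (hj : ∀ a x b y, R a (j x b y) = j (X.par x) (B.act a b) y)
    (κ : Z.V →ₗ[ℂ] V) (k : (S h ⊗[ℂ] X.V) ⊗[ℂ] (B.V ⊗[ℂ] Y.V) →ₗ[ℂ] V)
    (hk : ∀ g x b y, k ((g ⊗ₜ x) ⊗ₜ (b ⊗ₜ y)) = κ (Z.rho g (j x b y))) (x : X.V) (b : B.V) (y : Y.V) :
    k (D.gam 1 ((reg h).tensor (X.triv h)) (B.tensor (Y.triv h)) ((1 ⊗ₜ x) ⊗ₜ (b ⊗ₜ y))) =
      κ (D.gexp 1 Z.act R (j x b y)) := by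
  let m : (S h ⊗[ℂ] X.V) ⊗[ℂ] (B.V ⊗[ℂ] Y.V) →ₗ[ℂ] Z.V :=
    TensorProduct.lift (TensorProduct.lift (LinearMap.mk₂ ℂ
      (fun g x => TensorProduct.lift (((j x).compr₂ (Z.rho g) : B.V →ₗ[ℂ] Y.V →ₗ[ℂ] Z.V)))
      (fun g g' x => by ext; simp) (fun r g x => by ext; simp) (fun g x x' => by ext; simp)
      (fun r g x => by ext; simp)))
  have hm : ∀ g x b y, m ((g ⊗ₜ x) ⊗ₜ (b ⊗ₜ y)) = Z.rho g (j x b y) := fun g x b y => rfl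
  have hkm : k = κ ∘ₗ m := by
    refine TensorProduct.ext (TensorProduct.ext (LinearMap.ext fun g => LinearMap.ext fun x =>
      TensorProduct.ext (LinearMap.ext fun b => LinearMap.ext fun y => ?_)))
    exact hk g x b y
  have hRρ : ∀ a g z, R a (Z.rho g z) = Z.rho (invol g) (R a z) := fun a g z => by
    induction g using S.induction with
    | halg r => rw [invol.commutes, rho_algebraMap, rho_algebraMap, map_smul]
    | hadd g g' hg hg' => rw [map_add, map_add, LinearMap.add_apply, map_add, hg, hg', map_add]; rfl
    | hmul b g hg => rw [rho_ι_mul, hR, hg, invol_ι_mul, map_neg, LinearMap.neg_apply, rho_ι_mul]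
  have key := gexp_nat D 1 (k := m) (P := Fam.l ((reg h).tensor (X.triv h)).act (B.V ⊗[ℂ] Y.V))
    (Q := Fam.r ((reg h).tensor (X.triv h)).toSVect (B.tensor (Y.triv h)).act) (P' := Z.act) (Q' := R)
    (fun b' a v => by
      refine LinearMap.congr_fun (f := m ∘ₗ (Fam.l ((reg h).tensor (X.triv h)).act (B.V ⊗[ℂ] Y.V) b') ∘ₗ
        Fam.r ((reg h).tensor (X.triv h)).toSVect (B.tensor (Y.triv h)).act a) (g := Z.act b' ∘ₗ R a ∘ₗ m)
        (TensorProduct.ext (TensorProduct.ext (LinearMap.ext fun g => LinearMap.ext fun x =>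
          TensorProduct.ext (LinearMap.ext fun b => LinearMap.ext fun y => ?_)))) v
      have e1 : (B.tensor (Y.triv h)).act a (b ⊗ₜ y) = B.act a b ⊗ₜ y :=
        tensor_triv_act B Y a (b ⊗ₜ y)
      have e2 : ((reg h).tensor (X.triv h)).act b' ((reg h).par g ⊗ₜ X.par x) =
          ((ι ℂ b' * invol g : S h) ⊗ₜ X.par x) := tensor_triv_act (reg h) X b' _
      change m (((reg h).tensor (X.triv h)).act b' ((reg h).par g ⊗ₜ X.par x) ⊗ₜ[ℂ]
        (B.tensor (Y.triv h)).act a (b ⊗ₜ y)) = Z.act b' (R a (m ((g ⊗ₜ x) ⊗ₜ (b ⊗ₜ y))))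
      rw [e1, e2, hm, hm, hRρ, rho_ι_mul, hj])
    ((1 ⊗ₜ x) ⊗ₜ (b ⊗ₜ y))
  rw [hkm]
  refine congrArg κ (key.trans ?_)
  rw [hm, rho_one]

/-- The exponential identity behind the associator in sector 101. -/
lemma gexp_tensor_middle (A B C : SRep h) (z : (A.V ⊗[ℂ] B.V) ⊗[ℂ] C.V) :
    D.gexp 1 ((A.tensor B).tensor C).act (Fam.l (Fam.r A.toSVect B.act) C.V)
      (map (D.sig (-1) (A.tensor B)) 𝕀 z) =
    (assoc ℂ A.V B.V C.V).symm (map (D.sig (-1) A) (D.gam 1 B C ∘ₗ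
      map (D.sig 1 B) 𝕀) (assoc ℂ A.V B.V C.V z)) := by
  set w := assoc ℂ A.V B.V C.V z with hw
  have a11 := anti₁₁ A B C
  have a12 := anti₁₂ A B C
  have a13 := anti₁₃ A B C
  have a22 := anti₂₂ A B C
  have a23 := anti₂₃ A B C
  have a33 := anti₃₃ A B C
  have e1 : ∀ u, assoc ℂ A.V B.V C.V (D.gexp 1 ((A.tensor B).tensor C).act
      (Fam.l (Fam.r A.toSVect B.act) C.V) u) = D.gexp 1 (fam₁ A B C + (fam₂ A B C + fam₃ A B C)) (fam₂ A B C)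
        (assoc ℂ A.V B.V C.V u) := fun u => by
    refine gexp_nat D 1 (k := (assoc ℂ A.V B.V C.V).toLinearMap) (fun b a v => ?_) u
    refine triple_ext (A := A) (B := B) (C := C) (F := (assoc ℂ A.V B.V C.V).toLinearMap ∘ₗ
      (((A.tensor B).tensor C).act b) ∘ₗ Fam.l (Fam.r A.toSVect B.act) C.V a) (G :=
        (fam₁ A B C + (fam₂ A B C + fam₃ A B C)) b ∘ₗ fam₂ A B C a ∘ₗ
          (assoc ℂ A.V B.V C.V).toLinearMap) (fun x y z => ?_) v
    change assoc ℂ A.V B.V C.V (((A.tensor B).tensor C).act b ((A.par x ⊗ₜ B.act a y) ⊗ₜ z)) =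
      A.act b (A.par x) ⊗ₜ (B.act a y ⊗ₜ z) + (A.par (A.par x) ⊗ₜ (B.act b (B.act a y) ⊗ₜ z) +
        A.par (A.par x) ⊗ₜ (B.par (B.act a y) ⊗ₜ C.act b z))
    rw [tensor_act, tensor_act, tensor_par, add_tmul, map_add, map_add, add_assoc]
    rfl
  have e2 : assoc ℂ A.V B.V C.V (map (D.sig (-1) (A.tensor B)) 𝕀 z) =
      D.gexp (-1 / 2) (fam₁ A B C + fam₂ A B C) (fam₁ A B C + fam₂ A B C) w := by
    refine LinearMap.congr_fun (f := (assoc ℂ A.V B.V C.V).toLinearMap ∘ₗ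
      map (D.sig (-1) (A.tensor B)) 𝕀) (g := D.gexp (-1 / 2)
        (fam₁ A B C + fam₂ A B C) (fam₁ A B C + fam₂ A B C) ∘ₗ
        (assoc ℂ A.V B.V C.V).toLinearMap) (ext' fun t z => ?_) z
    have hn : ∀ a v, assoc ℂ A.V B.V C.V ((A.tensor B).act a v ⊗ₜ z) =
        (fam₁ A B C + fam₂ A B C) a (assoc ℂ A.V B.V C.V (v ⊗ₜ z)) := fun a v => by
      induction v using TensorProduct.induction_on with
      | zero => simp only [map_zero, zero_tmul]
      | add u v hu hv => simp only [map_add, add_tmul, hu, hv]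
      | tmul x y => rw [tensor_act, add_tmul, map_add]; rfl
    refine gexp_nat D (-1 / 2) (k := (assoc ℂ A.V B.V C.V).toLinearMap ∘ₗ
      (TensorProduct.mk ℂ (A.V ⊗[ℂ] B.V) C.V).flip z) (fun b a v => ?_) t
    exact (hn _ _).trans (congrArg _ (hn _ _))
  have e3 : map (D.sig (-1) A) (D.gam 1 B C ∘ₗ map (D.sig 1 B) 𝕀) w =
      D.gexp (-1 / 2) (fam₁ A B C) (fam₁ A B C) (D.gexp 1 (fam₂ A B C) (fam₃ A B C)
        (D.gexp (1 / 2) (fam₂ A B C) (fam₂ A B C) w)) := by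
    have f1 : ∀ u, map (D.sig (-1) A) 𝕀 u = D.gexp (-1 / 2) (fam₁ A B C) (fam₁ A B C) u := fun u => by
      refine LinearMap.congr_fun (f := map (D.sig (-1) A) 𝕀)
        (g := D.gexp (-1 / 2) (fam₁ A B C) (fam₁ A B C)) (ext' fun x t => ?_) u
      exact gexp_nat D (-1 / 2) (k := (TensorProduct.mk ℂ A.V (B.V ⊗[ℂ] C.V)).flip t) (fun b a v => rfl) x
    have f2 : ∀ u, map 𝕀 (map (D.sig 1 B) 𝕀) u =
        D.gexp (1 / 2) (fam₂ A B C) (fam₂ A B C) u := fun u => by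
      refine LinearMap.congr_fun (f := map 𝕀
        (map (D.sig 1 B) 𝕀)) (g := D.gexp (1 / 2) (fam₂ A B C) (fam₂ A B C))
        (ext' fun x t => ?_) u
      induction t with
      | tmul y z =>
        refine gexp_nat D (1 / 2) (k := (TensorProduct.mk ℂ A.V (B.V ⊗[ℂ] C.V) x) ∘ₗ
          (TensorProduct.mk ℂ B.V C.V).flip z) (fun b a v => ?_) y
        change x ⊗ₜ[ℂ] (B.act b (B.act a v) ⊗ₜ[ℂ] z) = A.par (A.par x) ⊗ₜ[ℂ] (B.act b (B.act a v) ⊗ₜ[ℂ] z)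
        rw [A.par_par]
      | _ => simp_all [add_tmul, tmul_add]
    rw [← f2, ← map_id_gam, ← f1, map_map, map_map]
    rfl
  rw [LinearEquiv.eq_symm_apply, e1, e2, e3, gexp_add_left D 1 a11 (a22.add_left a23.symm |>.add_right
    (a23.add_left a33)) a22 a12 (a22.add_left a23.symm) (a12.add_right a13),
    gexp_add_left D 1 a22 a33 a22 a22 a23.symm a23, gexp_swap D 1 a23.symm, gexp_add_add D (-1) a11 a22 a12,
    gexp_commute D 1 (-1) a12.symm a22 a13.symm a23.symm, gexp_commute D 1 (-1) a12.symm a22 a12.symm a22,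
    gexp_gexp_neg D 1 a11 a22 a12, gexp_commute D 1 (-1 / 2) a12.symm a12.symm a13.symm a13.symm,
    gexp_commute D 1 (-1 / 2) a12.symm a12.symm a12.symm a12.symm,
    gexp_commute D 1 (-1 / 2) a22 a22 a23.symm a23.symm, gexp_gexp D 1 (-1 / 2) a22 a22 a22,
    gexp_commute D 1 (1 / 2) a22 a22 a23.symm a23.symm]
  norm_num

end OrbitTriple

section Projections

variable {h : Type} [AddCommGroup h] [Module ℂ h] [FiniteDimensional ℂ h]
variable {D : SympData h} {f : Submodule ℂ h} {P : Polarization D f} {c : HChoice D f}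

namespace Core

section Generalities

variable (N : Core P c) (hβ : D.β = 1)

include hβ in
lemma p_gOne (y : N.one.V) : N.p (N.zero.rho (gOne P c) (N.q y)) = y := by
  rw [N.p_q, E_gOne P c hβ, rho_one]

include hβ in
lemma p_surjective (y : N.one.V) : ∃ n, N.p n = y := ⟨_, N.p_gOne hβ y⟩

lemma p_pull : Intertwines (N.zero.pull P.r) N.one N.p := fun a m => by
  change N.p (N.zero.act (P.r a) m) = _
  rw [N.p_act _ (P.r_mem a), N.one_r]

include hβ in
lemma zero_ext {m n : N.zero.V} (hmn : ∀ g, N.p (N.zero.rho g m) = N.p (N.zero.rho g n)) : m = n :=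
  sub_eq_zero.mp (N.sep _ fun g => by rw [map_sub, map_sub, hmn, sub_self])

end Generalities

/-- An even bilinear map, equivariant for `𝔥`, between the sectors 1 of modules. -/
structure Bihom (M N T : Core P c) where
  k : M.one.V ⊗[ℂ] N.one.V →ₗ[ℂ] T.one.V
  even : IsEven (M.one.tensor N.one).toSVect T.one.toSVect k
  equi : Intertwines (M.one.tensor N.one) T.one k

namespace Bihom

variable {M N T : Core P c} (k : Bihom M N T) (hβ : D.β = 1)

/-- The component in sector 10 of the projection. -/
def pi10 : M.one.V ⊗[ℂ] N.zero.V →ₗ[ℂ] T.one.V :=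
  k.k ∘ₗ map 𝕀 N.p ∘ₗ D.gam (-1) M.one N.zero

/-- The component in sector 01 of the projection. -/
def pi01 : M.zero.V ⊗[ℂ] N.one.V →ₗ[ℂ] T.one.V :=
  k.k ∘ₗ map M.p 𝕀 ∘ₗ D.gam 1 M.zero N.one ∘ₗ map (D.sig 1 M.zero) 𝕀

lemma pi10_apply (z : M.one.V ⊗[ℂ] N.zero.V) : k.pi10 z =
    k.k (map 𝕀 N.p (D.gam (-1) M.one N.zero z)) := rfl

lemma pi01_apply (z : M.zero.V ⊗[ℂ] N.one.V) : k.pi01 z = k.k (map M.p 𝕀 (D.gam 1 M.zero N.one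
      (map (D.sig 1 M.zero) 𝕀 z))) := rfl

lemma map_p_act_left {X : SRep h} {u : h} (hu : u ∈ f) (z : M.zero.V ⊗[ℂ] X.V) :
    map M.p 𝕀 ((M.zero.tensor X).act u z) = (M.one.tensor X).act u (map M.p 𝕀 z) := by
  induction z with
  | tmul x y =>
    rw [tensor_act, map_add, map_tmul, map_tmul, map_tmul, tensor_act, M.p_act u hu, M.p_par]
    rfl
  | _ => simp only [map_zero, map_add, *]

lemma map_p_act_right {X : SRep h} {u : h} (hu : u ∈ f) (z : X.V ⊗[ℂ] N.zero.V) :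
    map 𝕀 N.p ((X.tensor N.zero).act u z) = (X.tensor N.one).act u (map 𝕀 N.p z) := by
  induction z with
  | tmul x y =>
    rw [tensor_act, map_add, map_tmul, map_tmul, map_tmul, tensor_act, N.p_act u hu]
    rfl
  | _ => simp only [map_zero, map_add, *]

lemma pi10_act {u : h} (hu : u ∈ f) (z : M.one.V ⊗[ℂ] N.zero.V) :
    k.pi10 ((M.one.tensor N.zero).act u z) = T.one.act u (k.pi10 z) := by
  rw [pi10_apply, pi10_apply, intertwines_gam, map_p_act_right hu, k.equi]

lemma pi01_act {u : h} (hu : u ∈ f) (z : M.zero.V ⊗[ℂ] N.one.V) :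
    k.pi01 ((M.zero.tensor N.one).act u z) = T.one.act u (k.pi01 z) := by
  rw [pi01_apply, pi01_apply, intertwines_map_left N.one (X := M.zero) (X' := M.zero) (k := D.sig 1 M.zero) (fun a x => (act_sig D 1 M.zero a x).symm) (fun x => (sig_par D 1 M.zero x).symm),
    intertwines_gam, map_p_act_left hu, k.equi]

lemma pi10_even : IsEven (M.one.tensor N.zero).toSVect T.one.toSVect k.pi10 := fun z => by
  rw [pi10_apply, pi10_apply, isEven_gam, isEven_map_right M.one.toSVect N.p_par, k.even]

lemma pi01_even : IsEven (M.zero.tensor N.one).toSVect T.one.toSVect k.pi01 := fun z => by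
  rw [pi01_apply, pi01_apply, isEven_map_left N.one.toSVect (X := M.zero.toSVect) (X' := M.zero.toSVect) (k := D.sig 1 M.zero) (fun x => (sig_par D 1 M.zero x).symm),
    isEven_gam, isEven_map_left N.one.toSVect M.p_par, k.even]

/-- The component in sector 00 of the projection. -/
def pi00 : M.zero.V ⊗[ℂ] N.zero.V →ₗ[ℂ] T.zero.V :=
  T.hat hβ (X := M.zero.tensor N.zero) (k.pi10 ∘ₗ map M.p 𝕀) fun u hu z =>
    (congrArg k.pi10 (map_p_act_left hu z)).trans (k.pi10_act hu _)

lemma p_pi00 (z : M.zero.V ⊗[ℂ] N.zero.V) :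
    T.p (k.pi00 hβ z) = k.pi10 (map M.p 𝕀 z) :=
  T.p_hat hβ (X := M.zero.tensor N.zero) _ _ z

lemma p_pi00_tmul (m : M.zero.V) (n : N.zero.V) : T.p (k.pi00 hβ (m ⊗ₜ n)) = k.pi10 (M.p m ⊗ₜ n) :=
  k.p_pi00 hβ _

lemma pi00_intertwines : Intertwines (M.zero.tensor N.zero) T.zero (k.pi00 hβ) :=
  T.intertwines_hat hβ _ _

lemma pi00_even : IsEven (M.zero.tensor N.zero).toSVect T.zero.toSVect (k.pi00 hβ) :=
  T.isEven_hat hβ _ _ fun z => by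
    change k.pi10 _ = _
    rw [isEven_map_left N.zero.toSVect M.p_par, k.pi10_even]
    rfl

/-- The component in sector 11 of the projection. -/
def pi11 : S h ⊗[ℂ] (M.one.V ⊗[ℂ] N.one.V) →ₗ[ℂ] T.zero.V :=
  TensorProduct.lift (T.zero.rho.toLinearMap.flip ∘ₗ k.pi00 hβ ∘ₗ
    map (D.sig (-1) M.zero ∘ₗ M.q) (N.zero.rho (gOne P c) ∘ₗ N.q)).flip

lemma pi11_tmul (g : S h) (x : M.one.V) (y : N.one.V) : k.pi11 hβ (g ⊗ₜ (x ⊗ₜ y)) =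
    T.zero.rho g (k.pi00 hβ (D.sig (-1) M.zero (M.q x) ⊗ₜ N.zero.rho (gOne P c) (N.q y))) := rfl

/-- The exchange of the two ways to reach sector 11. -/
lemma map_p_gam (z : M.zero.V ⊗[ℂ] N.zero.V) :
    map 𝕀 N.p (D.gam (-1) M.one N.zero
      (map M.p 𝕀 (D.gam 1 M.zero N.zero z))) =
    map M.p 𝕀 (D.gam 1 M.zero N.one (map 𝕀 N.p z)) := by
  have e1 := gam_split D 1 M.zero N.zero P.r_add_s z
  have e2 := gam_natural_left D 1 N.zero M.p_pull M.p_par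
    (D.gam 1 (M.zero.pull P.s) N.zero z)
  rw [e1]
  refine (congrArg (fun t => map 𝕀 N.p (D.gam (-1) M.one N.zero t)) e2).trans ?_
  dsimp only
  rw [gam_neg_gam, ← gam_pull_right D 1 M.zero N.zero P.form_r]
  have e3 := gam_natural_right D 1 M.zero N.p_pull z
  rw [← e3, map_map, map_map]
  rfl

lemma pi01_map_p (z : M.zero.V ⊗[ℂ] N.zero.V) : k.pi01 (map 𝕀 N.p z) =
    T.p (k.pi00 hβ (D.gam 1 M.zero N.zero (map (D.sig 1 M.zero) 𝕀 z))) := by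
  rw [p_pi00, pi10_apply, map_p_gam, pi01_apply, map_map, map_map]
  rfl

lemma pi01_p (m : M.zero.V) (n : N.zero.V) : k.pi01 (m ⊗ₜ N.p n) =
    T.p (k.pi00 hβ (D.gam 1 M.zero N.zero (D.sig 1 M.zero m ⊗ₜ n))) :=
  k.pi01_map_p hβ (m ⊗ₜ n)

lemma a00_pi00 (l : c.L.V) (m : M.zero.V) (n : N.zero.V) :
    T.a00 (l ⊗ₜ k.pi00 hβ (m ⊗ₜ n)) = k.pi00 hβ (M.a00 (l ⊗ₜ m) ⊗ₜ n) := by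
  have hA : Intertwines (c.L.tensor (M.zero.tensor N.zero)) T.zero
      (T.a00 ∘ₗ map 𝕀 (k.pi00 hβ)) := fun a z => by
    refine (congrArg T.a00 (intertwines_map_right c.L (k.pi00_intertwines hβ) a z)).trans (T.a00_act a _)
  have hB : Intertwines (c.L.tensor (M.zero.tensor N.zero)) T.zero (k.pi00 hβ ∘ₗ map M.a00 𝕀 ∘ₗ
      (assoc ℂ c.L.V M.zero.V N.zero.V).symm.toLinearMap) := fun a z => by
    refine (congrArg (fun t => k.pi00 hβ (map M.a00 𝕀 t))
      (intertwines_assoc_symm c.L M.zero N.zero a z)).trans ?_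
    refine (congrArg (k.pi00 hβ) (intertwines_map_left N.zero M.a00_act M.a00_par a _)).trans (k.pi00_intertwines hβ a _)
  refine T.sep_ext hA hB (fun z => ?_) (l ⊗ₜ (m ⊗ₜ n))
  refine LinearMap.congr_fun (f := T.p ∘ₗ T.a00 ∘ₗ map 𝕀 (k.pi00 hβ))
    (g := T.p ∘ₗ k.pi00 hβ ∘ₗ map M.a00 𝕀 ∘ₗ (assoc ℂ c.L.V M.zero.V N.zero.V).symm.toLinearMap)
    (TensorProduct.ext (LinearMap.ext fun l => TensorProduct.ext (LinearMap.ext fun m =>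
      LinearMap.ext fun n => ?_))) z
  change T.p (T.a00 (l ⊗ₜ k.pi00 hβ (m ⊗ₜ n))) = T.p (k.pi00 hβ (M.a00 (l ⊗ₜ m) ⊗ₜ n))
  rw [T.p_a00, p_pi00_tmul, p_pi00_tmul, M.p_a00, ← smul_tmul', map_smul]

lemma q_pi10 (x : M.one.V) (n : N.zero.V) : T.q (k.pi10 (x ⊗ₜ n)) = k.pi00 hβ (M.q x ⊗ₜ n) := by
  obtain ⟨m, rfl⟩ := M.p_surjective hβ x
  rw [← k.p_pi00_tmul hβ, T.q_p hβ, a00_pi00, M.q_p hβ]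

/-- The operator `p` on an orbit in `M ⊗ N`. -/
lemma pi10_orbit_map (B : S h →ₗ[ℂ] S h) (x : M.one.V) (Z : S h ⊗[ℂ] N.zero.V) :
    T.p (k.pi00 hβ (map (M.zero.orb (M.q x) ∘ₗ B) 𝕀 Z)) =
      k.pi10 (map (M.one.orb x ∘ₗ c.E ∘ₗ B) 𝕀 Z) := by
  rw [p_pi00]
  refine congrArg k.pi10 ?_
  rw [map_map]
  refine congrArg (fun t => map t 𝕀 Z) (LinearMap.ext fun g => ?_)
  exact M.p_q (B g) x

lemma p_rho_pi00 (g : S h) (x : M.one.V) (n : N.zero.V) :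
    T.p (T.zero.rho g (k.pi00 hβ (D.sig (-1) M.zero (M.q x) ⊗ₜ n))) =
      k.pi01 (M.zero.rho (D.phi g) (M.q x) ⊗ₜ N.p n) := by
  refine eq_of_homogeneous (X := M.one.toSVect)
    (F := T.p ∘ₗ T.zero.rho g ∘ₗ k.pi00 hβ ∘ₗ (TensorProduct.mk ℂ _ _).flip n ∘ₗ D.sig (-1) M.zero ∘ₗ M.q)
    (G := k.pi01 ∘ₗ (TensorProduct.mk ℂ _ _).flip (N.p n) ∘ₗ M.zero.rho (D.phi g) ∘ₗ M.q)
    (fun ε x hε hx => ?_) x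
  change T.p (T.zero.rho g (k.pi00 hβ (D.sig (-1) M.zero (M.q x) ⊗ₜ n))) =
      k.pi01 (M.zero.rho (D.phi g) (M.q x) ⊗ₜ N.p n)
  have hq : M.zero.par (M.q x) = ε • M.q x := by rw [← M.q_par, hx, map_smul]
  have hq' : M.zero.par (D.sig (-1) M.zero (M.q x)) = ε • D.sig (-1) M.zero (M.q x) := by
    rw [sig_par, hq, map_smul]
  rw [k.pi01_p hβ, ← rho_natural (k.pi00_intertwines hβ), rho_tmul_homogeneous N.zero hq',
    gam_sig_rho_phi hβ N.zero hq, k.pi10_orbit_map hβ]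
  have e1 : M.zero.orb (D.sig (-1) M.zero (M.q x)) = M.zero.orb (M.q x) ∘ₗ D.sig (-1) (reg h) :=
    LinearMap.ext fun g => orb_sig D (-1) M.zero (M.q x) g
  rw [e1]
  refine (k.pi10_orbit_map hβ (D.sig (-1) (reg h)) x _).trans ?_
  have e2 : c.E ∘ₗ D.sig (-1) (reg h) = c.E ∘ₗ D.sig 1 (reg h) ∘ₗ D.phi :=
    LinearMap.ext fun g => (E_sig_phi P c hβ g).symm
  exact congrArg (fun t => k.pi10 (map (M.one.orb x ∘ₗ t) 𝕀 _)) e2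

lemma pi11_p (g : S h) (x : M.one.V) (n : N.zero.V) : k.pi11 hβ (g ⊗ₜ (x ⊗ₜ N.p n)) =
    T.zero.rho g (k.pi00 hβ (D.sig (-1) M.zero (M.q x) ⊗ₜ n)) := by
  rw [pi11_tmul]
  refine congrArg _ (T.zero_ext hβ fun g' => ?_)
  rw [p_rho_pi00, p_rho_pi00, N.p_gOne hβ]

lemma p_pi11 (g : S h) (x : M.one.V) (y : N.one.V) : T.p (k.pi11 hβ (g ⊗ₜ (x ⊗ₜ y))) =
    k.pi01 (M.zero.rho (D.phi g) (M.q x) ⊗ₜ y) := by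
  obtain ⟨n, rfl⟩ := N.p_surjective hβ y
  rw [pi11_p, p_rho_pi00]

lemma q_pi01 (m : M.zero.V) (y : N.one.V) : T.q (k.pi01 (m ⊗ₜ y)) =
    k.pi00 hβ (D.gam 1 M.zero N.zero (D.sig 1 M.zero m ⊗ₜ N.q y)) := by
  refine T.zero_ext hβ fun g => ?_
  have hs : Intertwines (M.zero.tensor N.zero) (M.zero.tensor N.zero)
      (map (D.sig 1 M.zero) 𝕀) := intertwines_map (X := M.zero) (X' := M.zero)
    (fun a x => (act_sig D 1 M.zero a x).symm) (fun x => (sig_par D 1 M.zero x).symm) (fun _ _ => rfl)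
  have e0 : D.sig 1 M.zero m ⊗ₜ[ℂ] N.q y = map (D.sig 1 M.zero) 𝕀 (m ⊗ₜ N.q y) := rfl
  rw [e0, T.p_q, ← rho_natural (k.pi00_intertwines hβ), ← rho_natural (intertwines_gam D 1 M.zero N.zero),
    ← rho_natural hs, ← pi01_map_p]
  have e1 : map 𝕀 N.p ((M.zero.tensor N.zero).rho g (m ⊗ₜ N.q y)) =
      (M.zero.tensor N.one).rho (c.E g) (m ⊗ₜ y) := by
    have h1 := rho_natural (intertwines_map_right M.zero (intertwines_orb N.zero (N.q y))) g (m ⊗ₜ (1 : S h))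
    have h2 := rho_natural (intertwines_map_right M.zero (intertwines_orb N.one y)) (c.E g) (m ⊗ₜ (1 : S h))
    rw [map_tmul, orb_apply, rho_one] at h1 h2
    rw [← map_E_rho c hβ] at h2
    refine (congrArg (map 𝕀 N.p) h1.symm).trans (Eq.trans ?_ h2)
    rw [map_map, map_map]
    refine congrArg (fun t => map _ t _) (LinearMap.ext fun g => N.p_q g y)
  rw [e1, ← mr_E P c hβ]
  have key : ∀ (z : S h) (v : M.zero.V ⊗[ℂ] N.one.V),
      T.one.rho (P.mr z) (k.pi01 v) = k.pi01 ((M.zero.tensor N.one).rho (P.mr z) v) := fun z v => by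
    induction z using S.induction with
    | halg r => rw [commutes, rho_algebraMap, rho_algebraMap, map_smul]
    | hadd x y hx hy => rw [map_add, map_add, LinearMap.add_apply, hx, hy, map_add, LinearMap.add_apply, map_add]
    | hmul a x hx => rw [map_mul, P.mr_ι, rho_ι_mul, hx, rho_ι_mul, k.pi01_act (P.r_mem a)]
  exact key _ _

end Bihom
end Core

lemma intertwines_ctrR (X : SRep h) : Intertwines (X.tensor (c.L.toSVect.triv h)) X
    (ctrR 𝕀 c.chiL) := fun a z => by
  rw [tensor_triv_act]
  induction z using TensorProduct.induction_on with
  | tmul x l => rw [Fam.l_tmul, ctrR_tmul, ctrR_tmul, map_smul]; rfl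
  | _ => simp only [map_zero, map_add, *]

lemma isEven_ctrR (X : SRep h) : IsEven (X.tensor (c.L.toSVect.triv h)).toSVect X.toSVect
    (ctrR 𝕀 c.chiL) := fun z => by
  induction z using TensorProduct.induction_on with
  | tmul x l => rw [tensor_par, ctrR_tmul, ctrR_tmul, map_smul, chiL_par]; rfl
  | _ => simp only [map_zero, map_add, *]

include P in
lemma ctrR_gam_M (hβ : D.β = 1) {X : SRep h} {x : X.V} {ε : ℂ} (hε : ε * ε = 1) (hx : X.par x = ε • x)
    (g : S h) : ctrR 𝕀 c.chiL (D.gam (-1) X c.L (x ⊗ₜ c.M g)) =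
      X.rho (c.E (D.phi (ExteriorAlgebra.map (ε • 𝕀 : h →ₗ[ℂ] h) g))) x := by
  have hj : ∀ l : c.L.V, ctr c.chiL 𝕀 (D.gam 1 c.L X (l ⊗ₜ x)) = X.rho (c.j l) x := fun l =>
    (rho_j c X l x).symm
  have hj' : ∀ g, c.j (c.M (invol g)) = c.E (D.phi g) := fun g => by
    rw [← phi_phi P c hβ, j_M_phi P c hβ]
  have hneg : ∀ l : c.L.V, ctr c.chiL 𝕀 (D.gam (-1) c.L X (l ⊗ₜ x)) =
      X.rho (c.j (c.L.par l)) x := fun l => by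
    have e1 := gam_par_left D 1 c.L X (c.L.par l ⊗ₜ x)
    rw [map_tmul, c.L.par_par, LinearMap.id_apply] at e1
    rw [← e1, ← hj]
    generalize D.gam 1 c.L X (c.L.par l ⊗ₜ x) = z
    induction z with
    | tmul l x => rw [map_tmul, ctr_tmul, ctr_tmul, chiL_par]; rfl
    | _ => simp only [map_zero, map_add, *]
  rw [← ctr_flip (X := X.toSVect) (Y := c.L.toSVect) (chiL_par c), gam_flip]
  rcases mul_self_eq_one_iff.mp hε with rfl | rfl
  · rw [flip_tmul_of_even (hx.trans (one_smul ℂ x)), hneg, (map_smul_id (ε := 1) g).1 rfl,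
      ← isEven_M c hβ, ← hj']
    rfl
  · rw [flip_tmul_of_odd (hx.trans (neg_one_smul ℂ x)), hneg, (map_smul_id (ε := -1) g).2 rfl, c.L.par_par, ← hj',
      invol_invol]

namespace Core

variable (hβ : D.β = 1)

namespace Bihom

section Right

variable {M N T : Core P c} (k : Bihom M N T)

lemma pi10_a00 (x : M.one.V) (l : c.L.V) (n : N.zero.V) : k.pi10 (x ⊗ₜ N.a00 (l ⊗ₜ n)) =
    k.pi10 (ctrR 𝕀 c.chiL (D.gam (-1) M.one c.L (x ⊗ₜ l)) ⊗ₜ n) := by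
  have e1 := gam_natural_right D (-1) M.one N.a00_act (x ⊗ₜ (l ⊗ₜ n))
  have e2 := gam_map_tensor_triv M.one c.L N.zero D (-1) ((x ⊗ₜ l) ⊗ₜ n)
  have e3 := gam_natural_left D (-1) N.zero (intertwines_ctrR (c := c) M.one) (isEven_ctrR (c := c) M.one)
    (D.gam (-1) M.one c.L (x ⊗ₜ l) ⊗ₜ n)
  rw [pi10_apply, pi10_apply]
  refine congrArg k.k ?_
  refine (congrArg (map 𝕀 N.p) e1.symm).trans ?_
  refine Eq.trans ?_ (congrArg (map 𝕀 N.p) e3)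
  rw [assoc_tmul] at e2
  refine (congrArg (fun t => map 𝕀 N.p (map 𝕀 N.a00 t))
    e2).trans ?_
  rw [map_tmul, LinearMap.id_apply]
  generalize D.gam (-1) (M.one.tensor (c.L.toSVect.triv h)) N.zero (D.gam (-1) M.one c.L (x ⊗ₜ l) ⊗ₜ n) = z
  refine LinearMap.congr_fun (f := map 𝕀 N.p ∘ₗ
    map 𝕀 N.a00 ∘ₗ (assoc ℂ M.one.V c.L.V N.zero.V).toLinearMap)
    (g := map 𝕀 N.p ∘ₗ map (ctrR 𝕀 c.chiL) 𝕀)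
    (ext_threefold fun x l n => ?_) z
  change x ⊗ₜ N.p (N.a00 (l ⊗ₜ n)) = (c.chiL l • x) ⊗ₜ N.p n
  rw [N.p_a00, smul_tmul]

include hβ in
lemma pi10_rho_q {x : M.one.V} {ε : ℂ} (hε : ε * ε = 1) (hx : M.one.par x = ε • x) (g : S h) (y : N.one.V) :
    k.pi10 (x ⊗ₜ N.zero.rho g (N.q y)) = k.pi01 (D.sig (-1) M.zero
      (M.zero.rho (D.phi (ExteriorAlgebra.map (ε • 𝕀 : h →ₗ[ℂ] h) g)) (M.q x)) ⊗ₜ y) := by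
  obtain ⟨n, rfl⟩ := N.p_surjective hβ y
  have hq : M.zero.par (M.q x) = ε • M.q x := by rw [← M.q_par, hx, map_smul]
  set τ : S h →ₗ[ℂ] S h := (ExteriorAlgebra.map (ε • 𝕀 : h →ₗ[ℂ] h)).toLinearMap with hτ
  have e1 : ∀ Z : S h ⊗[ℂ] N.zero.V, k.pi10 (x ⊗ₜ N.a00 (map c.M 𝕀 Z)) =
      k.pi10 (map (M.one.orb x ∘ₗ c.E ∘ₗ D.phi ∘ₗ τ) 𝕀 Z) := fun Z => by
    induction Z with
    | tmul g n =>
      rw [map_tmul, LinearMap.id_apply, pi10_a00, ctrR_gam_M (P := P) hβ hε hx]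
      rfl
    | _ => simp_all [add_tmul, tmul_add]
  have e2 : N.zero.rho g (N.q (N.p n)) = N.a00 (map c.M 𝕀 (((reg h).tensor N.zero).rho g (1 ⊗ₜ n))) := by
    rw [N.q_p hβ, ← rho_natural N.a00_act, rho_natural (intertwines_map_left N.zero (X' := c.L) (intertwines_M c) (isEven_M c hβ))]
    rfl
  rw [e2, e1, k.pi01_p hβ, sig_sig_neg, gam_rho_phi hβ N.zero hq, k.pi10_orbit_map hβ D.phi]
  refine congrArg k.pi10 ?_
  have e3 := rho_map_smul_tmul (N.zero.pull (ε • 𝕀)) ε g n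
  refine Eq.trans ?_ (congrArg (map (M.one.orb x ∘ₗ c.E ∘ₗ D.phi) 𝕀) e3).symm
  have e4 : ∀ a v, (((N.zero.pull (ε • 𝕀)).pull (ε • 𝕀))).act a v = N.zero.act a v :=
    fun a v => by
      change N.zero.act (ε • (ε • a)) v = _
      rw [smul_smul, hε, one_smul]
  have e5 := rho_natural (intertwines_map_right (reg h) (Y := (N.zero.pull (ε • 𝕀)).pull (ε • 𝕀)) (Y' := N.zero) (l := 𝕀) e4) g ((1 : S h) ⊗ₜ n)
  rw [map_id] at e5
  have e6 := congrArg (fun t => map (M.one.orb x ∘ₗ c.E ∘ₗ D.phi) 𝕀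
    (map τ 𝕀 t)) e5
  refine Eq.trans ?_ e6.symm
  dsimp only
  rw [map_map]
  rfl

end Right

lemma par_pi11 {M N T : Core P c} (k : Bihom M N T) (g : S h) (x : M.one.V) (y : N.one.V) :
    T.zero.par (k.pi11 hβ (g ⊗ₜ (x ⊗ₜ y))) = k.pi11 hβ (invol g ⊗ₜ (M.one.par x ⊗ₜ N.one.par y)) := by
  rw [pi11_tmul, pi11_tmul, par_rho, ← k.pi00_even hβ, tensor_par, sig_par, ← M.q_par, par_rho,
    invol_gOne P c hβ, ← N.q_par]

lemma sig_map_smul {ε : ℂ} (hε : ε * ε = 1) (s : ℂ) (g : S h) :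
    ExteriorAlgebra.map (ε • 𝕀 : h →ₗ[ℂ] h) (D.sig s (reg h) g) =
      D.sig s (reg h) (ExteriorAlgebra.map (ε • 𝕀 : h →ₗ[ℂ] h) g) := by
  rcases mul_self_eq_one_iff.mp hε with rfl | rfl
  · exact ((map_smul_id (ε := 1) _).1 rfl).trans (congrArg (D.sig s (reg h)) ((map_smul_id (ε := 1) g).1 rfl).symm)
  · exact ((map_smul_id (ε := -1) _).2 rfl).trans ((sig_par D s (reg h) g).trans
      (congrArg (D.sig s (reg h)) ((map_smul_id (ε := -1) g).2 rfl).symm))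

section Associativity

variable {M N Q T U V : Core P c} (k₂ : Bihom M N T) (k₁ : Bihom T Q V) (k₄ : Bihom N Q U)
  (k₃ : Bihom M U V)
  (hk : ∀ x y z, k₁.k (k₂.k (x ⊗ₜ y) ⊗ₜ z) = k₃.k (x ⊗ₜ k₄.k (y ⊗ₜ z)))

include hk in
lemma k_assoc (t : (M.one.V ⊗[ℂ] N.one.V) ⊗[ℂ] Q.one.V) : k₁.k (map k₂.k 𝕀 t) =
    k₃.k (map 𝕀 k₄.k (assoc ℂ M.one.V N.one.V Q.one.V t)) :=
  LinearMap.congr_fun (f := k₁.k ∘ₗ map k₂.k 𝕀) (g := k₃.k ∘ₗ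
    map 𝕀 k₄.k ∘ₗ (assoc ℂ M.one.V N.one.V Q.one.V).toLinearMap)
    (ext_threefold hk) t

include hk in
lemma assoc100' (t : (M.one.V ⊗[ℂ] N.zero.V) ⊗[ℂ] Q.zero.V) :
    k₁.pi10 (map k₂.pi10 𝕀 t) = k₃.pi10 (map 𝕀
      (k₄.pi00 hβ) (assoc ℂ M.one.V N.zero.V Q.zero.V t)) := by
  set s := map (D.gam (-1) M.one N.zero) 𝕀 t with hs
  set u := D.gam (-1) (M.one.tensor (N.zero.pull P.r)) Q.zero s with hu
  set w := D.gam (-1) M.one (N.zero.tensor Q.zero) (assoc ℂ M.one.V N.zero.V Q.zero.V t)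
    with hw
  have e0 : map k₂.pi10 𝕀 t = map k₂.k 𝕀
      (map (map 𝕀 N.p) 𝕀 s) := by
    rw [hs, map_map, map_map]; rfl
  have e1 := gam_natural_left D (-1) Q.zero k₂.equi k₂.even (map (map 𝕀 N.p) 𝕀 s)
  have e2 := gam_natural_left D (-1) Q.zero (intertwines_map_right M.one N.p_pull) (isEven_map_right M.one.toSVect N.p_par) s
  have e3 : assoc ℂ M.one.V N.zero.V Q.zero.V u = map 𝕀 (D.gam (-1) (N.zero.pull P.r) Q.zero) w :=
    gam_cocycle_pull M.one N.zero Q.zero D (-1) P.r t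
  have e4 := gam_natural_right D (-1) M.one (k₄.pi00_intertwines hβ) (assoc ℂ M.one.V N.zero.V Q.zero.V t)
  have e5 : U.p ∘ₗ k₄.pi00 hβ = k₄.k ∘ₗ map N.p Q.p ∘ₗ D.gam (-1) (N.zero.pull P.r) Q.zero :=
    LinearMap.ext fun z => by
      have h1 := gam_natural_left D (-1) Q.zero N.p_pull N.p_par z
      refine (k₄.p_pi00 hβ z).trans ((congrArg (fun t => k₄.k (map 𝕀 Q.p t))
        h1.symm).trans ?_)
      dsimp only
      rw [map_map]
      rfl
  have h1 : k₁.pi10 (map k₂.pi10 𝕀 t) = k₁.k (map k₂.k 𝕀 (map (map 𝕀 N.p) Q.p u)) := by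
    rw [e0, pi10_apply]
    refine congrArg k₁.k ((congrArg (map 𝕀 Q.p) e1.symm).trans ?_)
    refine (congrArg (fun t => map 𝕀 Q.p (map k₂.k 𝕀 t))
      e2.symm).trans ?_
    dsimp only
    rw [map_map, map_map, map_map]
    rfl
  have h2 : k₃.pi10 (map 𝕀 (k₄.pi00 hβ) (assoc ℂ M.one.V N.zero.V Q.zero.V t)) =
      k₃.k (map 𝕀 (k₄.k ∘ₗ map N.p Q.p)
        (assoc ℂ M.one.V N.zero.V Q.zero.V u)) := by
    rw [pi10_apply]
    refine congrArg k₃.k ((congrArg (map 𝕀 U.p) e4.symm).trans ?_)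
    rw [e3, map_map, map_map, e5]
    rfl
  rw [h1, h2, k_assoc k₂ k₁ k₄ k₃ hk]
  refine congrArg k₃.k ?_
  generalize u = u
  exact LinearMap.congr_fun (f := map 𝕀 k₄.k ∘ₗ (assoc ℂ M.one.V N.one.V Q.one.V).toLinearMap ∘ₗ
      map (map 𝕀 N.p) Q.p)
    (g := map 𝕀 (k₄.k ∘ₗ map N.p Q.p) ∘ₗ (assoc ℂ M.one.V N.zero.V Q.zero.V).toLinearMap)
    (ext_threefold fun x n q => rfl) u

include hk in
lemma assoc000' (t : (M.zero.V ⊗[ℂ] N.zero.V) ⊗[ℂ] Q.zero.V) :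
    k₁.pi00 hβ (map (k₂.pi00 hβ) 𝕀 t) = k₃.pi00 hβ (map 𝕀
      (k₄.pi00 hβ) (assoc ℂ M.zero.V N.zero.V Q.zero.V t)) := by
  have hA : Intertwines ((M.zero.tensor N.zero).tensor Q.zero) V.zero
      (k₁.pi00 hβ ∘ₗ map (k₂.pi00 hβ) 𝕀) := fun a z =>
    (congrArg (k₁.pi00 hβ) (intertwines_map_left Q.zero (k₂.pi00_intertwines hβ) (k₂.pi00_even hβ) a z)).trans (k₁.pi00_intertwines hβ a _)
  have hB : Intertwines ((M.zero.tensor N.zero).tensor Q.zero) V.zero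
      (k₃.pi00 hβ ∘ₗ map 𝕀 (k₄.pi00 hβ) ∘ₗ
        (assoc ℂ M.zero.V N.zero.V Q.zero.V).toLinearMap) := fun a z =>
    (congrArg (fun t => k₃.pi00 hβ (map 𝕀 (k₄.pi00 hβ) t))
      (intertwines_assoc M.zero N.zero Q.zero a z)).trans ((congrArg (k₃.pi00 hβ)
      (intertwines_map_right M.zero (k₄.pi00_intertwines hβ) a _)).trans (k₃.pi00_intertwines hβ a _))
  refine V.sep_ext hA hB (fun z => ?_) t
  refine LinearMap.congr_fun (f := V.p ∘ₗ k₁.pi00 hβ ∘ₗ map (k₂.pi00 hβ) 𝕀)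
    (g := V.p ∘ₗ k₃.pi00 hβ ∘ₗ map 𝕀 (k₄.pi00 hβ) ∘ₗ (assoc ℂ M.zero.V N.zero.V Q.zero.V).toLinearMap)
    (ext_threefold fun m n q => ?_) z
  change V.p (k₁.pi00 hβ (k₂.pi00 hβ (m ⊗ₜ n) ⊗ₜ q)) = V.p (k₃.pi00 hβ (m ⊗ₜ k₄.pi00 hβ (n ⊗ₜ q)))
  rw [p_pi00_tmul, p_pi00_tmul, p_pi00_tmul]
  exact assoc100' hβ k₂ k₁ k₄ k₃ hk ((M.p m ⊗ₜ n) ⊗ₜ q)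

include hk in
lemma assoc000 (m : M.zero.V) (n : N.zero.V) (q : Q.zero.V) :
    k₁.pi00 hβ (k₂.pi00 hβ (m ⊗ₜ n) ⊗ₜ q) = k₃.pi00 hβ (m ⊗ₜ k₄.pi00 hβ (n ⊗ₜ q)) :=
  assoc000' hβ k₂ k₁ k₄ k₃ hk ((m ⊗ₜ n) ⊗ₜ q)

lemma sig_pi00 (s : ℂ) (z : M.zero.V ⊗[ℂ] N.zero.V) :
    D.sig s T.zero (k₂.pi00 hβ z) = k₂.pi00 hβ (D.sig s (M.zero.tensor N.zero) z) :=
  (sig_natural D s (k₂.pi00_intertwines hβ) z).symm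

lemma gam_pi00_right (m : M.zero.V) (z : N.zero.V ⊗[ℂ] Q.zero.V) :
    D.gam 1 M.zero U.zero (m ⊗ₜ k₄.pi00 hβ z) =
      map 𝕀 (k₄.pi00 hβ) (D.gam 1 M.zero (N.zero.tensor Q.zero) (m ⊗ₜ z)) :=
  (gam_natural_right D 1 M.zero (k₄.pi00_intertwines hβ) (m ⊗ₜ z)).symm

lemma gam_pi00_left (z : M.zero.V ⊗[ℂ] N.zero.V) (q : Q.zero.V) :
    D.gam 1 T.zero Q.zero (k₂.pi00 hβ z ⊗ₜ q) =
      map (k₂.pi00 hβ) 𝕀 (D.gam 1 (M.zero.tensor N.zero) Q.zero (z ⊗ₜ q)) :=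
  (gam_natural_left D 1 Q.zero (k₂.pi00_intertwines hβ) (k₂.pi00_even hβ) (z ⊗ₜ q)).symm

include hβ hk in
lemma assoc001 (m : M.zero.V) (n : N.zero.V) (z : Q.one.V) :
    k₁.pi01 (k₂.pi00 hβ (m ⊗ₜ n) ⊗ₜ z) = k₃.pi01 (m ⊗ₜ k₄.pi01 (n ⊗ₜ z)) := by
  obtain ⟨q, rfl⟩ := Q.p_surjective hβ z
  rw [k₁.pi01_p hβ, k₄.pi01_p hβ, k₃.pi01_p hβ, sig_pi00, gam_pi00_left, gam_pi00_right,
    assoc000' hβ k₂ k₁ k₄ k₃ hk]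
  refine congrArg (fun t => V.p (k₃.pi00 hβ (map 𝕀 (k₄.pi00 hβ) t))) ?_
  have e1 := gam_cocycle M.zero N.zero Q.zero D 1 ((D.sig 1 M.zero m ⊗ₜ D.sig 1 N.zero n) ⊗ₜ q)
  have e2 := gam_natural_right D 1 M.zero (intertwines_gam D 1 N.zero Q.zero) (D.sig 1 M.zero m ⊗ₜ (D.sig 1 N.zero n ⊗ₜ q))
  rw [sig_tensor]
  exact e1.trans e2

include hβ hk in
lemma assoc010 (m : M.zero.V) (y : N.one.V) (q : Q.zero.V) :
    k₁.pi10 (map k₂.pi01 𝕀 (D.assoc010 M.zero N.one.toSVect Q.zero (m ⊗ₜ (y ⊗ₜ q)))) =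
      k₃.pi01 (m ⊗ₜ k₄.pi10 (y ⊗ₜ q)) := by
  obtain ⟨n, rfl⟩ := N.p_surjective hβ y
  rw [assoc010_apply, ← k₄.p_pi00_tmul hβ, k₃.pi01_p hβ, gam_pi00_right]
  have e1 := gam_natural_left D 1 Q.zero (X := M.zero.tensor (N.zero.toSVect.triv h)) (X' := M.zero.tensor (N.one.toSVect.triv h)) (intertwines_map_right M.zero (Y := N.zero.toSVect.triv h) (Y' := N.one.toSVect.triv h) (l := N.p) (fun a v => map_zero N.p)) (isEven_map_right M.zero.toSVect N.p_par) ((m ⊗ₜ n) ⊗ₜ q)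
  have hs : Intertwines (M.zero.tensor (N.zero.toSVect.triv h)) (M.zero.tensor (N.zero.toSVect.triv h))
      (map (D.sig 1 M.zero) 𝕀) := intertwines_map (X := M.zero) (X' := M.zero)
    (fun a x => (act_sig D 1 M.zero a x).symm) (fun x => (sig_par D 1 M.zero x).symm) (fun _ _ => rfl)
  have hs' : IsEven (M.zero.tensor (N.zero.toSVect.triv h)).toSVect
      (M.zero.tensor (N.zero.toSVect.triv h)).toSVect (map (D.sig 1 M.zero) 𝕀) :=
    isEven_map (X := M.zero.toSVect) (X' := M.zero.toSVect) (Y := N.zero.toSVect) (Y' := N.zero.toSVect)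
      (fun x => (sig_par D 1 M.zero x).symm) (fun _ => rfl)
  have e2 := gam_natural_left D 1 Q.zero hs hs'
    ((m ⊗ₜ n) ⊗ₜ q)
  have e3 := gam_tensor_triv_map M.zero N.zero Q.zero D 1 ((D.sig 1 M.zero m ⊗ₜ n) ⊗ₜ q)
  have e4 : ∀ v : (M.zero.V ⊗[ℂ] N.zero.V) ⊗[ℂ] Q.zero.V, map k₂.pi01 𝕀
      (map (map 𝕀 N.p) 𝕀 v) =
      map T.p 𝕀 (map (k₂.pi00 hβ) 𝕀
        (map (D.gam 1 M.zero N.zero) 𝕀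
          (map (map (D.sig 1 M.zero) 𝕀) 𝕀 v))) := fun v => by
    simp only [map_map]
    refine congrArg (fun t => map t _ v) (LinearMap.ext fun z => ?_)
    exact k₂.pi01_map_p hβ z
  refine (congrArg (fun t => k₁.pi10 (map k₂.pi01 𝕀 t)) e1.symm).trans ?_
  dsimp only
  rw [e4, ← k₁.p_pi00 hβ, assoc000' hβ k₂ k₁ k₄ k₃ hk]
  refine congrArg (fun t => V.p (k₃.pi00 hβ (map 𝕀 (k₄.pi00 hβ) t))) ?_
  refine Eq.trans (congrArg (fun t => assoc ℂ M.zero.V N.zero.V Q.zero.V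
    (map (D.gam 1 M.zero N.zero) 𝕀 t)) e2) ?_
  exact e3.symm

include hk in
lemma assoc011 (m : M.zero.V) (y : N.one.V) (z : Q.one.V) :
    k₁.pi11 hβ (1 ⊗ₜ (k₂.pi01 (m ⊗ₜ y) ⊗ₜ z)) = k₃.pi00 hβ (m ⊗ₜ k₄.pi11 hβ (1 ⊗ₜ (y ⊗ₜ z))) := by
  obtain ⟨q, rfl⟩ := Q.p_surjective hβ z
  rw [pi11_p, pi11_p, rho_one, rho_one, ← assoc000 hβ k₂ k₁ k₄ k₃ hk, q_pi01, sig_pi00, sig_tensor]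
  have e1 := gam_natural D 1 (X := M.zero) (X' := M.zero) (W := N.zero) (W' := N.zero)
    (fun a x => (act_sig D (-1) M.zero a x).symm) (fun x => (sig_par D (-1) M.zero x).symm)
    (fun a x => (act_sig D (-1) N.zero a x).symm) (D.sig 1 M.zero m ⊗ₜ N.q y)
  rw [e1, gam_neg_gam, map_tmul, sig_neg_sig]

include hk in
lemma assoc110 (x : M.one.V) (y : N.one.V) (q : Q.zero.V) :
    k₁.pi00 hβ (k₂.pi11 hβ (1 ⊗ₜ (x ⊗ₜ y)) ⊗ₜ q) = k₃.pi11 hβ (1 ⊗ₜ (x ⊗ₜ k₄.pi10 (y ⊗ₜ q))) := by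
  obtain ⟨n, rfl⟩ := N.p_surjective hβ y
  rw [← k₄.p_pi00_tmul hβ, pi11_p, pi11_p, rho_one, rho_one, assoc000 hβ k₂ k₁ k₄ k₃ hk]

lemma sig_comm_fam (A B : SRep h) (s : ℂ) (a : h) (z : A.V ⊗[ℂ] B.V) :
    Fam.r A.toSVect B.act a (D.sig s (A.tensor B) z) = D.sig s (A.tensor B) (Fam.r A.toSVect B.act a z) := by
  have hr : Anti (Fam.r A.toSVect B.act) (A.tensor B).act := by
    rw [tensor_act_eq]
    exact (Anti.l_r A.odd _).symm.add_right (B.anti.r _)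
  refine gexp_nat D (s / 2) (k := Fam.r A.toSVect B.act a) (fun b a' v => ?_) z
  rw [hr, hr, map_neg, neg_neg]

include hk in
lemma assoc101 (x : M.one.V) (n : N.zero.V) (z : Q.one.V) :
    k₁.pi11 hβ (map 𝕀 (map k₂.pi10 𝕀)
      (D.assoc101 M.one.toSVect N.zero Q.one.toSVect (1 ⊗ₜ (x ⊗ₜ (n ⊗ₜ z))))) =
      k₃.pi11 hβ (1 ⊗ₜ (x ⊗ₜ k₄.pi01 (n ⊗ₜ z))) := by
  let sec : Q.one.V →ₗ[ℂ] Q.zero.V := Q.zero.rho (gOne P c) ∘ₗ Q.q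
  have hsec : ∀ z, Q.p (sec z) = z := Q.p_gOne hβ
  let j : M.one.V →ₗ[ℂ] N.zero.V →ₗ[ℂ] Q.one.V →ₗ[ℂ] (M.zero.V ⊗[ℂ] N.zero.V) ⊗[ℂ] Q.zero.V :=
    LinearMap.mk₂ ℂ (fun x b => TensorProduct.mk ℂ _ _ (D.sig (-1) (M.zero.tensor N.zero) (M.q x ⊗ₜ b)) ∘ₗ sec)
      (fun x x' b => by ext; simp [add_tmul])
      (fun r x b => by ext; simp [← smul_tmul'])
      (fun x b b' => by ext; simp [tmul_add, add_tmul])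
      (fun r x b => by ext; simp [← smul_tmul'])
  have hj : ∀ x b y, j x b y = D.sig (-1) (M.zero.tensor N.zero) (M.q x ⊗ₜ b) ⊗ₜ sec y := fun _ _ _ => rfl
  let R : Fam h ((M.zero.V ⊗[ℂ] N.zero.V) ⊗[ℂ] Q.zero.V) :=
    Fam.l (Fam.r M.zero.toSVect N.zero.act) Q.zero.V
  have hodd : OddFam (M.zero.tensor N.zero).toSVect (Fam.r M.zero.toSVect N.zero.act) := fun a t => by
    induction t using TensorProduct.induction_on with
    | zero => simp only [map_zero, neg_zero]
    | add s t hs ht => simp only [map_add, hs, ht, neg_add]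
    | tmul y z =>
      rw [tensor_par, Fam.r_tmul, Fam.r_tmul, tensor_par, N.zero.act_par, tmul_neg]
  have hR : Anti R ((M.zero.tensor N.zero).tensor Q.zero).act := by
    rw [tensor_act_eq, tensor_act_eq]
    refine Anti.add_right (Anti.l ?_) (Anti.l_r hodd _)
    exact (Anti.l_r M.zero.odd _).symm.add_right (N.zero.anti.r _)
  have key := orbit_gam D (B := N.zero) (X := M.one.toSVect) (Y := Q.one.toSVect)
    (Z := (M.zero.tensor N.zero).tensor Q.zero) R hR j
    (fun a x b y => by
      rw [hj, hj]
      refine congrArg (· ⊗ₜ[ℂ] sec y) ((sig_comm_fam M.zero N.zero (-1) a _).trans ?_)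
      rw [Fam.r_tmul, M.q_par])
    (k₁.pi00 hβ ∘ₗ map (k₂.pi00 hβ) 𝕀)
    (k₁.pi11 hβ ∘ₗ map 𝕀 (map k₂.pi10 𝕀) ∘ₗ map 𝕀 (assocTriv M.one.V N.zero.V Q.one.V) ∘ₗ
      (assoc ℂ (S h) M.one.V (N.zero.V ⊗[ℂ] Q.one.V)).toLinearMap)
    (fun g x b y => by
      change k₁.pi11 hβ (g ⊗ₜ (k₂.pi10 (x ⊗ₜ b) ⊗ₜ y)) = k₁.pi00 hβ (map (k₂.pi00 hβ)
        𝕀 (((M.zero.tensor N.zero).tensor Q.zero).rho g (j x b y)))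
      have h1 := rho_natural (intertwines_map_left Q.zero (k₂.pi00_intertwines hβ) (k₂.pi00_even hβ)) g (j x b y)
      rw [h1, rho_natural (k₁.pi00_intertwines hβ)]
      have h2 := k₁.pi11_p hβ g (k₂.pi10 (x ⊗ₜ b)) (sec y)
      rw [hsec] at h2
      rw [h2, q_pi10 k₂ hβ, sig_pi00]
      rfl) x n z
  have e1 := assoc101_apply D M.one.toSVect N.zero Q.one.toSVect 1 x n z
  rw [e1]
  refine Eq.trans key ?_
  have e2 : j x n z = map (D.sig (-1) (M.zero.tensor N.zero)) 𝕀
      ((M.q x ⊗ₜ n) ⊗ₜ sec z) := rfl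
  rw [e2, gexp_tensor_middle, LinearMap.comp_apply, assoc000' hβ k₂ k₁ k₄ k₃ hk,
    LinearEquiv.apply_symm_apply]
  have e3 := k₄.pi01_p hβ n (sec z)
  rw [hsec] at e3
  rw [e3, pi11_p, rho_one]
  rfl

include hβ hk in
lemma assoc111 (g : S h) (x : M.one.V) (y : N.one.V) (z : Q.one.V) :
    k₁.pi01 (map (k₂.pi11 hβ) 𝕀
      (D.assoc111 M.one.toSVect N.one.toSVect Q.one.toSVect (x ⊗ₜ (g ⊗ₜ (y ⊗ₜ z))))) =
      k₃.pi10 (x ⊗ₜ k₄.pi11 hβ (g ⊗ₜ (y ⊗ₜ z))) := by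
  refine eq_of_homogeneous (X := M.one.toSVect) (F := k₁.pi01 ∘ₗ map (k₂.pi11 hβ) 𝕀 ∘ₗ
      D.assoc111 M.one.toSVect N.one.toSVect Q.one.toSVect ∘ₗ (TensorProduct.mk ℂ _ _).flip (g ⊗ₜ (y ⊗ₜ z)))
    (G := k₃.pi10 ∘ₗ (TensorProduct.mk ℂ _ _).flip (k₄.pi11 hβ (g ⊗ₜ (y ⊗ₜ z)))) (fun ε x hε hx => ?_) x
  refine eq_of_homogeneous (X := N.one.toSVect) (F := k₁.pi01 ∘ₗ map (k₂.pi11 hβ) 𝕀 ∘ₗ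
      D.assoc111 M.one.toSVect N.one.toSVect Q.one.toSVect ∘ₗ TensorProduct.mk ℂ _ _ x ∘ₗ
        TensorProduct.mk ℂ _ _ g ∘ₗ (TensorProduct.mk ℂ _ _).flip z)
    (G := k₃.pi10 ∘ₗ TensorProduct.mk ℂ _ _ x ∘ₗ k₄.pi11 hβ ∘ₗ TensorProduct.mk ℂ _ _ g ∘ₗ
      (TensorProduct.mk ℂ _ _).flip z) (fun δ y hδ hy => ?_) y
  obtain ⟨q, rfl⟩ := Q.p_surjective hβ z
  change k₁.pi01 (map (k₂.pi11 hβ) 𝕀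
      (D.assoc111 M.one.toSVect N.one.toSVect Q.one.toSVect (x ⊗ₜ (g ⊗ₜ (y ⊗ₜ Q.p q))))) =
      k₃.pi10 (x ⊗ₜ k₄.pi11 hβ (g ⊗ₜ (y ⊗ₜ Q.p q)))
  set τ : S h →ₗ[ℂ] S h := (ExteriorAlgebra.map (ε • 𝕀 : h →ₗ[ℂ] h)).toLinearMap with hτ
  set w := k₂.pi11 hβ (1 ⊗ₜ (x ⊗ₜ y)) with hwdef
  have hw1 : ∀ g, k₂.pi11 hβ (g ⊗ₜ (x ⊗ₜ y)) = T.zero.rho g w := fun g => by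
    rw [hwdef, pi11_tmul, pi11_tmul, rho_one]
  have hw : T.zero.par w = (ε * δ) • w := by
    rw [hwdef, par_pi11, hx, hy, map_one, ← smul_tmul', tmul_smul,
      tmul_smul, tmul_smul, map_smul, map_smul, smul_smul]
  have e1 : map (k₂.pi11 hβ) 𝕀
      (D.assoc111 M.one.toSVect N.one.toSVect Q.one.toSVect (x ⊗ₜ (g ⊗ₜ (y ⊗ₜ Q.p q)))) =
      T.zero.rho (D.phi (τ g)) w ⊗ₜ Q.p q := by
    rw [assoc111_apply, flip_tmul_homogeneous hε hx, ← hw1]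
    rfl
  have hq : N.zero.par (D.sig (-1) N.zero (N.q y)) = δ • D.sig (-1) N.zero (N.q y) := by
    rw [sig_par, ← N.q_par, hy, map_smul, map_smul]
  have e2 : ∀ (B : S h →ₗ[ℂ] N.zero.V) (Z : S h ⊗[ℂ] Q.zero.V), k₃.pi10 (x ⊗ₜ k₄.pi00 hβ (map B 𝕀 Z)) =
        k₁.pi10 (map (k₂.pi10 ∘ₗ TensorProduct.mk ℂ M.one.V N.zero.V x ∘ₗ B) 𝕀 Z) :=
    fun B Z => by
      induction Z with
      | tmul s n => exact (assoc100' hβ k₂ k₁ k₄ k₃ hk ((x ⊗ₜ B s) ⊗ₜ n)).symm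
      | _ => simp_all [add_tmul, tmul_add]
  have e3 : ∀ a v, (((Q.zero.pull ((ε * δ) • 𝕀)).pull (ε • 𝕀))).act a v =
      (Q.zero.pull (δ • 𝕀)).act a v := fun a v => by
    change Q.zero.act ((ε * δ) • (ε • a)) v = Q.zero.act (δ • a) v
    rw [smul_smul, mul_right_comm, hε, one_mul]
  have e4 := rho_natural (intertwines_map_right (reg h) (Y := (Q.zero.pull ((ε * δ) • 𝕀)).pull (ε • 𝕀)) (Y' := Q.zero.pull (δ • 𝕀)) (l := 𝕀) e3) g ((1 : S h) ⊗ₜ q)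
  rw [map_id] at e4
  have e5 : ((reg h).tensor (Q.zero.pull ((ε * δ) • 𝕀))).rho (τ g) ((1 : S h) ⊗ₜ q) =
      map τ 𝕀 (((reg h).tensor (Q.zero.pull (δ • 𝕀))).rho g (1 ⊗ₜ q)) :=
    (rho_map_smul_tmul (Q.zero.pull ((ε * δ) • 𝕀)) ε g q).trans
      (congrArg (map τ 𝕀) e4)
  rw [e1, k₁.pi01_p hβ, gam_sig_rho_phi hβ Q.zero hw, k₁.p_pi00 hβ, pi11_p,
    ← rho_natural (k₄.pi00_intertwines hβ), rho_tmul_homogeneous Q.zero hq, e2]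
  refine congrArg k₁.pi10 ((congrArg (fun t => map T.p 𝕀 (map
    (T.zero.orb w ∘ₗ D.sig 1 (reg h) ∘ₗ D.phi) 𝕀 t)) e5).trans ?_)
  dsimp only
  rw [map_map, map_map]
  refine congrArg (fun t => map t 𝕀 _) (LinearMap.ext fun s => ?_)
  change T.p (T.zero.rho (D.sig 1 (reg h) (D.phi (τ s))) w) =
    k₂.pi10 (x ⊗ₜ N.zero.orb (D.sig (-1) N.zero (N.q y)) s)
  have e6 := pi10_rho_q hβ k₂ hε hx (D.sig (-1) (reg h) s) y
  have e7 := sig_natural D (-1) (intertwines_orb M.zero (M.q x)) (D.phi (D.sig (-1) (reg h) (τ s)))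
  rw [orb_sig, orb_apply, e6, ← hw1, p_pi11, phi_sig_phi hβ, sig_map_smul hε]
  exact congrArg (fun t => k₂.pi01 (t ⊗ₜ y)) e7

end Associativity

end Bihom
end Core

namespace Core

variable (hβ : D.β = 1)

namespace Bihom

section Single

variable {M N T : Core P c} (k : Bihom M N T)

/-- The projection from the tensor product in `SF(𝔥)`. -/
def pi : LMap (M.obj.car.star h N.obj.car) T.obj.car :=
  (LinearMap.coprod (k.pi00 hβ) (k.pi11 hβ), LinearMap.coprod k.pi01 k.pi10)

lemma pi_zero_l (t : M.zero.V ⊗[ℂ] N.zero.V) : (k.pi hβ).1 (t, 0) = k.pi00 hβ t :=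
  coprod_l (k.pi00 hβ) (k.pi11 hβ) t

lemma pi_zero_r (t : S h ⊗[ℂ] (M.one.V ⊗[ℂ] N.one.V)) : (k.pi hβ).1 (0, t) = k.pi11 hβ t :=
  coprod_r (k.pi00 hβ) (k.pi11 hβ) t

lemma pi_one_l (t : M.zero.V ⊗[ℂ] N.one.V) : (k.pi hβ).2 (t, 0) = k.pi01 t :=
  coprod_l k.pi01 k.pi10 t

lemma pi_one_r (t : M.one.V ⊗[ℂ] N.zero.V) : (k.pi hβ).2 (0, t) = k.pi10 t :=
  coprod_r k.pi01 k.pi10 t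

lemma pi_mem : k.pi hβ ∈ homs (M.obj.star N.obj) T.obj := by
  refine ⟨fun v => ?_, fun a v => ?_, fun v => ?_⟩
  · refine LinearMap.congr_fun (f := (k.pi hβ).1 ∘ₗ (M.obj.star N.obj).zero.par)
      (g := T.obj.zero.par ∘ₗ (k.pi hβ).1) (star_ext₀ (X := M.obj.car) (Y := N.obj.car) (h := h)
        (fun x y => ?_) fun g x y => ?_) v
    · refine (congrArg (k.pi hβ).1 (star_par_zero_l M.obj N.obj (x ⊗ₜ y))).trans
        ((k.pi_zero_l hβ _).trans ?_)
      exact (k.pi00_even hβ (x ⊗ₜ y)).trans (congrArg T.zero.par (k.pi_zero_l hβ _).symm)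
    · refine (congrArg (k.pi hβ).1 (star_par_zero_r M.obj N.obj (g ⊗ₜ (x ⊗ₜ y)))).trans
        ((k.pi_zero_r hβ _).trans ?_)
      exact (k.par_pi11 hβ g x y).symm.trans (congrArg T.zero.par (k.pi_zero_r hβ _).symm)
  · refine LinearMap.congr_fun (f := (k.pi hβ).1 ∘ₗ (M.obj.star N.obj).zero.act a)
      (g := T.obj.zero.act a ∘ₗ (k.pi hβ).1) (star_ext₀ (X := M.obj.car) (Y := N.obj.car) (h := h)
        (fun x y => ?_) fun g x y => ?_) v
    · have e1 : (M.obj.star N.obj).zero.act a (x ⊗ₜ y, 0) = ((M.zero.tensor N.zero).act a (x ⊗ₜ y), 0) := by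
        rw [star_act M.obj N.obj, map_zero]
      refine (congrArg (k.pi hβ).1 e1).trans ((k.pi_zero_l hβ _).trans ?_)
      exact (k.pi00_intertwines hβ a (x ⊗ₜ y)).trans (congrArg (T.zero.act a) (k.pi_zero_l hβ _).symm)
    · have e1 : (M.obj.star N.obj).zero.act a (0, g ⊗ₜ (x ⊗ₜ y)) = (0, (ι ℂ a * g) ⊗ₜ (x ⊗ₜ y)) := by
        rw [star_act M.obj N.obj, map_zero]
        rfl
      refine (congrArg (k.pi hβ).1 e1).trans ((k.pi_zero_r hβ _).trans ?_)
      refine Eq.trans ?_ (congrArg (T.zero.act a) (k.pi_zero_r hβ _).symm)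
      rw [pi11_tmul, pi11_tmul, rho_ι_mul]
  · refine LinearMap.congr_fun (f := (k.pi hβ).2 ∘ₗ (M.obj.star N.obj).one.par)
      (g := T.obj.one.par ∘ₗ (k.pi hβ).2) (star_ext₁ (X := M.obj.car) (Y := N.obj.car) (h := h)
        (fun x y => ?_) fun x y => ?_) v
    · refine (congrArg (k.pi hβ).2 (star_par_one_l M.obj N.obj (x ⊗ₜ y))).trans
        ((k.pi_one_l hβ _).trans ?_)
      exact (k.pi01_even (x ⊗ₜ y)).trans (congrArg T.one.par (k.pi_one_l hβ _).symm)
    · refine (congrArg (k.pi hβ).2 (star_par_one_r M.obj N.obj (x ⊗ₜ y))).trans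
        ((k.pi_one_r hβ _).trans ?_)
      exact (k.pi10_even (x ⊗ₜ y)).trans (congrArg T.one.par (k.pi_one_r hβ _).symm)

end Single

section Associativity

variable {M N Q T U V : Core P c} (k₂ : Bihom M N T) (k₁ : Bihom T Q V) (k₄ : Bihom N Q U)
  (k₃ : Bihom M U V)
  (hk : ∀ x y z, k₁.k (k₂.k (x ⊗ₜ y) ⊗ₜ z) = k₃.k (x ⊗ₜ k₄.k (y ⊗ₜ z)))

set_option maxHeartbeats 800000 in
include hk in
lemma pi_assoc : ((k₁.pi hβ).comp ((k₂.pi hβ).star h (LMap.id Q.obj.car))).comp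
      (D.assoc M.obj N.obj Q.obj) =
    (k₃.pi hβ).comp ((LMap.id M.obj.car).star h (k₄.pi hβ)) := by
  have hL : (k₃.pi hβ).comp ((LMap.id M.obj.car).star h (k₄.pi hβ)) ∈
      homs (M.obj.star (N.obj.star Q.obj)) V.obj :=
    comp_mem_homs (Y := M.obj.star U.obj) (k₃.pi_mem hβ) (star_mem_homs (id_mem_homs M.obj) (k₄.pi_mem hβ))
  have hR : (k₁.pi hβ).comp ((k₂.pi hβ).star h (LMap.id Q.obj.car)) ∈
      homs ((M.obj.star N.obj).star Q.obj) V.obj :=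
    comp_mem_homs (Y := T.obj.star Q.obj) (k₁.pi_mem hβ) (star_mem_homs (k₂.pi_mem hβ) (id_mem_homs Q.obj))
  refine Prod.ext (star_star_ext_equivariant (X := M.obj) (Y := N.obj) (Z := Q.obj) (Q := V.obj)
    (fun a v => ?_) hL.2.1 (fun x y z => ?_) (fun x y z => ?_) (fun x y z => ?_) fun x y z => ?_)
    (star_star_ext₁ (X := M.obj.car) (Y := N.obj.car) (Z := Q.obj.car) (h := h) (fun x y z => ?_)
      (fun x y z => ?_) (fun x y z => ?_) fun g x y z => ?_)
  · exact (congrArg ((k₁.pi hβ).comp ((k₂.pi hβ).star h (LMap.id Q.obj.car))).1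
      (intertwines_assoc_star D M.obj N.obj Q.obj a v)).trans (hR.2.1 a _)
  · rw [comp_fst, comp_fst, assoc_000, comp_fst, star_fst_l, star_fst_l, map_tmul, map_tmul]
    refine (k₁.pi_zero_l hβ _).trans (Eq.trans ?_ (k₃.pi_zero_l hβ _).symm)
    refine (congrArg (fun w => k₁.pi00 hβ (w ⊗ₜ z)) (k₂.pi_zero_l hβ (x ⊗ₜ y))).trans ?_
    refine (k₂.assoc000 hβ k₁ k₄ k₃ hk x y z).trans ?_
    exact (congrArg (fun w => k₃.pi00 hβ (x ⊗ₜ w)) (k₄.pi_zero_l hβ (y ⊗ₜ z))).symm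
  · rw [comp_fst, comp_fst, assoc_011, assoc011_one, comp_fst, star_fst_l, map_tmul,
      map_tmul, map_tmul, star_fst_r, map_tmul,
      map_tmul]
    refine (k₁.pi_zero_r hβ _).trans (Eq.trans ?_ (k₃.pi_zero_l hβ _).symm)
    refine (congrArg (fun w => k₁.pi11 hβ ((1 : S h) ⊗ₜ (w ⊗ₜ z))) (k₂.pi_one_l hβ (x ⊗ₜ y))).trans ?_
    refine (k₂.assoc011 hβ k₁ k₄ k₃ hk x y z).trans ?_
    exact (congrArg (fun w => k₃.pi00 hβ (x ⊗ₜ w)) (k₄.pi_zero_r hβ _)).symm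
  · rw [comp_fst, comp_fst, assoc_101, comp_fst, star_fst_r, star_fst_r, map_tmul, map_tmul]
    refine (k₁.pi_zero_r hβ _).trans (Eq.trans ?_ (k₃.pi_zero_r hβ _).symm)
    refine Eq.trans ?_ ((k₂.assoc101 hβ k₁ k₄ k₃ hk x y z).trans
      (congrArg (fun w => k₃.pi11 hβ ((1 : S h) ⊗ₜ (x ⊗ₜ w))) (k₄.pi_one_l hβ (y ⊗ₜ z))).symm)
    refine congrArg (k₁.pi11 hβ) ?_
    have e1 : (k₂.pi hβ).2 ∘ₗ LinearMap.inr ℂ _ _ = k₂.pi10 :=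
      LinearMap.ext fun t => k₂.pi_one_r hβ t
    rw [map_map, ← map_comp]
    exact congrArg (fun t => map 𝕀 (map t 𝕀) _) e1
  · rw [comp_fst, comp_fst, assoc_110, assoc110_one, comp_fst, map_tmul, star_fst_l,
      map_tmul, star_fst_r, map_tmul, map_tmul]
    refine (k₁.pi_zero_l hβ _).trans (Eq.trans ?_ (k₃.pi_zero_r hβ _).symm)
    refine (congrArg (fun w => k₁.pi00 hβ (w ⊗ₜ z)) (k₂.pi_zero_r hβ _)).trans ?_
    refine (k₂.assoc110 hβ k₁ k₄ k₃ hk x y z).trans ?_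
    exact (congrArg (fun w => k₃.pi11 hβ ((1 : S h) ⊗ₜ (x ⊗ₜ w))) (k₄.pi_one_r hβ (y ⊗ₜ z))).symm
  · rw [comp_snd, comp_snd, assoc_001, comp_snd, star_snd_l, star_snd_l, map_tmul, map_tmul]
    refine (k₁.pi_one_l hβ _).trans (Eq.trans ?_ (k₃.pi_one_l hβ _).symm)
    refine (congrArg (fun w => k₁.pi01 (w ⊗ₜ z)) (k₂.pi_zero_l hβ (x ⊗ₜ y))).trans ?_
    refine (k₂.assoc001 hβ k₁ k₄ k₃ hk x y z).trans ?_
    exact (congrArg (fun w => k₃.pi01 (x ⊗ₜ w)) (k₄.pi_one_l hβ (y ⊗ₜ z))).symm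
  · rw [comp_snd, comp_snd, assoc_010, comp_snd, star_snd_l, map_tmul, star_snd_r]
    refine (k₁.pi_one_r hβ _).trans (Eq.trans ?_ (k₃.pi_one_l hβ _).symm)
    refine Eq.trans ?_ ((k₂.assoc010 hβ k₁ k₄ k₃ hk x y z).trans
      (congrArg (fun w => k₃.pi01 (x ⊗ₜ w)) (k₄.pi_one_r hβ (y ⊗ₜ z))).symm)
    refine congrArg k₁.pi10 ?_
    have e1 : (k₂.pi hβ).2 ∘ₗ LinearMap.inl ℂ _ _ = k₂.pi01 :=
      LinearMap.ext fun t => k₂.pi_one_l hβ t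
    rw [map_map]
    exact congrArg (fun t => map t 𝕀 _) e1
  · rw [comp_snd, comp_snd, assoc_100, comp_snd, star_snd_r, star_snd_r, map_tmul, map_tmul]
    refine (k₁.pi_one_r hβ _).trans (Eq.trans ?_ (k₃.pi_one_r hβ _).symm)
    refine (congrArg (fun w => k₁.pi10 (w ⊗ₜ z)) (k₂.pi_one_r hβ (x ⊗ₜ y))).trans ?_
    refine (k₂.assoc100' hβ k₁ k₄ k₃ hk ((x ⊗ₜ y) ⊗ₜ z)).trans ?_
    exact (congrArg (fun w => k₃.pi10 (x ⊗ₜ w)) (k₄.pi_zero_l hβ (y ⊗ₜ z))).symm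
  · rw [comp_snd, comp_snd, assoc_111, comp_snd, star_snd_r, map_tmul, star_snd_l]
    refine (k₁.pi_one_l hβ _).trans (Eq.trans ?_ (k₃.pi_one_r hβ _).symm)
    refine Eq.trans ?_ ((k₂.assoc111 hβ k₁ k₄ k₃ hk g x y z).trans
      (congrArg (fun w => k₃.pi10 (x ⊗ₜ w)) (k₄.pi_zero_r hβ _)).symm)
    refine congrArg k₁.pi01 ?_
    have e1 : (k₂.pi hβ).1 ∘ₗ LinearMap.inr ℂ _ _ = k₂.pi11 hβ :=
      LinearMap.ext fun t => k₂.pi_zero_r hβ t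
    rw [map_map]
    exact congrArg (fun t => map t 𝕀 _) e1

end Associativity

section Naturality

variable {M M' N N' T T' : Core P c}

/-- Composition with a homomorphism. -/
@[reducible] def postcomp (k : Bihom M N T) (l : Hom T T') : Bihom M N T' where
  k := l.k ∘ₗ k.k
  even z := (congrArg l.k (k.even z)).trans (l.even _)
  equi a z := (congrArg l.k (k.equi a z)).trans (l.equi a _)

/-- Composition with a pair of homomorphisms. -/
@[reducible] def precomp (k : Bihom M' N' T) (a : Hom M M') (b : Hom N N') : Bihom M N T where
  k := k.k ∘ₗ map a.k b.k
  even z := (congrArg k.k (isEven_map a.even b.even z)).trans (k.even _)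
  equi u z := (congrArg k.k (intertwines_map a.equi a.even b.equi u z)).trans (k.equi u _)

lemma postcomp_pi00 (k : Bihom M N T) (l : Hom T T') (z : M.zero.V ⊗[ℂ] N.zero.V) :
    l.zero hβ (k.pi00 hβ z) = (k.postcomp l).pi00 hβ z := by
  refine T'.sep_ext (X := M.zero.tensor N.zero) (A := l.zero hβ ∘ₗ k.pi00 hβ) (B := (k.postcomp l).pi00 hβ)
    (fun a z => (congrArg (l.zero hβ) (k.pi00_intertwines hβ a z)).trans (l.zero_intertwines hβ a _))
    ((k.postcomp l).pi00_intertwines hβ) (fun z => ?_) z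
  rw [p_pi00]
  exact (l.p_zero hβ _).trans (congrArg l.k (k.p_pi00 hβ z))

lemma postcomp_pi (k : Bihom M N T) (l : Hom T T') :
    (l.pair hβ).comp (k.pi hβ) = (k.postcomp l).pi hβ := by
  refine Prod.ext (star_ext₀ (X := M.obj.car) (Y := N.obj.car) (h := h) (fun x y => ?_) fun g x y => ?_)
    (star_ext₁ (X := M.obj.car) (Y := N.obj.car) (h := h) (fun x y => ?_) fun x y => ?_)
  · exact (congrArg (l.zero hβ) (k.pi_zero_l hβ _)).trans ((postcomp_pi00 hβ k l _).trans
      ((k.postcomp l).pi_zero_l hβ _).symm)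
  · refine (congrArg (l.zero hβ) (k.pi_zero_r hβ _)).trans (Eq.trans ?_
      ((k.postcomp l).pi_zero_r hβ _).symm)
    rw [pi11_tmul, pi11_tmul, rho_natural (l.zero_intertwines hβ), postcomp_pi00]
  · exact (congrArg l.k (k.pi_one_l hβ _)).trans ((k.postcomp l).pi_one_l hβ _).symm
  · exact (congrArg l.k (k.pi_one_r hβ _)).trans ((k.postcomp l).pi_one_r hβ _).symm

lemma precomp_pi10 (k : Bihom M' N' T) (a : Hom M M') (b : Hom N N') (z : M.one.V ⊗[ℂ] N.zero.V) :
    k.pi10 (map a.k (b.zero hβ) z) = (k.precomp a b).pi10 z := by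
  rw [pi10_apply, pi10_apply, ← gam_natural D (-1) a.equi a.even (b.zero_intertwines hβ)]
  generalize D.gam (-1) M.one N.zero z = w
  refine congrArg k.k ?_
  rw [map_map, map_map]
  exact congrArg (fun t => map a.k t w) (LinearMap.ext fun n => b.p_zero hβ n)

lemma precomp_pi01 (k : Bihom M' N' T) (a : Hom M M') (b : Hom N N') (z : M.zero.V ⊗[ℂ] N.one.V) :
    k.pi01 (map (a.zero hβ) b.k z) = (k.precomp a b).pi01 z := by
  rw [pi01_apply, pi01_apply]
  have e1 : map (D.sig 1 M'.zero) 𝕀 (map (a.zero hβ) b.k z) =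
      map (a.zero hβ) b.k (map (D.sig 1 M.zero) 𝕀 z) := by
    rw [map_map, map_map]
    exact congrArg (fun t => map t b.k z)
      (LinearMap.ext fun m => (sig_natural D 1 (a.zero_intertwines hβ) m).symm)
  rw [e1, ← gam_natural D 1 (a.zero_intertwines hβ) (a.zero_even hβ) b.equi]
  generalize D.gam 1 M.zero N.one _ = w
  refine congrArg k.k ?_
  rw [map_map, map_map]
  exact congrArg (fun t => map t b.k w) (LinearMap.ext fun n => a.p_zero hβ n)

lemma precomp_pi00 (k : Bihom M' N' T) (a : Hom M M') (b : Hom N N') (z : M.zero.V ⊗[ℂ] N.zero.V) :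
    k.pi00 hβ (map (a.zero hβ) (b.zero hβ) z) = (k.precomp a b).pi00 hβ z := by
  refine T.sep_ext (X := M.zero.tensor N.zero) (A := k.pi00 hβ ∘ₗ map (a.zero hβ) (b.zero hβ))
    (B := (k.precomp a b).pi00 hβ)
    (fun u z => (congrArg (k.pi00 hβ) (intertwines_map (a.zero_intertwines hβ) (a.zero_even hβ)
      (b.zero_intertwines hβ) u z)).trans (k.pi00_intertwines hβ u _))
    ((k.precomp a b).pi00_intertwines hβ) (fun z => ?_) z
  rw [p_pi00, ← precomp_pi10 hβ]
  refine (k.p_pi00 hβ _).trans (congrArg k.pi10 ?_)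
  rw [map_map, map_map]
  exact congrArg (fun t => map t (b.zero hβ) z) (LinearMap.ext fun n => a.p_zero hβ n)

lemma precomp_pi (k : Bihom M' N' T) (a : Hom M M') (b : Hom N N') :
    (k.pi hβ).comp ((a.pair hβ).star h (b.pair hβ)) = (k.precomp a b).pi hβ := by
  refine Prod.ext (star_ext₀ (X := M.obj.car) (Y := N.obj.car) (h := h) (fun x y => ?_) fun g x y => ?_)
    (star_ext₁ (X := M.obj.car) (Y := N.obj.car) (h := h) (fun x y => ?_) fun x y => ?_)
  · rw [comp_fst, star_fst_l]
    exact (k.pi_zero_l hβ _).trans ((precomp_pi00 hβ k a b _).trans ((k.precomp a b).pi_zero_l hβ _).symm)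
  · rw [comp_fst, star_fst_r]
    refine (k.pi_zero_r hβ _).trans (Eq.trans ?_ ((k.precomp a b).pi_zero_r hβ _).symm)
    refine (k.pi11_tmul hβ g (a.k x) (b.k y)).trans ?_
    rw [pi11_tmul, ← precomp_pi00]
    refine congrArg _ (congrArg (k.pi00 hβ) ?_)
    rw [map_tmul, rho_natural (b.zero_intertwines hβ), sig_natural D (-1) (a.zero_intertwines hβ),
      a.zero_q hβ, b.zero_q hβ]
  · rw [comp_snd, star_snd_l]
    exact (k.pi_one_l hβ _).trans ((precomp_pi01 hβ k a b _).trans ((k.precomp a b).pi_one_l hβ _).symm)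
  · rw [comp_snd, star_snd_r]
    exact (k.pi_one_r hβ _).trans ((precomp_pi10 hβ k a b _).trans ((k.precomp a b).pi_one_r hβ _).symm)

end Naturality

end Bihom
end Core

lemma gam_of_killed_left (s : ℂ) (X W : SRep h) {x : X.V} (hx : ∀ a, X.act a x = 0) (w : W.V) :
    D.gam s X W (x ⊗ₜ w) = x ⊗ₜ w :=
  gexp_of_left D (Anti.l_r X.odd W.act) fun a => by rw [Fam.l_tmul, hx, zero_tmul]

lemma gam_of_killed_right (s : ℂ) (X W : SRep h) (x : X.V) {w : W.V} (hw : ∀ a, W.act a w = 0) :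
    D.gam s X W (x ⊗ₜ w) = x ⊗ₜ w :=
  gexp_of_right D fun a => by rw [Fam.r_tmul, hw, tmul_zero]

include P in
lemma gam_L_right (s : ℂ) (X : SRep h) : D.gam s X c.L = D.gam s (X.pull P.r) c.L := by
  rw [← gam_pull_right D s X c.L (T := P.s) P.form_s]
  have h2 : (c.L.pull P.s).act = c.L.act := L_act_comp_s P c
  change D.gexp s _ (Fam.r X.toSVect c.L.act) = D.gexp s _ (Fam.r X.toSVect (c.L.pull P.s).act)
  rw [h2]

namespace Core

variable (hβ : D.β = 1)

lemma Hom.pair_eq {A B : Core P c} (k : Hom A B) {l : A.zero.V →ₗ[ℂ] B.zero.V}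
    (hl : Intertwines A.zero B.zero l) (hp : ∀ m, B.p (l m) = k.k (A.p m)) : k.pair hβ = (l, k.k) :=
  Prod.ext (LinearMap.ext fun m => B.sep_ext (k.zero_intertwines hβ) hl
    (fun m => (k.p_zero hβ m).trans (hp m).symm) m) rfl

namespace Bihom

variable (M : Core P c)

/-- The left action of the unit module. -/
@[reducible] def lid : Bihom (hCore P c hβ) M M where
  k := (TensorProduct.lid ℂ M.one.V).toLinearMap
  even := lid_even M.one.toSVect
  equi := lid_intertwines M.one

/-- The right action of the unit module. -/
@[reducible] def rid : Bihom M (hCore P c hβ) M where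
  k := (TensorProduct.rid ℂ M.one.V).toLinearMap
  even := rid_even M.one.toSVect
  equi := rid_intertwines M.one

lemma lid_pi10 (t : ℂ) (m : M.zero.V) : (lid hβ M).pi10 (t ⊗ₜ m) = t • M.p m := by
  rw [pi10_apply, gam_of_killed_left (-1) (unitSVect.triv h) M.zero (fun _ => rfl)]
  exact lid_tmul _ _

lemma lid_pi00 (z : c.L.V ⊗[ℂ] M.zero.V) : (lid hβ M).pi00 hβ z = M.a00 z := by
  refine M.sep_ext (X := c.L.tensor M.zero) (A := (lid hβ M).pi00 hβ) (B := M.a00)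
    ((lid hβ M).pi00_intertwines hβ) M.a00_act (fun z => ?_) z
  refine LinearMap.congr_fun (f := M.p ∘ₗ (lid hβ M).pi00 hβ) (g := M.p ∘ₗ M.a00)
    (ext' fun l m => ?_) z
  exact ((lid hβ M).p_pi00_tmul hβ l m).trans ((lid_pi10 hβ M _ m).trans (M.p_a00 l m).symm)

lemma lid_pi : (lid hβ M).pi hβ = M.act := by
  refine Prod.ext (star_ext₀ (X := c.O.car) (Y := M.obj.car) (h := h) (fun x y => ?_) fun g x y => ?_)
    (star_ext₁ (X := c.O.car) (Y := M.obj.car) (h := h) (fun x y => ?_) fun x y => ?_)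
  · exact ((lid hβ M).pi_zero_l hβ _).trans ((lid_pi00 hβ M _).trans (M.act_zero_l _).symm)
  · refine ((lid hβ M).pi_zero_r hβ _).trans (Eq.trans ?_ (M.act_zero_r g x y).symm)
    obtain ⟨n, rfl⟩ := M.p_surjective hβ y
    refine ((lid hβ M).pi11_p hβ g x n).trans ?_
    rw [M.q_p hβ, ← map_smul]
    refine congrArg (M.zero.rho g) ?_
    refine (congrArg (fun w : c.L.V => (lid hβ M).pi00 hβ (w ⊗ₜ n)) (sig_L P c (-1) (x • c.M 1))).trans ?_
    refine (lid_pi00 hβ M _).trans ?_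
    rw [← smul_tmul', map_smul]
  · refine ((lid hβ M).pi_one_l hβ _).trans (Eq.trans ?_ (M.act_one_l x y).symm)
    rw [pi01_apply, rho_j, map_tmul]
    exact congrArg (fun w : c.L.V => TensorProduct.lid ℂ M.one.V (map c.chiL 𝕀
      (D.gam 1 c.L M.one (w ⊗ₜ y)))) (sig_L P c 1 x)
  · exact ((lid hβ M).pi_one_r hβ _).trans ((lid_pi10 hβ M x y).trans (M.act_one_r x y).symm)

lemma rid_pi10 (z : M.one.V ⊗[ℂ] c.L.V) :
    (rid hβ M).pi10 z = ctrR 𝕀 c.chiL (D.gam (-1) M.one c.L z) := rfl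

lemma rid_pi00 (z : M.zero.V ⊗[ℂ] c.L.V) :
    (rid hβ M).pi00 hβ z = M.a00 (M.zero.flip c.L.toSVect (D.gam (-1) M.zero c.L z)) := by
  rw [← LinearMap.comp_apply, ← LinearMap.comp_apply]
  refine M.sep_ext (X := M.zero.tensor c.L) (A := (rid hβ M).pi00 hβ)
    (B := (M.a00 ∘ₗ M.zero.flip c.L.toSVect) ∘ₗ D.gam (-1) M.zero c.L)
    ((rid hβ M).pi00_intertwines hβ) (fun a z => ?_) (fun z => ?_) z
  · refine (congrArg (fun t => M.a00 (M.zero.flip c.L.toSVect t)) (intertwines_gam D (-1) M.zero c.L a z)).trans ?_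
    exact (congrArg M.a00 (intertwines_flip M.zero c.L a _)).trans (M.a00_act a _)
  · refine ((rid hβ M).p_pi00 hβ z).trans ((rid_pi10 hβ M _).trans ?_)
    refine Eq.trans ?_ (M.p_a00' _).symm
    rw [ctr_flip (chiL_par c), gam_L_right (P := P) (-1) M.zero]
    have e1 := gam_natural_left D (-1) c.L M.p_pull M.p_par z
    refine (congrArg (ctrR 𝕀 c.chiL) e1.symm).trans ?_
    generalize D.gam (-1) (M.zero.pull P.r) c.L z = w
    refine LinearMap.congr_fun (f := ctrR 𝕀 c.chiL ∘ₗ map M.p 𝕀)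
      (g := ctrR M.p c.chiL) (ext' fun m l => ?_) w
    change ctrR 𝕀 c.chiL (M.p m ⊗ₜ l) = _
    rw [ctrR_tmul, ctrR_tmul, LinearMap.id_apply]

lemma rid_pi : (rid hβ M).pi hβ = M.act.comp (D.braid M.obj c.O) := by
  refine Prod.ext (star_ext₀ (X := M.obj.car) (Y := c.O.car) (h := h) (fun x y => ?_) fun g x y => ?_)
    (star_ext₁ (X := M.obj.car) (Y := c.O.car) (h := h) (fun x y => ?_) fun x y => ?_)
  · refine ((rid hβ M).pi_zero_l hβ _).trans ((rid_pi00 hβ M _).trans ?_)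
    have e1 : (D.braid M.obj c.O).1 (x ⊗ₜ y, 0) =
        (M.zero.flip c.L.toSVect (D.gam (-1) M.zero c.L (x ⊗ₜ y)), 0) := by
      rw [← gammaInv_eq]
      exact Prod.ext rfl (map_zero (D.β • map (D.sigmaInv (reg h))
        (M.one.flip unitSVect ∘ₗ map 𝕀 𝕀)))
    exact (M.act_zero_l _).symm.trans (congrArg M.act.1 e1).symm
  · refine ((rid hβ M).pi_zero_r hβ _).trans ?_
    have e0 : y = c.chiL (y • c.e) := by
      rw [map_smul, chiL_apply, chi_e, smul_eq_mul, mul_one]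
    have e1 : (D.braid M.obj c.O).1 (0, g ⊗ₜ (x ⊗ₜ y)) = (0, D.sig (-1) (reg h) g ⊗ₜ (y ⊗ₜ x)) := by
      refine Prod.ext (map_zero (M.zero.flip c.L.toSVect ∘ₗ D.gammaInv M.zero c.L.act)) ?_
      change D.β • map (D.sigmaInv (reg h)) _ (g ⊗ₜ (x ⊗ₜ y)) = _
      rw [hβ, one_smul, sigmaInv_eq, map_tmul]
      exact congrArg _ (flip_tmul_of_even_right (Y := unitSVect) x rfl)
    refine Eq.trans ?_ (congrArg M.act.1 e1).symm
    refine Eq.trans ?_ (M.act_zero_r _ y x).symm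
    have e2 : (rid hβ M).pi11 hβ (g ⊗ₜ (x ⊗ₜ c.chiL (y • c.e))) =
        M.zero.rho g ((rid hβ M).pi00 hβ (D.sig (-1) M.zero (M.q x) ⊗ₜ (y • c.e))) :=
      (rid hβ M).pi11_p hβ g x (y • c.e)
    rw [← e0] at e2
    refine e2.trans ?_
    rw [← map_smul]
    have e3 : (rid hβ M).pi00 hβ (D.sig (-1) M.zero (M.q x) ⊗ₜ (y • c.e)) = y • D.sig (-1) M.zero (M.q x) := by
      refine (rid_pi00 hβ M _).trans ?_
      rw [gam_of_killed_right (-1) M.zero c.L _ (fun a => by rw [map_smul, L_act_e, smul_zero]),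
        flip_tmul_of_even_right (Y := c.L.toSVect) _ (by rw [map_smul, L_par_e]),
        ← smul_tmul', map_smul, M.a00_e]
    rw [e3, map_smul, map_smul]
    exact congrArg (fun t => y • t) (orb_sig D (-1) M.zero (M.q x) g)
  · refine ((rid hβ M).pi_one_l hβ _).trans ?_
    have e1 : (D.braid M.obj c.O).2 (x ⊗ₜ y, 0) = (0, y ⊗ₜ D.sig 1 M.zero x) := by
      refine (coprod_l _ _ _).trans ?_
      change ((0, M.zero.flip unitSVect (D.sigma M.zero x ⊗ₜ y)) : _ × _) = _
      rw [sigma_eq]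
      exact congrArg _ (flip_tmul_of_even_right (Y := unitSVect) _ rfl)
    refine Eq.trans ?_ (congrArg M.act.2 e1).symm
    refine Eq.trans ?_ (M.act_one_r y _).symm
    rw [pi01_apply, map_tmul,
      gam_of_killed_right 1 M.zero (unitSVect.triv h) _ (w := 𝕀 y) (fun _ => rfl)]
    exact rid_tmul _ _
  · refine ((rid hβ M).pi_one_r hβ _).trans ((rid_pi10 hβ M _).trans ?_)
    have e1 : (D.braid M.obj c.O).2 (0, x ⊗ₜ y) = (M.one.flip c.L.toSVect (x ⊗ₜ c.L.par y), 0) := by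
      refine (coprod_r _ _ _).trans ?_
      change ((M.one.flip c.L.toSVect (x ⊗ₜ D.sigma c.L (c.L.par y)), 0) : _ × _) = _
      rw [sigma_eq, sig_L P]
    refine Eq.trans ?_ (congrArg M.act.2 e1).symm
    refine Eq.trans ?_ (coprod_l M.a01 _ _).symm
    have e2 : ∀ w : c.L.V ⊗[ℂ] M.one.V, M.a01 w = ctr c.chiL 𝕀 (D.gam 1 c.L M.one w) := fun w =>
      LinearMap.congr_fun (f := M.a01) (g := ctr c.chiL 𝕀 ∘ₗ D.gam 1 c.L M.one)
        (ext' fun l y => (M.a01_tmul l y).trans (rho_j c M.one l y)) w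
    rw [e2, ← gam_flip, ctr_flip (chiL_par c)]
    have e3 := gam_par_right D (-1) M.one c.L (x ⊗ₜ y)
    rw [neg_neg, map_tmul, LinearMap.id_apply] at e3
    rw [← e3]
    generalize D.gam (-1) M.one c.L (x ⊗ₜ y) = w
    refine LinearMap.congr_fun (f := ctrR 𝕀 c.chiL)
      (g := ctrR 𝕀 c.chiL ∘ₗ map 𝕀 c.L.par)
      (ext' fun m l => ?_) w
    change _ = ctrR 𝕀 c.chiL (m ⊗ₜ c.L.par l)
    rw [ctrR_tmul, ctrR_tmul, chiL_par]

end Bihom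
end Core

namespace Core

variable (hβ : D.β = 1)

/-- A right inverse of the operator `p`. -/
def sec (N : Core P c) : N.one.V →ₗ[ℂ] N.zero.V := N.zero.rho (gOne P c) ∘ₗ N.q

include hβ in
lemma p_comp_sec (N : Core P c) : N.p ∘ₗ N.sec = 𝕀 := LinearMap.ext fun y => N.p_gOne hβ y

include hβ in
lemma sec_p (N : Core P c) (n : N.zero.V) : N.sec (N.p n) =
    N.a00 (map c.M 𝕀 (((reg h).tensor N.zero).rho (gOne P c) (1 ⊗ₜ n))) := by
  change N.zero.rho (gOne P c) (N.q (N.p n)) = _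
  rw [N.q_p hβ, ← rho_natural N.a00_act, rho_natural (intertwines_map_left N.zero (X' := c.L) (intertwines_M c) (isEven_M c hβ))]
  rfl

namespace Bihom

variable {M N T : Core P c} (k : Bihom M N T)

/-- Maps on `M₁ ⊗ N₀` on which the action of `L` on `N₀` is exchanged with its right action
on `M₁`. -/
def Exchanges (M N : Core P c) {W : Type} [AddCommGroup W] [Module ℂ W]
    (K : M.one.V ⊗[ℂ] N.zero.V →ₗ[ℂ] W) : Prop :=
  ∀ x l n, K (x ⊗ₜ N.a00 (l ⊗ₜ n)) = K (ctrR 𝕀 c.chiL (D.gam (-1) M.one c.L (x ⊗ₜ l)) ⊗ₜ n)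

lemma Exchanges.gam_a00 {W : Type} [AddCommGroup W] [Module ℂ W] {K : M.one.V ⊗[ℂ] N.zero.V →ₗ[ℂ] W}
    (hK : Exchanges M N K) (x : M.one.V) (l : c.L.V) (n : N.zero.V) :
    K (D.gam 1 M.one N.zero (x ⊗ₜ N.a00 (l ⊗ₜ n))) = c.chiL l • K (D.gam 1 M.one N.zero (x ⊗ₜ n)) := by
  have e0 : ∀ t : (M.one.V ⊗[ℂ] c.L.V) ⊗[ℂ] N.zero.V, K (map 𝕀 N.a00
      (assoc ℂ M.one.V c.L.V N.zero.V (map (D.gam 1 M.one c.L) 𝕀 t))) =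
      K (map (ctrR 𝕀 c.chiL) 𝕀 t) := fun t => by
    have e1 : ∀ t : (M.one.V ⊗[ℂ] c.L.V) ⊗[ℂ] N.zero.V, K (map 𝕀 N.a00
        (assoc ℂ M.one.V c.L.V N.zero.V t)) =
        K (map (ctrR 𝕀 c.chiL ∘ₗ D.gam (-1) M.one c.L) 𝕀 t) :=
      LinearMap.congr_fun (f := K ∘ₗ map 𝕀 N.a00 ∘ₗ (assoc ℂ M.one.V c.L.V N.zero.V).toLinearMap)
        (g := K ∘ₗ map (ctrR 𝕀 c.chiL ∘ₗ D.gam (-1) M.one c.L) 𝕀)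
        (ext_threefold fun x l n => hK x l n)
    rw [e1, map_map]
    refine congrArg (fun s => K (map s 𝕀 t)) (LinearMap.ext fun z => ?_)
    exact congrArg (ctrR 𝕀 c.chiL) (gam_neg_gam D 1 M.one c.L z)
  have e1 := gam_natural_right D 1 M.one N.a00_act (x ⊗ₜ (l ⊗ₜ n))
  have e2 := gam_tensor_triv_map M.one c.L N.zero D 1 ((x ⊗ₜ l) ⊗ₜ n)
  have e3 := gam_natural_left D 1 N.zero (intertwines_ctrR (c := c) M.one) (isEven_ctrR (c := c) M.one) ((x ⊗ₜ l) ⊗ₜ n)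
  refine (congrArg K e1.symm).trans ?_
  refine (congrArg (fun t => K (map 𝕀 N.a00 t)) e2).trans ((e0 _).trans ?_)
  refine (congrArg K e3).trans ?_
  rw [map_tmul, ctrR_tmul, ← smul_tmul', map_smul, map_smul]
  rfl

include hβ in
lemma Exchanges.gam_sec {W : Type} [AddCommGroup W] [Module ℂ W] {K : M.one.V ⊗[ℂ] N.zero.V →ₗ[ℂ] W}
    (hK : Exchanges M N K) (z : M.one.V ⊗[ℂ] N.zero.V) :
    K (D.gam 1 M.one N.zero (map 𝕀 (N.sec ∘ₗ N.p) z)) = K (D.gam 1 M.one N.zero z) := by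
  refine LinearMap.congr_fun (f := K ∘ₗ D.gam 1 M.one N.zero ∘ₗ map 𝕀 (N.sec ∘ₗ N.p))
    (g := K ∘ₗ D.gam 1 M.one N.zero) (ext' fun x n => ?_) z
  change K (D.gam 1 M.one N.zero (x ⊗ₜ N.sec (N.p n))) = K (D.gam 1 M.one N.zero (x ⊗ₜ n))
  rw [sec_p hβ]
  have e1 : ∀ Z : S h ⊗[ℂ] N.zero.V, K (D.gam 1 M.one N.zero (x ⊗ₜ N.a00 (map c.M 𝕀 Z))) =
      K (D.gam 1 M.one N.zero (x ⊗ₜ TensorProduct.lid ℂ N.zero.V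
        (map c.theta 𝕀 Z))) := fun Z => by
    induction Z with
    | tmul g n =>
      rw [map_tmul, map_tmul, lid_tmul, LinearMap.id_apply,
        hK.gam_a00, tmul_smul, map_smul, map_smul, chiL_apply, chi_M]
    | _ => simp_all [add_tmul, tmul_add]
  rw [e1, ← rho_conv]
  have e2 : N.zero.rho (conv c.theta (gOne P c)) n = n := by
    have e3 := E_gOne P c hβ
    exact (congrArg (fun g => N.zero.rho g n) e3).trans (rho_one _ _)
  rw [e2]

include hβ in
/-- Exchanging maps factor through the projection in sector 10. -/
lemma Exchanges.factors {W : Type} [AddCommGroup W] [Module ℂ W] {K : M.one.V ⊗[ℂ] N.zero.V →ₗ[ℂ] W}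
    (hK : Exchanges M N K) (hk : Function.Bijective k.k) :
    ∃ l : T.one.V →ₗ[ℂ] W, ∀ z, l (k.pi10 z) = K z := by
  let E := LinearEquiv.ofBijective k.k hk
  refine ⟨K ∘ₗ D.gam 1 M.one N.zero ∘ₗ map 𝕀 N.sec ∘ₗ E.symm.toLinearMap, fun z => ?_⟩
  have e1 : E.symm (k.pi10 z) = map 𝕀 N.p (D.gam (-1) M.one N.zero z) :=
    E.symm_apply_apply _
  change K (D.gam 1 M.one N.zero (map 𝕀 N.sec (E.symm (k.pi10 z)))) = K z
  have e2 := hK.gam_sec hβ (D.gam (-1) M.one N.zero z)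
  rw [gam_gam_neg] at e2
  rw [e1, map_map]
  exact e2

include hβ in
lemma pi10_surjective (hk : Function.Bijective k.k) : Function.Surjective k.pi10 := fun t => by
  obtain ⟨s, rfl⟩ := hk.2 t
  refine ⟨D.gam 1 M.one N.zero (map 𝕀 N.sec s), ?_⟩
  rw [pi10_apply, gam_neg_gam, map_map, N.p_comp_sec hβ]
  exact congrArg k.k (LinearMap.congr_fun map_id s)

lemma q_pi10' (z : M.one.V ⊗[ℂ] N.zero.V) :
    T.q (k.pi10 z) = k.pi00 hβ (map M.q 𝕀 z) :=
  LinearMap.congr_fun (f := T.q ∘ₗ k.pi10) (g := k.pi00 hβ ∘ₗ map M.q 𝕀)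
    (ext' fun x n => k.q_pi10 hβ x n) z

lemma pi00_surjective (hk : Function.Bijective k.k) : Function.Surjective (k.pi00 hβ) := fun t => by
  refine T.gen_induction hβ (C := fun t => ∃ z, k.pi00 hβ z = t) ⟨0, map_zero _⟩ ?_ (fun g y => ?_) t
  · rintro _ _ ⟨z, rfl⟩ ⟨w, rfl⟩
    exact ⟨z + w, map_add _ _ _⟩
  · obtain ⟨z, rfl⟩ := k.pi10_surjective hβ hk y
    exact ⟨(M.zero.tensor N.zero).rho g (map M.q 𝕀 z), by
      rw [rho_natural (k.pi00_intertwines hβ), q_pi10']⟩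

/-- Balanced maps, in terms of cores. -/
def Balanced (M N : Core P c) {Q : Car} (g : LMap (M.obj.car.star h N.obj.car) Q) : Prop :=
  g.comp ((((rid hβ M).pi hβ).star h (LMap.id N.obj.car)).comp (D.assoc M.obj c.O N.obj)) =
    g.comp ((LMap.id M.obj.car).star h ((lid hβ N).pi hβ))

lemma balanced_pi : Balanced hβ M N (k.pi hβ) := by
  have e1 := pi_assoc hβ (rid hβ M) k (lid hβ N) k (fun x y z => by
    change k.k (TensorProduct.rid ℂ M.one.V (x ⊗ₜ y) ⊗ₜ z) =
      k.k (x ⊗ₜ TensorProduct.lid ℂ N.one.V (y ⊗ₜ z))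
    rw [rid_tmul, lid_tmul, smul_tmul])
  exact e1

namespace Balanced

variable {hβ}

section Sectors

variable {Q : Car} {g : LMap (M.obj.car.star h N.obj.car) Q} (hg : Balanced hβ M N g)
include hg

lemma sector000 (m : M.zero.V) (l : c.L.V) (n : N.zero.V) :
    g.1 (m ⊗ₜ N.a00 (l ⊗ₜ n), 0) = g.1 ((rid hβ M).pi00 hβ (m ⊗ₜ l) ⊗ₜ n, 0) := by
  have e := LinearMap.congr_fun (congrArg Prod.fst hg) (m ⊗ₜ (l ⊗ₜ n, 0), 0)
  rw [comp_fst, comp_fst, comp_fst, assoc_000, star_fst_l, star_fst_l, map_tmul, map_tmul] at e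
  refine Eq.trans ?_ (e.symm.trans ?_)
  · exact congrArg (fun w => g.1 (m ⊗ₜ w, 0))
      ((lid_pi00 hβ N (l ⊗ₜ n)).symm.trans ((lid hβ N).pi_zero_l hβ (l ⊗ₜ n)).symm)
  · exact congrArg (fun w => g.1 (w ⊗ₜ n, 0)) ((rid hβ M).pi_zero_l hβ (m ⊗ₜ l))

lemma sector100 : Exchanges M N (g.2 ∘ₗ LinearMap.inr ℂ _ _) := fun x l n => by
  have e := LinearMap.congr_fun (congrArg Prod.snd hg) (0, x ⊗ₜ (l ⊗ₜ n, 0))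
  rw [comp_snd, comp_snd, comp_snd, assoc_100, star_snd_r, star_snd_r, map_tmul, map_tmul] at e
  refine Eq.trans ?_ (e.symm.trans ?_)
  · exact congrArg (fun w => g.2 (0, x ⊗ₜ w))
      ((lid_pi00 hβ N (l ⊗ₜ n)).symm.trans ((lid hβ N).pi_zero_l hβ (l ⊗ₜ n)).symm)
  · exact congrArg (fun w => g.2 (0, w ⊗ₜ n)) (((rid hβ M).pi_one_r hβ (x ⊗ₜ l)).trans (rid_pi10 hβ M _))

lemma sector110 (x : M.one.V) (n : N.zero.V) :
    g.1 (0, 1 ⊗ₜ (x ⊗ₜ N.p n)) = g.1 ((rid hβ M).pi11 hβ (1 ⊗ₜ (x ⊗ₜ (1 : ℂ))) ⊗ₜ n, 0) := by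
  have e := LinearMap.congr_fun (congrArg Prod.fst hg) (0, 1 ⊗ₜ (x ⊗ₜ (0, (1 : ℂ) ⊗ₜ n)))
  rw [comp_fst, comp_fst, comp_fst, assoc_110, assoc110_one, map_tmul, star_fst_l,
    map_tmul, star_fst_r, map_tmul, map_tmul] at e
  refine Eq.trans ?_ (e.symm.trans ?_)
  · exact congrArg (fun w => g.1 (0, (1 : S h) ⊗ₜ (x ⊗ₜ w)))
      (((one_smul ℂ _).symm.trans (lid_pi10 hβ N 1 n).symm).trans ((lid hβ N).pi_one_r hβ _).symm)
  · exact congrArg (fun w => g.1 (w ⊗ₜ n, 0)) ((rid hβ M).pi_zero_r hβ (1 ⊗ₜ (x ⊗ₜ (1 : ℂ))))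

lemma sector010 (m : M.zero.V) (n : N.zero.V) :
    g.2 (m ⊗ₜ N.p n, 0) = g.2 (0, map ((rid hβ M).pi01 ∘ₗ
      (TensorProduct.mk ℂ M.zero.V ℂ).flip 1) 𝕀 (D.gam 1 M.zero N.zero (m ⊗ₜ n))) := by
  have e := LinearMap.congr_fun (congrArg Prod.snd hg) (m ⊗ₜ (0, (1 : ℂ) ⊗ₜ n), 0)
  rw [comp_snd, comp_snd, comp_snd, assoc_010, star_snd_l, map_tmul, star_snd_r] at e
  refine Eq.trans ?_ (e.symm.trans ?_)
  · exact congrArg (fun w => g.2 (m ⊗ₜ w, 0))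
      (((one_smul ℂ _).symm.trans (lid_pi10 hβ N 1 n).symm).trans ((lid hβ N).pi_one_r hβ _).symm)
  · refine congrArg (fun w => g.2 (0, w)) ?_
    have e1 := gam_triv_tensor D 1 M.zero N.zero (Y := unitSVect) (y := 1) rfl (m ⊗ₜ n)
    have e2 := assoc010_apply D M.zero unitSVect N.zero m 1 n
    refine (congrArg (fun w => map ((rid hβ M).pi hβ).2 𝕀
      (map (LinearMap.inl ℂ _ _) 𝕀 w)) (e2.trans e1.symm)).trans ?_
    dsimp only
    rw [map_map, map_map]
    refine congrArg (fun t => map t 𝕀 (D.gam 1 M.zero N.zero (m ⊗ₜ n))) ?_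
    exact LinearMap.ext fun m => (rid hβ M).pi_one_l hβ (m ⊗ₜ (1 : ℂ))

end Sectors

lemma ext {Q : SF h} {g g' : LMap (M.obj.car.star h N.obj.car) Q.car} (hg : g ∈ homs (M.obj.star N.obj) Q)
    (hg' : g' ∈ homs (M.obj.star N.obj) Q) (hb : Balanced hβ M N g) (hb' : Balanced hβ M N g')
    (h00 : ∀ z, g.1 (z, 0) = g'.1 (z, 0)) (h10 : ∀ z, g.2 (0, z) = g'.2 (0, z)) : g = g' := by
  refine Prod.ext (star_ext₀ (X := M.obj.car) (Y := N.obj.car) (h := h) (fun x y => h00 _) fun s x y => ?_)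
    (star_ext₁ (X := M.obj.car) (Y := N.obj.car) (h := h) (fun x y => ?_) fun x y => h10 _)
  · have hact : ∀ (a : h) (s : S h), (M.obj.star N.obj).zero.act a (0, s ⊗ₜ (x ⊗ₜ y)) =
        (0, (ι ℂ a * s) ⊗ₜ (x ⊗ₜ y)) := fun a s => by
      rw [star_act M.obj N.obj, map_zero]
      rfl
    induction s using S.induction with
    | halg r =>
      obtain ⟨n, rfl⟩ := N.p_surjective hβ y
      have e1 : ((0, algebraMap ℂ (S h) r ⊗ₜ (x ⊗ₜ N.p n)) : (M.obj.car.star h N.obj.car).V₀) =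
          r • (0, 1 ⊗ₜ (x ⊗ₜ N.p n)) := by
        rw [algebraMap_eq_smul_one, ← smul_tmul']
        exact Prod.ext (smul_zero r).symm rfl
      refine (congrArg g.1 e1).trans (Eq.trans ?_ (congrArg g'.1 e1).symm)
      refine (map_smul g.1 r _).trans (Eq.trans ?_ (map_smul g'.1 r _).symm)
      exact congrArg (fun t => r • t) ((hb.sector110 x n).trans ((h00 _).trans (hb'.sector110 x n).symm))
    | hadd s t hs ht =>
      have e1 : ((0, (s + t) ⊗ₜ (x ⊗ₜ y)) : (M.obj.car.star h N.obj.car).V₀) =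
          (0, s ⊗ₜ (x ⊗ₜ y)) + (0, t ⊗ₜ (x ⊗ₜ y)) := by
        rw [add_tmul]
        exact Prod.ext (add_zero _).symm rfl
      refine (congrArg g.1 e1).trans (Eq.trans ?_ (congrArg g'.1 e1).symm)
      exact (map_add g.1 _ _).trans ((congrArg₂ _ hs ht).trans (map_add g'.1 _ _).symm)
    | hmul a s hs =>
      refine (congrArg g.1 (hact a s).symm).trans ((hg.2.1 a _).trans ?_)
      refine Eq.trans ?_ ((hg'.2.1 a _).symm.trans (congrArg g'.1 (hact a s)))
      exact congrArg (Q.zero.act a) hs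
  · obtain ⟨n, rfl⟩ := N.p_surjective hβ y
    exact (hb.sector010 x n).trans ((h10 _).trans (hb'.sector010 x n).symm)

end Balanced

include hβ in
lemma pi_epi (hk : Function.Bijective k.k) {Q : Car} {l l' : LMap T.obj.car Q}
    (hl : l.comp (k.pi hβ) = l'.comp (k.pi hβ)) : l = l' := by
  refine Prod.ext (LinearMap.ext fun t => ?_) (LinearMap.ext fun t => ?_)
  · obtain ⟨z, rfl⟩ := k.pi00_surjective hβ hk t
    rw [← k.pi_zero_l hβ]
    exact LinearMap.congr_fun (congrArg Prod.fst hl) (z, 0)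
  · obtain ⟨z, rfl⟩ := k.pi10_surjective hβ hk t
    rw [← k.pi_one_r hβ]
    exact LinearMap.congr_fun (congrArg Prod.snd hl) (0, z)

lemma pi00_factors (hk : Function.Bijective k.k) {Y : SRep h} {G : M.zero.V ⊗[ℂ] N.zero.V →ₗ[ℂ] Y.V}
    (hG : Intertwines (M.zero.tensor N.zero) Y G) (hGp : IsEven (M.zero.tensor N.zero).toSVect Y.toSVect G)
    (hb : ∀ m l n, G (m ⊗ₜ N.a00 (l ⊗ₜ n)) = G ((rid hβ M).pi00 hβ (m ⊗ₜ l) ⊗ₜ n)) :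
    ∃ l : T.zero.V →ₗ[ℂ] Y.V, ∀ z, l (k.pi00 hβ z) = G z := by
  have hK : Exchanges M N (G ∘ₗ map M.q 𝕀) := fun x l n => by
    change G (M.q x ⊗ₜ N.a00 (l ⊗ₜ n)) = G (M.q _ ⊗ₜ n)
    rw [hb, ← rid_pi10 hβ]
    exact congrArg (fun w => G (w ⊗ₜ n)) ((rid hβ M).q_pi10 hβ x l).symm
  obtain ⟨l₁, hl₁⟩ := hK.factors hβ k hk
  let κ : S h ⊗[ℂ] (M.zero.V ⊗[ℂ] N.zero.V) →ₗ[ℂ] Y.V := G ∘ₗ map (M.a00 ∘ₗ map c.M 𝕀) 𝕀 ∘ₗ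
    (assoc ℂ (S h) M.zero.V N.zero.V).symm.toLinearMap
  have hA : Intertwines ((reg h).tensor M.zero) M.zero (M.a00 ∘ₗ map c.M 𝕀) :=
    fun a z => (congrArg M.a00 (intertwines_map_left M.zero (X' := c.L) (intertwines_M c) (isEven_M c hβ) a z)).trans (M.a00_act a _)
  have hAp : IsEven ((reg h).tensor M.zero).toSVect M.zero.toSVect
      (M.a00 ∘ₗ map c.M 𝕀) :=
    fun z => (congrArg M.a00 (isEven_map_left M.zero.toSVect (X' := c.L.toSVect) (isEven_M c hβ) z)).trans (M.a00_par _)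
  have hκ : Intertwines ((reg h).tensor (M.zero.tensor N.zero)) Y κ := fun a z => by
    refine (congrArg (fun t => G (map (M.a00 ∘ₗ map c.M 𝕀)
      𝕀 t)) (intertwines_assoc_symm (reg h) M.zero N.zero a z)).trans ?_
    exact (congrArg G (intertwines_map_left N.zero hA hAp a _)).trans (hG a _)
  have hκp : IsEven ((reg h).tensor (M.zero.tensor N.zero)).toSVect Y.toSVect κ := fun z => by
    refine (congrArg (fun t => G (map (M.a00 ∘ₗ map c.M 𝕀)
      𝕀 t)) (isEven_assoc_symm (reg h).toSVect M.zero.toSVect N.zero.toSVect z)).trans ?_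
    exact (congrArg G (isEven_map_left N.zero.toSVect hAp _)).trans (hGp _)
  have hone : ∀ z, κ (1 ⊗ₜ z) = l₁ (T.p (k.pi00 hβ z)) :=
    LinearMap.congr_fun (f := κ ∘ₗ TensorProduct.mk ℂ (S h) _ 1) (g := l₁ ∘ₗ T.p ∘ₗ k.pi00 hβ)
      (ext' fun m n => by
        change G (M.a00 (c.M 1 ⊗ₜ m) ⊗ₜ n) = l₁ (T.p (k.pi00 hβ (m ⊗ₜ n)))
        rw [p_pi00_tmul, hl₁, ← M.q_p hβ]
        rfl)
  have hgOne : ∀ z, κ (gOne P c ⊗ₜ z) = G z :=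
    LinearMap.congr_fun (f := κ ∘ₗ TensorProduct.mk ℂ (S h) _ (gOne P c)) (g := G)
      (ext' fun m n => by
        change G (M.a00 (c.M (gOne P c) ⊗ₜ m) ⊗ₜ n) = G (m ⊗ₜ n)
        rw [M_gOne, M.a00_e])
  have hker : ∀ z, k.pi00 hβ z = 0 → G z = 0 := fun z hz => by
    have := mem_of_one_tmul hκ hκp (LinearMap.ker (k.pi00 hβ)) ⊥
      (fun a x hx => (k.pi00_intertwines hβ a x).trans (by rw [LinearMap.mem_ker.mp hx, map_zero]))
      (fun x hx => (k.pi00_even hβ x).trans (by rw [LinearMap.mem_ker.mp hx]; exact map_zero T.zero.par))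
      (fun a y hy => by rw [(Submodule.mem_bot ℂ).mp hy, map_zero]; exact zero_mem _)
      (fun y hy => by rw [(Submodule.mem_bot ℂ).mp hy, map_zero]; exact zero_mem _)
      (fun x hx => by
        rw [Submodule.mem_bot, hone, LinearMap.mem_ker.mp hx, map_zero, map_zero]) (gOne P c) z hz
    rw [← hgOne]
    exact (Submodule.mem_bot ℂ).mp this
  obtain ⟨s, hs⟩ := (k.pi00 hβ).exists_rightInverse_of_surjective
    (LinearMap.range_eq_top.mpr (k.pi00_surjective hβ hk))
  refine ⟨G ∘ₗ s, fun z => ?_⟩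
  rw [LinearMap.comp_apply, ← sub_eq_zero, ← map_sub]
  refine hker _ ?_
  rw [map_sub, sub_eq_zero]
  exact LinearMap.congr_fun hs _

/-- The projection is the coequaliser of the two actions. -/
lemma exists_factor (hk : Function.Bijective k.k) {Q : SF h} {g : LMap (M.obj.car.star h N.obj.car) Q.car}
    (hg : g ∈ homs (M.obj.star N.obj) Q) (hb : Balanced hβ M N g) :
    ∃ l ∈ homs T.obj Q, l.comp (k.pi hβ) = g := by
  have hG : Intertwines (M.zero.tensor N.zero) Q.zero (g.1 ∘ₗ LinearMap.inl ℂ _ _) := fun a z => by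
    have e1 : (M.obj.star N.obj).zero.act a (z, 0) = ((M.zero.tensor N.zero).act a z, 0) := by
      rw [star_act M.obj N.obj, map_zero]
    exact (congrArg g.1 e1.symm).trans (hg.2.1 a _)
  have hGp : IsEven (M.zero.tensor N.zero).toSVect Q.zero.toSVect (g.1 ∘ₗ LinearMap.inl ℂ _ _) := fun z =>
    (congrArg g.1 (star_par_zero_l M.obj N.obj z).symm).trans (hg.1 _)
  have hKp : IsEven (M.one.tensor N.zero).toSVect Q.one (g.2 ∘ₗ LinearMap.inr ℂ _ _) := fun z =>
    (congrArg g.2 (star_par_one_r M.obj N.obj z).symm).trans (hg.2.2 _)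
  obtain ⟨l₀, hl₀⟩ := k.pi00_factors hβ hk hG hGp hb.sector000
  obtain ⟨l₁, hl₁⟩ := hb.sector100.factors hβ k hk
  have hl : ((l₀, l₁) : LMap T.obj.car Q.car) ∈ homs T.obj Q := by
    refine ⟨fun t => ?_, fun a t => ?_, fun t => ?_⟩
    · obtain ⟨z, rfl⟩ := k.pi00_surjective hβ hk t
      change l₀ (T.zero.par (k.pi00 hβ z)) = Q.zero.par (l₀ (k.pi00 hβ z))
      rw [← k.pi00_even hβ, hl₀, hl₀]
      exact hGp z
    · obtain ⟨z, rfl⟩ := k.pi00_surjective hβ hk t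
      change l₀ (T.zero.act a (k.pi00 hβ z)) = Q.zero.act a (l₀ (k.pi00 hβ z))
      rw [← k.pi00_intertwines hβ, hl₀, hl₀]
      exact hG a z
    · obtain ⟨z, rfl⟩ := k.pi10_surjective hβ hk t
      change l₁ (T.one.par (k.pi10 z)) = Q.one.par (l₁ (k.pi10 z))
      rw [← k.pi10_even, hl₁, hl₁]
      exact hKp z
  refine ⟨_, hl, Balanced.ext (comp_mem_homs (Y := T.obj) hl (k.pi_mem hβ)) hg
    (congrArg (fun t => LMap.comp ((l₀, l₁) : LMap T.obj.car Q.car) t) (k.balanced_pi hβ)) hb (fun z => ?_) fun z => ?_⟩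
  · exact (congrArg l₀ (k.pi_zero_l hβ z)).trans (hl₀ z)
  · exact (congrArg l₁ (k.pi_one_r hβ z)).trans (hl₁ z)

end Bihom
end Core

end Projections

section TensorOver

variable {h : Type} [AddCommGroup h] [Module ℂ h] [FiniteDimensional ℂ h]
variable {D : SympData h} {f : Submodule ℂ h} {c : HChoice D f}

lemma Core.Bihom.pi_congr {P : Polarization D f} (hβ : D.β = 1) {M N T : Core P c}
    {k k' : Core.Bihom M N T} (hk : k.k = k'.k) : k.pi hβ = k'.pi hβ := by
  cases k
  cases k'
  cases hk
  rfl

namespace Mod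

variable (P : Polarization D f) (hβ : D.β = 1)

/-- The universal bilinear map of two modules. -/
@[reducible] def tensBihom (M N : Mod D c.H) :
    Core.Bihom (M.core P hβ) (N.core P hβ) ((tens P hβ M N).core P hβ) where
  k := (𝕀 : M.obj.one.V ⊗[ℂ] N.obj.one.V →ₗ[ℂ] M.obj.one.V ⊗[ℂ] N.obj.one.V)
  even _ := rfl
  equi a z := (tens_act P hβ M N a z).symm

/-- The homomorphism of cores that underlies a homomorphism of modules. -/
@[reducible] def coreHom {M N : Mod D c.H} (k : M ⟶ N) : Core.Hom (M.core P hβ) (N.core P hβ) :=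
  ⟨snd k, isEven_snd k, intertwines_snd P hβ k⟩

lemma coreHom_pair {M N : Mod D c.H} (k : M ⟶ N) : (coreHom P hβ k).pair hβ = k.1 :=
  (coreHom P hβ k).pair_eq hβ (intertwines_fst k) (fun m => p_fst k m)

/-- The unit module, by means of its core. -/
@[reducible] def unitHom : Core.Hom ((unitMod c P hβ).core P hβ) (hCore P c hβ) where
  k := (𝕀 : ℂ →ₗ[ℂ] ℂ)
  even _ := rfl
  equi a t := unit_act P hβ a t

lemma unitHom_pair : (unitHom (c := c) P hβ).pair hβ = LMap.id c.O.car :=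
  (unitHom (c := c) P hβ).pair_eq hβ (l := (𝕀 : c.L.V →ₗ[ℂ] c.L.V)) (fun _ _ => rfl)
    fun m => ((mul_one_r c 1 m).trans (one_mul _)).symm

variable {P hβ} in
lemma balanced_iff {M N : Mod D c.H} {Q : Car} {g : LMap (M.obj.car.star h N.obj.car) Q} :
    Core.Bihom.Balanced hβ (M.core P hβ) (N.core P hβ) g ↔ Mod.Balanced M N g := by
  unfold Core.Bihom.Balanced
  rw [Core.Bihom.rid_pi, Core.Bihom.lid_pi, M.core_act P hβ, N.core_act P hβ]
  exact Iff.rfl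

section Generic

variable {P hβ} {M N T : Mod D c.H} (k : Core.Bihom (M.core P hβ) (N.core P hβ) (T.core P hβ))

/-- The morphism of objects that underlies a bilinear map of modules. -/
def ofBihom : M.obj.star N.obj ⟶ T.obj := ⟨k.pi hβ, k.pi_mem hβ⟩

lemma ofBihom_balanced : Mod.Balanced M N (ofBihom k).1 := balanced_iff.mp (k.balanced_pi hβ)

lemma ofBihom_coequalizer (hk : Function.Bijective k.k) (Q : SF h) (g : M.obj.star N.obj ⟶ Q)
    (hg : Mod.Balanced M N g.1) : ∃! l : T.obj ⟶ Q, ofBihom k ≫ l = g := by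
  obtain ⟨l, hl, hlg⟩ := k.exists_factor hβ hk g.2 (balanced_iff.mpr hg)
  refine ⟨⟨l, hl⟩, Subtype.ext hlg, fun l' hl' => Subtype.ext ?_⟩
  exact k.pi_epi hβ hk ((congrArg Subtype.val hl').trans hlg.symm)

lemma ofBihom_act :
    T.act.comp ((LMap.id c.H.obj.car).star h (ofBihom k).1) = LMap.comp (ofBihom k).1
        ((M.act.star h (LMap.id N.obj.car)).comp (D.assoc c.H.obj M.obj N.obj)) := by
  have e := Core.Bihom.pi_assoc hβ (Core.Bihom.lid hβ (M.core P hβ)) k k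
    (Core.Bihom.lid hβ (T.core P hβ)) (fun t x y => by
      change k.k (lid ℂ M.obj.one.V (t ⊗ₜ x) ⊗ₜ y) =
        lid ℂ T.obj.one.V (t ⊗ₜ k.k (x ⊗ₜ y))
      rw [lid_tmul, lid_tmul]
      exact map_smul k.k t (x ⊗ₜ y))
  rw [Core.Bihom.lid_pi, Core.Bihom.lid_pi, M.core_act P hβ, T.core_act P hβ] at e
  exact e.symm

lemma ofBihom_natural {M' N' T' : Mod D c.H}
    (k' : Core.Bihom (M'.core P hβ) (N'.core P hβ) (T'.core P hβ)) (a : M ⟶ M') (b : N ⟶ N')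
    (l : T ⟶ T') (e : (snd l).comp k.k = k'.k.comp (map (snd a) (snd b))) :
    LMap.comp l.1 (ofBihom k).1 = LMap.comp (ofBihom k').1 (LMap.star a.1 h b.1) := by
  rw [← coreHom_pair P hβ a, ← coreHom_pair P hβ b, ← coreHom_pair P hβ l]
  refine (Core.Bihom.postcomp_pi hβ k (coreHom P hβ l)).trans
    (Eq.trans ?_ (Core.Bihom.precomp_pi hβ k' (coreHom P hβ a) (coreHom P hβ b)).symm)
  exact Core.Bihom.pi_congr hβ e

lemma ofBihom_left {U : Mod D c.H} (u : Core.Hom (U.core P hβ) (hCore P c hβ))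
    (k : Core.Bihom (U.core P hβ) (M.core P hβ) (T.core P hβ)) (l : T ⟶ M)
    (e : (snd l).comp k.k = (lid ℂ M.obj.one.V).toLinearMap.comp (map u.k 𝕀)) :
    LMap.comp l.1 (ofBihom k).1 =
      LMap.comp (Y := c.O.car.star h M.obj.car) M.act (LMap.star (u.pair hβ) h (LMap.id M.obj.car)) := by
  rw [← coreHom_pair P hβ l]
  refine (Core.Bihom.postcomp_pi hβ k (coreHom P hβ l)).trans ?_
  have e' := Core.Bihom.precomp_pi hβ (Core.Bihom.lid hβ (M.core P hβ)) u (coreHom P hβ (𝟙 M))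
  rw [coreHom_pair, Core.Bihom.lid_pi, M.core_act P hβ] at e'
  exact (Core.Bihom.pi_congr hβ e).trans e'.symm

lemma ofBihom_right {U : Mod D c.H} (u : Core.Hom (U.core P hβ) (hCore P c hβ))
    (k : Core.Bihom (M.core P hβ) (U.core P hβ) (T.core P hβ)) (l : T ⟶ M)
    (e : (snd l).comp k.k = (rid ℂ M.obj.one.V).toLinearMap.comp (map 𝕀 u.k)) :
    LMap.comp l.1 (ofBihom k).1 =
      LMap.comp (Y := M.obj.car.star h c.O.car) M.ract (LMap.star (LMap.id M.obj.car) h (u.pair hβ)) := by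
  rw [← coreHom_pair P hβ l]
  refine (Core.Bihom.postcomp_pi hβ k (coreHom P hβ l)).trans ?_
  have e' := Core.Bihom.precomp_pi hβ (Core.Bihom.rid hβ (M.core P hβ)) (coreHom P hβ (𝟙 M)) u
  rw [coreHom_pair, Core.Bihom.rid_pi, M.core_act P hβ] at e'
  exact (Core.Bihom.pi_congr hβ e).trans e'.symm

lemma ofBihom_assoc {Q U V V' : Mod D c.H}
    (k' : Core.Bihom (T.core P hβ) (Q.core P hβ) (U.core P hβ))
    (k₄ : Core.Bihom (N.core P hβ) (Q.core P hβ) (V.core P hβ))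
    (k₃ : Core.Bihom (M.core P hβ) (V.core P hβ) (V'.core P hβ)) (l : U ⟶ V')
    (e : ∀ x y z, snd l (k'.k (k.k (x ⊗ₜ y) ⊗ₜ z)) = k₃.k (x ⊗ₜ k₄.k (y ⊗ₜ z))) :
    LMap.comp l.1 (LMap.comp (ofBihom k').1
      (LMap.comp (LMap.star (ofBihom k).1 h (LMap.id Q.obj.car)) (D.assoc M.obj N.obj Q.obj))) =
    LMap.comp (ofBihom k₃).1 (LMap.star (LMap.id M.obj.car) h (ofBihom k₄).1) := by
  rw [← coreHom_pair P hβ l]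
  have e' := Core.Bihom.pi_assoc hβ k (k'.postcomp (coreHom P hβ l)) k₄ k₃ e
  rw [← Core.Bihom.postcomp_pi] at e'
  exact e'

end Generic

/-- The projection `M ∗ N → M ⊗ N`. -/
def proj (M N : Mod D c.H) : M.obj.star N.obj ⟶ (tens P hβ M N).obj := ofBihom (tensBihom P hβ M N)

lemma proj_left (M : Mod D c.H) :
    LMap.comp (tensLeft P hβ M).hom.1 (proj P hβ (unitMod c P hβ) M).1 = M.act := by
  refine (ofBihom_left (unitHom (c := c) P hβ) _ _ (ext' fun t x => rfl)).trans ?_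
  rw [unitHom_pair]
  exact (congrArg M.act.comp (id_star_id (h := h) (X := c.O.car) (Y := M.obj.car))).trans rfl

lemma proj_right (M : Mod D c.H) :
    LMap.comp (tensRight P hβ M).hom.1 (proj P hβ M (unitMod c P hβ)).1 = M.ract := by
  refine (ofBihom_right (unitHom (c := c) P hβ) _ _ (ext' fun x t => rfl)).trans ?_
  rw [unitHom_pair]
  exact (congrArg M.ract.comp (id_star_id (h := h) (X := M.obj.car) (Y := c.O.car))).trans rfl

/-- The monoidal structure on the category of modules is the tensor product over `H(f)`. -/
def isTensorOver (hH : c.H.IsAlgebra D) : letI := monoidal (c := c) P hβ; IsTensorOver hH :=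
  letI := monoidal (c := c) P hβ
  { π := fun M N => proj P hβ M N
    balanced := fun M N => ofBihom_balanced (tensBihom P hβ M N)
    coequalizer := fun M N => ofBihom_coequalizer (tensBihom P hβ M N) Function.bijective_id
    act := fun M N => ofBihom_act (tensBihom P hβ M N)
    natural := fun k l => ofBihom_natural (tensBihom P hβ _ _) (tensBihom P hβ _ _) k l (tensHom k l) rfl
    unit := Iso.refl (unitMod c P hβ)
    leftUnitor := fun M => by
      have e : (𝟙 (𝟙_ (Mod D c.H)) ▷ M) ≫ (λ_ M).hom = (tensLeft P hβ M).hom :=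
        (congrArg (fun t => t ≫ (λ_ M).hom) (id_whiskerRight (𝟙_ (Mod D c.H)) M)).trans (Category.id_comp _)
      exact (congrArg (fun t : tens P hβ (unitMod c P hβ) M ⟶ M =>
        LMap.comp t.1 (proj P hβ (unitMod c P hβ) M).1) e).trans (proj_left P hβ M)
    rightUnitor := fun M => by
      have e : (M ◁ 𝟙 (𝟙_ (Mod D c.H))) ≫ (ρ_ M).hom = (tensRight P hβ M).hom :=
        (congrArg (fun t => t ≫ (ρ_ M).hom) (whiskerLeft_id M (𝟙_ (Mod D c.H)))).trans (Category.id_comp _)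
      exact (congrArg (fun t : tens P hβ M (unitMod c P hβ) ⟶ M =>
        LMap.comp t.1 (proj P hβ M (unitMod c P hβ)).1) e).trans (proj_right P hβ M)
    associator := fun M N Q => ofBihom_assoc (tensBihom P hβ M N) (tensBihom P hβ _ Q) (tensBihom P hβ N Q)
      (tensBihom P hβ M _) (tensAssoc P hβ M N Q).hom fun _ _ _ => rfl }

end Mod

end TensorOver

end SymplecticFermion

/-- The Lagrangian algebra `H(𝔣)` has exactly the two simple modules `H` and `ΠH`, and its modules
form a finite tensor category with the tensor product over `H`. -/
theorem theorem5p3 {h : Type} [AddCommGroup h] [Module ℂ h] [FiniteDimensional ℂ h]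
    (D : SymplecticFermion.SympData h) (hβ : D.β = 1)
    (f : Submodule ℂ h) (hf : D.IsLagrangian f) (c : SymplecticFermion.HChoice D f) :
    ∃ hH : c.H.IsAlgebra D,
      (∀ M : SymplecticFermion.Mod D c.H, CategoryTheory.Simple M ↔
        (Nonempty (M ≅ SymplecticFermion.Mod.regular hH) ∨
          Nonempty (M ≅ (SymplecticFermion.Mod.regular hH).shift))) ∧
      ¬ Nonempty (SymplecticFermion.Mod.regular hH ≅ (SymplecticFermion.Mod.regular hH).shift) ∧
      ∃ _ : CategoryTheory.MonoidalCategory (SymplecticFermion.Mod D c.H),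
        Nonempty (SymplecticFermion.IsTensorOver hH) ∧
        SymplecticFermion.IsFiniteTensorCategory (SymplecticFermion.Mod D c.H) := by
  obtain ⟨P⟩ := SymplecticFermion.exists_polarization hf
  have hH := SymplecticFermion.isAlgebra_H P c hβ
  exact ⟨hH, fun M => SymplecticFermion.Mod.simple_iff P hβ hH M,
    SymplecticFermion.Mod.not_iso_shift hH, SymplecticFermion.Mod.monoidal P hβ,
    ⟨SymplecticFermion.Mod.isTensorOver P hβ hH⟩, SymplecticFermion.Mod.isFiniteTensor P hβ⟩
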